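/- **Setting.** Let $M$ be a compact manifold of dimension $2n$ with a generalized Kähler structure $(\mathcal J,\mathcal J_\psi)$ of symplectic type. Here $\psi=e^{b-\sqrt{-1}\,\omega}$, where $\omega$ is a symplectic form and $b$ is a closed real $2$-form. The structures $\mathcal J$ and $\mathcal J_\psi$ are commuting generalized complex structures. The $-\sqrt{-1}$-eigenbundle of $\mathcal J_\psi$ is $\{e\in (TM\oplus T^*M)^{\mathbb C}: e\cdot\psi=0\}$, and $\langle-\mathcal J\mathcal J_\psi\,\cdot\,,\cdot\rangle$ is positive definite on $TM\oplus T^*M$. Put $\langle\alpha,\beta\rangle_s=(\alpha\wedge\sigma\beta)_{[2n]}$, where $\sigma$ is the Clifford involution. Orient $M$ by the volume form $\mathrm{vol}_M=\sqrt{-1}^{\,n}\langle\psi,\overline\psi\rangle_s$. Let $(E,h)$ be a smooth Hermitian vector bundle of rank $r$ over $M$. Let $\mathcal D=D^A+V$ be a generalized Hermitian connection on it, where $D^A$ is a unitary connection and $V\in\Gamma(\mathfrak u(E)\otimes TM)$. Let $\mathcal D^{0,1}$ be its component in $E\otimes\overline{\mathcal L}_{\mathcal J}$, where $\mathcal L_{\mathcal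 J}$ is the $-\sqrt{-1}$-eigenbundle of $\mathcal J$. The curvature is $$\mathcal F_{\mathcal A}(\psi)=F_A\cdot\psi+d^A(V\cdot\psi)+\tfrac12[V\cdot V]\cdot\psi .$$ The mean curvature $\mathcal K_{\mathcal A}(\psi)$ is the Hermitian part of the coefficient of $\psi$ in the component of $\mathcal F_{\mathcal A}(\psi)$ in $\mathrm{End}(E)\otimes U^{-n}$, $U^{-n}=\mathbb C\psi$; this coefficient is $\langle\mathcal F_{\mathcal A}(\psi),\overline\psi\rangle_s/\langle\psi,\overline\psi\rangle_s$. The degree and the slope of a complex vector bundle $F\neq0$ are $$\deg F=\int_M\sqrt{-1}^{\,n-1}\langle c_1(F)\cdot\psi,\overline\psi\rangle_s,\qquad \mu(F)=\frac{\deg F}{\operatorname{rank}F},$$ where $c_1(F)$ is any closed $2$-form representing the first Chern class. A weak generalized holomorphic subbundle of a generalized holomorphic Hermitian bundle $F$ is an element $\pi\in L^2_1(\mathrm{End}\,F)$ with $\pi^*=\pi=\pi^2$ and $(\mathrm{id}_F-\pi)\circ\overline\partial{}^F_{\mathcal J}\pi=0$. It is smooth outside a closed null set $S$. Its rank is the rank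 of $\pi$ on $M\setminus S$. Its degree is the integral over $M\setminus S$ of $\sqrt{-1}^{\,n-1}\langle c_1\cdot\psi,\overline\psi\rangle_s$, where $c_1$ is the first Chern form of the canonical generalized connection of the image of $\pi$ with the induced metric. The bundle $F$ is $\psi$-stable if $\mu(\pi)<\mu(F)$ for every such $\pi$ with $0<\operatorname{rank}\pi<\operatorname{rank}F$. **Theorem.** Suppose that $\mathcal D^{0,1}\circ\mathcal D^{0,1}=0$ and that $\mathcal D$ is Einstein–Hermitian, that is, $\mathcal K_{\mathcal A}(\psi)=\lambda\,\mathrm{id}_E$ for a real constant $\lambda$. Consider $E$ as a generalized holomorphic bundle by means of $\mathcal D^{0,1}$. Then: 1. Every generalized holomorphic subbundle $E_1\neq0$ of $E$ satisfies $\mu(E_1)\le\mu(E)$. 2. $E$ is $\psi$-polystable: there is a finite $h$-orthogonal decomposition $(E,h)=\bigoplus_i(E_i,h_i)$ into nonzero generalized holomorphic subbundles with the induced metrics $h_i=h|_{E_i}$. Each $E_i$ is $\psi$-stable. The canonical generalized connection of $(E_i,h_i)$ is Einstein–Hermitian with the same factor $\lambda$. Moreover $\mu(E_i)=\mu(E)$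 for every $i$. -/

import Mathlib

open Bundle Manifold MeasureTheory Module
open scoped Manifold ContDiff TensorProduct

namespace GenKaehler

/-! ### Spinors on one tangent space -/

section Pointwise

/-- The model of a tangent space of a `2n`-dimensional manifold. -/
abbrev W (n : ℕ) := EuclideanSpace ℝ (Fin (2 * n))

/-- The complex exterior algebra of the dual of `W n`, that is complex differential forms of
mixed degree at a point. -/
abbrev Forms (n : ℕ) := ExteriorAlgebra ℂ (W n →L[ℝ] ℂ)

variable {n : ℕ}

/-- The standard basis vector `e i`. -/
noncomputable def stdVec (i : Fin (2 * n)) : W n := EuclideanSpace.single i 1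

/-- The standard covector `dx i`, dual to `stdVec i`. -/
noncomputable def dx (i : Fin (2 * n)) : W n →L[ℝ] ℝ := EuclideanSpace.proj i

/-- A real covector as a complex differential form of degree one. -/
noncomputable def oneForm (ξ : W n →L[ℝ] ℝ) : Forms n :=
  ExteriorAlgebra.ι ℂ (Complex.ofRealCLM ∘L ξ)

/-- A real two-form as an element of the exterior algebra. -/
noncomputable def twoForm (β : W n →L[ℝ] W n →L[ℝ] ℝ) : Forms n :=
  (1 / 2 : ℂ) • ∑ i, ∑ j, ((β (stdVec i) (stdVec j) : ℝ) : ℂ) • (oneForm (dx i) * oneForm (dx j))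

/-- Evaluation at a tangent vector, an element of the dual of the space of complex covectors. -/
noncomputable def evalAt (v : W n) : Module.Dual ℂ (W n →L[ℝ] ℂ) where
  toFun ξ := ξ v
  map_add' _ _ := rfl
  map_smul' _ _ := rfl

/-- The interior product with a tangent vector. -/
noncomputable def interior (v : W n) : Forms n →ₗ[ℂ] Forms n :=
  CliffordAlgebra.contractLeft (evalAt v)

/-- The spin representation of `T ⊕ T*`: `(v + ξ) · φ = i_v φ + ξ ∧ φ`. -/
noncomputable def cliff (a : W n × (W n →L[ℝ] ℝ)) : Forms n →ₗ[ℂ] Forms n :=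
  interior a.1 + LinearMap.mulLeft ℂ (oneForm a.2)

/-- `exp (b - √-1 om)`. -/
noncomputable def psi (b om : W n →L[ℝ] W n →L[ℝ] ℝ) : Forms n :=
  ∑ k ∈ Finset.range (n + 1),
    (1 / (k.factorial : ℂ)) • (twoForm b - Complex.I • twoForm om) ^ k

/-- `exp (b + √-1 om)`, the complex conjugate of `psi b om`. -/
noncomputable def psiBar (b om : W n →L[ℝ] W n →L[ℝ] ℝ) : Forms n :=
  ∑ k ∈ Finset.range (n + 1),
    (1 / (k.factorial : ℂ)) • (twoForm b + Complex.I • twoForm om) ^ k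

/-- The values of a complex covector on the standard basis. -/
noncomputable def coords : (W n →L[ℝ] ℂ) →ₗ[ℂ] (Fin (2 * n) → ℂ) :=
  LinearMap.pi fun i => evalAt (stdVec i)

/-- The component of degree `2n` of a form, written as a multiple of `dx 0 ∧ ... ∧ dx (2n - 1)`. -/
noncomputable def topCoeff : Forms n →ₗ[ℂ] ℂ :=
  ExteriorAlgebra.liftAlternating
    (Function.update (0 : ∀ k, (W n →L[ℝ] ℂ) [⋀^Fin k]→ₗ[ℂ] ℂ) (2 * n)
      (Matrix.detRowAlternating.compLinearMap coords))

/-- The inner product `⟨α, β⟩_s = (α ∧ σ β)_[2n]` of the spin representation; `σ` is the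
Clifford involution, with sign `(-1) ^ (p (p - 1) / 2)` in degree `p`. -/
noncomputable def mukai (α β : Forms n) : ℂ := topCoeff (α * CliffordAlgebra.reverse β)

/-- The coefficient of `ψ` in the component in `U^{-n} = ℂ ψ`:
`φ ↦ ⟨φ, ψ̄⟩_s / ⟨ψ, ψ̄⟩_s`. -/
noncomputable def projU (b om : W n →L[ℝ] W n →L[ℝ] ℝ) : Forms n →ₗ[ℂ] ℂ :=
  (mukai (psi b om) (psiBar b om))⁻¹ •
    (topCoeff ∘ₗ LinearMap.mulRight ℂ (CliffordAlgebra.reverse (psiBar b om)))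

/-- The natural pairing of `T ⊕ T*`. -/
noncomputable def pairing (a c : W n × (W n →L[ℝ] ℝ)) : ℝ := (1 / 2) * (c.2 a.1 + a.2 c.1)

end Pointwise

/-! ### Generalized Kähler structures of symplectic type -/

section Base

variable {n : ℕ} {M : Type*} [TopologicalSpace M] [ChartedSpace (W n) M]

variable (n) in
/-- The fibre of `TM ⊕ T*M` at a point. -/
abbrev GT (x : M) := TangentSpace (𝓡 (2 * n)) x × (TangentSpace (𝓡 (2 * n)) x →L[ℝ] ℝ)

variable (n) in
/-- A field of bilinear forms on the tangent spaces. -/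
abbrev Bilin (M : Type*) [TopologicalSpace M] [ChartedSpace (W n) M] :=
  ∀ x : M, TangentSpace (𝓡 (2 * n)) x →L[ℝ] TangentSpace (𝓡 (2 * n)) x →L[ℝ] ℝ

/-- A smooth vector field. -/
def SmoothVF [IsManifold (𝓡 (2 * n)) ∞ M] (X : ∀ x : M, TangentSpace (𝓡 (2 * n)) x) : Prop :=
  ContMDiff (𝓡 (2 * n)) (𝓡 (2 * n)).tangent ∞
    (fun x => (⟨x, X x⟩ : TangentBundle (𝓡 (2 * n)) M))

/-- A smooth one-form. -/
def SmoothOneForm [IsManifold (𝓡 (2 * n)) ∞ M]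
    (ξ : ∀ x : M, TangentSpace (𝓡 (2 * n)) x →L[ℝ] ℝ) : Prop :=
  ∀ X : ∀ x : M, TangentSpace (𝓡 (2 * n)) x, SmoothVF X →
    ContMDiff (𝓡 (2 * n)) 𝓘(ℝ, ℝ) ∞ (fun x => ξ x (X x))

/-- A smooth section of `TM ⊕ T*M`. -/
def SmoothGT [IsManifold (𝓡 (2 * n)) ∞ M] (a : ∀ x : M, GT n x) : Prop :=
  SmoothVF (fun x => (a x).1) ∧ SmoothOneForm (fun x => (a x).2)

/-- A smooth differential two-form. -/
structure IsSmoothTwoForm [IsManifold (𝓡 (2 * n)) ∞ M] (β : Bilin n M) : Prop where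
  alt : ∀ x (v : TangentSpace (𝓡 (2 * n)) x), β x v v = 0
  smooth : ∀ X Y : ∀ x : M, TangentSpace (𝓡 (2 * n)) x, SmoothVF X → SmoothVF Y →
    ContMDiff (𝓡 (2 * n)) 𝓘(ℝ, ℝ) ∞ (fun x => β x (X x) (Y x))

/-- `dβ = 0`, by the invariant formula for the exterior derivative. -/
def IsClosedTwoForm [IsManifold (𝓡 (2 * n)) ∞ M] (β : Bilin n M) : Prop :=
  ∀ X Y Z : ∀ x : M, TangentSpace (𝓡 (2 * n)) x, SmoothVF X → SmoothVF Y → SmoothVF Z → ∀ x,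
    mvfderiv (𝓡 (2 * n)) (fun y => β y (Y y) (Z y)) x (X x)
      - mvfderiv (𝓡 (2 * n)) (fun y => β y (X y) (Z y)) x (Y x)
      + mvfderiv (𝓡 (2 * n)) (fun y => β y (X y) (Y y)) x (Z x)
      - β x (VectorField.mlieBracket (𝓡 (2 * n)) X Y x) (Z x)
      + β x (VectorField.mlieBracket (𝓡 (2 * n)) X Z x) (Y x)
      - β x (VectorField.mlieBracket (𝓡 (2 * n)) Y Z x) (X x) = 0

/-- A vector field extending a given tangent vector, constant in a chart near the point. -/
noncomputable def extVF [IsManifold (𝓡 (2 * n)) ∞ M] {x : M} (v : TangentSpace (𝓡 (2 * n)) x) :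
    ∀ y : M, TangentSpace (𝓡 (2 * n)) y :=
  FiberBundle.extend (W n) v

/-- The Lie derivative `L_X η` of a one-form, the covector with the values
`X (η (E)) - η [X, E]` on basis vectors extended to vector fields `E`. -/
noncomputable def lieForm [IsManifold (𝓡 (2 * n)) ∞ M] (X : ∀ x : M, TangentSpace (𝓡 (2 * n)) x)
    (η : ∀ x : M, TangentSpace (𝓡 (2 * n)) x →L[ℝ] ℝ) (x : M) :
    TangentSpace (𝓡 (2 * n)) x →L[ℝ] ℝ :=
  ∑ i : Fin (2 * n),
    (mvfderiv (𝓡 (2 * n)) (fun y => η y (extVF (x := x) (stdVec i) y)) x (X x)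
      - η x (VectorField.mlieBracket (𝓡 (2 * n)) X (extVF (x := x) (stdVec i)) x)) • (dx i)

/-- The Courant bracket of two sections of `TM ⊕ T*M`. -/
noncomputable def courant [IsManifold (𝓡 (2 * n)) ∞ M] (a c : ∀ x : M, GT n x) (x : M) : GT n x :=
  (VectorField.mlieBracket (𝓡 (2 * n)) (fun y => (a y).1) (fun y => (c y).1) x,
    lieForm (fun y => (a y).1) (fun y => (c y).2) x
      - lieForm (fun y => (c y).1) (fun y => (a y).2) x
      - (1 / 2 : ℝ) • mvfderiv (𝓡 (2 * n)) (fun y => (c y).2 (a y).1 - (a y).2 (c y).1) x)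

/-- For real sections `a`, `c` the sections `a + √-1 J a` and `c + √-1 J c` are the general
sections of the `-√-1`-eigenbundle `L_J`. This is the real part of their Courant bracket. -/
noncomputable def bracketRe [IsManifold (𝓡 (2 * n)) ∞ M] (J : ∀ x : M, GT n x →ₗ[ℝ] GT n x)
    (a c : ∀ x : M, GT n x) (x : M) : GT n x :=
  courant a c x - courant (fun y => J y (a y)) (fun y => J y (c y)) x

/-- The imaginary part of the Courant bracket of `a + √-1 J a` and `c + √-1 J c`. -/
noncomputable def bracketIm [IsManifold (𝓡 (2 * n)) ∞ M] (J : ∀ x : M, GT n x →ₗ[ℝ] GT n x)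
    (a c : ∀ x : M, GT n x) (x : M) : GT n x :=
  courant (fun y => J y (a y)) c x + courant a (fun y => J y (c y)) x

/-- Generalized complex structures. A complex section `p + √-1 q` of `TM ⊕ T*M` lies in `L_J` if
and only if `q = J p`; so `involutive` says that `L_J` is closed under the Courant bracket. -/
structure IsGenComplex [IsManifold (𝓡 (2 * n)) ∞ M] (J : ∀ x : M, GT n x →ₗ[ℝ] GT n x) :
    Prop where
  smooth : ∀ a : ∀ x : M, GT n x, SmoothGT a → SmoothGT (fun x => J x (a x))
  sq : ∀ x a, J x (J x a) = -a
  orth : ∀ x a c, pairing (J x a) (J x c) = pairing a c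
  involutive : ∀ a c : ∀ x : M, GT n x, SmoothGT a → SmoothGT c → ∀ x,
    bracketIm J a c x = J x (bracketRe J a c x)

variable (n) in
/-- A generalized Kähler structure of symplectic type `(J, J_ψ)` with `ψ = exp (b - √-1 om)`. -/
structure GenKaehlerSympl (M : Type*) [TopologicalSpace M] [ChartedSpace (W n) M]
    [IsManifold (𝓡 (2 * n)) ∞ M] where
  /-- the symplectic form -/
  om : Bilin n M
  /-- the closed real two-form -/
  b : Bilin n M
  /-- the first generalized complex structure -/
  J : ∀ x : M, GT n x →ₗ[ℝ] GT n x
  /-- the generalized complex structure induced by `ψ` -/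
  Jψ : ∀ x : M, GT n x →ₗ[ℝ] GT n x
  om_form : IsSmoothTwoForm om
  om_closed : IsClosedTwoForm om
  om_nondeg : ∀ x (v : TangentSpace (𝓡 (2 * n)) x), (∀ w, om x v w = 0) → v = 0
  b_form : IsSmoothTwoForm b
  b_closed : IsClosedTwoForm b
  J_complex : IsGenComplex J
  Jψ_complex : IsGenComplex Jψ
  /-- the `-√-1`-eigenbundle of `Jψ`, which consists of the `a + √-1 Jψ a`, annihilates `ψ` -/
  Jψ_ker : ∀ x a, cliff a (psi (b x) (om x)) + Complex.I • cliff (Jψ x a) (psi (b x) (om x)) = 0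
  comm : ∀ x a, J x (Jψ x a) = Jψ x (J x a)
  /-- the generalized metric `⟨-J Jψ ·, ·⟩` is positive definite -/
  pos : ∀ x a, a ≠ 0 → 0 < pairing (-(J x (Jψ x a))) a

variable [IsManifold (𝓡 (2 * n)) ∞ M]

/-! ### The volume form `√-1 ^ n ⟨ψ, ψ̄⟩_s` and integration -/

/-- The differential at `y` of the inverse of the chart `extChartAt c`. -/
noncomputable def chartTangent (c : M) (y : W n) :
    W n →L[ℝ] TangentSpace (𝓡 (2 * n)) ((extChartAt (𝓡 (2 * n)) c).symm y) :=
  mfderiv 𝓘(ℝ, W n) (𝓡 (2 * n)) (extChartAt (𝓡 (2 * n)) c).symm y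

/-- The density of the volume form in the chart `extChartAt c`, with respect to Lebesgue
measure. The volume form is positive for the orientation that it defines. -/
noncomputable def volDensity (K : GenKaehlerSympl n M) (c : M) (y : W n) : ℝ :=
  let x := (extChartAt (𝓡 (2 * n)) c).symm y
  ‖Complex.I ^ n * mukai (psi (K.b x) (K.om x)) (psiBar (K.b x) (K.om x))‖
    * |LinearMap.det (M := W n) (chartTangent c y).toLinearMap|

/-- The measure of the volume form `√-1 ^ n ⟨ψ, ψ̄⟩_s`, by a partition of unity. -/
noncomputable def vol [CompactSpace M] [T2Space M] [MeasurableSpace M]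
    (K : GenKaehlerSympl n M) : Measure M :=
  let ρ := Classical.choose
    (SmoothPartitionOfUnity.exists_isSubordinate_chartAt_source (𝓡 (2 * n)) M)
  Measure.sum fun c : M =>
    Measure.map (extChartAt (𝓡 (2 * n)) c).symm
      ((volume.restrict (extChartAt (𝓡 (2 * n)) c).target).withDensity
        (fun y => ENNReal.ofReal
          (ρ c ((extChartAt (𝓡 (2 * n)) c).symm y) * volDensity K c y)))

/-- The integral over `U` of a top degree form; `τ x` is its coefficient at `x` with respect to
`dx 0 ∧ ... ∧ dx (2n - 1)`. The manifold is oriented by the volume form. -/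
noncomputable def integralTop [CompactSpace M] [T2Space M] [MeasurableSpace M]
    (K : GenKaehlerSympl n M) (U : Set M) (τ : M → ℂ) : ℂ :=
  ∫ x in U, τ x / (Complex.I ^ n * mukai (psi (K.b x) (K.om x)) (psiBar (K.b x) (K.om x))) ∂(vol K)

/-- `θ` is the weak differential of `f : M → ℂ`. -/
def HasWeakDifferential (f : M → ℂ) (θ : ∀ x : M, TangentSpace (𝓡 (2 * n)) x → ℂ) : Prop :=
  ∀ (c : M) (φ : W n → ℝ), ContDiff ℝ ∞ φ → HasCompactSupport φ →
    tsupport φ ⊆ (extChartAt (𝓡 (2 * n)) c).target → ∀ i : Fin (2 * n),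
    ∫ y in (extChartAt (𝓡 (2 * n)) c).target,
        ((fderiv ℝ φ y (stdVec i) : ℝ) : ℂ) * f ((extChartAt (𝓡 (2 * n)) c).symm y)
      = - ∫ y in (extChartAt (𝓡 (2 * n)) c).target,
        ((φ y : ℝ) : ℂ) * θ ((extChartAt (𝓡 (2 * n)) c).symm y) (chartTangent c y (stdVec i))

end Base

/-! ### Generalized connections on Hermitian vector bundles -/

section VBundle

variable {n r : ℕ} {M : Type*} [TopologicalSpace M] [ChartedSpace (W n) M]
  [IsManifold (𝓡 (2 * n)) ∞ M]
  {E : M → Type*} [TopologicalSpace (TotalSpace (EuclideanSpace ℂ (Fin r)) E)]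
  [∀ x, NormedAddCommGroup (E x)] [∀ x, InnerProductSpace ℂ (E x)]
  [FiberBundle (EuclideanSpace ℂ (Fin r)) E]
  [VectorBundle ℂ (EuclideanSpace ℂ (Fin r)) E] [VectorBundle ℝ (EuclideanSpace ℂ (Fin r)) E]
  [ContMDiffVectorBundle ∞ (EuclideanSpace ℂ (Fin r)) E (𝓡 (2 * n))]

variable (n r) in
/-- A section that is smooth on `U`. -/
def SmoothSecOn (U : Set M) (s : ∀ x, E x) : Prop :=
  ContMDiffOn (𝓡 (2 * n)) ((𝓡 (2 * n)).prod 𝓘(ℝ, EuclideanSpace ℂ (Fin r))) ∞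
    (fun x => TotalSpace.mk' (EuclideanSpace ℂ (Fin r)) x (s x)) U

variable (n r) in
/-- A smooth section. -/
def SmoothSec (s : ∀ x, E x) : Prop := SmoothSecOn n r Set.univ s

variable (n r E) in
/-- The Hermitian metric, given by the inner products of the fibres, is smooth. -/
def IsSmoothMetric : Prop :=
  ∀ s t : ∀ x, E x, SmoothSec n r s → SmoothSec n r t →
    ContMDiff (𝓡 (2 * n)) 𝓘(ℝ, ℂ) ∞ (fun x => inner ℂ (s x) (t x))

variable (n r) in
/-- A field of endomorphisms of `E` that is smooth on `U`. -/
def SmoothEndOn (U : Set M) (P : ∀ x, Module.End ℂ (E x)) : Prop :=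
  ∀ s : ∀ x, E x, SmoothSec n r s → SmoothSecOn n r U (fun x => P x (s x))

variable (n r E) in
/-- A smooth complex linear connection on the complex vector bundle `E`. -/
structure CConnection where
  /-- the covariant derivative; `nabla s x v` is the derivative of `s` along `v` -/
  nabla : CovariantDerivative (𝓡 (2 * n)) (EuclideanSpace ℂ (Fin r)) E
  smooth : CovariantDerivative.ContMDiffCovariantDerivative nabla ∞
  complex : ∀ s : ∀ x, E x, SmoothSec n r s → ∀ x v,
    nabla (fun y => Complex.I • s y) x v = Complex.I • nabla s x v

variable (n r E) in
/-- A generalized connection `D : Γ(E) → Γ(E ⊗ (TM ⊕ T*M)^ℂ)`. By the Leibniz rule it is the sum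
of a connection, its part in `E ⊗ T*M`, and a section `vec` of `End(E) ⊗ TM`; here an element of
`End(E) ⊗ TM` is a map from `T*M` to `End(E)`. -/
structure GenConnection extends CConnection n r E where
  /-- the part in `End(E) ⊗ TM` -/
  vec : ∀ x, (TangentSpace (𝓡 (2 * n)) x →L[ℝ] ℝ) →ₗ[ℝ] Module.End ℂ (E x)
  vec_smooth : ∀ ξ : ∀ x : M, TangentSpace (𝓡 (2 * n)) x →L[ℝ] ℝ, SmoothOneForm ξ →
    SmoothEndOn n r Set.univ (fun x => vec x (ξ x))

/-- Generalized Hermitian connections: `d h(s, t) = h(D s, t) + h(s, D t)` in `TM ⊕ T*M`. -/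
structure GenConnection.IsHermitian (D : GenConnection n r E) : Prop where
  form : ∀ s t : ∀ x, E x, SmoothSec n r s → SmoothSec n r t → ∀ x v,
    mvfderiv (𝓡 (2 * n)) (fun y => inner ℂ (s y) (t y)) x v
      = inner ℂ (D.nabla s x v) (t x) + inner ℂ (s x) (D.nabla t x v)
  vector : ∀ x ξ (u w : E x), inner ℂ (D.vec x ξ u) w + inner ℂ u (D.vec x ξ w) = 0

/-- `D_a s = 2 ⟨D s, a⟩` for a real element `a = v + ξ` of `TM ⊕ T*M`. -/
noncomputable def GenConnection.along (D : GenConnection n r E) (s : ∀ x, E x) (x : M)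
    (a : GT n x) : E x :=
  D.nabla s x a.1 + D.vec x a.2 (s x)

/-- The part `D^{0,1} s` in `E ⊗ L̄_J`, paired with the element `a + √-1 J a` of `L_J`; the bundle
`L̄_J` is dual to `L_J` under `2 ⟨·, ·⟩`. -/
noncomputable def GenConnection.dbar (D : GenConnection n r E)
    (J : ∀ x : M, GT n x →ₗ[ℝ] GT n x) (s : ∀ x, E x) (x : M) (a : GT n x) : E x :=
  D.along s x a + Complex.I • D.along s x (J x a)

/-- `D^{0,1} ∘ D^{0,1} = 0`, with `D^{0,1}` extended to `E ⊗ ∧ L̄_J` by the Lie algebroid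
differential of `L_J`. -/
def GenConnection.IsFlat01 (D : GenConnection n r E) (J : ∀ x : M, GT n x →ₗ[ℝ] GT n x) : Prop :=
  ∀ (a c : ∀ x : M, GT n x) (s : ∀ x, E x), SmoothGT a → SmoothGT c → SmoothSec n r s → ∀ x,
    D.dbar J (fun y => D.dbar J s y (c y)) x (a x)
      - D.dbar J (fun y => D.dbar J s y (a y)) x (c x)
      - D.dbar J s x (bracketRe J a c x) = 0

/-! ### Subbundles

A subbundle is given by its orthogonal projection `P`. The identity stands for `E`. The metric and
the generalized Hermitian connection of `E` induce the restricted metric and the generalized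
Hermitian connection `P ∘ D ∘ P` on the image of `P`. If the image is a generalized holomorphic
subbundle, then the latter is its canonical generalized connection, since it is Hermitian and its
`(0,1)`-part is the restriction of `D^{0,1}`. -/

variable (n r) in
/-- `P` is the orthogonal projection onto a smooth subbundle of rank `p`. -/
structure IsSubbundle (P : ∀ x, Module.End ℂ (E x)) (p : ℕ) : Prop where
  smooth : SmoothEndOn n r Set.univ P
  idem : ∀ x u, P x (P x u) = P x u
  symm : ∀ x u w, inner ℂ (P x u) w = inner ℂ u (P x w)
  rank : ∀ x, finrank ℂ (LinearMap.range (P x)) = p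

/-- `P` is the orthogonal projection onto a generalized holomorphic subbundle of rank `p`. -/
structure IsGenHolSubbundle (J : ∀ x : M, GT n x →ₗ[ℝ] GT n x) (D : GenConnection n r E)
    (P : ∀ x, Module.End ℂ (E x)) (p : ℕ) : Prop extends IsSubbundle n r P p where
  hol : ∀ s : ∀ x, E x, SmoothSec n r s → ∀ x a,
    P x (D.dbar J (fun y => P y (s y)) x a) = D.dbar J (fun y => P y (s y)) x a

/-- The operator `P ∘ ∇ ∘ P`. -/
noncomputable def compress (P : ∀ x, Module.End ℂ (E x)) (C : CConnection n r E) (s : ∀ x, E x) (x : M)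
    (v : TangentSpace (𝓡 (2 * n)) x) : E x :=
  P x (C.nabla (fun y => P y (s y)) x v)

/-- The section `P ∘ V ∘ P` of `End(E) ⊗ TM`. -/
noncomputable def compressVec (P : ∀ x, Module.End ℂ (E x)) (D : GenConnection n r E) (x : M)
    (ξ : TangentSpace (𝓡 (2 * n)) x →L[ℝ] ℝ) : Module.End ℂ (E x) :=
  P x * D.vec x ξ * P x

/-! ### Curvature -/

variable (r) in
/-- A local smooth section that extends a given vector. -/
noncomputable def extSec {x : M} (e : E x) : ∀ y, E y :=
  FiberBundle.extend (EuclideanSpace ℂ (Fin r)) e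

variable (r E) in
/-- A basis of the fibre. -/
noncomputable def fibreBasis (x : M) : Basis (Fin r) ℂ (E x) :=
  (EuclideanSpace.basisFun (Fin r) ℂ).toBasis.map
    ((trivializationAt (EuclideanSpace ℂ (Fin r)) E x).linearEquivAt ℂ x
      (FiberBundle.mem_baseSet_trivializationAt' x)).symm

variable (r) in
/-- The linear endomorphism with the values of `f` on a basis; it is `f` when `f` is linear. -/
noncomputable def linearize {x : M} (f : E x → E x) : Module.End ℂ (E x) :=
  (fibreBasis r E x).constr ℂ (fun k => f (fibreBasis r E x k))

/-- The curvature
`F(X, Y) s = ∇_X ∇_Y s - ∇_Y ∇_X s - ∇_{[X, Y]} s` of `∇` replaced by `P ∘ ∇ ∘ P`. -/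
noncomputable def curv (P : ∀ x, Module.End ℂ (E x)) (C : CConnection n r E) (x : M)
    (v w : TangentSpace (𝓡 (2 * n)) x) : Module.End ℂ (E x) :=
  linearize r fun e =>
    compress P C (fun y => compress P C (extSec r e) y (extVF w y)) x v
      - compress P C (fun y => compress P C (extSec r e) y (extVF v y)) x w
      - compress P C (extSec r e) x
          (VectorField.mlieBracket (𝓡 (2 * n)) (extVF v) (extVF w) x)

/-- The `End(E)`-valued one-form `θ` with `V · ψ = θ ∧ ψ`, the contraction of `V` with
`b - √-1 om`; note `β(·, w) = -β(w, ·)` for two-forms `β`. -/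
noncomputable def theta (K : GenKaehlerSympl n M) (P : ∀ x, Module.End ℂ (E x))
    (D : GenConnection n r E) (x : M) (w : TangentSpace (𝓡 (2 * n)) x) : Module.End ℂ (E x) :=
  compressVec P D x (-(K.b x w)) - Complex.I • compressVec P D x (-(K.om x w))

/-- The exterior covariant derivative `d^A θ`. Since `dψ = 0`, one has
`d^A (V · ψ) = d^A (θ ∧ ψ) = (d^A θ) ∧ ψ`. -/
noncomputable def dTheta (K : GenKaehlerSympl n M) (P : ∀ x, Module.End ℂ (E x))
    (D : GenConnection n r E) (x : M) (v w : TangentSpace (𝓡 (2 * n)) x) :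
    Module.End ℂ (E x) :=
  linearize r fun e =>
    (compress P D.toCConnection (fun y => theta K P D y (extVF w y) (extSec r e y)) x v
        - theta K P D x w (compress P D.toCConnection (extSec r e) x v))
      - (compress P D.toCConnection (fun y => theta K P D y (extVF v y) (extSec r e y)) x w
        - theta K P D x v (compress P D.toCConnection (extSec r e) x w))
      - theta K P D x (VectorField.mlieBracket (𝓡 (2 * n)) (extVF v) (extVF w) x) e

/-- An `End(E)`-valued two-form acting on `ψ`. -/
noncomputable def actPsi (K : GenKaehlerSympl n M) (x : M)
    (F : TangentSpace (𝓡 (2 * n)) x → TangentSpace (𝓡 (2 * n)) x → Module.End ℂ (E x)) :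
    Module.End ℂ (E x) ⊗[ℂ] Forms n :=
  (1 / 2 : ℂ) • ∑ i, ∑ j, F (stdVec i) (stdVec j) ⊗ₜ[ℂ]
    (oneForm (dx i) * oneForm (dx j) * psi (K.b x) (K.om x))

/-- `[V · V] · ψ = ∑ [V_i, V_j] ⊗ (e_i · e_j · ψ)` for `V = ∑ V_i e_i`. -/
noncomputable def vecVecPsi (K : GenKaehlerSympl n M) (P : ∀ x, Module.End ℂ (E x))
    (D : GenConnection n r E) (x : M) : Module.End ℂ (E x) ⊗[ℂ] Forms n :=
  ∑ i, ∑ j, (compressVec P D x (dx i) * compressVec P D x (dx j)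
      - compressVec P D x (dx j) * compressVec P D x (dx i)) ⊗ₜ[ℂ]
    (interior (stdVec i) (interior (stdVec j) (psi (K.b x) (K.om x))))

/-- The curvature `F_A · ψ + d^A (V · ψ) + (1/2) [V · V] · ψ` of the generalized connection
`P ∘ D ∘ P`. -/
noncomputable def genCurv (K : GenKaehlerSympl n M) (P : ∀ x, Module.End ℂ (E x))
    (D : GenConnection n r E) (x : M) : Module.End ℂ (E x) ⊗[ℂ] Forms n :=
  actPsi K x (curv P D.toCConnection x) + actPsi K x (dTheta K P D x)
    + (1 / 2 : ℂ) • vecVecPsi K P D x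

/-- The `U^{-n}`-component of the curvature, as an endomorphism. -/
noncomputable def curvU (K : GenKaehlerSympl n M) (P : ∀ x, Module.End ℂ (E x))
    (D : GenConnection n r E) (x : M) : Module.End ℂ (E x) :=
  TensorProduct.rid ℂ _ (LinearMap.lTensor _ (projU (K.b x) (K.om x)) (genCurv K P D x))

/-- The Einstein-Hermitian condition with factor `lam` for the bundle with projection `P`: the
Hermitian part `(T + T*) / 2` of the `U^{-n}`-component `T` of the curvature is `lam` times the
identity of the bundle. -/
def IsEinsteinHermitian (K : GenKaehlerSympl n M) (P : ∀ x, Module.End ℂ (E x))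
    (D : GenConnection n r E) (lam : ℝ) : Prop :=
  ∀ x (u w : E x), (1 / 2 : ℂ) * (inner ℂ u (curvU K P D x w) + inner ℂ (curvU K P D x u) w)
    = lam * inner ℂ u (P x w)

/-! ### Degree, slope and stability -/

/-- The first Chern form `(√-1 / 2π) tr F` of `P ∘ ∇ ∘ P`, as a complex form. -/
noncomputable def chernForm (P : ∀ x, Module.End ℂ (E x)) (C : CConnection n r E) (x : M) :
    Forms n :=
  (1 / 2 : ℂ) • ∑ i, ∑ j, (Complex.I / (2 * Real.pi) *
    LinearMap.trace ℂ (E x) (curv P C x (stdVec i) (stdVec j))) •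
      (oneForm (dx i) * oneForm (dx j))

/-- `∫_U √-1 ^ (n - 1) ⟨c₁ · ψ, ψ̄⟩_s`, with `c₁` the first Chern form of `P ∘ ∇ ∘ P`. -/
noncomputable def degreeOn [CompactSpace M] [T2Space M] [MeasurableSpace M]
    (K : GenKaehlerSympl n M) (C : CConnection n r E) (U : Set M)
    (P : ∀ x, Module.End ℂ (E x)) : ℝ :=
  (integralTop K U fun x => -Complex.I * Complex.I ^ n *
    mukai (chernForm P C x * psi (K.b x) (K.om x)) (psiBar (K.b x) (K.om x))).re

/-- The slope of the subbundle of rank `p` with projection `P`. Its first Chern class is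
represented by means of the connection `C` on `E`; the slope does not depend on `C`. -/
noncomputable def slope [CompactSpace M] [T2Space M] [MeasurableSpace M]
    (K : GenKaehlerSympl n M) (C : CConnection n r E) (P : ∀ x, Module.End ℂ (E x)) (p : ℕ) : ℝ :=
  degreeOn K C Set.univ P / p

/-- `T` is the weak covariant derivative of the field of endomorphisms `q`: the functions
`h(q s, t)` have the weak differentials given by the Leibniz rule. -/
def HasWeakCovDeriv (D : GenConnection n r E) (q : ∀ x, Module.End ℂ (E x))
    (T : ∀ x, TangentSpace (𝓡 (2 * n)) x →ₗ[ℝ] Module.End ℂ (E x)) : Prop :=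
  ∀ s t : ∀ x, E x, SmoothSec n r s → SmoothSec n r t →
    HasWeakDifferential (n := n) (fun x => inner ℂ (t x) (q x (s x))) (fun x v =>
      inner ℂ (t x) (T x v (s x)) + inner ℂ (t x) (q x (D.nabla s x v))
        + inner ℂ (D.nabla t x v) (q x (s x)))

/-- `q` is a weak generalized holomorphic subbundle of the bundle with projection `P`: it is of
class `L²₁`, with weak covariant derivative `T`, it satisfies `q* = q = q²` and
`(id - q) ∘ (∂̄_J q) = 0`, and it takes values in the image of `P`. -/
structure IsWeakSubbundle [CompactSpace M] [T2Space M] [MeasurableSpace M]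
    (K : GenKaehlerSympl n M) (D : GenConnection n r E) (P q : ∀ x, Module.End ℂ (E x))
    (T : ∀ x, TangentSpace (𝓡 (2 * n)) x →ₗ[ℝ] Module.End ℂ (E x)) : Prop where
  memLp : ∀ s t : ∀ x, E x, SmoothSec n r s → SmoothSec n r t →
    MemLp (fun x => inner ℂ (t x) (q x (s x))) 2 (vol K)
  memLp_deriv : ∀ (X : ∀ x : M, TangentSpace (𝓡 (2 * n)) x) (s t : ∀ x, E x), SmoothVF X →
    SmoothSec n r s → SmoothSec n r t →
    MemLp (fun x => inner ℂ (t x) (T x (X x) (s x))) 2 (vol K)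
  weak : HasWeakCovDeriv D q T
  sub : ∀ᵐ x ∂(vol K), P x * q x = q x
  idem : ∀ᵐ x ∂(vol K), q x * q x = q x
  symm : ∀ᵐ x ∂(vol K), ∀ u w, inner ℂ (q x u) w = inner ℂ u (q x w)
  hol : ∀ᵐ x ∂(vol K), ∀ a : GT n x,
    (1 - q x) * ((T x a.1 + (D.vec x a.2 * q x - q x * D.vec x a.2))
      + Complex.I • (T x (K.J x a).1
        + (D.vec x (K.J x a).2 * q x - q x * D.vec x (K.J x a).2))) = 0

/-- `ψ`-stability of the generalized holomorphic bundle of rank `p` with projection `P`. A weak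
generalized holomorphic subbundle `q` is smooth outside of a closed null set `S`, where it is the
projection onto a generalized holomorphic subbundle; its rank `k` and its degree, the integral of
the first Chern form of the canonical generalized connection, are taken there. -/
def IsStable [CompactSpace M] [T2Space M] [MeasurableSpace M]
    (K : GenKaehlerSympl n M) (D : GenConnection n r E) (C : CConnection n r E)
    (P : ∀ x, Module.End ℂ (E x)) (p : ℕ) : Prop :=
  ∀ (q : ∀ x, Module.End ℂ (E x))
    (T : ∀ x, TangentSpace (𝓡 (2 * n)) x →ₗ[ℝ] Module.End ℂ (E x)) (S : Set M) (k : ℕ),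
    IsWeakSubbundle K D P q T → IsClosed S → vol K S = 0 → SmoothEndOn n r Sᶜ q →
    (∀ x ∈ Sᶜ, finrank ℂ (LinearMap.range (q x)) = k) → 0 < k → k < p →
    degreeOn K D.toCConnection Sᶜ q / k < slope K C P p

end VBundle

end GenKaehler

/-! Let `P` be the orthogonal projection onto a subbundle and let R_a = ∇_v P + [V_ξ, P], for a = v
+ ξ, be its total derivative. A Gauss equation (`curvU_eq_quad`) writes the ψ-coefficient of the
curvature of P ∘ D ∘ P as the compression of the ψ-coefficient for D plus a term quadratic in R. If
the image of P is generalized holomorphic, then R_{Ja} P = √-1 R_a P. Since J and J_ψ are commuting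
orthogonal complex structures and ⟨-J J_ψ ·, ·⟩ is positive, the real trace of the quadratic term is
minus a positively weighted sum of squares |R_f P|² over a metric-orthogonal basis (`re_trace_quad`,
`pairTr_trRe_nonneg`). This sum is the `defect`. It vanishes exactly when R P does, and then R = 0
(`totalDeriv_eq_zero`).

Now take traces. The term [V · V] is a sum of commutators and has no trace. The term d^A (V · ψ),
and likewise a change of the connection that represents c₁, contributes an exact two-form dτ. If τ =
∑ f dg, the ψ-coefficient of dτ ∧ ψ is a constant times ∑ X_g f, with X_g the Hamiltonian vector
field of g (`contractD_grad`). As `om` is closed, X_g is divergence free for the volume form, so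
these terms integrate to zero (`IsWeaklyDiff.stokes`). With the Einstein–Hermitian equation this
gives deg = (1/2π)(λ k Vol - ∫ defect) for a subbundle of rank k. The formula also holds for weak
subbundles (`IsWeakSubbundle.degreeOn_eq`): integration by parts needs only the weak derivative of
the projection, which exists across the singular set.

Hence every slope is at most λ Vol / 2π, which is the slope of E; this is the first claim. If a
parallel subbundle P is not stable, some weak subbundle q of it reaches this bound. Its defect
vanishes almost everywhere, so q has zero covariant derivative and commutes with V. The coefficients
h(t, q s) then satisfy a linear system df = ∑ f A with smooth A. Bounded solutions are Lipschitz
across the null set, extend continuously and are smooth by bootstrapping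
(`exists_contDiffOn_of_weakFDeriv`). So q extends to a smooth parallel projection Q, both Q and P -
Q are parallel of smaller rank, and induction on the rank gives the decomposition. Parallel summands
have zero defect, so they have slope λ Vol / 2π, and by the Gauss equation they inherit the
Einstein–Hermitian condition. -/

namespace GenKaehler

/-! ### Exterior algebra of the covectors: degree, contraction, top coefficient. -/

section SpinorAlgebra

variable {n : ℕ}

/-- The forms of degree `k`. -/
noncomputable def degForms (n k : ℕ) : Submodule ℂ (Forms n) :=
  LinearMap.range (ExteriorAlgebra.ι ℂ (M := W n →L[ℝ] ℂ)) ^ k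

theorem span_ιMulti (k : ℕ) : Submodule.span ℂ
    (Set.range (ExteriorAlgebra.ιMulti ℂ (M := W n →L[ℝ] ℂ) k)) = degForms n k :=
  ExteriorAlgebra.ιMulti_span_fixedDegree ℂ k

theorem sum_coord_stdVec (v : W n) : ∑ i, v i • stdVec (n := n) i = v := by
  ext j
  simp [stdVec, Finset.sum_apply, Pi.single_apply]

theorem coords_injective : Function.Injective (coords (n := n)) := by
  intro ξ η h
  ext v
  rw [← sum_coord_stdVec v]
  simp only [map_sum, map_smul]
  refine Finset.sum_congr rfl fun i _ => ?_
  congr 1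
  exact congrFun h i

noncomputable instance : FiniteDimensional ℂ (W n →L[ℝ] ℂ) :=
  FiniteDimensional.of_injective (coords (n := n)) coords_injective

theorem finrank_covectors_le : finrank ℂ (W n →L[ℝ] ℂ) ≤ 2 * n := by
  have := LinearMap.finrank_le_finrank_of_injective (coords_injective (n := n))
  simpa using this

/-- Covectors embed in ℂ^(2n), so more than 2n of them are linearly dependent. -/
theorem ιMulti_eq_zero_of_lt {k : ℕ} (hk : 2 * n < k) (v : Fin k → W n →L[ℝ] ℂ) :
    ExteriorAlgebra.ιMulti ℂ k v = 0 := by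
  apply AlternatingMap.map_linearDependent
  intro h
  have := h.fintype_card_le_finrank
  have := finrank_covectors_le (n := n)
  simp at *
  omega

theorem degForms_induction {k : ℕ} {p : Forms n → Prop} {φ : Forms n} (hφ : φ ∈ degForms n k)
    (h : ∀ v, p (ExteriorAlgebra.ιMulti ℂ k v)) (h0 : p 0)
    (hadd : ∀ a b, p a → p b → p (a + b)) (hsmul : ∀ (c : ℂ) a, p a → p (c • a)) : p φ := by
  rw [← span_ιMulti] at hφ
  induction hφ using Submodule.span_induction with
  | mem x hx => obtain ⟨v, rfl⟩ := hx; exact h v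
  | zero => exact h0
  | add x y _ _ hx hy => exact hadd _ _ hx hy
  | smul c x _ hx => exact hsmul _ _ hx

theorem ιMulti_mem_degForms {k : ℕ} (v : Fin k → W n →L[ℝ] ℂ) :
    ExteriorAlgebra.ιMulti ℂ k v ∈ degForms n k := by
  rw [← span_ιMulti]
  exact Submodule.subset_span ⟨v, rfl⟩

theorem forms_induction {p : Forms n → Prop}
    (h : ∀ k, ∀ φ ∈ degForms n k, p φ) (hadd : ∀ a b, p a → p b → p (a + b)) (φ : Forms n) :
    p φ := by
  have hφ : φ ∈ ⨆ k, degForms n k := by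
    have : (⊤ : Submodule ℂ (Forms n)) ≤ ⨆ k, degForms n k := by
      rw [← ExteriorAlgebra.ιMulti_span ℂ (W n →L[ℝ] ℂ), Submodule.span_le]
      rintro _ ⟨⟨k, v⟩, rfl⟩
      exact Submodule.mem_iSup_of_mem k (ιMulti_mem_degForms v)
    exact this trivial
  exact Submodule.iSup_induction _ (motive := p) hφ h (h 0 0 (zero_mem _)) hadd

theorem degForms_eq_zero {k : ℕ} (hk : 2 * n < k) {φ : Forms n} (hφ : φ ∈ degForms n k) :
    φ = 0 := by
  refine degForms_induction (p := fun φ => φ = 0) hφ ?_ ?_ ?_ ?_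
  · intro v
    exact ιMulti_eq_zero_of_lt hk v
  · rfl
  · intro a b ha hb
    simp [ha, hb]
  · intro c a ha
    simp [ha]

theorem topCoeff_ιMulti {k : ℕ} (v : Fin k → W n →L[ℝ] ℂ) (hk : k ≠ 2 * n) :
    topCoeff (ExteriorAlgebra.ιMulti ℂ k v) = 0 := by
  rw [topCoeff, ExteriorAlgebra.liftAlternating_apply_ιMulti, Function.update_of_ne hk]
  rfl

theorem topCoeff_ιMulti_top (v : Fin (2 * n) → W n →L[ℝ] ℂ) :
    topCoeff (ExteriorAlgebra.ιMulti ℂ (2 * n) v) = Matrix.det fun i j => v i (stdVec j) := by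
  rw [topCoeff, ExteriorAlgebra.liftAlternating_apply_ιMulti, Function.update_self]
  rfl

theorem topCoeff_of_mem {k : ℕ} (hk : k ≠ 2 * n) {φ : Forms n} (hφ : φ ∈ degForms n k) :
    topCoeff φ = 0 := by
  refine degForms_induction (p := fun φ => topCoeff φ = 0) hφ ?_ ?_ ?_ ?_
  · intro v
    exact topCoeff_ιMulti v hk
  · simp
  · intro a b ha hb
    simp [ha, hb]
  · intro c a ha
    simp [ha]

theorem ι_mul_mem {k : ℕ} (ξ : W n →L[ℝ] ℂ) {φ : Forms n} (hφ : φ ∈ degForms n k) :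
    ExteriorAlgebra.ι ℂ ξ * φ ∈ degForms n (k + 1) := by
  rw [degForms, pow_succ']
  exact Submodule.mul_mem_mul ⟨ξ, rfl⟩ hφ

theorem interior_ι_mul (X : W n) (ξ : W n →L[ℝ] ℂ) (φ : Forms n) :
    interior X (ExteriorAlgebra.ι ℂ ξ * φ)
      = ξ X • φ - ExteriorAlgebra.ι ℂ ξ * interior X φ :=
  CliffordAlgebra.contractLeft_ι_mul (d := evalAt X) ξ φ

theorem interior_one (X : W n) : interior X (1 : Forms n) = 0 :=
  CliffordAlgebra.contractLeft_one _ (evalAt X)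

theorem degForms_succ_induction {k : ℕ} {p : Forms n → Prop} {φ : Forms n}
    (hφ : φ ∈ degForms n (k + 1))
    (h : ∀ ξ, ∀ φ ∈ degForms n k, p (ExteriorAlgebra.ι ℂ ξ * φ))
    (hadd : ∀ a b, p a → p b → p (a + b)) : p φ := by
  rw [degForms, pow_succ'] at hφ
  induction hφ using Submodule.mul_induction_on' with
  | mem_mul_mem m hm ψ hψ => obtain ⟨ξ, rfl⟩ := hm; exact h ξ ψ hψ
  | add x _ y _ hx hy => exact hadd _ _ hx hy

theorem mem_degForms_zero {φ : Forms n} (hφ : φ ∈ degForms n 0) :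
    ∃ c : ℂ, φ = c • (1 : Forms n) := by
  rw [degForms, pow_zero, Submodule.mem_one] at hφ
  obtain ⟨c, rfl⟩ := hφ
  exact ⟨c, by rw [Algebra.algebraMap_eq_smul_one]⟩

theorem interior_mem (X : W n) {k : ℕ} {φ : Forms n} (hφ : φ ∈ degForms n (k + 1)) :
    interior X φ ∈ degForms n k := by
  induction k generalizing φ with
  | zero =>
    refine degForms_succ_induction (p := fun φ => interior X φ ∈ degForms n 0) hφ ?_ ?_
    · intro ξ φ hφ
      obtain ⟨c, rfl⟩ := mem_degForms_zero hφ
      rw [interior_ι_mul, map_smul, interior_one]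
      simpa using Submodule.smul_mem _ _ hφ
    · intro a b ha hb
      rw [map_add]; exact add_mem ha hb
  | succ k ih =>
    refine degForms_succ_induction (p := fun φ => interior X φ ∈ degForms n (k + 1)) hφ ?_ ?_
    · intro ξ φ hφ
      rw [interior_ι_mul]
      exact sub_mem (Submodule.smul_mem _ _ hφ) (ι_mul_mem _ (ih hφ))
    · intro a b ha hb
      rw [map_add]; exact add_mem ha hb

/-- Contraction lowers the degree by one, so a top-degree part could come only from degree 2n + 1,
where all forms vanish. Applied to products, this serves as a pointwise integration by parts: it
moves a contraction from one factor to the other. -/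
theorem topCoeff_interior (X : W n) (φ : Forms n) : topCoeff (interior X φ) = 0 := by
  induction φ using forms_induction with
  | h k φ hφ =>
    rcases k with _ | k
    · obtain ⟨c, rfl⟩ := mem_degForms_zero hφ
      simp [interior_one]
    · rcases eq_or_ne k (2 * n) with rfl | hk
      · rw [degForms_eq_zero (by omega) hφ]; simp
      · exact topCoeff_of_mem hk (interior_mem X hφ)
  | hadd a b ha hb => simp [ha, hb]

/-! ### Two-forms and their exponentials -/

theorem ι_mul_ι_comm (a b : W n →L[ℝ] ℂ) :
    ExteriorAlgebra.ι ℂ a * ExteriorAlgebra.ι ℂ b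
      = -(ExteriorAlgebra.ι ℂ b * ExteriorAlgebra.ι ℂ a) :=
  eq_neg_of_add_eq_zero_left (ExteriorAlgebra.ι_add_mul_swap a b)

/-- Scalars need no separate hypothesis, because they can be absorbed into the second covector. -/
theorem two_induction {p : Forms n → Prop} {B : Forms n} (hB : B ∈ degForms n 2)
    (h : ∀ a b, p (ExteriorAlgebra.ι ℂ a * ExteriorAlgebra.ι ℂ b))
    (hadd : ∀ a b, p a → p b → p (a + b)) : p B := by
  refine degForms_succ_induction (p := p) hB ?_ ?_
  · intro ξ φ hφ
    refine degForms_succ_induction (p := fun φ => p (ExteriorAlgebra.ι ℂ ξ * φ)) hφ ?_ ?_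
    · intro η φ hφ
      obtain ⟨c, rfl⟩ := mem_degForms_zero hφ
      have := h ξ (c • η)
      simpa using this
    · intro a b ha hb
      rw [mul_add]; exact hadd _ _ ha hb
  · intro a b ha hb
    exact hadd _ _ ha hb

/-- Moving a covector past a product of two covectors costs two signs, which cancel. -/
theorem two_commute {B : Forms n} (hB : B ∈ degForms n 2) (φ : Forms n) : B * φ = φ * B := by
  refine two_induction (p := fun B => B * φ = φ * B) hB ?_ ?_
  · intro a b
    induction φ using ExteriorAlgebra.induction with
    | algebraMap r => exact (Algebra.commutes r _).symm
    | ι x =>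
      rw [mul_assoc, ι_mul_ι_comm b x, mul_neg, ← mul_assoc, ι_mul_ι_comm a x, neg_mul, neg_neg,
        mul_assoc]
    | mul x y hx hy => rw [← mul_assoc, hx, mul_assoc, hy, mul_assoc]
    | add x y hx hy => rw [mul_add, hx, hy, add_mul]
  · intro a b ha hb
    rw [add_mul, ha, hb, mul_add]

theorem interior_two_mul (X : W n) {B : Forms n} (hB : B ∈ degForms n 2) (φ : Forms n) :
    interior X (B * φ) = interior X B * φ + B * interior X φ := by
  refine two_induction (p := fun B => interior X (B * φ) = interior X B * φ + B * interior X φ) hB ?_ ?_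
  · intro a b
    have hb : interior X (ExteriorAlgebra.ι ℂ b) = b X • (1 : Forms n) := by
      have := interior_ι_mul X b 1
      simpa [interior_one] using this
    rw [mul_assoc, interior_ι_mul, interior_ι_mul, interior_ι_mul, hb]
    simp only [mul_sub, sub_mul, smul_mul_assoc, mul_smul_comm, mul_assoc, mul_one]
    abel
  · intro a b ha hb
    rw [add_mul, map_add, ha, hb, map_add]; simp only [add_mul]; abel

theorem reverse_two {B : Forms n} (hB : B ∈ degForms n 2) :
    CliffordAlgebra.reverse B = -B := by
  refine two_induction (p := fun B => CliffordAlgebra.reverse B = -B) hB ?_ ?_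
  · intro a b
    rw [CliffordAlgebra.reverse.map_mul]
    erw [CliffordAlgebra.reverse_ι, CliffordAlgebra.reverse_ι]
    exact ι_mul_ι_comm b a
  · intro a b ha hb
    rw [map_add, ha, hb]; abel

theorem two_pow_mem {B : Forms n} (hB : B ∈ degForms n 2) (k : ℕ) :
    B ^ k ∈ degForms n (2 * k) := by
  rw [degForms, pow_mul]
  exact Submodule.pow_mem_pow _ hB k

theorem two_pow_eq_zero {B : Forms n} (hB : B ∈ degForms n 2) {k : ℕ} (hk : n < k) : B ^ k = 0 :=
  degForms_eq_zero (by omega) (two_pow_mem hB k)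

/-- The exponential of a two-form. -/
noncomputable def expTwo (B : Forms n) : Forms n :=
  ∑ k ∈ Finset.range (n + 1), (1 / (k.factorial : ℂ)) • B ^ k

/-- Powers beyond the n-th have degree above 2n and vanish, so the truncated series is the
exponential of a nilpotent element. The addition law of the exponential becomes available. -/
theorem expTwo_eq_exp {B : Forms n} (hB : B ∈ degForms n 2) : expTwo B = IsNilpotent.exp B := by
  rw [IsNilpotent.exp_eq_sum (two_pow_eq_zero hB (Nat.lt_succ_self n)), expTwo]
  refine Finset.sum_congr rfl fun k _ => ?_
  rw [← algebraMap_smul ℂ ((k.factorial : ℚ)⁻¹) (B ^ k)]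
  simp

theorem expTwo_mul {A B : Forms n} (hA : A ∈ degForms n 2) (hB : B ∈ degForms n 2) :
    expTwo A * expTwo B = expTwo (A + B) := by
  rw [expTwo_eq_exp hA, expTwo_eq_exp hB, expTwo_eq_exp (add_mem hA hB),
    IsNilpotent.exp_add_of_commute (two_commute hA B) ⟨n + 1, two_pow_eq_zero hA (Nat.lt_succ_self n)⟩
      ⟨n + 1, two_pow_eq_zero hB (Nat.lt_succ_self n)⟩]

theorem expTwo_zero : expTwo (0 : Forms n) = 1 := by
  rw [expTwo_eq_exp (zero_mem _), IsNilpotent.exp_zero]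

theorem expTwo_commute {B : Forms n} (hB : B ∈ degForms n 2) (φ : Forms n) :
    expTwo B * φ = φ * expTwo B := by
  have h : ∀ k, B ^ k * φ = φ * B ^ k := fun k => Commute.pow_left (two_commute hB φ) k
  simp only [expTwo, Finset.sum_mul, Finset.mul_sum, smul_mul_assoc, mul_smul_comm, h]

theorem reverse_expTwo {B : Forms n} (hB : B ∈ degForms n 2) :
    CliffordAlgebra.reverse (expTwo B) = expTwo (-B) := by
  have h : ∀ k : ℕ, CliffordAlgebra.reverse (B ^ k) = (-B) ^ k := by
    intro k
    induction k with
    | zero => simp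
    | succ k ih =>
      rw [pow_succ, CliffordAlgebra.reverse.map_mul, ih, reverse_two hB, pow_succ']
  rw [expTwo, expTwo, map_sum]
  exact Finset.sum_congr rfl fun k _ => by rw [map_smul, h]

theorem interior_pow_succ (X : W n) {B : Forms n} (hB : B ∈ degForms n 2) (k : ℕ) :
    interior X (B ^ (k + 1)) = ((k : ℂ) + 1) • (interior X B * B ^ k) := by
  induction k with
  | zero => simp
  | succ k ih =>
    rw [pow_succ', interior_two_mul X hB, ih, mul_smul_comm, ← mul_assoc, two_commute hB,
      mul_assoc, ← pow_succ']
    rw [← one_smul ℂ (interior X B * B ^ (k + 1)), smul_smul, ← add_smul, one_smul]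
    push_cast
    congr 1
    ring

theorem interior_expTwo (X : W n) {B : Forms n} (hB : B ∈ degForms n 2) :
    interior X (expTwo B) = interior X B * expTwo B := by
  -- Differentiation drops the last term of the truncated series; this term is absent on the other
  -- side too, having degree 2n + 1.
  have h0 : interior X B * B ^ n = 0 :=
    degForms_eq_zero (k := 2 * n + 1) (by omega) (by
      have h1 : interior X B ∈ degForms n 1 := interior_mem X hB
      have := Submodule.mul_mem_mul h1 (two_pow_mem hB n)
      rwa [degForms, degForms, ← pow_add, add_comm] at this)
  have hR : interior X B * expTwo B
      = ∑ k ∈ Finset.range n, interior X B * ((1 / (k.factorial : ℂ)) • B ^ k) := by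
    rw [expTwo, Finset.sum_range_succ, mul_add, Finset.mul_sum, mul_smul_comm, h0, smul_zero,
      add_zero]
  rw [hR, expTwo, Finset.sum_range_succ', map_add, map_sum]
  simp only [pow_zero, map_smul, interior_one, smul_zero, add_zero]
  refine Finset.sum_congr rfl fun k _ => ?_
  rw [interior_pow_succ X hB, smul_smul, mul_smul_comm]
  congr 1
  have : (k.factorial : ℂ) ≠ 0 := by exact_mod_cast k.factorial_ne_zero
  have : (k : ℂ) + 1 ≠ 0 := by exact_mod_cast k.succ_ne_zero
  rw [Nat.factorial_succ]
  push_cast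
  field_simp

theorem interior_expTwo_mul (X : W n) {B : Forms n} (hB : B ∈ degForms n 2) (φ : Forms n) :
    interior X (expTwo B * φ) = interior X B * expTwo B * φ + expTwo B * interior X φ := by
  have h : ∀ k, interior X (B ^ k * φ) = interior X (B ^ k) * φ + B ^ k * interior X φ := by
    intro k
    induction k with
    | zero => simp [interior_one]
    | succ k ih =>
      rw [pow_succ', mul_assoc, interior_two_mul X hB, ih, interior_two_mul X hB]
      simp only [mul_add, add_mul, mul_assoc, add_assoc]
  rw [← interior_expTwo X hB]
  simp only [expTwo, Finset.sum_mul, map_sum, smul_mul_assoc, map_smul, h, smul_add,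
    Finset.sum_add_distrib]

end SpinorAlgebra
end GenKaehler

namespace GenKaehler

/-! ### The spinor ψ, its pairing with ψ̄, and nondegeneracy of the volume form. -/

section Spinors

variable {n : ℕ}

theorem oneForm_add (ξ η : W n →L[ℝ] ℝ) : oneForm (ξ + η) = oneForm ξ + oneForm η := by
  rw [oneForm, ContinuousLinearMap.comp_add, map_add]; rfl

theorem ofReal_comp_smul (c : ℝ) (ξ : W n →L[ℝ] ℝ) :
    Complex.ofRealCLM ∘L (c • ξ) = (c : ℂ) • (Complex.ofRealCLM ∘L ξ) := by
  ext v; simp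

theorem oneForm_smul (c : ℝ) (ξ : W n →L[ℝ] ℝ) : oneForm (c • ξ) = (c : ℂ) • oneForm ξ := by
  rw [oneForm, ofReal_comp_smul, map_smul]; rfl

/-- `oneForm` as a real linear map. -/
noncomputable def oneFormₗ : (W n →L[ℝ] ℝ) →ₗ[ℝ] Forms n where
  toFun := oneForm
  map_add' := oneForm_add
  map_smul' c ξ := by rw [oneForm_smul]; simp

theorem oneForm_sum {ι : Type*} (s : Finset ι) (f : ι → W n →L[ℝ] ℝ) :
    oneForm (∑ i ∈ s, f i) = ∑ i ∈ s, oneForm (f i) := map_sum oneFormₗ f s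

theorem sum_dx (ξ : W n →L[ℝ] ℝ) : ∑ i, ξ (stdVec i) • dx i = ξ := by
  ext v
  conv_rhs => rw [← sum_coord_stdVec v]
  simp [dx, mul_comm]

theorem twoForm_mem (β : W n →L[ℝ] W n →L[ℝ] ℝ) : twoForm β ∈ degForms n 2 := by
  refine Submodule.smul_mem _ _ (Submodule.sum_mem _ fun i _ => Submodule.sum_mem _ fun j _ =>
    Submodule.smul_mem _ _ ?_)
  rw [degForms, pow_two]
  exact Submodule.mul_mem_mul ⟨_, rfl⟩ ⟨_, rfl⟩

theorem interior_ι (X : W n) (ξ : W n →L[ℝ] ℂ) :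
    interior X (ExteriorAlgebra.ι ℂ ξ) = ξ X • (1 : Forms n) := by
  have := interior_ι_mul X ξ 1
  simpa [interior_one] using this

theorem interior_oneForm (X : W n) (ξ : W n →L[ℝ] ℝ) :
    interior X (oneForm ξ) = (ξ X : ℂ) • (1 : Forms n) := interior_ι X _

theorem interior_oneForm_mul (X : W n) (ξ : W n →L[ℝ] ℝ) (φ : Forms n) :
    interior X (oneForm ξ * φ) = (ξ X : ℂ) • φ - oneForm ξ * interior X φ := interior_ι_mul X _ φ

theorem alt_swap {β : W n →L[ℝ] W n →L[ℝ] ℝ} (hβ : ∀ v, β v v = 0) (v w : W n) :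
    β v w = -β w v := by
  have := hβ (v + w)
  simp only [map_add, add_apply, hβ] at this
  linarith

theorem interior_twoForm {β : W n →L[ℝ] W n →L[ℝ] ℝ} (hβ : ∀ v, β v v = 0) (X : W n) :
    interior X (twoForm β) = oneForm (β X) := by
  have h1 : oneForm (β X)
      = ∑ i, ∑ j, (((β (stdVec i) (stdVec j) * dx i X : ℝ)) : ℂ) • oneForm (dx j) := by
    conv_lhs => rw [← sum_dx (β X), oneForm_sum]
    rw [Finset.sum_comm]
    refine Finset.sum_congr rfl fun j _ => ?_
    rw [oneForm_smul, ← Finset.sum_smul]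
    congr 1
    conv_lhs => rw [← sum_coord_stdVec X]
    simp [dx, mul_comm]
  have h2 : interior X (twoForm β)
      = (1 / 2 : ℂ) • ((∑ i, ∑ j, (((β (stdVec i) (stdVec j) * dx i X : ℝ)) : ℂ) • oneForm (dx j))
        - ∑ i, ∑ j, (((β (stdVec i) (stdVec j) * dx j X : ℝ)) : ℂ) • oneForm (dx i)) := by
    rw [twoForm, map_smul, ← Finset.sum_sub_distrib]
    simp only [← Finset.sum_sub_distrib, map_sum, map_smul, interior_oneForm_mul, interior_oneForm]
    refine congrArg _ (Finset.sum_congr rfl fun i _ => Finset.sum_congr rfl fun j _ => ?_)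
    rw [smul_sub, smul_smul, mul_smul_comm, mul_one, smul_smul]
    push_cast
    rfl
  have h3 : ∑ i, ∑ j, (((β (stdVec i) (stdVec j) * dx j X : ℝ)) : ℂ) • oneForm (n := n) (dx i)
      = - ∑ i, ∑ j, (((β (stdVec i) (stdVec j) * dx i X : ℝ)) : ℂ) • oneForm (dx j) := by
    rw [Finset.sum_comm, ← Finset.sum_neg_distrib]
    refine Finset.sum_congr rfl fun i _ => ?_
    rw [← Finset.sum_neg_distrib]
    refine Finset.sum_congr rfl fun j _ => ?_
    rw [alt_swap hβ (stdVec j) (stdVec i), ← neg_smul]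
    push_cast
    congr 1
    ring
  rw [h2, h3, h1, sub_neg_eq_add, ← two_smul ℂ, smul_smul]
  norm_num

/-- The complex two-form `b - √-1 om`. -/
noncomputable def expo (b om : W n →L[ℝ] W n →L[ℝ] ℝ) : Forms n :=
  twoForm b - Complex.I • twoForm om

theorem expo_mem (b om : W n →L[ℝ] W n →L[ℝ] ℝ) : expo b om ∈ degForms n 2 :=
  sub_mem (twoForm_mem b) (Submodule.smul_mem _ _ (twoForm_mem om))

theorem psi_eq (b om : W n →L[ℝ] W n →L[ℝ] ℝ) : psi b om = expTwo (expo b om) := rfl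

theorem interior_expo {b om : W n →L[ℝ] W n →L[ℝ] ℝ} (hb : ∀ v, b v v = 0)
    (ho : ∀ v, om v v = 0) (X : W n) :
    interior X (expo b om) = oneForm (b X) - Complex.I • oneForm (om X) := by
  rw [expo, map_sub, map_smul, interior_twoForm hb, interior_twoForm ho]

/-- The form `exp (-2 √-1 om) = ψ ∧ σ ψ̄`. -/
noncomputable def chi (om : W n →L[ℝ] W n →L[ℝ] ℝ) : Forms n :=
  expTwo ((-2 * Complex.I) • twoForm om)

theorem chi_arg_mem (om : W n →L[ℝ] W n →L[ℝ] ℝ) :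
    (-2 * Complex.I) • twoForm om ∈ degForms n 2 :=
  Submodule.smul_mem _ _ (twoForm_mem om)

/-- Reversal negates two-forms, so the exponents add up to (b - √-1 om) - (b + √-1 om) and `b`
cancels. All pairings of φ ∧ ψ with ψ̄ therefore depend on `om` alone. -/
theorem psi_mul_reverse (b om : W n →L[ℝ] W n →L[ℝ] ℝ) :
    psi b om * CliffordAlgebra.reverse (psiBar b om) = chi om := by
  have hmem : twoForm b + Complex.I • twoForm om ∈ degForms n 2 :=
    add_mem (twoForm_mem b) (Submodule.smul_mem _ _ (twoForm_mem om))
  have hbar : psiBar b om = expTwo (twoForm b + Complex.I • twoForm om) := rfl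
  rw [psi_eq, hbar, reverse_expTwo hmem, expTwo_mul (expo_mem b om) (neg_mem hmem), chi]
  congr 1
  rw [expo]
  module

theorem mukai_mul_psi (b om : W n →L[ℝ] W n →L[ℝ] ℝ) (φ : Forms n) :
    mukai (φ * psi b om) (psiBar b om) = topCoeff (φ * chi om) := by
  rw [mukai, mul_assoc, psi_mul_reverse]

theorem mukai_psi (b om : W n →L[ℝ] W n →L[ℝ] ℝ) :
    mukai (psi b om) (psiBar b om) = topCoeff (chi om) := by
  rw [mukai, psi_mul_reverse]

theorem projU_apply (b om : W n →L[ℝ] W n →L[ℝ] ℝ) (φ : Forms n) :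
    projU b om (φ * psi b om) = (topCoeff (chi om))⁻¹ * topCoeff (φ * chi om) := by
  rw [← mukai_psi b om, ← mukai_mul_psi b om]
  rfl

theorem interior_chi {om : W n →L[ℝ] W n →L[ℝ] ℝ} (ho : ∀ v, om v v = 0) (X : W n) :
    interior X ((-2 * Complex.I) • twoForm om) = (-2 * Complex.I) • oneForm (om X) := by
  rw [map_smul, interior_twoForm ho]

theorem chi_commute (om : W n →L[ℝ] W n →L[ℝ] ℝ) (φ : Forms n) :
    chi om * φ = φ * chi om := expTwo_commute (chi_arg_mem om) φ

theorem ιMulti_dx_topCoeff :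
    topCoeff (ExteriorAlgebra.ιMulti ℂ (2 * n)
      fun i => Complex.ofRealCLM ∘L (dx (n := n) i)) = 1 := by
  rw [topCoeff_ιMulti_top]
  rw [← Matrix.det_one (n := Fin (2 * n)) (R := ℂ)]
  congr 1
  funext i j
  by_cases h : i = j <;> simp [dx, stdVec, Matrix.one_apply, h]

theorem exists_real_parts (α : W n →L[ℝ] ℂ) : ∃ ξ η : W n →L[ℝ] ℝ,
    ExteriorAlgebra.ι ℂ α = oneForm ξ + Complex.I • oneForm η := by
  refine ⟨Complex.reCLM ∘L α, Complex.imCLM ∘L α, ?_⟩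
  rw [oneForm, oneForm, ← map_smul, ← map_add]
  congr 1
  ext v
  simp [mul_comm Complex.I]

/-- For nondegenerate `om` every covector is of the form `om X`. -/
theorem exists_contraction {om : W n →L[ℝ] W n →L[ℝ] ℝ} (hnd : ∀ v, (∀ w, om v w = 0) → v = 0)
    (ξ : W n →L[ℝ] ℝ) : ∃ X, om X = ξ := by
  have hinj : Function.Injective (om : W n →ₗ[ℝ] W n →L[ℝ] ℝ) := by
    rw [injective_iff_map_eq_zero]
    intro v hv
    exact hnd v fun w => by
      have := congrArg (fun f : W n →L[ℝ] ℝ => f w) hv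
      exact this
  have hfin : finrank ℝ (W n) = finrank ℝ (W n →L[ℝ] ℝ) := by
    rw [← LinearEquiv.finrank_eq (LinearMap.toContinuousLinearMap (𝕜 := ℝ) (E := W n) (F' := ℝ))]
    exact (Subspace.dual_finrank_eq).symm
  exact (LinearMap.injective_iff_surjective_of_finrank_eq_finrank hfin).1 hinj ξ

/-- If the top coefficient of χ vanished, so would that of χ ∧ φ for every form φ, by induction on
the degree of φ. As χ is invertible, every top coefficient would be zero, which is false for dx 0 ∧
... ∧ dx (2n - 1). -/
theorem topCoeff_chi_ne_zero {om : W n →L[ℝ] W n →L[ℝ] ℝ} (ho : ∀ v, om v v = 0)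
    (hnd : ∀ v, (∀ w, om v w = 0) → v = 0) : topCoeff (chi om) ≠ 0 := by
  intro h0
  -- Contracting χ ∧ φ with X has no top part. The derivative of χ produces the covector `om X`,
  -- which is arbitrary by nondegeneracy, and the other term is controlled by the hypothesis on φ.
  have step : ∀ (φ : Forms n), (∀ X, topCoeff (chi om * interior X φ) = 0) →
      ∀ ξ : W n →L[ℝ] ℂ, topCoeff (chi om * (ExteriorAlgebra.ι ℂ ξ * φ)) = 0 := by
    intro φ hφ ξ
    have key : ∀ η : W n →L[ℝ] ℝ, topCoeff (chi om * (oneForm η * φ)) = 0 := by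
      intro η
      obtain ⟨X, rfl⟩ := exists_contraction hnd η
      have h1 := topCoeff_interior X (chi om * φ)
      rw [chi, interior_expTwo_mul X (chi_arg_mem om), ← chi, map_add, hφ X, add_zero,
        interior_chi ho, smul_mul_assoc, smul_mul_assoc, map_smul, smul_eq_mul, ← chi_commute,
        mul_assoc (chi om)] at h1
      exact (mul_eq_zero.1 h1).resolve_left (by simp)
    obtain ⟨ξ₁, ξ₂, h⟩ := exists_real_parts ξ
    rw [h, add_mul, mul_add, map_add, key, smul_mul_assoc, mul_smul_comm, map_smul, key]
    simp
  have all : ∀ k, ∀ φ ∈ degForms n k, topCoeff (chi om * φ) = 0 := by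
    intro k
    induction k using Nat.strong_induction_on with
    | _ k ih =>
      intro φ hφ
      rcases k with _ | k
      · obtain ⟨c, rfl⟩ := mem_degForms_zero hφ
        simp [h0]
      · refine degForms_succ_induction (p := fun φ => topCoeff (chi om * φ) = 0) hφ ?_ ?_
        · intro ξ φ hφ
          refine step φ (fun X => ?_) ξ
          rcases k with _ | k
          · obtain ⟨c, rfl⟩ := mem_degForms_zero hφ
            simp [interior_one]
          · exact ih k (by omega) _ (interior_mem X hφ)
        · intro a b ha hb
          rw [mul_add, map_add, ha, hb, add_zero]
  have all' : ∀ φ : Forms n, topCoeff (chi om * φ) = 0 := fun φ =>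
    forms_induction (p := fun φ => topCoeff (chi om * φ) = 0) all
      (fun a b ha hb => by rw [mul_add, map_add, ha, hb, add_zero]) φ
  -- Multiply the standard volume form by the inverse of χ.
  have h1 := all' (expTwo (-((-2 * Complex.I) • twoForm om)) * ExteriorAlgebra.ιMulti ℂ (2 * n)
      fun i => Complex.ofRealCLM ∘L (dx (n := n) i))
  rw [← mul_assoc, chi, expTwo_mul (chi_arg_mem om) (neg_mem (chi_arg_mem om)), add_neg_cancel,
    expTwo_zero, one_mul, ιMulti_dx_topCoeff] at h1
  exact one_ne_zero h1

/-- If `ι_Y om = -η` then the `U^{-n}`-coefficient of `ξ ∧ η ∧ ψ` is `-(√-1 / 2) ξ(Y)`. -/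
theorem projU_oneForm_oneForm {b om : W n →L[ℝ] W n →L[ℝ] ℝ} (ho : ∀ v, om v v = 0)
    (hnd : ∀ v, (∀ w, om v w = 0) → v = 0) (ξ η : W n →L[ℝ] ℝ) {Y : W n} (hY : om Y = -η) :
    projU b om (oneForm ξ * oneForm η * psi b om) = -(Complex.I / 2) * (ξ Y : ℂ) := by
  rw [projU_apply]
  -- In the contraction of χ ∧ ξ with Y, the factor χ yields -2√-1 om Y = 2√-1 η and the factor ξ
  -- yields the number ξ(Y). The vanishing of the top part relates the two.
  have h1 := topCoeff_interior Y (chi om * oneForm ξ)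
  have h2 : oneForm (-η) = -oneForm η := map_neg oneFormₗ η
  have h4 : oneForm η * chi om * oneForm ξ = -(oneForm ξ * oneForm η * chi om) := by
    rw [mul_assoc, chi_commute, ← mul_assoc, oneForm, oneForm, ι_mul_ι_comm, neg_mul]
  rw [chi, interior_expTwo_mul Y (chi_arg_mem om), ← chi, interior_chi ho, hY, h2,
    interior_oneForm, map_add, mul_smul_comm, mul_one, map_smul, smul_mul_assoc, smul_mul_assoc,
    neg_mul (oneForm η), neg_mul (oneForm η * chi om), h4, neg_neg, map_smul, smul_eq_mul,
    smul_eq_mul] at h1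
  have h3 := topCoeff_chi_ne_zero ho hnd
  field_simp
  have hI : Complex.I * Complex.I = -1 := Complex.I_mul_I
  linear_combination Complex.I * h1 + 2 * topCoeff (oneForm ξ * oneForm η * chi om) * hI

end Spinors
end GenKaehler

namespace GenKaehler

/-! ### Pullback and variation of the volume coefficient; Clifford products on ψ. -/

section Spinors

variable {n : ℕ}

noncomputable instance instNormedAddCommGroupBilin :
    NormedAddCommGroup (W n →L[ℝ] W n →L[ℝ] ℝ) := ContinuousLinearMap.toNormedAddCommGroup

noncomputable instance instAddCommGroupBilin : AddCommGroup (W n →L[ℝ] W n →L[ℝ] ℝ) :=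
  instNormedAddCommGroupBilin.toAddCommGroup

noncomputable instance instNormedSpaceBilin :
    NormedSpace ℝ (W n →L[ℝ] W n →L[ℝ] ℝ) := ContinuousLinearMap.toNormedSpace

noncomputable instance instModuleBilin :
    Module ℝ (W n →L[ℝ] W n →L[ℝ] ℝ) := instNormedSpaceBilin.toModule

/-! ### Pullback -/

/-- Pullback of complex covectors. -/
noncomputable def pullCov (A : W n →L[ℝ] W n) : (W n →L[ℝ] ℂ) →ₗ[ℂ] (W n →L[ℝ] ℂ) where
  toFun ξ := ξ ∘L A
  map_add' _ _ := rfl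
  map_smul' _ _ := rfl

theorem map_pullCov_oneForm (A : W n →L[ℝ] W n) (ξ : W n →L[ℝ] ℝ) :
    ExteriorAlgebra.map (pullCov A) (oneForm ξ) = oneForm (ξ ∘L A) := by
  rw [oneForm, ExteriorAlgebra.map_apply_ι]; rfl

theorem twoForm_eq_sum (β : W n →L[ℝ] W n →L[ℝ] ℝ) :
    twoForm β = (1 / 2 : ℂ) • ∑ i, oneForm (dx i) * oneForm (β (stdVec i)) := by
  rw [twoForm]
  congr 1
  refine Finset.sum_congr rfl fun i _ => ?_
  conv_rhs => rw [← sum_dx (β (stdVec i)), oneForm_sum, Finset.mul_sum]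
  refine Finset.sum_congr rfl fun j _ => ?_
  rw [oneForm_smul, mul_smul_comm]

theorem map_pullCov_twoForm (A : W n →L[ℝ] W n) (β : W n →L[ℝ] W n →L[ℝ] ℝ) :
    ExteriorAlgebra.map (pullCov A) (twoForm β) = twoForm (β.bilinearComp A A) := by
  rw [twoForm_eq_sum, twoForm_eq_sum, map_smul, map_sum]
  congr 1
  have h1 : ∀ k, oneForm ((β.bilinearComp A A) (stdVec k))
      = ∑ i, ((dx i (A (stdVec k)) : ℝ) : ℂ) • oneForm (β (stdVec i) ∘L A) := by
    intro k
    have : (β.bilinearComp A A) (stdVec k)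
        = ∑ i, dx i (A (stdVec k)) • (β (stdVec i) ∘L A) := by
      ext v
      have h := sum_coord_stdVec (A (stdVec k))
      conv_lhs => rw [ContinuousLinearMap.bilinearComp_apply, ← h]
      simp [dx]
    rw [this, oneForm_sum]
    simp only [oneForm_smul]
  simp only [map_mul, map_pullCov_oneForm, h1, Finset.mul_sum]
  rw [Finset.sum_comm]
  refine Finset.sum_congr rfl fun i _ => ?_
  simp only [mul_smul_comm, ← smul_mul_assoc, ← Finset.sum_mul]
  congr 1
  conv_lhs => rw [← sum_dx (dx i ∘L A), oneForm_sum]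
  simp [oneForm_smul]

/-- In top degree both sides are determinants, and the determinant is multiplicative; in other
degrees both vanish. -/
theorem topCoeff_map (A : W n →L[ℝ] W n) (φ : Forms n) :
    topCoeff (ExteriorAlgebra.map (pullCov A) φ)
      = ((LinearMap.det (A : W n →ₗ[ℝ] W n) : ℝ) : ℂ) * topCoeff φ := by
  induction φ using forms_induction with
  | hadd a b ha hb => rw [map_add, map_add, ha, hb, map_add, mul_add]
  | h k φ hφ =>
  refine degForms_induction (p := fun φ => topCoeff (ExteriorAlgebra.map (pullCov A) φ)
      = ((LinearMap.det (A : W n →ₗ[ℝ] W n) : ℝ) : ℂ) * topCoeff φ) hφ ?_ ?_ ?_ ?_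
  · intro v
    rw [ExteriorAlgebra.map_apply_ιMulti]
    rcases eq_or_ne k (2 * n) with rfl | hk
    · rw [topCoeff_ιMulti_top, topCoeff_ιMulti_top]
      let e : Basis (Fin (2 * n)) ℝ (W n) := (EuclideanSpace.basisFun (Fin (2 * n)) ℝ).toBasis
      have he : ∀ i, e i = stdVec i := fun i => by simp [e, stdVec]
      have hM : (Matrix.of fun i j => ((pullCov A ∘ v) i) (stdVec j))
          = (Matrix.of fun i j => v i (stdVec j))
            * (LinearMap.toMatrix e e (A : W n →ₗ[ℝ] W n)).map Complex.ofRealHom := by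
        ext i j
        rw [Matrix.mul_apply]
        have h := sum_coord_stdVec (A (stdVec j))
        have h2 : ((pullCov A ∘ v) i) (stdVec j) = v i (A (stdVec j)) := rfl
        rw [Matrix.of_apply, h2]
        conv_lhs => rw [← h, map_sum]
        refine Finset.sum_congr rfl fun l _ => ?_
        rw [map_smul, Matrix.map_apply, LinearMap.toMatrix_apply, he]
        simp [e, mul_comm]
      have hdet : ((LinearMap.det (A : W n →ₗ[ℝ] W n) : ℝ) : ℂ)
          = ((LinearMap.toMatrix e e (A : W n →ₗ[ℝ] W n)).map Complex.ofRealHom).det := by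
        rw [← LinearMap.det_toMatrix e]
        exact RingHom.map_det Complex.ofRealHom _
      rw [hdet]
      exact ((congrArg Matrix.det hM).trans (Matrix.det_mul _ _)).trans (mul_comm _ _)
    · rw [topCoeff_ιMulti _ hk, topCoeff_ιMulti _ hk, mul_zero]
  · simp
  · intro a b ha hb
    rw [map_add, map_add, ha, hb, map_add, mul_add]
  · intro c a ha
    rw [map_smul, map_smul, ha, map_smul, smul_eq_mul, smul_eq_mul]
    ring

theorem map_expTwo (A : W n →L[ℝ] W n) (B : Forms n) :
    ExteriorAlgebra.map (pullCov A) (expTwo B)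
      = expTwo (ExteriorAlgebra.map (pullCov A) B) := by
  simp [expTwo, map_sum]

/-- This is what makes the volume density transform by the Jacobian under a change of chart. -/
theorem topCoeff_chi_pull (A : W n →L[ℝ] W n) (om : W n →L[ℝ] W n →L[ℝ] ℝ) :
    topCoeff (chi (om.bilinearComp A A))
      = ((LinearMap.det (A : W n →ₗ[ℝ] W n) : ℝ) : ℂ) * topCoeff (chi om) := by
  rw [← topCoeff_map, chi, chi, map_expTwo, map_smul, map_pullCov_twoForm]

/-! ### The derivative of the volume coefficient -/

theorem twoForm_mul (β : W n →L[ℝ] W n →L[ℝ] ℝ) (φ : Forms n) :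
    twoForm β * φ = (1 / 2 : ℂ) • ∑ i, ∑ j,
      ((β (stdVec i) (stdVec j) : ℝ) : ℂ) • (oneForm (dx i) * oneForm (dx j) * φ) := by
  simp only [twoForm, smul_mul_assoc, Finset.sum_mul]

/-- A linear functional ℓ is applied so that only scalar functions are differentiated. It is kept
arbitrary because the inductive step absorbs multiplication by dx i ∧ dx j into it. -/
theorem contDiff_twoForm_pow (k : ℕ) (ℓ : Forms n →ₗ[ℂ] ℂ) :
    ContDiff ℝ ∞ fun om : W n →L[ℝ] W n →L[ℝ] ℝ => ℓ (twoForm om ^ k) := by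
  induction k generalizing ℓ with
  | zero => simpa using contDiff_const
  | succ k ih =>
    have h : (fun om : W n →L[ℝ] W n →L[ℝ] ℝ => ℓ (twoForm om ^ (k + 1)))
        = fun om => (1 / 2 : ℂ) * ∑ i, ∑ j, ((om (stdVec i) (stdVec j) : ℝ) : ℂ)
          * (ℓ ∘ₗ LinearMap.mulLeft ℂ (oneForm (dx i) * oneForm (dx j))) (twoForm om ^ k) := by
      ext om
      rw [pow_succ']
      rw [twoForm_mul]
      simp [mul_assoc]
    rw [h]
    refine contDiff_const.mul (ContDiff.sum fun i _ => ContDiff.sum fun j _ => ?_)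
    refine ContDiff.mul ?_ (ih _)
    refine Complex.ofRealCLM.contDiff.comp ?_
    exact (ContDiff.clm_apply (ContDiff.clm_apply contDiff_id contDiff_const) contDiff_const)

/-- Product rule; the k terms agree because two-forms are central. For k = 0 the truncated exponent
k - 1 is harmless, since the factor k vanishes. -/
theorem hasFDerivAt_twoForm_pow (k : ℕ) (ℓ : Forms n →ₗ[ℂ] ℂ) (om : W n →L[ℝ] W n →L[ℝ] ℝ) :
    ∃ L : (W n →L[ℝ] W n →L[ℝ] ℝ) →L[ℝ] ℂ,
      HasFDerivAt (fun om : W n →L[ℝ] W n →L[ℝ] ℝ => ℓ (twoForm om ^ k)) L om ∧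
      ∀ δ, L δ = k * ℓ (twoForm δ * twoForm om ^ (k - 1)) := by
  induction k generalizing ℓ with
  | zero =>
    refine ⟨0, ?_, fun δ => by simp⟩
    simpa using hasFDerivAt_const _ _
  | succ k ih =>
    have h : (fun om : W n →L[ℝ] W n →L[ℝ] ℝ => ℓ (twoForm om ^ (k + 1)))
        = fun om => (1 / 2 : ℂ) * ∑ i, ∑ j, ((om (stdVec i) (stdVec j) : ℝ) : ℂ)
          * (ℓ ∘ₗ LinearMap.mulLeft ℂ (oneForm (dx i) * oneForm (dx j))) (twoForm om ^ k) := by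
      ext om
      rw [pow_succ']
      rw [twoForm_mul]
      simp [mul_assoc]
    choose L hL hL' using fun i j =>
      ih (ℓ ∘ₗ LinearMap.mulLeft ℂ (oneForm (dx (n := n) i) * oneForm (dx j)))
    have hE : ∀ i j, HasFDerivAt (fun om : W n →L[ℝ] W n →L[ℝ] ℝ =>
        ((om (stdVec i) (stdVec j) : ℝ) : ℂ))
        (Complex.ofRealCLM ∘L (ContinuousLinearMap.apply ℝ ℝ (stdVec j))
          ∘L (ContinuousLinearMap.apply ℝ (W n →L[ℝ] ℝ) (stdVec i))) om := fun i j =>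
      (Complex.ofRealCLM ∘L (ContinuousLinearMap.apply ℝ ℝ (stdVec j))
          ∘L (ContinuousLinearMap.apply ℝ (W n →L[ℝ] ℝ) (stdVec i))).hasFDerivAt
    have hD := (HasFDerivAt.fun_sum (u := Finset.univ) fun i _ =>
      HasFDerivAt.fun_sum (u := Finset.univ) fun j _ =>
        (hE i j).mul (hL i j)).const_mul (1 / 2 : ℂ)
    refine ⟨_, by rw [h]; exact hD, ?_⟩
    · intro δ
      have h1 : ℓ (twoForm δ * twoForm om ^ k) = (1 / 2 : ℂ) * ∑ i, ∑ j,
          ((δ (stdVec i) (stdVec j) : ℝ) : ℂ)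
          * ℓ (oneForm (dx i) * oneForm (dx j) * twoForm om ^ k) := by
        rw [twoForm_mul]
        simp
      have h2 : ℓ (twoForm om * (twoForm δ * twoForm om ^ (k - 1))) = (1 / 2 : ℂ) * ∑ i, ∑ j,
          ((om (stdVec i) (stdVec j) : ℝ) : ℂ)
          * ℓ (oneForm (dx i) * oneForm (dx j) * (twoForm δ * twoForm om ^ (k - 1))) := by
        rw [twoForm_mul]
        simp
      have h3 : (k : ℂ) * ℓ (twoForm om * (twoForm δ * twoForm om ^ (k - 1)))
          = k * ℓ (twoForm δ * twoForm om ^ k) := by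
        rcases k with _ | k
        · simp
        · rw [← mul_assoc, two_commute (twoForm_mem om), mul_assoc, Nat.add_sub_cancel,
            ← pow_succ']
      simp only [smul_apply, sum_apply, add_apply, hL', smul_eq_mul, ContinuousLinearMap.comp_apply,
        ContinuousLinearMap.apply_apply, Complex.ofRealCLM_apply, LinearMap.comp_apply,
        LinearMap.mulLeft_apply, Nat.add_sub_cancel]
      push_cast
      rw [add_mul, one_mul, ← h3, h2, h1, ← mul_assoc, mul_comm (k : ℂ) (1 / 2), mul_assoc,
        ← mul_add]
      simp only [Finset.mul_sum, mul_add, ← Finset.sum_add_distrib]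
      refine Finset.sum_congr rfl fun i _ => Finset.sum_congr rfl fun j _ => ?_
      ring

/-- Only the n-th power has degree 2n. -/
theorem topCoeff_chi_eq (om : W n →L[ℝ] W n →L[ℝ] ℝ) :
    topCoeff (chi om) = ((-2 * Complex.I) ^ n / n.factorial) * topCoeff (twoForm om ^ n) := by
  rw [chi, expTwo, map_sum, Finset.sum_eq_single n]
  · rw [smul_pow, smul_smul, map_smul, smul_eq_mul]; ring
  · intro k _ hk
    rw [map_smul, topCoeff_of_mem (k := 2 * k) (by omega)
      (two_pow_mem (chi_arg_mem om) k), smul_zero]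
  · simp

theorem contDiff_topCoeff_chi :
    ContDiff ℝ ∞ fun om : W n →L[ℝ] W n →L[ℝ] ℝ => topCoeff (chi om) := by
  simp only [topCoeff_chi_eq]
  exact contDiff_const.mul (contDiff_twoForm_pow n topCoeff)

/-- Only the (n - 1)-st power of the exponent contributes. The right-hand side is the derivative of
the formula in `topCoeff_chi_eq`. -/
theorem topCoeff_two_mul_chi {B : Forms n} (hB : B ∈ degForms n 2)
    (om : W n →L[ℝ] W n →L[ℝ] ℝ) :
    (-2 * Complex.I) * topCoeff (B * chi om)
      = ((-2 * Complex.I) ^ n / n.factorial) * (n * topCoeff (B * twoForm om ^ (n - 1))) := by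
  rcases n with _ | m
  · have : B = 0 := degForms_eq_zero (k := 2) (by omega) hB
    simp [this]
  · rw [chi, expTwo, Finset.mul_sum, map_sum, Finset.sum_eq_single m]
    · rw [smul_pow, mul_smul_comm, mul_smul_comm, map_smul, map_smul, smul_eq_mul, smul_eq_mul,
        Nat.factorial_succ, Nat.add_sub_cancel]
      have : (m.factorial : ℂ) ≠ 0 := by exact_mod_cast m.factorial_ne_zero
      have : (m : ℂ) + 1 ≠ 0 := by exact_mod_cast m.succ_ne_zero
      push_cast
      field_simp
      ring
    · intro k _ hk
      have : B * ((-2 * Complex.I) • twoForm om) ^ k ∈ degForms (m + 1) (2 + 2 * k) := by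
        have := Submodule.mul_mem_mul hB (two_pow_mem (chi_arg_mem om) k)
        rwa [degForms, degForms, ← pow_add] at this
      rw [mul_smul_comm, map_smul, topCoeff_of_mem (by omega) this, smul_zero]
    · simp

theorem hasFDerivAt_topCoeff_chi (om : W n →L[ℝ] W n →L[ℝ] ℝ) :
    ∃ L : (W n →L[ℝ] W n →L[ℝ] ℝ) →L[ℝ] ℂ,
      HasFDerivAt (fun om : W n →L[ℝ] W n →L[ℝ] ℝ => topCoeff (chi om)) L om ∧
      ∀ δ, L δ = (-2 * Complex.I) * topCoeff (twoForm δ * chi om) := by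
  obtain ⟨L, hL, hL'⟩ := hasFDerivAt_twoForm_pow n topCoeff om
  refine ⟨((-2 * Complex.I) ^ n / n.factorial : ℂ) • L, ?_, fun δ => ?_⟩
  · simp only [topCoeff_chi_eq]
    exact hL.const_mul _
  · rw [topCoeff_two_mul_chi (twoForm_mem δ), smul_apply, hL', smul_eq_mul]

/-- If `om (Y j) = -dx j`, the logarithmic derivative of the volume coefficient in the direction
`δ` is `-(1/2) ∑ δ i j dx i (Y j)`. -/
theorem topCoeff_twoForm_mul_chi {om : W n →L[ℝ] W n →L[ℝ] ℝ} (ho : ∀ v, om v v = 0)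
    (hnd : ∀ v, (∀ w, om v w = 0) → v = 0) {Y : Fin (2 * n) → W n} (hY : ∀ j, om (Y j) = -dx j)
    (δ : W n →L[ℝ] W n →L[ℝ] ℝ) :
    (-2 * Complex.I) * topCoeff (twoForm δ * chi om)
      = ((-(1 / 2) * ∑ i, ∑ j, δ (stdVec i) (stdVec j) * dx i (Y j) : ℝ) : ℂ)
        * topCoeff (chi om) := by
  have h3 := topCoeff_chi_ne_zero ho hnd
  -- The coefficient does not depend on `b`, so `b = 0` may be used.
  have key : ∀ i j, topCoeff (oneForm (dx i) * oneForm (dx j) * chi om)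
      = -(Complex.I / 2) * (dx i (Y j) : ℂ) * topCoeff (chi om) := by
    intro i j
    have := projU_oneForm_oneForm (b := 0) ho hnd (dx i) (dx j) (hY j)
    rw [projU_apply] at this
    rw [← this]
    field_simp
  rw [twoForm, smul_mul_assoc, map_smul, Finset.sum_mul, map_sum]
  have : ∀ i, topCoeff ((∑ j, ((δ (stdVec i) (stdVec j) : ℝ) : ℂ)
        • (oneForm (dx i) * oneForm (dx j))) * chi om)
      = ∑ j, ((δ (stdVec i) (stdVec j) : ℝ) : ℂ)
        * (-(Complex.I / 2) * (dx i (Y j) : ℂ) * topCoeff (chi om)) := by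
    intro i
    rw [Finset.sum_mul, map_sum]
    refine Finset.sum_congr rfl fun j _ => ?_
    rw [smul_mul_assoc, map_smul, key, smul_eq_mul]
  simp only [this, smul_eq_mul]
  push_cast
  simp only [Finset.mul_sum, Finset.sum_mul]
  refine Finset.sum_congr rfl fun i _ => Finset.sum_congr rfl fun j _ => ?_
  have hI : Complex.I * Complex.I = -1 := Complex.I_mul_I
  linear_combination (1 / 2 * ((δ (stdVec i) (stdVec j) : ℝ) : ℂ) * (dx i (Y j) : ℂ)
    * topCoeff (chi om)) * hI

/-! ### The Clifford action on `ψ` -/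

theorem cliff_psi {b om : W n →L[ℝ] W n →L[ℝ] ℝ} (hb : ∀ v, b v v = 0) (ho : ∀ v, om v v = 0)
    (a : W n × (W n →L[ℝ] ℝ)) :
    cliff a (psi b om)
      = (oneForm a.2 + oneForm (b a.1) - Complex.I • oneForm (om a.1)) * psi b om := by
  rw [cliff, LinearMap.add_apply, LinearMap.mulLeft_apply, psi_eq,
    interior_expTwo _ (expo_mem b om), interior_expo hb ho]
  simp only [add_mul, sub_mul]
  abel

theorem cliff_cliff (a c : W n × (W n →L[ℝ] ℝ)) (φ : Forms n) :
    cliff a (cliff c φ) + cliff c (cliff a φ) = ((2 * pairing a c : ℝ) : ℂ) • φ := by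
  have h1 : interior a.1 (interior c.1 φ) = -interior c.1 (interior a.1 φ) :=
    CliffordAlgebra.contractLeft_comm (d := evalAt a.1) (d' := evalAt c.1) φ
  have h2 : oneForm a.2 * (oneForm c.2 * φ) = -(oneForm c.2 * (oneForm a.2 * φ)) := by
    rw [← mul_assoc, ← mul_assoc, oneForm, oneForm, ι_mul_ι_comm, neg_mul]
  simp only [cliff, LinearMap.add_apply, LinearMap.mulLeft_apply, map_add,
    interior_oneForm_mul, h1, h2]
  have h3 : ((2 * pairing a c : ℝ) : ℂ) = (c.2 a.1 : ℂ) + (a.2 c.1 : ℂ) := by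
    rw [pairing]; push_cast; ring
  rw [h3, add_smul]
  abel

theorem projU_psi {b om : W n →L[ℝ] W n →L[ℝ] ℝ} (ho : ∀ v, om v v = 0)
    (hnd : ∀ v, (∀ w, om v w = 0) → v = 0) : projU b om (psi b om) = 1 := by
  have := projU_apply b om 1
  rw [one_mul, one_mul] at this
  rw [this, inv_mul_cancel₀ (topCoeff_chi_ne_zero ho hnd)]

/-- ψ is an exponential and hence invertible. -/
theorem oneForm_mul_psi_eq_zero {b om : W n →L[ℝ] W n →L[ℝ] ℝ} {α : W n →L[ℝ] ℂ}
    (h : ExteriorAlgebra.ι ℂ α * psi b om = 0) : α = 0 := by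
  have h1 : ExteriorAlgebra.ι ℂ α * psi b om * expTwo (-expo b om) = 0 := by rw [h, zero_mul]
  rw [mul_assoc, psi_eq, expTwo_mul (expo_mem b om) (neg_mem (expo_mem b om)), add_neg_cancel,
    expTwo_zero, mul_one] at h1
  exact (ExteriorAlgebra.ι_eq_zero_iff _).1 h1

/-- The annihilation of ψ by (0, ξ) + √-1 Jψ (0, ξ) is a relation between complex covectors, because
ψ is invertible. Its real part involves only ξ and `om`. So the tangent part of Jψ on an exact
covector is the Hamiltonian vector. -/
theorem om_anchor {b om : W n →L[ℝ] W n →L[ℝ] ℝ} (hb : ∀ v, b v v = 0) (ho : ∀ v, om v v = 0)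
    {J : W n × (W n →L[ℝ] ℝ) →ₗ[ℝ] W n × (W n →L[ℝ] ℝ)}
    (hJ : ∀ a, cliff a (psi b om) + Complex.I • cliff (J a) (psi b om) = 0)
    (ξ : W n →L[ℝ] ℝ) : om (J (0, ξ)).1 = -ξ := by
  have h := hJ (0, ξ)
  rw [cliff_psi hb ho, cliff_psi hb ho, ← smul_mul_assoc, ← add_mul] at h
  have h2 : oneForm ((0 : W n), ξ).2 + oneForm (b ((0 : W n), ξ).1)
        - Complex.I • oneForm (om ((0 : W n), ξ).1)
      + Complex.I • (oneForm (J (0, ξ)).2 + oneForm (b (J (0, ξ)).1)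
        - Complex.I • oneForm (om (J (0, ξ)).1))
      = ExteriorAlgebra.ι ℂ (Complex.ofRealCLM ∘L (ξ + om (J (0, ξ)).1)
        + Complex.I • (Complex.ofRealCLM ∘L ((J (0, ξ)).2 + b (J (0, ξ)).1))) := by
    have h0 : oneForm (0 : W n →L[ℝ] ℝ) = 0 := map_zero oneFormₗ
    rw [map_add, map_smul, ← oneForm, ← oneForm, oneForm_add, oneForm_add]
    simp only [map_zero, h0, smul_zero, sub_zero, add_zero, smul_add, smul_sub, smul_smul,
      Complex.I_mul_I, neg_smul, one_smul]
    abel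
  rw [h2] at h
  have h3 := oneForm_mul_psi_eq_zero h
  ext v
  have h4 := congrArg (fun f : W n →L[ℝ] ℂ => (f v).re) h3
  simp at h4
  change om (J (0, ξ)).1 v = -(ξ v)
  linarith

theorem pairing_comm (a c : W n × (W n →L[ℝ] ℝ)) : pairing a c = pairing c a := by
  rw [pairing, pairing, add_comm]

theorem pairing_add_right (a c d : W n × (W n →L[ℝ] ℝ)) :
    pairing a (c + d) = pairing a c + pairing a d := by
  simp [pairing]; ring

theorem pairing_smul_right (r : ℝ) (a c : W n × (W n →L[ℝ] ℝ)) :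
    pairing a (r • c) = r * pairing a c := by
  simp [pairing]; ring

/-- The pairing as a bilinear form. -/
noncomputable def pairingB : LinearMap.BilinForm ℝ (W n × (W n →L[ℝ] ℝ)) :=
  LinearMap.mk₂ ℝ pairing
    (fun a b c => by rw [pairing_comm, pairing_add_right, pairing_comm c, pairing_comm c])
    (fun r a c => by rw [pairing_comm, pairing_smul_right, pairing_comm c]; rfl)
    pairing_add_right (fun r a c => by rw [pairing_smul_right]; rfl)

theorem pairing_skew {J : W n × (W n →L[ℝ] ℝ) →ₗ[ℝ] W n × (W n →L[ℝ] ℝ)}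
    (hsq : ∀ a, J (J a) = -a) (horth : ∀ a c, pairing (J a) (J c) = pairing a c)
    (a c : W n × (W n →L[ℝ] ℝ)) : pairing (J a) c = -pairing a (J c) := by
  rw [← horth (J a) c, hsq, ← neg_one_smul ℝ a, pairing_comm, pairing_smul_right, pairing_comm]
  ring

/-- The `U^{-n}`-coefficient of `a · c · ψ`. -/
theorem projU_cliff_cliff {b om : W n →L[ℝ] W n →L[ℝ] ℝ} (hb : ∀ v, b v v = 0)
    (ho : ∀ v, om v v = 0) (hnd : ∀ v, (∀ w, om v w = 0) → v = 0)
    {J : W n × (W n →L[ℝ] ℝ) →ₗ[ℝ] W n × (W n →L[ℝ] ℝ)}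
    (hsq : ∀ a, J (J a) = -a) (horth : ∀ a c, pairing (J a) (J c) = pairing a c)
    (hJ : ∀ a, cliff a (psi b om) + Complex.I • cliff (J a) (psi b om) = 0)
    (a c : W n × (W n →L[ℝ] ℝ)) :
    projU b om (cliff a (cliff c (psi b om)))
      = (pairing a c : ℂ) - Complex.I * (pairing a (J c) : ℂ) := by
  -- Δ is the error in the claimed formula. It is antisymmetric by the Clifford relation, Δ(a, Jc) =
  -- √-1 Δ(a, c) because J c acts on ψ as √-1 c, and it vanishes on pairs of covectors. Covectors
  -- and their images under J span, so Δ = 0.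
  let Δ : W n × (W n →L[ℝ] ℝ) → W n × (W n →L[ℝ] ℝ) → ℂ := fun a c =>
    projU b om (cliff a (cliff c (psi b om)))
      - ((pairing a c : ℂ) - Complex.I * (pairing a (J c) : ℂ))
  suffices h : Δ a c = 0 from sub_eq_zero.1 h
  have cliff_sub : ∀ (u w : W n × (W n →L[ℝ] ℝ)) (φ : Forms n),
      cliff (u - w) φ = cliff u φ - cliff w φ := by
    intro u w φ
    have h1 : evalAt (u.1 - w.1) = evalAt u.1 - evalAt w.1 := by
      ext ξ; exact map_sub ξ _ _
    have h2 : oneForm (u.2 - w.2) = oneForm u.2 - oneForm w.2 := map_sub oneFormₗ _ _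
    simp only [cliff, interior, Prod.fst_sub, Prod.snd_sub, h1, h2, LinearMap.add_apply,
      LinearMap.mulLeft_apply, map_sub, LinearMap.sub_apply, sub_mul]
    abel
  have psub : ∀ u v w : W n × (W n →L[ℝ] ℝ), pairing u (v - w) = pairing u v - pairing u w :=
    fun u v w => (pairingB u).map_sub v w
  have hanti : ∀ a c, Δ a c = -Δ c a := by
    intro a c
    have h1 := congrArg (projU b om) (cliff_cliff a c (psi b om))
    rw [map_add, map_smul, projU_psi ho hnd] at h1
    have h2 : pairing c (J a) = -pairing a (J c) := by
      rw [pairing_comm, pairing_skew hsq horth]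
    simp only [Δ]
    rw [h2, pairing_comm c a]
    simp only [smul_eq_mul, mul_one] at h1
    push_cast at h1 ⊢
    linear_combination h1
  have hJc : ∀ a c, Δ a (J c) = Complex.I * Δ a c := by
    intro a c
    have h1 : cliff (J c) (psi b om) = Complex.I • cliff c (psi b om) := by
      have h := congrArg (fun φ => Complex.I • φ) (hJ c)
      simp only [smul_add, smul_smul, Complex.I_mul_I, smul_zero, neg_smul, one_smul] at h
      exact (eq_of_sub_eq_zero (by rw [sub_eq_add_neg]; exact h)).symm
    simp only [Δ]
    rw [h1, map_smul, map_smul, hsq, ← zero_sub c, psub, smul_eq_mul]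
    have : pairing a 0 = 0 := (pairingB a).map_zero
    rw [this]
    push_cast
    have hI : Complex.I * Complex.I = -1 := Complex.I_mul_I
    linear_combination -(pairing a (J c) : ℂ) * hI
  have hsub : ∀ a c d, Δ a (c - d) = Δ a c - Δ a d := by
    intro a c d
    simp only [Δ]
    rw [cliff_sub, map_sub, map_sub, psub, map_sub, psub]
    push_cast
    ring
  have hcc : ∀ ξ η : W n →L[ℝ] ℝ, Δ (0, ξ) (0, η) = 0 := by
    intro ξ η
    have h1 : ∀ (ζ : W n →L[ℝ] ℝ) (φ : Forms n), cliff ((0 : W n), ζ) φ = oneForm ζ * φ := by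
      intro ζ φ
      have : evalAt (0 : W n) = 0 := by ext ξ; exact map_zero ξ
      simp [cliff, interior, this]
    simp only [Δ]
    rw [h1, h1, ← mul_assoc, projU_oneForm_oneForm ho hnd ξ η (om_anchor hb ho hJ η)]
    simp only [pairing, map_zero]
    push_cast
    ring
  have hvec : ∀ X : W n, ∃ ξ : W n →L[ℝ] ℝ, (J (0, ξ)).1 = X := by
    intro X
    refine ⟨-om X, ?_⟩
    have h1 := om_anchor hb ho hJ (-om X)
    rw [neg_neg] at h1
    refine eq_of_sub_eq_zero (hnd _ fun w => ?_)
    rw [map_sub, h1, sub_self]; rfl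
  -- Every vector is the tangent part of some J (0, ξ), by nondegeneracy of `om`; the remaining
  -- covector part is corrected by (0, η).
  have hdec : ∀ c : W n × (W n →L[ℝ] ℝ), ∃ ξ η : W n →L[ℝ] ℝ, c = J (0, ξ) - (0, η) := by
    intro c
    obtain ⟨ξ, hξ⟩ := hvec c.1
    exact ⟨ξ, (J (0, ξ)).2 - c.2, by ext1 <;> simp [hξ]⟩
  have hca : ∀ (ζ : W n →L[ℝ] ℝ) c, Δ (0, ζ) c = 0 := by
    intro ζ c
    obtain ⟨ξ, η, rfl⟩ := hdec c
    rw [hsub, hJc, hcc, hcc]; ring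
  obtain ⟨ξ, η, rfl⟩ := hdec c
  rw [hsub, hJc, hanti a, hanti a, hca, hca]
  ring

end Spinors
end GenKaehler

namespace GenKaehler

/-! ### Generalized Kähler linear algebra on one tangent space. -/

section PointwiseKaehler

variable {n : ℕ}

/-- A generalized Kähler structure of symplectic type on one tangent space. -/
structure PointKaehler (n : ℕ) where
  /-- the symplectic form -/
  om : W n →L[ℝ] W n →L[ℝ] ℝ
  /-- the two-form `b` -/
  b : W n →L[ℝ] W n →L[ℝ] ℝ
  /-- the first generalized complex structure -/
  J : W n × (W n →L[ℝ] ℝ) →ₗ[ℝ] W n × (W n →L[ℝ] ℝ)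
  /-- the generalized complex structure of `ψ` -/
  Jψ : W n × (W n →L[ℝ] ℝ) →ₗ[ℝ] W n × (W n →L[ℝ] ℝ)
  om_alt : ∀ v, om v v = 0
  om_nondeg : ∀ v, (∀ w, om v w = 0) → v = 0
  b_alt : ∀ v, b v v = 0
  J_sq : ∀ a, J (J a) = -a
  J_orth : ∀ a c, pairing (J a) (J c) = pairing a c
  Jψ_sq : ∀ a, Jψ (Jψ a) = -a
  Jψ_orth : ∀ a c, pairing (Jψ a) (Jψ c) = pairing a c
  Jψ_ker : ∀ a, cliff a (psi b om) + Complex.I • cliff (Jψ a) (psi b om) = 0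
  comm : ∀ a, J (Jψ a) = Jψ (J a)
  pos : ∀ a, a ≠ 0 → 0 < pairing (-(J (Jψ a))) a

/-- The generalized Kähler structure on the tangent space at `x`. -/
noncomputable def GenKaehlerSympl.pt {M : Type*} [TopologicalSpace M] [ChartedSpace (W n) M]
    [IsManifold (𝓡 (2 * n)) ∞ M] (K : GenKaehlerSympl n M) (x : M) : PointKaehler n where
  om := K.om x
  b := K.b x
  J := K.J x
  Jψ := K.Jψ x
  om_alt := K.om_form.alt x
  om_nondeg := K.om_nondeg x
  b_alt := K.b_form.alt x
  J_sq := K.J_complex.sq x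
  J_orth := K.J_complex.orth x
  Jψ_sq := K.Jψ_complex.sq x
  Jψ_orth := K.Jψ_complex.orth x
  Jψ_ker := K.Jψ_ker x
  comm := K.comm x
  pos := K.pos x

/-- The vector `v` as an element of `T ⊕ T*`. -/
noncomputable abbrev vecPart (v : W n) : W n × (W n →L[ℝ] ℝ) := (v, 0)

/-- The covector `ξ` as an element of `T ⊕ T*`. -/
noncomputable abbrev covPart (ξ : W n →L[ℝ] ℝ) : W n × (W n →L[ℝ] ℝ) := (0, ξ)

theorem pairing_expand (y : W n × (W n →L[ℝ] ℝ)) :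
    ∑ i, ((2 * pairing (covPart (dx i)) y) • vecPart (stdVec i)
      + (2 * pairing (vecPart (stdVec i)) y) • covPart (dx i)) = y := by
  have h1 : ∀ i, 2 * pairing (covPart (dx i)) y = y.1 i := by
    intro i; simp [pairing, dx]
  have h2 : ∀ i, 2 * pairing (vecPart (stdVec i)) y = y.2 (stdVec i) := by
    intro i; simp [pairing]
  simp only [h1, h2]
  ext1
  · simp only [Prod.fst_sum, Prod.fst_add, Prod.smul_fst, smul_zero, add_zero]
    exact sum_coord_stdVec y.1
  · simp only [Prod.snd_sum, Prod.snd_add, Prod.smul_snd, smul_zero, zero_add]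
    exact sum_dx y.2

/-- The contraction of a bilinear form on `T ⊕ T*` with the natural pairing. -/
noncomputable def pairTr (k : LinearMap.BilinForm ℝ (W n × (W n →L[ℝ] ℝ))) : ℝ :=
  ∑ i, (k (covPart (dx i)) (vecPart (stdVec i)) + k (vecPart (stdVec i)) (covPart (dx i)))

/-- The contraction is the same for any two families that are dual under 2⟨·, ·⟩ in the sense of
resolving the identity. They need not be bases, so orthogonal bases, images under J and finite
global frames are all allowed. -/
theorem pairTr_eq {ι : Type*} [Fintype ι] (k : LinearMap.BilinForm ℝ (W n × (W n →L[ℝ] ℝ)))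
    (f f' : ι → W n × (W n →L[ℝ] ℝ))
    (hf : ∀ y, ∑ c, (2 * pairing (f' c) y) • f c = y) :
    ∑ c, k (f' c) (f c) = pairTr k := by
  have h : ∀ c, k (f' c) (f c)
      = ∑ i, (k (vecPart (stdVec i)) ((2 * pairing (f' c) (covPart (dx i))) • f c)
        + k (covPart (dx i)) ((2 * pairing (f' c) (vecPart (stdVec i))) • f c)) := by
    intro c
    conv_lhs => rw [← pairing_expand (f' c)]
    simp only [map_sum, LinearMap.sum_apply, map_add, LinearMap.add_apply, map_smul,
      LinearMap.smul_apply, pairing_comm (f' c)]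
  simp only [h]
  rw [Finset.sum_comm, pairTr]
  refine Finset.sum_congr rfl fun i _ => ?_
  rw [Finset.sum_add_distrib, ← map_sum, ← map_sum, hf, hf, add_comm]

/-- An isometry of the pairing carries dual families to dual families. -/
theorem pairTr_isometry {J : W n × (W n →L[ℝ] ℝ) →ₗ[ℝ] W n × (W n →L[ℝ] ℝ)}
    (hsq : ∀ a, J (J a) = -a) (horth : ∀ a c, pairing (J a) (J c) = pairing a c)
    (k : LinearMap.BilinForm ℝ (W n × (W n →L[ℝ] ℝ))) :
    pairTr (k.compl₁₂ J J) = pairTr k := by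
  rw [← pairTr_eq k
    (Sum.elim (fun i => J (vecPart (stdVec i))) fun i => J (covPart (dx i)))
    (Sum.elim (fun i => J (covPart (dx i))) fun i => J (vecPart (stdVec i)))]
  · simp [pairTr, Finset.sum_add_distrib]
  · intro y
    have hy : y = J (-(J y)) := by rw [map_neg, hsq, neg_neg]
    rw [Fintype.sum_sum_type]
    simp only [Sum.elim_inl, Sum.elim_inr]
    rw [hy]
    simp only [horth]
    rw [← Finset.sum_add_distrib]
    conv_rhs => rw [← pairing_expand (-(J y)), map_sum]
    simp only [map_add, map_smul]

namespace PointKaehler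

variable (Q : PointKaehler n)

theorem projU_cliff (a c : W n × (W n →L[ℝ] ℝ)) :
    projU Q.b Q.om (cliff a (cliff c (psi Q.b Q.om)))
      = (pairing a c : ℂ) - Complex.I * (pairing a (Q.Jψ c) : ℂ) :=
  projU_cliff_cliff Q.b_alt Q.om_alt Q.om_nondeg Q.Jψ_sq Q.Jψ_orth Q.Jψ_ker a c

/-- The generalized metric. -/
noncomputable def metric : LinearMap.BilinForm ℝ (W n × (W n →L[ℝ] ℝ)) :=
  pairingB.compl₁₂ (-(Q.J ∘ₗ Q.Jψ)) LinearMap.id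

theorem metric_apply (a c : W n × (W n →L[ℝ] ℝ)) :
    Q.metric a c = pairing (-(Q.J (Q.Jψ a))) c := rfl

/-- J and Jψ are skew for the pairing and commute, so their composite is self-adjoint. -/
theorem metric_symm : LinearMap.IsSymm Q.metric := by
  refine ⟨fun a c => ?_⟩
  rw [RingHom.id_apply]
  rw [metric_apply, metric_apply, ← map_neg, pairing_skew Q.J_sq Q.J_orth,
    ← map_neg, pairing_skew Q.Jψ_sq Q.Jψ_orth, neg_neg, ← Q.comm, pairing_comm]
  simp [pairing]

/-- Take a metric-orthogonal basis f_c. Since the metric is ⟨-J Jψ ·, ·⟩, the element dual to f_c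
under 2⟨·, ·⟩ is -J Jψ f_c divided by twice its squared length. -/
theorem exists_dual_family : ∃ f : Fin (finrank ℝ (W n × (W n →L[ℝ] ℝ))) → W n × (W n →L[ℝ] ℝ),
    (∀ c, 0 < Q.metric (f c) (f c)) ∧ Submodule.span ℝ (Set.range f) = ⊤ ∧
    ∀ y, ∑ c, (2 * pairing ((1 / (2 * Q.metric (f c) (f c))) • -(Q.J (Q.Jψ (f c)))) y) • f c
      = y := by
  obtain ⟨v, hv⟩ := LinearMap.BilinForm.exists_orthogonal_basis (K := ℝ) (B := Q.metric) Q.metric_symm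
  have hpos : ∀ c, 0 < Q.metric (v c) (v c) := fun c => Q.pos _ (v.ne_zero c)
  refine ⟨v, hpos, v.span_eq, fun y => ?_⟩
  have h : ∀ c, 2 * pairing ((1 / (2 * Q.metric (v c) (v c))) • -(Q.J (Q.Jψ (v c)))) y
      = v.repr y c := by
    intro c
    rw [pairing_comm, pairing_smul_right, pairing_comm, ← metric_apply]
    have h1 : Q.metric (v c) y = v.repr y c * Q.metric (v c) (v c) := by
      conv_lhs => rw [← v.sum_repr y, map_sum]
      rw [Finset.sum_eq_single c]
      · simp
      · intro d _ hd
        have : Q.metric (v c) (v d) = 0 := hv (Ne.symm hd)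
        simp [this]
      · simp
    rw [h1]
    have := (hpos c).ne'
    field_simp
  simp only [h]
  exact v.sum_repr y

/-- Because (J Jψ)² = 1, the twist undoes the -J Jψ in the dual family. A diagonal sum with positive
weights remains, which is the source of positivity. -/
theorem pairTr_metric (k : LinearMap.BilinForm ℝ (W n × (W n →L[ℝ] ℝ)))
    (f : Fin (finrank ℝ (W n × (W n →L[ℝ] ℝ))) → W n × (W n →L[ℝ] ℝ))
    (hf : ∀ y, ∑ c, (2 * pairing ((1 / (2 * Q.metric (f c) (f c))) • -(Q.J (Q.Jψ (f c)))) y) • f c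
      = y) :
    pairTr (k.compl₁₂ (-(Q.J ∘ₗ Q.Jψ)) LinearMap.id)
      = ∑ c, (1 / (2 * Q.metric (f c) (f c))) * k (f c) (f c) := by
  rw [← pairTr_eq _ f _ hf]
  refine Finset.sum_congr rfl fun c _ => ?_
  simp only [LinearMap.compl₁₂_apply, LinearMap.id_apply, map_smul, LinearMap.smul_apply,
    smul_eq_mul, LinearMap.neg_apply, LinearMap.comp_apply, map_neg, neg_neg]
  have h : Q.J (Q.Jψ (Q.J (Q.Jψ (f c)))) = f c := by
    rw [Q.comm (f c), Q.Jψ_sq, map_neg, Q.J_sq, neg_neg]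
  rw [h]


/-- The coefficient of `ψ` in `dx i · dx j · ψ`. -/
noncomputable def projDx (i j : Fin (2 * n)) : ℂ :=
  projU Q.b Q.om (oneForm (dx i) * oneForm (dx j) * psi Q.b Q.om)

theorem projDx_eq (i j : Fin (2 * n)) :
    Q.projDx i j = -Complex.I * (pairing (covPart (dx i)) (Q.Jψ (covPart (dx j))) : ℂ) := by
  have h := Q.projU_cliff (covPart (dx i)) (covPart (dx j))
  have h0 : interior (0 : W n) = 0 := by
    have : evalAt (0 : W n) = 0 := by ext; simp [evalAt]
    simp [interior, this]
  simp only [cliff, h0, zero_add, LinearMap.mulLeft_apply, ← mul_assoc] at h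
  rw [projDx, h]
  simp [pairing]

theorem projDx_swap (i j : Fin (2 * n)) : Q.projDx j i = -Q.projDx i j := by
  rw [projDx, projDx, ← map_neg]
  congr 1
  have h : oneForm (dx j) * oneForm (dx i) = -(oneForm (dx i) * oneForm (dx j)) := by
    rw [eq_neg_iff_add_eq_zero]
    exact ExteriorAlgebra.ι_add_mul_swap _ _
  rw [h, neg_mul]

/-- The coefficient of `ψ` in `e_i · e_j · ψ`. -/
noncomputable def projVec (i j : Fin (2 * n)) : ℂ :=
  projU Q.b Q.om (interior (stdVec i) (interior (stdVec j) (psi Q.b Q.om)))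

theorem projVec_eq (i j : Fin (2 * n)) :
    Q.projVec i j = -Complex.I * (pairing (vecPart (stdVec i)) (Q.Jψ (vecPart (stdVec j))) : ℂ) := by
  have h := Q.projU_cliff (vecPart (stdVec i)) (vecPart (stdVec j))
  have h0 : oneForm (0 : W n →L[ℝ] ℝ) = 0 := by
    simpa using oneForm_smul (n := n) 0 0
  simp only [cliff, h0, LinearMap.mulLeft_zero_eq_zero, add_zero] at h
  rw [projVec, h]
  simp [pairing]

/-- The contraction of the two-form `θ_j dx_j` with `dx_i` and `ψ`. -/
theorem sum_projDx_smul {H : Type*} [AddCommGroup H] [Module ℂ H]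
    (R : (W n →L[ℝ] ℝ) →ₗ[ℝ] H) (i : Fin (2 * n)) :
    ∑ j, Q.projDx i j • (R (-(Q.b (stdVec j))) - Complex.I • R (-(Q.om (stdVec j))))
      = ∑ k, ((pairing (covPart (dx i)) (vecPart (stdVec k)) : ℂ)
        - Complex.I * (pairing (covPart (dx i)) (Q.Jψ (vecPart (stdVec k))) : ℂ)) • R (dx k) := by
  -- On ψ the vector e_k acts as the wedge product with its contraction into b - √-1 om. So the
  -- coefficient of dx_i · e_k · ψ can be expanded through the coefficients of dx_i · dx_j · ψ.
  have hk : ∀ k, ((pairing (covPart (dx i)) (vecPart (stdVec k)) : ℂ)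
      - Complex.I * (pairing (covPart (dx i)) (Q.Jψ (vecPart (stdVec k))) : ℂ))
      = ∑ j, (-(Q.b (stdVec j) (stdVec k) : ℂ) + Complex.I * (Q.om (stdVec j) (stdVec k) : ℂ))
        * Q.projDx i j := by
    intro k
    have h0 : interior (0 : W n) = 0 := by
      have : evalAt (0 : W n) = 0 := by ext; simp [evalAt]
      simp [interior, this]
    have h1 : ∀ ζ : W n →L[ℝ] ℝ,
        projU Q.b Q.om (oneForm (dx i) * (oneForm ζ * psi Q.b Q.om))
          = ∑ j, (ζ (stdVec j) : ℂ) * Q.projDx i j := by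
      intro ζ
      conv_lhs => rw [← sum_dx ζ]
      simp only [oneForm_sum, oneForm_smul, Finset.sum_mul, Finset.mul_sum, map_sum, smul_mul_assoc,
        mul_smul_comm, map_smul, smul_eq_mul, projDx, mul_assoc]
    rw [← Q.projU_cliff]
    rw [cliff_psi Q.b_alt Q.om_alt]
    simp only [cliff, h0, zero_add, LinearMap.mulLeft_apply, add_mul, sub_mul, smul_mul_assoc,
      mul_add, mul_sub, mul_smul_comm, map_add, map_sub, map_smul, smul_eq_mul, h1]
    simp only [ContinuousLinearMap.zero_apply, Complex.ofReal_zero, zero_mul,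
      Finset.sum_const_zero, zero_add, Finset.mul_sum, ← Finset.sum_sub_distrib]
    refine Finset.sum_congr rfl fun j _ => ?_
    rw [alt_swap Q.b_alt (stdVec j) (stdVec k), alt_swap Q.om_alt (stdVec j) (stdVec k)]
    push_cast
    ring
  have hR : ∀ ζ : W n →L[ℝ] ℝ, R ζ = ∑ k, (ζ (stdVec k) : ℂ) • R (dx k) := by
    intro ζ
    conv_lhs => rw [← sum_dx ζ, map_sum]
    simp only [map_smul, Complex.coe_smul]
  simp only [hk]
  simp only [hR (-_), Finset.smul_sum, Finset.sum_smul]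
  simp only [← Finset.sum_sub_distrib, Finset.smul_sum]
  rw [Finset.sum_comm]
  refine Finset.sum_congr rfl fun k _ => Finset.sum_congr rfl fun j _ => ?_
  rw [smul_smul, ← sub_smul, smul_smul]
  congr 1
  simp only [neg_apply]
  push_cast
  ring

section Quadratic

variable {H : Type*} [NormedAddCommGroup H] [InnerProductSpace ℂ H]

/-- The term of second order in `R` in the curvature of a subbundle; `R` is the covariant
derivative of the projection. -/
noncomputable def quad (R : W n × (W n →L[ℝ] ℝ) →ₗ[ℝ] Module.End ℂ H) : Module.End ℂ H :=
  let θ := fun j => R (covPart (-(Q.b (stdVec j)))) - Complex.I • R (covPart (-(Q.om (stdVec j))))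
  let e := fun i => R (vecPart (stdVec i))
  (1 / 2 : ℂ) • ∑ i, ∑ j, Q.projDx i j • (e i * e j - e j * e i)
    + (1 / 2 : ℂ) • ∑ i, ∑ j, Q.projDx i j • ((e i * θ j - θ j * e i) - (e j * θ i - θ i * e j))
    + (1 / 2 : ℂ) • ∑ i, ∑ j, Q.projVec i j •
      (R (covPart (dx i)) * R (covPart (dx j)) - R (covPart (dx j)) * R (covPart (dx i)))

/-- By antisymmetry of `projDx` the two halves of the mixed term agree, which removes the factor
1/2. Rewriting θ through V then makes all three terms contractions of commutators of R along T ⊕ T*.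
-/
theorem quad_eq (R : W n × (W n →L[ℝ] ℝ) →ₗ[ℝ] Module.End ℂ H) :
    Q.quad R = (1 / 2 : ℂ) • ∑ i, ∑ j, Q.projDx i j •
        (R (vecPart (stdVec i)) * R (vecPart (stdVec j))
          - R (vecPart (stdVec j)) * R (vecPart (stdVec i)))
      + ∑ i, ∑ j, ((pairing (covPart (dx i)) (vecPart (stdVec j)) : ℂ)
        - Complex.I * (pairing (covPart (dx i)) (Q.Jψ (vecPart (stdVec j))) : ℂ)) •
        (R (vecPart (stdVec i)) * R (covPart (dx j)) - R (covPart (dx j)) * R (vecPart (stdVec i)))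
      + (1 / 2 : ℂ) • ∑ i, ∑ j, Q.projVec i j •
      (R (covPart (dx i)) * R (covPart (dx j)) - R (covPart (dx j)) * R (covPart (dx i))) := by
  rw [quad]
  congr 2
  set θ := fun j => R (covPart (-(Q.b (stdVec j)))) - Complex.I • R (covPart (-(Q.om (stdVec j))))
    with hθ
  set e := fun i => R (vecPart (stdVec i)) with he
  have h2 : ∑ i, ∑ j, Q.projDx i j • (e j * θ i - θ i * e j)
      = -∑ i, ∑ j, Q.projDx i j • (e i * θ j - θ j * e i) := by
    rw [Finset.sum_comm, ← Finset.sum_neg_distrib]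
    refine Finset.sum_congr rfl fun i _ => ?_
    rw [← Finset.sum_neg_distrib]
    refine Finset.sum_congr rfl fun j _ => ?_
    rw [Q.projDx_swap i j, neg_smul]
  have h1 : (1 / 2 : ℂ) • ∑ i, ∑ j, Q.projDx i j •
      ((e i * θ j - θ j * e i) - (e j * θ i - θ i * e j))
      = ∑ i, ∑ j, Q.projDx i j • (e i * θ j - θ j * e i) := by
    simp only [smul_sub (Q.projDx _ _), Finset.sum_sub_distrib] at h2 ⊢
    rw [h2, smul_sub]
    module
  refine h1.trans (Finset.sum_congr rfl fun i _ => ?_)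
  have h := Q.sum_projDx_smul (R ∘ₗ LinearMap.inr ℝ (W n) (W n →L[ℝ] ℝ)) i
  simp only [LinearMap.comp_apply, LinearMap.inr_apply] at h
  have h' := congrArg (fun A => e i * A - A * e i) h
  simp only [Finset.mul_sum, Finset.sum_mul, mul_smul_comm, smul_mul_assoc,
    ← Finset.sum_sub_distrib, ← smul_sub] at h'
  exact h'

/-- The real part of the trace of `P R_a R_c`. -/
noncomputable def trRe (P : Module.End ℂ H) (R : W n × (W n →L[ℝ] ℝ) →ₗ[ℝ] Module.End ℂ H) :
    LinearMap.BilinForm ℝ (W n × (W n →L[ℝ] ℝ)) :=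
  LinearMap.mk₂ ℝ (fun a c => (LinearMap.trace ℂ H (P * R a * R c)).re)
    (fun a a' c => by simp [mul_add, add_mul]) (fun t a c => by simp [smul_mul_assoc])
    (fun a c c' => by simp [mul_add]) (fun t a c => by simp)

theorem trRe_apply (P : Module.End ℂ H) (R : W n × (W n →L[ℝ] ℝ) →ₗ[ℝ] Module.End ℂ H)
    (a c : W n × (W n →L[ℝ] ℝ)) :
    trRe P R a c = (LinearMap.trace ℂ H (P * R a * R c)).re := rfl

theorem trace_eq_conj [FiniteDimensional ℂ H] {A B : Module.End ℂ H}
    (h : ∀ u w, inner ℂ (A u) w = inner ℂ u (B w)) :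
    LinearMap.trace ℂ H B = (starRingEnd ℂ) (LinearMap.trace ℂ H A) := by
  rw [LinearMap.trace_eq_sum_inner B (stdOrthonormalBasis ℂ H),
    LinearMap.trace_eq_sum_inner A (stdOrthonormalBasis ℂ H), map_sum]
  simp only [inner_conj_symm, h]

variable [FiniteDimensional ℂ H] {P : Module.End ℂ H}
  {R : W n × (W n →L[ℝ] ℝ) →ₗ[ℝ] Module.End ℂ H}

/-- Since P R_a P = 0, the operators R_a P already take values in the kernel of P, and the factor 1
- P can be dropped. -/
theorem hol_eq (hPR : ∀ a, P * R a * P = 0)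
    (hol : ∀ a, (1 - P) * (R a + Complex.I • R (Q.J a)) * P = 0) (a : W n × (W n →L[ℝ] ℝ)) :
    R (Q.J a) * P = Complex.I • (R a * P) := by
  have h := hol a
  rw [sub_mul, sub_mul, one_mul, mul_add, add_mul, add_mul, mul_smul_comm, smul_mul_assoc,
    smul_mul_assoc, hPR, hPR, smul_zero, add_zero, sub_zero] at h
  have h2 := congrArg (fun A => Complex.I • A) h
  simp only [smul_add, smul_smul, Complex.I_mul_I, smul_zero, neg_smul, one_smul] at h2
  rw [eq_comm, ← sub_eq_zero, sub_eq_add_neg, h2]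

/-- With Ω(a, c) = Im tr(P R_a R_c), self-adjointness gives tr(P [R_a, R_c]) = 2√-1 Ω(a, c). So the
real trace of the quadratic term is a contraction of Ω with ⟨·, Jψ ·⟩. Holomorphy turns Ω(a, c) into
-Re tr(P R_a R_{Jc}), and since J is an isometry the result is a contraction twisted by -J Jψ. -/
theorem re_trace_quad (hPs : ∀ u w, inner ℂ (P u) w = inner ℂ u (P w))
    (hRs : ∀ a u w, inner ℂ (R a u) w = inner ℂ u (R a w)) (hPR : ∀ a, P * R a * P = 0)
    (hol : ∀ a, (1 - P) * (R a + Complex.I • R (Q.J a)) * P = 0) :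
    (LinearMap.trace ℂ H (P * Q.quad R)).re
      = -(1 / 2) * pairTr ((trRe P R).compl₁₂ (-(Q.J ∘ₗ Q.Jψ)) LinearMap.id) := by
  set B := fun a c => LinearMap.trace ℂ H (P * R a * R c) with hB
  set Ω := fun a c => (B a c).im with hΩ
  have hconj : ∀ a c, B c a = (starRingEnd ℂ) (B a c) := by
    intro a c
    have h1 : B c a = LinearMap.trace ℂ H (R c * R a * P) := by
      simp only [hB]
      rw [LinearMap.trace_mul_comm, mul_assoc, LinearMap.trace_mul_cycle', ← mul_assoc,
        LinearMap.trace_mul_comm, ← mul_assoc, LinearMap.trace_mul_comm, ← mul_assoc]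
    rw [h1]
    refine trace_eq_conj fun u w => ?_
    simp only [Module.End.mul_apply, hPs, hRs]
  have hsub : ∀ a c, B a c - B c a = 2 * Complex.I * (Ω a c : ℂ) := by
    intro a c
    rw [hconj a c, Complex.sub_conj]
    push_cast
    ring
  have hsk : ∀ a c, Ω c a = -Ω a c := by
    intro a c
    simp only [hΩ, hconj a c, Complex.conj_im]
  -- By cyclicity R_{Jc} stands next to P, where holomorphy replaces it by √-1 R_c.
  have hJ : ∀ a c, trRe P R a (Q.J c) = -Ω a c := by
    intro a c
    have h1 : ∀ d, LinearMap.trace ℂ H (P * R a * R d) = LinearMap.trace ℂ H (R a * (R d * P)) := by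
      intro d
      rw [mul_assoc, LinearMap.trace_mul_comm, mul_assoc]
    rw [trRe_apply, h1, Q.hol_eq hPR hol, mul_smul_comm, map_smul, smul_eq_mul, ← h1]
    simp [hΩ, hB]
  have hadd : ∀ a a' c, Ω (a + a') c = Ω a c + Ω a' c := by
    intro a a' c; simp [hΩ, hB, mul_add, add_mul]
  have hsmul : ∀ (t : ℝ) a c, Ω (t • a) c = t * Ω a c := by
    intro t a c; simp [hΩ, hB]
  have hsum : ∀ (f : Fin (2 * n) → W n × (W n →L[ℝ] ℝ)) c, Ω (∑ i, f i) c = ∑ i, Ω (f i) c := by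
    intro f c
    exact map_sum (AddMonoidHom.mk' (fun a => Ω a c) (fun a a' => hadd a a' c)) f Finset.univ
  have hexp : ∀ y c, Ω y c = ∑ i, (2 * pairing (covPart (dx i)) y * Ω (vecPart (stdVec i)) c
      + 2 * pairing (vecPart (stdVec i)) y * Ω (covPart (dx i)) c) := by
    intro y c
    conv_lhs => rw [← pairing_expand y, hsum]
    simp only [hadd, hsmul]
  -- The traces are purely imaginary, so only the imaginary parts of the coefficients contribute;
  -- the plain pairing in the mixed term drops out.
  have hlhs : (LinearMap.trace ℂ H (P * Q.quad R)).re
      = ∑ i, ∑ j, (pairing (covPart (dx i)) (Q.Jψ (covPart (dx j)))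
            * Ω (vecPart (stdVec i)) (vecPart (stdVec j))
          + 2 * pairing (covPart (dx i)) (Q.Jψ (vecPart (stdVec j)))
            * Ω (vecPart (stdVec i)) (covPart (dx j))
          + pairing (vecPart (stdVec i)) (Q.Jψ (vecPart (stdVec j)))
            * Ω (covPart (dx i)) (covPart (dx j))) := by
    have hcomm : ∀ a c, LinearMap.trace ℂ H (P * (R a * R c - R c * R a))
        = 2 * Complex.I * (Ω a c : ℂ) := by
      intro a c
      rw [mul_sub, ← mul_assoc, ← mul_assoc, map_sub]
      exact hsub a c
    rw [Q.quad_eq]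
    simp only [mul_add, mul_smul_comm, Finset.mul_sum, map_add, map_smul, map_sum, hcomm,
      projDx_eq, projVec_eq, smul_eq_mul]
    simp only [Complex.add_re, Complex.mul_re, Complex.re_sum, Finset.mul_sum, Finset.sum_mul]
    simp only [← Finset.sum_add_distrib]
    refine Finset.sum_congr rfl fun i _ => Finset.sum_congr rfl fun j _ => ?_
    simp
    ring
  have hrhs : pairTr ((trRe P R).compl₁₂ (-(Q.J ∘ₗ Q.Jψ)) LinearMap.id)
      = -∑ j, (Ω (Q.Jψ (covPart (dx j))) (vecPart (stdVec j))
        + Ω (Q.Jψ (vecPart (stdVec j))) (covPart (dx j))) := by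
    -- Inserting J in both slots moves one J from the first argument to the second, because J² = -1.
    -- The isometry J ⊗ J can then be removed from the contraction.
    have h1 : (trRe P R).compl₁₂ (-(Q.J ∘ₗ Q.Jψ)) LinearMap.id
        = ((trRe P R).compl₁₂ Q.Jψ Q.J).compl₁₂ Q.J Q.J := by
      refine LinearMap.ext₂ fun a c => ?_
      simp only [LinearMap.compl₁₂_apply, LinearMap.id_apply, LinearMap.neg_apply,
        LinearMap.comp_apply, Q.J_sq, ← Q.comm, map_neg]
    rw [h1, pairTr_isometry Q.J_sq Q.J_orth, pairTr]
    simp only [LinearMap.compl₁₂_apply, hJ, Finset.sum_add_distrib, Finset.sum_neg_distrib]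
    ring
  have hpsk : ∀ i j, pairing (vecPart (stdVec i)) (Q.Jψ (covPart (dx j)))
      = -pairing (covPart (dx j)) (Q.Jψ (vecPart (stdVec i))) := by
    intro i j
    have := pairing_skew Q.Jψ_sq Q.Jψ_orth (vecPart (stdVec i)) (covPart (dx j))
    rw [pairing_comm (covPart (dx j))]
    linarith
  rw [hlhs, hrhs]
  have hA : ∑ j, ∑ i, 2 * pairing (vecPart (stdVec i)) (Q.Jψ (covPart (dx j)))
        * Ω (covPart (dx i)) (vecPart (stdVec j))
      = ∑ i, ∑ j, 2 * pairing (covPart (dx j)) (Q.Jψ (vecPart (stdVec i)))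
        * Ω (vecPart (stdVec j)) (covPart (dx i)) := by
    rw [Finset.sum_comm]
    refine Finset.sum_congr rfl fun i _ => Finset.sum_congr rfl fun j _ => ?_
    rw [hpsk, hsk (vecPart (stdVec j))]
    ring
  simp only [hexp (Q.Jψ _), Finset.sum_add_distrib] at hA ⊢
  rw [hA]
  rw [Finset.sum_comm (f := fun j i => 2 * pairing (covPart (dx i)) (Q.Jψ (covPart (dx j)))
        * Ω (vecPart (stdVec i)) (vecPart (stdVec j))),
    Finset.sum_comm (f := fun j i => 2 * pairing (vecPart (stdVec i)) (Q.Jψ (vecPart (stdVec j)))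
        * Ω (covPart (dx i)) (covPart (dx j))),
    Finset.sum_comm (f := fun i j => 2 * pairing (covPart (dx i)) (Q.Jψ (vecPart (stdVec j)))
        * Ω (vecPart (stdVec i)) (covPart (dx j)))]
  simp only [mul_assoc, ← Finset.mul_sum]
  ring

theorem trRe_self (hPs : ∀ u w, inner ℂ (P u) w = inner ℂ u (P w)) (hP : P * P = P)
    (hRs : ∀ a u w, inner ℂ (R a u) w = inner ℂ u (R a w)) (a : W n × (W n →L[ℝ] ℝ)) :
    trRe P R a a = ∑ i, ‖R a (P (stdOrthonormalBasis ℂ H i))‖ ^ 2 := by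
  have h1 : LinearMap.trace ℂ H (P * R a * R a) = LinearMap.trace ℂ H (P * (R a * R a * P)) := by
    conv_lhs => rw [← hP, mul_assoc, mul_assoc, LinearMap.trace_mul_comm]
    simp only [mul_assoc]
  rw [trRe_apply, h1, LinearMap.trace_eq_sum_inner _ (stdOrthonormalBasis ℂ H), Complex.re_sum]
  refine Finset.sum_congr rfl fun i _ => ?_
  simp only [Module.End.mul_apply]
  rw [← hPs, ← hRs]
  exact inner_self_eq_norm_sq (𝕜 := ℂ) _

/-- The contraction of the second fundamental form is nonnegative; it vanishes only if the second
fundamental form does. -/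
theorem pairTr_trRe_nonneg (hPs : ∀ u w, inner ℂ (P u) w = inner ℂ u (P w)) (hP : P * P = P)
    (hRs : ∀ a u w, inner ℂ (R a u) w = inner ℂ u (R a w)) :
    0 ≤ pairTr ((trRe P R).compl₁₂ (-(Q.J ∘ₗ Q.Jψ)) LinearMap.id) ∧
    (pairTr ((trRe P R).compl₁₂ (-(Q.J ∘ₗ Q.Jψ)) LinearMap.id) = 0 → ∀ a, R a * P = 0) := by
  obtain ⟨f, hpos, hspan, hf⟩ := Q.exists_dual_family
  have hnn : ∀ c, 0 ≤ (1 / (2 * Q.metric (f c) (f c))) * trRe P R (f c) (f c) := by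
    intro c
    rw [trRe_self hPs hP hRs]
    have := hpos c
    positivity
  rw [Q.pairTr_metric _ f hf]
  refine ⟨Finset.sum_nonneg fun c _ => hnn c, fun h0 => ?_⟩
  rw [Finset.sum_eq_zero_iff_of_nonneg fun c _ => hnn c] at h0
  have hz : ∀ c, R (f c) * P = 0 := by
    intro c
    have h1 := h0 c (Finset.mem_univ c)
    have h2 : trRe P R (f c) (f c) = 0 := by
      rcases mul_eq_zero.1 h1 with h | h
      · have := hpos c
        exact absurd h (by positivity)
      · exact h
    rw [trRe_self hPs hP hRs, Finset.sum_eq_zero_iff_of_nonneg fun i _ => by positivity] at h2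
    refine (stdOrthonormalBasis ℂ H).toBasis.ext fun i => ?_
    have := h2 i (Finset.mem_univ i)
    simpa using this
  intro a
  have ha : a ∈ Submodule.span ℝ (Set.range f) := hspan ▸ Submodule.mem_top
  induction ha using Submodule.span_induction with
  | mem x hx => obtain ⟨c, rfl⟩ := hx; exact hz c
  | zero => simp
  | add x y _ _ hx hy => rw [map_add, add_mul, hx, hy, add_zero]
  | smul t x _ hx => rw [map_smul, smul_mul_assoc, hx, smul_zero]

end Quadratic

end PointKaehler

end PointwiseKaehler
end GenKaehler

namespace GenKaehler

/-! ### Cutoff functions and finite global frames. -/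

section Cutoffs

open Filter Topology

variable {n : ℕ} {M : Type*} [TopologicalSpace M] [ChartedSpace (W n) M]
  [IsManifold (𝓡 (2 * n)) ∞ M]

theorem exists_cutoff [T2Space M] {U : Set M} {x : M} (hU : U ∈ 𝓝 x) :
    ∃ χ : M → ℝ, ContMDiff (𝓡 (2 * n)) 𝓘(ℝ, ℝ) ∞ χ ∧ tsupport χ ⊆ U ∧ (∀ᶠ y in 𝓝 x, χ y = 1) := by
  obtain ⟨f, hf, -⟩ := (SmoothBumpFunction.nhds_basis_support (I := 𝓡 (2 * n)) hU).mem_iff.1 hU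
  exact ⟨f, f.contMDiff, hf, f.eventuallyEq_one⟩

/-- Take finitely many bumps ρ_i whose unit sets cover, and σ_i = ρ_i / ∑ ρ_j². The partition of
unity comes split into two smooth factors so that one can localize a frame and the other its dual
frame. -/
theorem exists_cutoff_family [T2Space M] [CompactSpace M] (U : M → Set M)
    (hU : ∀ x, U x ∈ 𝓝 x) :
    ∃ (N : ℕ) (c : Fin N → M) (ρ σ : Fin N → M → ℝ),
      (∀ i, ContMDiff (𝓡 (2 * n)) 𝓘(ℝ, ℝ) ∞ (ρ i)) ∧
      (∀ i, ContMDiff (𝓡 (2 * n)) 𝓘(ℝ, ℝ) ∞ (σ i)) ∧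
      (∀ i, tsupport (ρ i) ⊆ U (c i)) ∧ (∀ i, tsupport (σ i) ⊆ U (c i)) ∧
      ∀ x, ∑ i, ρ i x * σ i x = 1 := by
  choose f hf hf2 hf1 using fun x => exists_cutoff (n := n) (hU x)
  obtain ⟨T, hT⟩ := isCompact_univ.elim_nhds_subcover (fun x => {y | f x y = 1})
    (fun x _ => hf1 x)
  have e := T.equivFin.symm
  let ρ : Fin T.card → M → ℝ := fun i => f (e i)
  have hpos : ∀ x, 0 < ∑ i, ρ i x ^ 2 := by
    intro x
    obtain ⟨c, hc, hx⟩ := Set.mem_iUnion₂.1 (hT.2 (Set.mem_univ x))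
    refine Finset.sum_pos' (fun i _ => sq_nonneg _) ⟨e.symm ⟨c, hc⟩, Finset.mem_univ _, ?_⟩
    have : ρ (e.symm ⟨c, hc⟩) x = 1 := by
      simpa [ρ] using hx
    rw [this]; norm_num
  have hρ : ∀ i, ContMDiff (𝓡 (2 * n)) 𝓘(ℝ, ℝ) ∞ (ρ i) := fun i => hf _
  have hS : ContMDiff (𝓡 (2 * n)) 𝓘(ℝ, ℝ) ∞ (fun x => (∑ i, ρ i x ^ 2)⁻¹) := by
    refine ContMDiff.inv₀ ?_ fun x => (hpos x).ne'
    exact contMDiff_finsetSum fun i _ => (hρ i).pow 2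
  refine ⟨T.card, fun i => e i, ρ, fun i x => (∑ i, ρ i x ^ 2)⁻¹ * ρ i x, hρ,
    fun i => hS.mul (hρ i), fun i => hf2 _, fun i => ?_, fun x => ?_⟩
  · exact (tsupport_mul_subset_right (f := fun x => (∑ i, ρ i x ^ 2)⁻¹) (g := ρ i)).trans (hf2 _)
  · have : ∀ i, ρ i x * ((∑ i, ρ i x ^ 2)⁻¹ * ρ i x) = (∑ i, ρ i x ^ 2)⁻¹ * ρ i x ^ 2 := by
      intro i; ring
    simp only [this]
    rw [← Finset.mul_sum, inv_mul_cancel₀ (hpos x).ne']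

end Cutoffs

section VF

open Filter Topology

variable {n : ℕ} {M : Type*} [TopologicalSpace M] [ChartedSpace (W n) M]
  [IsManifold (𝓡 (2 * n)) ∞ M]

theorem SmoothVF.smul {f : M → ℝ} {X : ∀ x : M, TangentSpace (𝓡 (2 * n)) x}
    (hf : ContMDiff (𝓡 (2 * n)) 𝓘(ℝ, ℝ) ∞ f) (hX : SmoothVF X) : SmoothVF (fun x => f x • X x) :=
  ContMDiff.smul_section hf hX

theorem smoothVF_zero : SmoothVF (fun x : M => (0 : TangentSpace (𝓡 (2 * n)) x)) :=
  contMDiff_zeroSection ℝ (TangentSpace (𝓡 (2 * n)) : M → Type _)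

theorem SmoothOneForm.neg {ξ : ∀ x : M, TangentSpace (𝓡 (2 * n)) x →L[ℝ] ℝ}
    (hξ : SmoothOneForm ξ) : SmoothOneForm (fun x => -ξ x) :=
  fun X hX => (hξ X hX).neg

/-- A finite family of smooth vector fields and one-forms that resolves the identity. -/
structure VecFrame (n : ℕ) (M : Type*) [TopologicalSpace M] [ChartedSpace (W n) M]
    [IsManifold (𝓡 (2 * n)) ∞ M] where
  /-- the number of vector fields -/
  card : ℕ
  /-- the vector fields -/
  X : Fin card → ∀ x : M, TangentSpace (𝓡 (2 * n)) x
  /-- the one-forms -/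
  ξ : Fin card → ∀ x : M, TangentSpace (𝓡 (2 * n)) x →L[ℝ] ℝ
  smooth_X : ∀ a, SmoothVF (X a)
  smooth_ξ : ∀ a, SmoothOneForm (ξ a)
  expand : ∀ x v, ∑ a, ξ a x v • X a x = v

/-- Local frames multiplied by ρ_i and local coframes multiplied by σ_i are globally smooth.
Together they resolve the identity, although a global basis need not exist. -/
theorem exists_vecFrame [T2Space M] [CompactSpace M] : Nonempty (VecFrame n M) := by
  obtain ⟨N, c, ρ, σ, hρ, hσ, hρs, hσs, h1⟩ := exists_cutoff_family (n := n) (M := M)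
    (fun x => (trivializationAt (W n) (TangentSpace (𝓡 (2 * n))) x).baseSet)
    (fun x => (trivializationAt (W n) (TangentSpace (𝓡 (2 * n))) x).open_baseSet.mem_nhds
      (FiberBundle.mem_baseSet_trivializationAt' x))
  let e : Fin N → Trivialization (W n) (π (W n) (TangentSpace (𝓡 (2 * n)) : M → Type _)) :=
    fun i => trivializationAt (W n) (TangentSpace (𝓡 (2 * n))) (c i)
  let eq := (finProdFinEquiv (m := N) (n := 2 * n)).symm
  have hX : ∀ i j, SmoothVF (fun x : M => ρ i x • (e i).symm x (stdVec j)) := by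
    intro i j
    refine ContMDiffOn.smul_section_of_tsupport (u := (e i).baseSet) (hρ i).contMDiffOn
      (e i).open_baseSet (hρs i) ?_
    rw [(e i).contMDiffOn_section_baseSet_iff]
    refine (contMDiffOn_const (c := stdVec j)).congr fun y hy => ?_
    rw [(e i).apply_mk_symm hy]
  have hξ : ∀ i j, SmoothOneForm (fun x : M => σ i x • ((dx j) ∘L ((e i).continuousLinearMapAt ℝ x)
      : TangentSpace (𝓡 (2 * n)) x →L[ℝ] ℝ)) := by
    intro i j Y hY
    refine contMDiff_of_tsupport fun x hx => ?_
    have hx' : x ∈ (e i).baseSet := by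
      refine hσs i (closure_mono ?_ hx)
      intro y hy
      simp only [Function.mem_support] at hy ⊢
      intro h
      apply hy
      simp [h]
    have h3 : ContMDiffAt (𝓡 (2 * n)) 𝓘(ℝ, W n) ∞ (fun y => ((e i) ⟨y, Y y⟩).2) x :=
      ((e i).contMDiffAt_section_iff hx').1 (hY x)
    have h4 := (dx j).contDiff.contMDiff.contMDiffAt (n := ∞) |>.comp x h3
    refine ((hσ i).contMDiffAt.mul h4).congr_of_eventuallyEq ?_
    filter_upwards [(e i).open_baseSet.mem_nhds hx'] with y hy
    simp only [smul_apply, ContinuousLinearMap.comp_apply, smul_eq_mul, Function.comp_apply]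
    rw [(e i).continuousLinearMapAt_apply_of_mem ℝ hy]
    rfl
  refine ⟨⟨N * (2 * n), fun a x => ρ (eq a).1 x • (e (eq a).1).symm x (stdVec (eq a).2),
    fun a x => σ (eq a).1 x • ((dx (eq a).2) ∘L ((e (eq a).1).continuousLinearMapAt ℝ x)),
    fun a => hX _ _, fun a => hξ _ _, fun x v => ?_⟩⟩
  rw [Equiv.sum_comp eq (fun p => (σ p.1 x • ((dx p.2) ∘L ((e p.1).continuousLinearMapAt ℝ x)
      : TangentSpace (𝓡 (2 * n)) x →L[ℝ] ℝ)) v • ρ p.1 x • (e p.1).symm x (stdVec p.2)),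
    Fintype.sum_prod_type]
  have h2 : ∀ i, ∑ j, (σ i x • ((dx j) ∘L ((e i).continuousLinearMapAt ℝ x)
      : TangentSpace (𝓡 (2 * n)) x →L[ℝ] ℝ)) v • ρ i x • (e i).symm x (stdVec j)
      = (ρ i x * σ i x) • v := by
    intro i
    by_cases hx : x ∈ (e i).baseSet
    · have h3 : ∀ j, (e i).symm x (stdVec j) = (e i).symmL ℝ x (stdVec j) :=
        fun j => ((e i).symmL_apply (R := ℝ) hx _).symm
      have h4 : (e i).symmL ℝ x (∑ j, ((e i).continuousLinearMapAt ℝ x v) j • stdVec j) = v := by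
        rw [sum_coord_stdVec, (e i).symmL_continuousLinearMapAt hx]
      conv_rhs => rw [← h4, map_sum, Finset.smul_sum]
      refine Finset.sum_congr rfl fun j _ => ?_
      rw [h3, map_smul, smul_smul, smul_smul]
      congr 1
      simp only [smul_apply, ContinuousLinearMap.comp_apply, smul_eq_mul]
      have h5 : ∀ w : W n, dx j w = w j := fun _ => rfl
      rw [h5]
      ring
    · have h3 : ρ i x = 0 := image_eq_zero_of_notMem_tsupport fun h => hx (hρs i h)
      simp [h3]
  simp only [h2]
  rw [← Finset.sum_smul, h1, one_smul]

end VF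

section Sections

open Filter Topology

variable {n r : ℕ} {M : Type*} [TopologicalSpace M] [ChartedSpace (W n) M]
  [IsManifold (𝓡 (2 * n)) ∞ M]
  {E : M → Type*} [TopologicalSpace (TotalSpace (EuclideanSpace ℂ (Fin r)) E)]
  [∀ x, NormedAddCommGroup (E x)] [∀ x, InnerProductSpace ℂ (E x)]
  [FiberBundle (EuclideanSpace ℂ (Fin r)) E]
  [VectorBundle ℂ (EuclideanSpace ℂ (Fin r)) E] [VectorBundle ℝ (EuclideanSpace ℂ (Fin r)) E]
  [ContMDiffVectorBundle ∞ (EuclideanSpace ℂ (Fin r)) E (𝓡 (2 * n))]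

theorem SmoothSecOn.mono {U U' : Set M} {s : ∀ x, E x} (h : SmoothSecOn n r U s) (hU : U' ⊆ U) :
    SmoothSecOn n r U' s := ContMDiffOn.mono h hU

theorem SmoothSecOn.congr {U : Set M} {s s' : ∀ x, E x} (h : SmoothSecOn n r U s)
    (hs : ∀ x ∈ U, s' x = s x) : SmoothSecOn n r U s' :=
  ContMDiffOn.congr h fun x hx => by rw [hs x hx]

theorem SmoothSecOn.add {U : Set M} {s t : ∀ x, E x} (hs : SmoothSecOn n r U s)
    (ht : SmoothSecOn n r U t) : SmoothSecOn n r U (fun x => s x + t x) :=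
  ContMDiffOn.add_section hs ht

theorem SmoothSecOn.sub {U : Set M} {s t : ∀ x, E x} (hs : SmoothSecOn n r U s)
    (ht : SmoothSecOn n r U t) : SmoothSecOn n r U (fun x => s x - t x) :=
  ContMDiffOn.sub_section hs ht

theorem SmoothSecOn.sum {U : Set M} {ι : Type*} {T : Finset ι} {s : ι → ∀ x, E x}
    (hs : ∀ i ∈ T, SmoothSecOn n r U (s i)) : SmoothSecOn n r U (fun x => ∑ i ∈ T, s i x) :=
  ContMDiffOn.sum_section hs

theorem smoothSecOn_zero (U : Set M) : SmoothSecOn n r U (fun x => (0 : E x)) :=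
  (contMDiff_zeroSection ℝ E).contMDiffOn

theorem SmoothSecOn.smul {U : Set M} {f : M → ℂ} {s : ∀ x, E x}
    (hf : ContMDiffOn (𝓡 (2 * n)) 𝓘(ℝ, ℂ) ∞ f U) (hs : SmoothSecOn n r U s) :
    SmoothSecOn n r U (fun x => f x • s x) := by
  intro x₀ hx₀
  have h1 := hs x₀ hx₀
  rw [contMDiffWithinAt_section] at h1 ⊢
  set e := trivializationAt (EuclideanSpace ℂ (Fin r)) E x₀
  have h2 : ContMDiffWithinAt (𝓡 (2 * n)) 𝓘(ℝ, EuclideanSpace ℂ (Fin r)) ∞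
      (fun x => f x • (e ⟨x, s x⟩).2) U x₀ := by
    have h3 : ContDiff ℝ ∞ (fun p : ℂ × EuclideanSpace ℂ (Fin r) => p.1 • p.2) := by fun_prop
    exact h3.contMDiff.contMDiffAt.comp_contMDiffWithinAt x₀ ((hf x₀ hx₀).prodMk_space h1)
  refine h2.congr_of_eventuallyEq ?_ ?_
  · filter_upwards [mem_nhdsWithin_of_mem_nhds
      (e.open_baseSet.mem_nhds (mem_baseSet_trivializationAt _ E x₀))] with x hx
    exact (e.linear ℂ hx).2 _ _
  · exact (e.linear ℂ (FiberBundle.mem_baseSet_trivializationAt' x₀)).2 _ _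

theorem SmoothSecOn.contMDiffAt {U : Set M} {s : ∀ x, E x} (hs : SmoothSecOn n r U s) {x : M}
    (hU : U ∈ 𝓝 x) : ContMDiffAt (𝓡 (2 * n)) ((𝓡 (2 * n)).prod 𝓘(ℝ, EuclideanSpace ℂ (Fin r))) ∞
      (fun x => TotalSpace.mk' (EuclideanSpace ℂ (Fin r)) x (s x)) x :=
  ContMDiffOn.contMDiffAt hs hU

theorem SmoothSecOn.mdiffAt {U : Set M} {s : ∀ x, E x} (hs : SmoothSecOn n r U s) {x : M}
    (hU : U ∈ 𝓝 x) : MDifferentiableAt (𝓡 (2 * n))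
      ((𝓡 (2 * n)).prod 𝓘(ℝ, EuclideanSpace ℂ (Fin r)))
      (fun x => TotalSpace.mk' (EuclideanSpace ℂ (Fin r)) x (s x)) x :=
  (hs.contMDiffAt hU).mdifferentiableAt (by simp)

/-- The operators used below are local, so a local section may be replaced by a global one with the
same germ. -/
theorem SmoothSecOn.exists_global [T2Space M] {U : Set M} {s : ∀ x, E x}
    (hs : SmoothSecOn n r U s) (hU : IsOpen U) {x : M} (hx : x ∈ U) :
    ∃ s' : ∀ x, E x, SmoothSec n r s' ∧ ∀ᶠ y in 𝓝 x, s' y = s y := by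
  obtain ⟨χ, hχ, hsupp, h1⟩ := exists_cutoff (n := n) (hU.mem_nhds hx)
  refine ⟨fun y => χ y • s y, ?_, h1.mono fun y hy => by simp [hy]⟩
  exact (ContMDiffOn.smul_section_of_tsupport hχ.contMDiffOn hU hsupp hs).contMDiffOn

theorem SmoothEndOn.apply [T2Space M] {U : Set M} {P : ∀ x, Module.End ℂ (E x)} {s : ∀ x, E x}
    (hP : SmoothEndOn n r U P) (hs : SmoothSecOn n r U s) (hU : IsOpen U) :
    SmoothSecOn n r U (fun x => P x (s x)) := by
  intro x hx
  obtain ⟨s', hs', he⟩ := hs.exists_global hU hx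
  exact (((hP s' hs').contMDiffAt (hU.mem_nhds hx)).congr_of_eventuallyEq
    (he.mono fun y hy => by simp [hy])).contMDiffWithinAt

theorem smoothEndOn_one (U : Set M) : SmoothEndOn n r U (fun x => (1 : Module.End ℂ (E x))) :=
  fun _ hs => SmoothSecOn.mono hs (Set.subset_univ _)

theorem SmoothEndOn.mul [T2Space M] {U : Set M} {P Q : ∀ x, Module.End ℂ (E x)}
    (hP : SmoothEndOn n r U P) (hQ : SmoothEndOn n r U Q) (hU : IsOpen U) :
    SmoothEndOn n r U (fun x => P x * Q x) :=
  fun s hs => hP.apply (hQ s hs) hU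

theorem SmoothEndOn.sub {U : Set M} {P Q : ∀ x, Module.End ℂ (E x)}
    (hP : SmoothEndOn n r U P) (hQ : SmoothEndOn n r U Q) :
    SmoothEndOn n r U (fun x => P x - Q x) :=
  fun s hs => (hP s hs).sub (hQ s hs)

theorem SmoothEndOn.smul {U : Set M} {f : M → ℂ} {P : ∀ x, Module.End ℂ (E x)}
    (hf : ContMDiffOn (𝓡 (2 * n)) 𝓘(ℝ, ℂ) ∞ f U) (hP : SmoothEndOn n r U P) :
    SmoothEndOn n r U (fun x => f x • P x) :=
  fun s hs => SmoothSecOn.smul hf (hP s hs)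

theorem SmoothEndOn.exists_global [T2Space M] {U : Set M} {P : ∀ x, Module.End ℂ (E x)}
    (hP : SmoothEndOn n r U P) (hU : IsOpen U) {x : M} (hx : x ∈ U) :
    ∃ Φ : ∀ x, Module.End ℂ (E x), SmoothEndOn n r Set.univ Φ ∧ ∀ᶠ y in 𝓝 x, Φ y = P y := by
  obtain ⟨χ, hχ, hsupp, h1⟩ := exists_cutoff (n := n) (hU.mem_nhds hx)
  refine ⟨fun y => χ y • P y, fun s hs => ?_, h1.mono fun y hy => by simp [hy]⟩
  exact (ContMDiffOn.smul_section_of_tsupport hχ.contMDiffOn hU hsupp (hP s hs)).contMDiffOn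

variable (r) in
theorem finiteDimensional_fibre {E : M → Type*}
    [TopologicalSpace (TotalSpace (EuclideanSpace ℂ (Fin r)) E)]
    [∀ x, NormedAddCommGroup (E x)] [∀ x, InnerProductSpace ℂ (E x)]
    [FiberBundle (EuclideanSpace ℂ (Fin r)) E] [VectorBundle ℂ (EuclideanSpace ℂ (Fin r)) E]
    (x : M) : FiniteDimensional ℂ (E x) :=
  Module.Finite.of_basis (fibreBasis r E x)

theorem linearize_eq {x : M} {f : E x → E x} (L : Module.End ℂ (E x)) (h : ∀ e, f e = L e) :
    linearize r f = L := by
  refine (fibreBasis r E x).ext fun k => ?_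
  rw [linearize, Basis.constr_basis, h]

/-- A finite family of pairs of smooth sections that resolves the identity. -/
structure SecFrame (n r : ℕ) {M : Type*} [TopologicalSpace M] [ChartedSpace (W n) M]
    (E : M → Type*) [TopologicalSpace (TotalSpace (EuclideanSpace ℂ (Fin r)) E)]
    [∀ x, NormedAddCommGroup (E x)] [∀ x, InnerProductSpace ℂ (E x)]
    [FiberBundle (EuclideanSpace ℂ (Fin r)) E] where
  /-- the number of pairs -/
  card : ℕ
  /-- the generating sections -/
  s : Fin card → ∀ x, E x
  /-- the dual sections -/
  t : Fin card → ∀ x, E x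
  smooth_s : ∀ k, SmoothSec n r (s k)
  smooth_t : ∀ k, SmoothSec n r (t k)
  expand : ∀ x u, ∑ k, inner ℂ (t k x) u • s k x = u
  metric : IsSmoothMetric n r E

theorem IsSmoothMetric.inner_on [T2Space M] (hmetric : IsSmoothMetric n r E) {U : Set M}
    (hU : IsOpen U)
    {s t : ∀ x, E x} (hs : SmoothSecOn n r U s) (ht : SmoothSecOn n r U t) :
    ContMDiffOn (𝓡 (2 * n)) 𝓘(ℝ, ℂ) ∞ (fun x => inner ℂ (s x) (t x)) U := by
  intro x hx
  obtain ⟨s', hs', he⟩ := hs.exists_global hU hx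
  obtain ⟨t', ht', he'⟩ := ht.exists_global hU hx
  refine (((hmetric s' t' hs' ht') x).congr_of_eventuallyEq ?_).contMDiffWithinAt
  filter_upwards [he, he'] with y hy hy'
  rw [hy, hy']

theorem contDiff_det {m : ℕ} :
    ContDiff ℝ ∞ (fun A : Fin m → Fin m → ℂ => (Matrix.of A).det) := by
  simp only [Matrix.det_apply, Matrix.of_apply]
  refine ContDiff.sum fun σ _ => ?_
  refine ContDiff.const_smul _ (contDiff_prod fun i _ => ?_)
  fun_prop

/-- Cramer's rule. -/
theorem contDiffAt_matrix_inv {m : ℕ} (A : Fin m → Fin m → ℂ) (hA : (Matrix.of A).det ≠ 0)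
    (i j : Fin m) :
    ContDiffAt ℝ ∞ (fun B : Fin m → Fin m → ℂ => (Matrix.of B)⁻¹ i j) A := by
  have h : (fun B : Fin m → Fin m → ℂ => (Matrix.of B)⁻¹ i j)
      = fun B => ((Matrix.of B).det)⁻¹ * (Matrix.of (fun k l =>
        if k = j then (Pi.single i 1 : Fin m → ℂ) l else B k l)).det := by
    ext B
    rw [Matrix.inv_def, Matrix.smul_apply, Ring.inverse_eq_inv', smul_eq_mul,
      Matrix.adjugate_apply]
    congr 2
    ext k l
    rw [Matrix.updateRow_apply, Matrix.of_apply, Matrix.of_apply]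
  rw [h]
  refine (contDiff_det.contDiffAt.inv hA).mul ?_
  refine ContDiffAt.comp (f := fun (B : Fin m → Fin m → ℂ) (k l : Fin m) =>
    if k = j then (Pi.single i 1 : Fin m → ℂ) l else B k l) A (contDiff_det (m := m)).contDiffAt ?_
  refine ContDiff.contDiffAt ?_
  refine contDiff_pi.2 fun k => contDiff_pi.2 fun l => ?_
  split_ifs
  · exact contDiff_const
  · fun_prop

/-- On each trivializing set the dual frame is obtained from the inverse Gram matrix, which is
smooth because the metric is; cutoffs globalize both frames. -/
theorem exists_secFrame [T2Space M] [CompactSpace M] (hmetric : IsSmoothMetric n r E) :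
    Nonempty (SecFrame n r E) := by
  obtain ⟨N, c, ρ, σ, hρ, hσ, hρs, hσs, h1⟩ := exists_cutoff_family (n := n) (M := M)
    (fun x => (trivializationAt (EuclideanSpace ℂ (Fin r)) E x).baseSet)
    (fun x => (trivializationAt (EuclideanSpace ℂ (Fin r)) E x).open_baseSet.mem_nhds
      (FiberBundle.mem_baseSet_trivializationAt' x))
  let e : Fin N → Trivialization (EuclideanSpace ℂ (Fin r)) (π (EuclideanSpace ℂ (Fin r)) E) :=
    fun i => trivializationAt (EuclideanSpace ℂ (Fin r)) E (c i)
  have hmem : ∀ i, MemTrivializationAtlas (e i) := fun i => by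
    dsimp only [e]; infer_instance
  let eq := (finProdFinEquiv (m := N) (n := r)).symm
  let f : Fin N → Fin r → ∀ x, E x := fun i k x => (e i).symm x (EuclideanSpace.single k 1)
  have hf : ∀ i k, SmoothSecOn n r (e i).baseSet (f i k) := by
    intro i k
    have : MemTrivializationAtlas (e i) := hmem i
    refine ((e i).contMDiffOn_section_baseSet_iff).2 ?_
    refine (contMDiffOn_const (c := EuclideanSpace.single k (1 : ℂ))).congr fun y hy => ?_
    simp only [f]
    rw [(e i).apply_mk_symm hy]
  let b : ∀ i x, x ∈ (e i).baseSet → Basis (Fin r) ℂ (E x) := fun i x hx =>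
    (EuclideanSpace.basisFun (Fin r) ℂ).toBasis.map
      (((trivializationAt (EuclideanSpace ℂ (Fin r)) E (c i)).linearEquivAt ℂ x hx).symm)
  have hb : ∀ i x hx k, b i x hx k = f i k x := by
    intro i x hx k
    simp [b, f, e]
  let G : Fin N → M → Fin r → Fin r → ℂ := fun i x k l => inner ℂ (f i k x) (f i l x)
  have hG : ∀ i, ∀ x ∈ (e i).baseSet, (Matrix.of (G i x)).det ≠ 0 := by
    intro i x hx
    have h := Matrix.det_gram_ne_zero_iff_linearIndependent (𝕜 := ℂ) (v := fun k => f i k x)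
    have h2 : Matrix.gram ℂ (fun k => f i k x) = Matrix.of (G i x) := by
      ext k l; rfl
    rw [← h2]
    refine h.2 ?_
    have h3 : (fun k => f i k x) = b i x hx := by
      ext1 k; rw [hb]
    rw [h3]
    exact (b i x hx).linearIndependent
  have hGs : ∀ i k l, ContMDiffOn (𝓡 (2 * n)) 𝓘(ℝ, ℂ) ∞ (fun x => (Matrix.of (G i x))⁻¹ k l)
      (e i).baseSet := by
    intro i k l x hx
    have h2 : ContMDiffWithinAt (𝓡 (2 * n)) 𝓘(ℝ, Fin r → Fin r → ℂ) ∞ (G i) (e i).baseSet x :=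
      contMDiffWithinAt_pi_space.2 fun k => contMDiffWithinAt_pi_space.2 fun l =>
        hmetric.inner_on (e i).open_baseSet (hf i k) (hf i l) x hx
    exact (contDiffAt_matrix_inv (G i x) (hG i x hx) k l).contMDiffAt.comp_contMDiffWithinAt x h2
  -- The conjugate compensates for the conjugate-linearity of the inner product in its first
  -- argument.
  let g : Fin N → Fin r → ∀ x, E x := fun i k x =>
    ∑ l, (starRingEnd ℂ) ((Matrix.of (G i x))⁻¹ k l) • f i l x
  have hg : ∀ i k, SmoothSecOn n r (e i).baseSet (g i k) := by
    intro i k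
    refine SmoothSecOn.sum fun l _ => SmoothSecOn.smul ?_ (hf i l)
    intro x hx
    exact (Complex.conjCLE.contDiff.contMDiff.contMDiffAt.comp_contMDiffWithinAt x (hGs i k l x hx))
  have hgf : ∀ i, ∀ x ∈ (e i).baseSet, ∀ k m, inner ℂ (g i k x) (f i m x) = if k = m then 1 else 0 := by
    intro i x hx k m
    simp only [g, sum_inner, inner_smul_left, Complex.conj_conj]
    have h2 : (Matrix.of (G i x))⁻¹ * Matrix.of (G i x) = 1 :=
      Matrix.nonsing_inv_mul _ (isUnit_iff_ne_zero.2 (hG i x hx))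
    have h3 := congrFun (congrFun h2 k) m
    rw [Matrix.mul_apply, Matrix.one_apply] at h3
    exact h3
  refine ⟨⟨N * r, fun a x => ρ (eq a).1 x • f (eq a).1 (eq a).2 x,
    fun a x => σ (eq a).1 x • g (eq a).1 (eq a).2 x, fun a => ?_, fun a => ?_, fun x u => ?_, hmetric⟩⟩
  · exact (ContMDiffOn.smul_section_of_tsupport (hρ _).contMDiffOn (e _).open_baseSet (hρs _)
      (hf _ _)).contMDiffOn
  · exact (ContMDiffOn.smul_section_of_tsupport (hσ _).contMDiffOn (e _).open_baseSet (hσs _)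
      (hg _ _)).contMDiffOn
  · rw [Equiv.sum_comp eq (fun p => inner ℂ (σ p.1 x • g p.1 p.2 x) u • ρ p.1 x • f p.1 p.2 x),
      Fintype.sum_prod_type]
    have h2 : ∀ i, ∑ k, inner ℂ (σ i x • g i k x) u • ρ i x • f i k x = (ρ i x * σ i x) • u := by
      intro i
      by_cases hx : x ∈ (e i).baseSet
      · have h4 : ∑ k, inner ℂ (g i k x) u • f i k x = u := by
          conv_rhs => rw [← (b i x hx).sum_repr u]
          refine Finset.sum_congr rfl fun k _ => ?_
          rw [hb]
          congr 1
          conv_lhs => rw [← (b i x hx).sum_repr u]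
          simp [inner_sum, inner_smul_right, hb, hgf i x hx]
        conv_rhs => rw [← h4, Finset.smul_sum]
        refine Finset.sum_congr rfl fun k _ => ?_
        rw [← Complex.coe_smul, inner_smul_left, Complex.conj_ofReal, ← Complex.coe_smul,
          ← Complex.coe_smul, smul_smul, smul_smul]
        congr 1
        push_cast
        ring
      · have h3 : ρ i x = 0 := image_eq_zero_of_notMem_tsupport fun h => hx (hρs i h)
        simp [h3]
    simp only [h2]
    rw [← Finset.sum_smul, h1, one_smul]

end Sections
end GenKaehler

namespace GenKaehler

/-! ### Derivatives of functions on the manifold. -/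

section Functions

open Filter Topology

variable {n : ℕ} {M : Type*} [TopologicalSpace M] [ChartedSpace (W n) M]

theorem mvfderiv_clm_comp {F F' : Type*} [NormedAddCommGroup F] [NormedSpace ℝ F]
    [NormedAddCommGroup F'] [NormedSpace ℝ F'] (L : F →L[ℝ] F') {f : M → F} {x : M}
    (hf : MDifferentiableAt (𝓡 (2 * n)) 𝓘(ℝ, F) f x) (v : TangentSpace (𝓡 (2 * n)) x) :
    mvfderiv (𝓡 (2 * n)) (fun y => L (f y)) x v = L (mvfderiv (𝓡 (2 * n)) f x v) := by
  have h := (L.hasMFDerivAt (x := f x)).comp x hf.hasMFDerivAt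
  have h2 : mfderiv (𝓡 (2 * n)) 𝓘(ℝ, F') (fun y => L (f y)) x = _ := h.mfderiv
  simp only [mvfderiv, h2]
  rfl

theorem mvfderiv_mul_complex {f g : M → ℂ} {x : M}
    (hf : MDifferentiableAt (𝓡 (2 * n)) 𝓘(ℝ, ℂ) f x)
    (hg : MDifferentiableAt (𝓡 (2 * n)) 𝓘(ℝ, ℂ) g x) (v : TangentSpace (𝓡 (2 * n)) x) :
    mvfderiv (𝓡 (2 * n)) (fun y => f y * g y) x v
      = f x * mvfderiv (𝓡 (2 * n)) g x v + mvfderiv (𝓡 (2 * n)) f x v * g x := by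
  have h := hf.hasMFDerivAt.mul' hg.hasMFDerivAt
  have h2 : mfderiv (𝓡 (2 * n)) 𝓘(ℝ, ℂ) (fun y => f y * g y) x = _ := h.mfderiv
  simp only [mvfderiv, h2]
  rfl

theorem mvfderiv_sum_apply {F : Type*} [NormedAddCommGroup F] [NormedSpace ℝ F] {ι : Type*}
    (T : Finset ι) {f : ι → M → F} {x : M}
    (hf : ∀ i ∈ T, MDifferentiableAt (𝓡 (2 * n)) 𝓘(ℝ, F) (f i) x)
    (v : TangentSpace (𝓡 (2 * n)) x) :
    mvfderiv (𝓡 (2 * n)) (fun y => ∑ i ∈ T, f i y) x v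
      = ∑ i ∈ T, mvfderiv (𝓡 (2 * n)) (f i) x v := by
  classical
  suffices h : MDifferentiableAt (𝓡 (2 * n)) 𝓘(ℝ, F) (fun y => ∑ i ∈ T, f i y) x ∧
      mvfderiv (𝓡 (2 * n)) (fun y => ∑ i ∈ T, f i y) x v
        = ∑ i ∈ T, mvfderiv (𝓡 (2 * n)) (f i) x v from h.2
  induction T using Finset.induction_on with
  | empty =>
    have h2 : mvfderiv (𝓡 (2 * n)) (fun _ : M => (0 : F)) x = 0 := mvfderiv_const 0
    simp only [Finset.sum_empty]
    exact ⟨mdifferentiableAt_const, by rw [h2, zero_apply]⟩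
  | insert i T hi ih =>
    obtain ⟨h1, h2⟩ := ih fun i hi => hf i (Finset.mem_insert_of_mem hi)
    have h3 := hf i (Finset.mem_insert_self _ _)
    have h4 : mvfderiv (𝓡 (2 * n)) (fun y => f i y + ∑ i ∈ T, f i y) x
        = mvfderiv (𝓡 (2 * n)) (f i) x + mvfderiv (𝓡 (2 * n)) (fun y => ∑ i ∈ T, f i y) x :=
      mvfderiv_add h3 h1
    simp only [Finset.sum_insert hi]
    exact ⟨h3.add h1, by rw [h4, add_apply, h2]⟩

theorem mvfderiv_congr {F : Type*} [NormedAddCommGroup F] [NormedSpace ℝ F] {f g : M → F} {x : M}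
    (h : f =ᶠ[𝓝 x] g) (v : TangentSpace (𝓡 (2 * n)) x) :
    mvfderiv (𝓡 (2 * n)) f x v = mvfderiv (𝓡 (2 * n)) g x v := by
  simp only [mvfderiv]
  have h1 := h.mfderiv_eq (I := 𝓡 (2 * n)) (I' := 𝓘(ℝ, F))
  simp only [ContinuousLinearMap.comp_apply, h1]
  rfl

/-- Smooth complex functions. -/
abbrev SmoothFn (f : M → ℂ) : Prop := ContMDiff (𝓡 (2 * n)) 𝓘(ℝ, ℂ) ∞ f

theorem SmoothFn.mdiffAt {f : M → ℂ} (hf : SmoothFn (n := n) f) (x : M) :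
    MDifferentiableAt (𝓡 (2 * n)) 𝓘(ℝ, ℂ) f x :=
  (hf x).mdifferentiableAt (by simp)

end Functions

/-! ### Connections, tensorial operators and covariant derivatives of endomorphisms. -/

section Calculus

open Filter Topology

variable {n r : ℕ} {M : Type*} [TopologicalSpace M] [ChartedSpace (W n) M]
  [IsManifold (𝓡 (2 * n)) ∞ M]
  {E : M → Type*} [TopologicalSpace (TotalSpace (EuclideanSpace ℂ (Fin r)) E)]
  [∀ x, NormedAddCommGroup (E x)] [∀ x, InnerProductSpace ℂ (E x)]
  [FiberBundle (EuclideanSpace ℂ (Fin r)) E]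
  [VectorBundle ℂ (EuclideanSpace ℂ (Fin r)) E] [VectorBundle ℝ (EuclideanSpace ℂ (Fin r)) E]
  [ContMDiffVectorBundle ∞ (EuclideanSpace ℂ (Fin r)) E (𝓡 (2 * n))]

theorem SmoothSec.mdiffAt {s : ∀ x, E x} (hs : SmoothSec n r s) (x : M) :
    MDifferentiableAt (𝓡 (2 * n)) ((𝓡 (2 * n)).prod 𝓘(ℝ, EuclideanSpace ℂ (Fin r)))
      (fun x => TotalSpace.mk' (EuclideanSpace ℂ (Fin r)) x (s x)) x :=
  SmoothSecOn.mdiffAt hs univ_mem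

theorem SmoothSec.smul {f : M → ℂ} {s : ∀ x, E x} (hf : SmoothFn (n := n) f)
    (hs : SmoothSec n r s) : SmoothSec n r (fun x => f x • s x) :=
  SmoothSecOn.smul hf.contMDiffOn hs

theorem SmoothSec.const_smul (c : ℂ) {s : ∀ x, E x} (hs : SmoothSec n r s) :
    SmoothSec n r (fun x => c • s x) :=
  SmoothSec.smul (f := fun _ => c) contMDiff_const hs

namespace CConnection

variable (C : CConnection n r E)

theorem nabla_congr {s s' : ∀ x, E x} {x : M} (hs : SmoothSec n r s) (h : ∀ᶠ y in 𝓝 x, s' y = s y) :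
    C.nabla s' x = C.nabla s x := by
  refine C.nabla.isCovariantDerivativeOnUniv.congr_of_eventuallyEq ?_ (hs.mdiffAt x) univ_mem h
  exact (hs.mdiffAt x).congr_of_eventuallyEq (h.mono fun y hy => by simp [hy])

theorem nabla_add {s t : ∀ x, E x} (hs : SmoothSec n r s) (ht : SmoothSec n r t) (x : M) :
    C.nabla (fun y => s y + t y) x = C.nabla s x + C.nabla t x :=
  C.nabla.isCovariantDerivativeOnUniv.add (hs.mdiffAt x) (ht.mdiffAt x)

theorem nabla_smul_real {f : M → ℝ} {s : ∀ x, E x}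
    (hf : ContMDiff (𝓡 (2 * n)) 𝓘(ℝ, ℝ) ∞ f) (hs : SmoothSec n r s) (x : M)
    (v : TangentSpace (𝓡 (2 * n)) x) :
    C.nabla (fun y => f y • s y) x v
      = f x • C.nabla s x v + mvfderiv (𝓡 (2 * n)) f x v • s x := by
  have h := C.nabla.isCovariantDerivativeOnUniv.leibniz (hs.mdiffAt x)
    ((hf x).mdifferentiableAt (by simp))
  have h2 := congrArg (fun A : TangentSpace (𝓡 (2 * n)) x →L[ℝ] E x => A v) h
  exact h2

/-- The Leibniz rule of a covariant derivative concerns real functions only; the complex one follows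
by splitting f and using that ∇ commutes with √-1. -/
theorem nabla_smul {f : M → ℂ} {s : ∀ x, E x} (hf : SmoothFn (n := n) f) (hs : SmoothSec n r s)
    (x : M) (v : TangentSpace (𝓡 (2 * n)) x) :
    C.nabla (fun y => f y • s y) x v
      = f x • C.nabla s x v + mvfderiv (𝓡 (2 * n)) f x v • s x := by
  have hre : ContMDiff (𝓡 (2 * n)) 𝓘(ℝ, ℝ) ∞ (fun y => (f y).re) :=
    Complex.reCLM.contDiff.contMDiff.comp hf
  have him : ContMDiff (𝓡 (2 * n)) 𝓘(ℝ, ℝ) ∞ (fun y => (f y).im) :=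
    Complex.imCLM.contDiff.contMDiff.comp hf
  have hI := hs.const_smul Complex.I
  have h1 : (fun y => f y • s y) = fun y => (f y).re • s y + (f y).im • (Complex.I • s y) := by
    ext y
    rw [← Complex.coe_smul, ← Complex.coe_smul, smul_smul, ← add_smul, Complex.re_add_im]
  have hs1 : SmoothSec n r (fun y => (f y).re • s y) := by
    have := SmoothSec.smul (f := fun y => (((f y).re : ℝ) : ℂ))
      (Complex.ofRealCLM.contDiff.contMDiff.comp hre) hs
    simpa only [Complex.coe_smul] using this
  have hs2 : SmoothSec n r (fun y => (f y).im • (Complex.I • s y)) := by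
    have := SmoothSec.smul (f := fun y => (((f y).im : ℝ) : ℂ))
      (Complex.ofRealCLM.contDiff.contMDiff.comp him) hI
    simpa only [Complex.coe_smul] using this
  rw [h1, C.nabla_add hs1 hs2, add_apply, C.nabla_smul_real hre hs, C.nabla_smul_real him hI,
    C.complex s hs]
  have e1 : mvfderiv (𝓡 (2 * n)) (fun y => (f y).re) x v = (mvfderiv (𝓡 (2 * n)) f x v).re :=
    mvfderiv_clm_comp Complex.reCLM (hf.mdiffAt x) v
  have e2 : mvfderiv (𝓡 (2 * n)) (fun y => (f y).im) x v = (mvfderiv (𝓡 (2 * n)) f x v).im :=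
    mvfderiv_clm_comp Complex.imCLM (hf.mdiffAt x) v
  rw [e1, e2]
  conv_rhs => rw [← Complex.re_add_im (f x), ← Complex.re_add_im (mvfderiv (𝓡 (2 * n)) f x v)]
  simp only [add_smul, mul_smul, Complex.coe_smul]
  abel

theorem nabla_zero (x : M) : C.nabla (fun _ => 0) x = 0 := by
  have := C.nabla.isCovariantDerivativeOnUniv.zero (x := x)
  exact this

theorem nabla_const_smul (c : ℂ) {s : ∀ x, E x} (hs : SmoothSec n r s) (x : M)
    (v : TangentSpace (𝓡 (2 * n)) x) :
    C.nabla (fun y => c • s y) x v = c • C.nabla s x v := by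
  have h := C.nabla_smul (f := fun _ => c) contMDiff_const hs x v
  have h2 : mvfderiv (𝓡 (2 * n)) (fun _ : M => c) x = 0 := mvfderiv_const c
  rw [h, h2, zero_apply, zero_smul, add_zero]

theorem nabla_sub {s t : ∀ x, E x} (hs : SmoothSec n r s) (ht : SmoothSec n r t) (x : M)
    (v : TangentSpace (𝓡 (2 * n)) x) :
    C.nabla (fun y => s y - t y) x v = C.nabla s x v - C.nabla t x v := by
  have h1 : (fun y => s y - t y) = fun y => s y + (-1 : ℂ) • t y := by
    ext y; simp [sub_eq_add_neg]
  rw [h1, C.nabla_add hs (ht.const_smul _), add_apply, C.nabla_const_smul _ ht]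
  simp [sub_eq_add_neg]

theorem nabla_sum {ι : Type*} (T : Finset ι) {s : ι → ∀ x, E x} (hs : ∀ i, SmoothSec n r (s i))
    (x : M) (v : TangentSpace (𝓡 (2 * n)) x) :
    C.nabla (fun y => ∑ i ∈ T, s i y) x v = ∑ i ∈ T, C.nabla (s i) x v := by
  classical
  induction T using Finset.induction_on with
  | empty => simp only [Finset.sum_empty]; rw [C.nabla_zero]; rfl
  | insert i T hi ih =>
    simp only [Finset.sum_insert hi]
    rw [C.nabla_add (hs i) (SmoothSecOn.sum fun i _ => hs i), add_apply, ih]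

theorem smooth_nabla {X : ∀ x : M, TangentSpace (𝓡 (2 * n)) x} {s : ∀ x, E x} (hX : SmoothVF X)
    (hs : SmoothSec n r s) : SmoothSec n r (fun y => C.nabla s y (X y)) := by
  have h := C.smooth.contMDiff.contMDiff (σ := s) (by rw [show (∞ : WithTop ℕ∞) + 1 = ∞ from rfl]; exact hs)
  exact ContMDiffOn.clm_bundle_apply h hX.contMDiffOn

end CConnection

/-- An operator from smooth sections to the fibre at `x` that is linear over smooth functions. -/
structure IsTensorial {x : M} (L : (∀ y, E y) → E x) : Prop where
  add : ∀ s t : ∀ y, E y, SmoothSec n r s → SmoothSec n r t →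
    L (fun y => s y + t y) = L s + L t
  smul : ∀ (f : M → ℂ) (s : ∀ y, E y), SmoothFn (n := n) f → SmoothSec n r s →
    L (fun y => f y • s y) = f x • L s

namespace SecFrame

variable (F : SecFrame n r E)

/-- The endomorphism of a fibre given by a tensorial operator. -/
noncomputable def hat {x : M} (L : (∀ y, E y) → E x) : Module.End ℂ (E x) :=
  ∑ k, LinearMap.smulRight (innerₛₗ ℂ (F.t k x)) (L (F.s k))

theorem hat_apply {x : M} (L : (∀ y, E y) → E x) (e : E x) :
    F.hat L e = ∑ k, inner ℂ (F.t k x) e • L (F.s k) := by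
  simp [hat]

theorem smooth_inner (F : SecFrame n r E) {s t : ∀ x, E x} (hs : SmoothSec n r s) (ht : SmoothSec n r t) :
    SmoothFn (n := n) (fun y => inner ℂ (s y) (t y)) :=
  F.metric s t hs ht

/-- Expanding s in the frame shows that a function-linear operator sees only the value s x.
Curvature, covariant derivatives of endomorphisms and differences of connections all become
endomorphisms in this way. -/
theorem hat_eq {x : M} {L : (∀ y, E y) → E x} (hL : IsTensorial (n := n) (r := r) L)
    {s : ∀ y, E y} (hs : SmoothSec n r s) : F.hat L (s x) = L s := by
  have hsum : ∀ (T : Finset (Fin F.card)) (u : Fin F.card → ∀ y, E y),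
      (∀ k, SmoothSec n r (u k)) → L (fun y => ∑ k ∈ T, u k y) = ∑ k ∈ T, L (u k) := by
    classical
    intro T u hu
    induction T using Finset.induction_on with
    | empty =>
      simp only [Finset.sum_empty]
      have := hL.smul (fun _ => 0) s contMDiff_const hs
      simpa using this
    | insert k T hk ih =>
      simp only [Finset.sum_insert hk]
      rw [hL.add _ _ (hu k) (SmoothSecOn.sum fun i _ => hu i), ih]
  have h1 : s = fun y => ∑ k, inner ℂ (F.t k y) (s y) • F.s k y := by
    ext y; rw [F.expand]
  conv_rhs => rw [h1]
  rw [hsum _ _ fun k => SmoothSec.smul (F.smooth_inner (F.smooth_t k) hs) (F.smooth_s k),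
    F.hat_apply]
  refine Finset.sum_congr rfl fun k _ => ?_
  rw [hL.smul _ _ (F.smooth_inner (F.smooth_t k) hs) (F.smooth_s k)]

theorem exists_sec (F : SecFrame n r E) {x : M} (e : E x) : ∃ s : ∀ y, E y, SmoothSec n r s ∧ s x = e :=
  ⟨fun y => ∑ k, inner ℂ (F.t k x) e • F.s k y,
    SmoothSecOn.sum fun k _ => SmoothSec.const_smul _ (F.smooth_s k), F.expand x e⟩

theorem end_ext (F : SecFrame n r E) {x : M} {A B : Module.End ℂ (E x)}
    (h : ∀ s : ∀ y, E y, SmoothSec n r s → A (s x) = B (s x)) : A = B := by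
  ext e
  obtain ⟨s, hs, rfl⟩ := F.exists_sec e
  exact h s hs

theorem trace_eq (F : SecFrame n r E) {x : M} (A : Module.End ℂ (E x)) :
    LinearMap.trace ℂ (E x) A = ∑ k, inner ℂ (F.t k x) (A (F.s k x)) := by
  have := finiteDimensional_fibre r (E := E) x
  have h : A = ∑ k, LinearMap.smulRight (innerₛₗ ℂ (F.t k x)) (A (F.s k x)) := by
    ext e
    conv_lhs => rw [← F.expand x e, map_sum]
    simp
  conv_lhs => rw [h]
  rw [map_sum]
  refine Finset.sum_congr rfl fun k _ => ?_
  rw [LinearMap.trace_smulRight]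
  rfl

theorem smooth_trace (F : SecFrame n r E) {Φ : ∀ x, Module.End ℂ (E x)} (hΦ : SmoothEndOn n r Set.univ Φ) :
    SmoothFn (n := n) (fun y => LinearMap.trace ℂ (E y) (Φ y)) := by
  simp only [F.trace_eq]
  exact contMDiff_finsetSum fun k _ => F.smooth_inner (F.smooth_t k) (hΦ _ (F.smooth_s k))

theorem _root_.GenKaehler.isTensorial_cov (C : CConnection n r E) {Φ : ∀ x, Module.End ℂ (E x)}
    (hΦ : SmoothEndOn n r Set.univ Φ) (x : M) (v : TangentSpace (𝓡 (2 * n)) x) :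
    IsTensorial (n := n) (r := r) (x := x)
      (fun s => C.nabla (fun y => Φ y (s y)) x v - Φ x (C.nabla s x v)) where
  add s t hs ht := by
    simp only [map_add]
    rw [C.nabla_add (hΦ s hs) (hΦ t ht), C.nabla_add hs ht, add_apply, add_apply, map_add]
    abel
  smul f s hf hs := by
    simp only [map_smul]
    rw [C.nabla_smul hf (hΦ s hs), C.nabla_smul hf hs, map_add, map_smul, map_smul]
    module

/-- The covariant derivative of a field of endomorphisms. -/
noncomputable def covEnd (C : CConnection n r E) (Φ : ∀ x, Module.End ℂ (E x)) (x : M)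
    (v : TangentSpace (𝓡 (2 * n)) x) : Module.End ℂ (E x) :=
  F.hat (fun s => C.nabla (fun y => Φ y (s y)) x v - Φ x (C.nabla s x v))

variable (C : CConnection n r E) {Φ Ψ : ∀ x, Module.End ℂ (E x)}

theorem covEnd_apply (hΦ : SmoothEndOn n r Set.univ Φ) {s : ∀ y, E y} (hs : SmoothSec n r s) (x : M)
    (v : TangentSpace (𝓡 (2 * n)) x) :
    F.covEnd C Φ x v (s x) = C.nabla (fun y => Φ y (s y)) x v - Φ x (C.nabla s x v) :=
  F.hat_eq (isTensorial_cov C hΦ x v) hs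

theorem nabla_end (hΦ : SmoothEndOn n r Set.univ Φ) {s : ∀ y, E y} (hs : SmoothSec n r s) (x : M)
    (v : TangentSpace (𝓡 (2 * n)) x) :
    C.nabla (fun y => Φ y (s y)) x v = F.covEnd C Φ x v (s x) + Φ x (C.nabla s x v) := by
  rw [F.covEnd_apply C hΦ hs, sub_add_cancel]

theorem covEnd_add_right (x : M) (v w : TangentSpace (𝓡 (2 * n)) x) :
    F.covEnd C Φ x (v + w) = F.covEnd C Φ x v + F.covEnd C Φ x w := by
  ext e
  simp only [covEnd, LinearMap.add_apply, hat_apply, map_add, ← Finset.sum_add_distrib, ← smul_add]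
  refine Finset.sum_congr rfl fun k _ => ?_
  congr 1
  abel

theorem covEnd_smul_right (x : M) (c : ℝ) (v : TangentSpace (𝓡 (2 * n)) x) :
    F.covEnd C Φ x (c • v) = c • F.covEnd C Φ x v := by
  ext e
  simp only [covEnd, LinearMap.smul_apply, hat_apply, map_smul, Finset.smul_sum]
  refine Finset.sum_congr rfl fun k _ => ?_
  rw [← Complex.coe_smul, ← Complex.coe_smul, map_smul, ← smul_sub, smul_comm, Complex.coe_smul]

/-- The covariant derivative of a field of endomorphisms as a real linear map. -/
noncomputable def covEndₗ (Φ : ∀ x, Module.End ℂ (E x)) (x : M) :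
    TangentSpace (𝓡 (2 * n)) x →ₗ[ℝ] Module.End ℂ (E x) where
  toFun v := F.covEnd C Φ x v
  map_add' := F.covEnd_add_right C x
  map_smul' c v := F.covEnd_smul_right C x c v

theorem covEndₗ_apply (x : M) (v : TangentSpace (𝓡 (2 * n)) x) :
    F.covEndₗ C Φ x v = F.covEnd C Φ x v := rfl

theorem smooth_covEnd (hΦ : SmoothEndOn n r Set.univ Φ) {X : ∀ x : M, TangentSpace (𝓡 (2 * n)) x}
    (hX : SmoothVF X) : SmoothEndOn n r Set.univ (fun x => F.covEnd C Φ x (X x)) := by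
  intro s hs
  refine SmoothSecOn.congr (SmoothSecOn.sub (C.smooth_nabla hX (hΦ s hs))
    (hΦ _ (C.smooth_nabla hX hs))) fun x _ => ?_
  exact F.covEnd_apply C hΦ hs x _

theorem covEnd_mul [T2Space M] (hΦ : SmoothEndOn n r Set.univ Φ) (hΨ : SmoothEndOn n r Set.univ Ψ)
    (x : M) (v : TangentSpace (𝓡 (2 * n)) x) :
    F.covEnd C (fun y => Φ y * Ψ y) x v = F.covEnd C Φ x v * Ψ x + Φ x * F.covEnd C Ψ x v := by
  refine F.end_ext fun s hs => ?_
  rw [F.covEnd_apply C (hΦ.mul hΨ isOpen_univ) hs]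
  simp only [Module.End.mul_apply, LinearMap.add_apply]
  rw [F.nabla_end C hΦ (hΨ s hs), F.nabla_end C hΨ hs, map_add]
  abel

theorem covEnd_sub (hΦ : SmoothEndOn n r Set.univ Φ) (hΨ : SmoothEndOn n r Set.univ Ψ)
    (x : M) (v : TangentSpace (𝓡 (2 * n)) x) :
    F.covEnd C (fun y => Φ y - Ψ y) x v = F.covEnd C Φ x v - F.covEnd C Ψ x v := by
  refine F.end_ext fun s hs => ?_
  rw [F.covEnd_apply C (hΦ.sub hΨ) hs]
  simp only [LinearMap.sub_apply]
  rw [F.covEnd_apply C hΦ hs, F.covEnd_apply C hΨ hs, C.nabla_sub (hΦ s hs) (hΨ s hs)]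
  abel

theorem covEnd_one (x : M) (v : TangentSpace (𝓡 (2 * n)) x) :
    F.covEnd C (fun _ => 1) x v = 0 := by
  refine F.end_ext fun s hs => ?_
  rw [F.covEnd_apply C (smoothEndOn_one _) hs]
  simp

/-- Projections that are smooth only on an open set are handled through a global field with the same
germ. -/
theorem covEnd_congr (hΦ : SmoothEndOn n r Set.univ Φ) {x : M} (h : ∀ᶠ y in 𝓝 x, Ψ y = Φ y)
    (v : TangentSpace (𝓡 (2 * n)) x) : F.covEnd C Ψ x v = F.covEnd C Φ x v := by
  rw [covEnd, covEnd]
  ext e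
  simp only [hat_apply]
  refine Finset.sum_congr rfl fun k _ => ?_
  rw [h.self_of_nhds, C.nabla_congr (hΦ _ (F.smooth_s k)) (h.mono fun y hy => by rw [hy])]

end SecFrame

section Hermitian

variable {D : GenConnection n r E} {Φ Ψ : ∀ x, Module.End ℂ (E x)}

theorem SecFrame.covEnd_adjoint (F : SecFrame n r E) (hD : D.IsHermitian)
    (hΦ : SmoothEndOn n r Set.univ Φ)
    (hΨ : SmoothEndOn n r Set.univ Ψ) {x : M}
    (h : ∀ᶠ y in 𝓝 x, ∀ u w, inner ℂ (Φ y u) w = inner ℂ u (Ψ y w))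
    (v : TangentSpace (𝓡 (2 * n)) x) (u w : E x) :
    inner ℂ (F.covEnd D.toCConnection Φ x v u) w = inner ℂ u (F.covEnd D.toCConnection Ψ x v w) := by
  obtain ⟨s, hs, rfl⟩ := F.exists_sec u
  obtain ⟨t, ht, rfl⟩ := F.exists_sec w
  have h1 := hD.form _ _ (hΦ s hs) ht x v
  have h2 := hD.form _ _ hs (hΨ t ht) x v
  have h3 := mvfderiv_congr (n := n) (f := fun y => inner ℂ (Φ y (s y)) (t y))
    (g := fun y => inner ℂ (s y) (Ψ y (t y))) (h.mono fun y hy => hy _ _) v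
  rw [h1, h2, F.nabla_end _ hΦ hs, F.nabla_end _ hΨ ht, inner_add_left, inner_add_right,
    h.self_of_nhds, h.self_of_nhds] at h3
  linear_combination h3

theorem SecFrame.mvfderiv_trace (F : SecFrame n r E) (hD : D.IsHermitian)
    (hΦ : SmoothEndOn n r Set.univ Φ) (x : M)
    (v : TangentSpace (𝓡 (2 * n)) x) :
    mvfderiv (𝓡 (2 * n)) (fun y => LinearMap.trace ℂ (E y) (Φ y)) x v
      = LinearMap.trace ℂ (E x) (F.covEnd D.toCConnection Φ x v) := by
  have := finiteDimensional_fibre r (E := E) x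
  -- Differentiating the resolution of the identity: the frame sections are not parallel, but their
  -- derivatives cancel in total.
  have h0 : ∑ k, (LinearMap.smulRight (innerₛₗ ℂ (D.nabla (F.t k) x v)) (F.s k x)
      + LinearMap.smulRight (innerₛₗ ℂ (F.t k x)) (D.nabla (F.s k) x v)) = 0 := by
    refine F.end_ext fun s hs => ?_
    have h1 : s = fun y => ∑ k, inner ℂ (F.t k y) (s y) • F.s k y := by
      ext y; rw [F.expand]
    have h2 : D.nabla s x v = D.nabla (fun y => ∑ k, inner ℂ (F.t k y) (s y) • F.s k y) x v := by
      rw [← h1]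
    rw [D.nabla_sum _ fun k => SmoothSec.smul (F.smooth_inner (F.smooth_t k) hs) (F.smooth_s k)]
      at h2
    have h3 : ∀ k, D.nabla (fun y => inner ℂ (F.t k y) (s y) • F.s k y) x v
        = inner ℂ (F.t k x) (s x) • D.nabla (F.s k) x v
          + inner ℂ (D.nabla (F.t k) x v) (s x) • F.s k x
          + inner ℂ (F.t k x) (D.nabla s x v) • F.s k x := by
      intro k
      rw [D.nabla_smul (F.smooth_inner (F.smooth_t k) hs) (F.smooth_s k),
        hD.form _ _ (F.smooth_t k) hs, add_smul, add_assoc]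
    simp only [h3, Finset.sum_add_distrib, F.expand] at h2
    simp only [LinearMap.sum_apply, LinearMap.add_apply, LinearMap.smulRight_apply,
      innerₛₗ_apply_apply, LinearMap.zero_apply, Finset.sum_add_distrib]
    rw [add_comm]
    exact left_eq_add.1 (h2.trans (add_comm _ _))
  have h1 := congrArg (fun A => LinearMap.trace ℂ (E x) (Φ x * A)) h0
  simp only [Finset.mul_sum, map_sum, mul_add, map_add, mul_zero, map_zero] at h1
  have h2 : ∀ u w : E x, LinearMap.trace ℂ (E x) (Φ x * LinearMap.smulRight (innerₛₗ ℂ u) w)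
      = inner ℂ u (Φ x w) := by
    intro u w
    have : Φ x * LinearMap.smulRight (innerₛₗ ℂ u) w
        = LinearMap.smulRight (innerₛₗ ℂ u) (Φ x w) := by
      ext e; simp
    rw [this, LinearMap.trace_smulRight]
    rfl
  simp only [h2] at h1
  simp only [F.trace_eq]
  rw [mvfderiv_sum_apply _ fun k _ =>
    (F.smooth_inner (F.smooth_t k) (hΦ _ (F.smooth_s k))).mdiffAt x]
  have h3 : ∀ k, mvfderiv (𝓡 (2 * n)) (fun y => inner ℂ (F.t k y) (Φ y (F.s k y))) x v
      = inner ℂ (D.nabla (F.t k) x v) (Φ x (F.s k x))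
        + inner ℂ (F.t k x) (Φ x (D.nabla (F.s k) x v))
        + inner ℂ (F.t k x) (F.covEnd D.toCConnection Φ x v (F.s k x)) := by
    intro k
    rw [hD.form _ _ (F.smooth_t k) (hΦ _ (F.smooth_s k)), F.nabla_end _ hΦ (F.smooth_s k),
      inner_add_right]
    ring
  simp only [h3, Finset.sum_add_distrib] at h1 ⊢
  rw [h1, zero_add]

end Hermitian

end Calculus
end GenKaehler

namespace GenKaehler

/-! ### Coordinate vector fields and derivatives in charts. -/

section Charts

open Filter Topology

variable {n : ℕ} {M : Type*} [TopologicalSpace M] [ChartedSpace (W n) M]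
  [IsManifold (𝓡 (2 * n)) ∞ M]

/-- The chart at `c`, as a partial equivalence with the model space. -/
noncomputable abbrev chartE (c : M) : PartialEquiv M (W n) := extChartAt (𝓡 (2 * n)) c

theorem isOpen_chartE_target (c : M) : IsOpen (chartE (n := n) c).target := isOpen_extChartAt_target c

theorem isOpen_chartE_source (c : M) : IsOpen (chartE (n := n) c).source := isOpen_extChartAt_source c

theorem range_model : Set.range (𝓡 (2 * n)) = Set.univ := (𝓡 (2 * n)).range_eq_univ

/-- The vector field near `c` that is constant in the chart at `c`. -/
noncomputable def coordField (c : M) (v : W n) (y : M) : TangentSpace (𝓡 (2 * n)) y :=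
  (trivializationAt (W n) (TangentSpace (𝓡 (2 * n))) c).symm y v

/-- The coordinates of a tangent vector in the chart at `c`. -/
noncomputable def coordOf (c : M) {y : M} (v : TangentSpace (𝓡 (2 * n)) y) : W n :=
  (trivializationAt (W n) (TangentSpace (𝓡 (2 * n))) c ⟨y, v⟩).2

theorem mem_source_iff {c y : M} : y ∈ (chartE (n := n) c).source
    ↔ y ∈ (trivializationAt (W n) (TangentSpace (𝓡 (2 * n))) c).baseSet := by
  rw [TangentBundle.trivializationAt_baseSet, extChartAt_source]

theorem coordField_coordOf {c y : M} (hy : y ∈ (chartE (n := n) c).source)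
    (v : TangentSpace (𝓡 (2 * n)) y) : coordField c (coordOf c v) y = v := by
  rw [coordField, coordOf]
  exact Trivialization.symm_apply_apply_mk _ (mem_source_iff.1 hy) v

theorem coordOf_coordField {c y : M} (hy : y ∈ (chartE (n := n) c).source) (v : W n) :
    coordOf c (coordField c v y) = v := by
  rw [coordField, coordOf, Trivialization.apply_mk_symm _ (mem_source_iff.1 hy)]

theorem coordField_eq {c y : M} (hy : y ∈ (chartE (n := n) c).source) (v : W n) :
    coordField c v y = mfderiv 𝓘(ℝ, W n) (𝓡 (2 * n)) (chartE (n := n) c).symm (chartE c y) v := by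
  have h1 := (trivializationAt (W n) (TangentSpace (𝓡 (2 * n))) c).symmL_apply (R := ℝ)
    (mem_source_iff.1 hy) v
  rw [coordField, ← h1, TangentBundle.symmL_trivializationAt (by simpa using hy), range_model,
    mfderivWithin_univ]
  rfl

theorem chartTangent_eq {c : M} {p : W n} (hp : p ∈ (chartE (n := n) c).target) (v : W n) :
    chartTangent c p v = coordField c v ((chartE (n := n) c).symm p) := by
  rw [coordField_eq ((chartE c).map_target hp), (chartE c).right_inv hp]
  rfl

theorem contMDiffOn_coordField (c : M) (v : W n) :
    ContMDiffOn (𝓡 (2 * n)) (𝓡 (2 * n)).tangent ∞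
      (fun x => (⟨x, coordField c v x⟩ : TangentBundle (𝓡 (2 * n)) M)) (chartE (n := n) c).source := by
  have h : (chartE (n := n) c).source
      = (trivializationAt (W n) (TangentSpace (𝓡 (2 * n))) c).baseSet := by
    ext y; exact mem_source_iff
  rw [h]
  refine (((trivializationAt (W n) (TangentSpace (𝓡 (2 * n))) c).contMDiffOn_section_baseSet_iff)).2 ?_
  refine (contMDiffOn_const (c := v)).congr fun y hy => ?_
  exact congrArg Prod.snd (Trivialization.apply_mk_symm _ hy v)

theorem exists_smoothVF_coordField [T2Space M] {c y : M} (hy : y ∈ (chartE (n := n) c).source)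
    (v : W n) : ∃ X : ∀ x : M, TangentSpace (𝓡 (2 * n)) x, SmoothVF X ∧
      ∀ᶠ z in 𝓝 y, X z = coordField c v z := by
  obtain ⟨χ, hχ, hsupp, h1⟩ := exists_cutoff (n := n) ((isOpen_chartE_source c).mem_nhds hy)
  refine ⟨fun z => χ z • coordField c v z, ?_, h1.mono fun z hz => by simp [hz]⟩
  exact ContMDiffOn.smul_section_of_tsupport hχ.contMDiffOn (isOpen_chartE_source c) hsupp
    (contMDiffOn_coordField c v)

theorem contMDiffOn_coordOf {X : ∀ x : M, TangentSpace (𝓡 (2 * n)) x} (hX : SmoothVF X) (c : M) :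
    ContMDiffOn (𝓡 (2 * n)) 𝓘(ℝ, W n) ∞ (fun y => coordOf c (X y)) (chartE (n := n) c).source := by
  intro y hy
  exact (((trivializationAt (W n) (TangentSpace (𝓡 (2 * n))) c).contMDiffAt_section_iff
    (mem_source_iff.1 hy)).1 (hX y)).contMDiffWithinAt

variable {F : Type*} [NormedAddCommGroup F] [NormedSpace ℝ F]

theorem contDiffOn_chart {f : M → F} {U : Set M} (hf : ContMDiffOn (𝓡 (2 * n)) 𝓘(ℝ, F) ∞ f U) (c : M) :
    ContDiffOn ℝ ∞ (f ∘ (chartE (n := n) c).symm)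
      ((chartE (n := n) c).target ∩ (chartE c).symm ⁻¹' U) := by
  have h := hf.comp ((contMDiffOn_extChartAt_symm (I := 𝓡 (2 * n)) (n := ∞) c).mono
    (Set.inter_subset_left (t := (chartE (n := n) c).symm ⁻¹' U))) fun p hp => hp.2
  exact h.contDiffOn

theorem contDiffOn_chart_target {f : M → F} (hf : ContMDiff (𝓡 (2 * n)) 𝓘(ℝ, F) ∞ f) (c : M) :
    ContDiffOn ℝ ∞ (f ∘ (chartE (n := n) c).symm) (chartE (n := n) c).target :=
  (contDiffOn_chart (U := Set.univ) hf.contMDiffOn c).mono fun p hp => ⟨hp, Set.mem_univ _⟩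

theorem mvfderiv_coordField {f : M → F} {c y : M} (hy : y ∈ (chartE (n := n) c).source)
    (hf : MDifferentiableAt (𝓡 (2 * n)) 𝓘(ℝ, F) f y) (v : W n) :
    mvfderiv (𝓡 (2 * n)) f y (coordField c v y)
      = fderiv ℝ (f ∘ (chartE (n := n) c).symm) (chartE c y) v := by
  obtain ⟨p, hp, rfl⟩ : ∃ p ∈ (chartE (n := n) c).target, (chartE c).symm p = y :=
    ⟨chartE c y, (chartE c).map_source hy, (chartE c).left_inv hy⟩
  have hs : MDifferentiableAt 𝓘(ℝ, W n) (𝓡 (2 * n)) (chartE (n := n) c).symm p := by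
    have := mdifferentiableWithinAt_extChartAt_symm (I := 𝓡 (2 * n)) (x := c) hp
    rwa [range_model, mdifferentiableWithinAt_univ] at this
  rw [← chartTangent_eq hp, (chartE c).right_inv hp, ← mfderiv_eq_fderiv,
    mfderiv_comp p hf hs]
  rfl

theorem mvfderiv_eq_coordOf {f : M → F} {c y : M} (hy : y ∈ (chartE (n := n) c).source)
    (hf : MDifferentiableAt (𝓡 (2 * n)) 𝓘(ℝ, F) f y) (v : TangentSpace (𝓡 (2 * n)) y) :
    mvfderiv (𝓡 (2 * n)) f y v
      = fderiv ℝ (f ∘ (chartE (n := n) c).symm) (chartE c y) (coordOf c v) := by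
  rw [← mvfderiv_coordField hy hf, coordField_coordOf hy]

theorem contMDiff_mvfderiv {f : M → F} (hf : ContMDiff (𝓡 (2 * n)) 𝓘(ℝ, F) ∞ f)
    {X : ∀ x : M, TangentSpace (𝓡 (2 * n)) x} (hX : SmoothVF X) :
    ContMDiff (𝓡 (2 * n)) 𝓘(ℝ, F) ∞ (fun y => mvfderiv (𝓡 (2 * n)) f y (X y)) := by
  intro c
  have hc : c ∈ (chartE (n := n) c).source := mem_extChartAt_source c
  have hn := (isOpen_chartE_source (n := n) c).mem_nhds hc
  have h1 : ContMDiffAt (𝓡 (2 * n)) 𝓘(ℝ, W n) ∞ (chartE (n := n) c) c := contMDiffAt_extChartAt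
  have h2 : ContDiffAt ℝ ∞ (fderiv ℝ (f ∘ (chartE (n := n) c).symm)) (chartE c c) := by
    have := (contDiffOn_chart_target hf c).fderiv_of_isOpen (m := ∞) (isOpen_chartE_target c)
      (by simp)
    exact this.contDiffAt ((isOpen_chartE_target c).mem_nhds ((chartE c).map_source hc))
  have h3 : ContMDiffAt (𝓡 (2 * n)) 𝓘(ℝ, W n →L[ℝ] F) ∞
      (fun y => fderiv ℝ (f ∘ (chartE (n := n) c).symm) (chartE c y)) c :=
    h2.contMDiffAt.comp c h1
  have h4 := (contMDiffOn_coordOf hX c).contMDiffAt hn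
  refine (h3.clm_apply h4).congr_of_eventuallyEq ?_
  filter_upwards [hn] with y hy
  exact mvfderiv_eq_coordOf hy ((hf y).mdifferentiableAt (by simp)) _

/-- In the chart this is the symmetry of the second derivative. -/
theorem mvfderiv_coordField_comm {f : M → F} (hf : ContMDiff (𝓡 (2 * n)) 𝓘(ℝ, F) ∞ f) {c y : M}
    (hy : y ∈ (chartE (n := n) c).source) {X Y : ∀ x : M, TangentSpace (𝓡 (2 * n)) x}
    (hX : SmoothVF X) (hY : SmoothVF Y) {v w : W n} (hXv : ∀ᶠ z in 𝓝 y, X z = coordField c v z)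
    (hYw : ∀ᶠ z in 𝓝 y, Y z = coordField c w z) :
    mvfderiv (𝓡 (2 * n)) (fun z => mvfderiv (𝓡 (2 * n)) f z (Y z)) y (X y)
      = mvfderiv (𝓡 (2 * n)) (fun z => mvfderiv (𝓡 (2 * n)) f z (X z)) y (Y y) := by
  set g := f ∘ (chartE (n := n) c).symm with hg
  have hp : chartE c y ∈ (chartE (n := n) c).target := (chartE c).map_source hy
  have hgc : ContDiffAt ℝ ∞ g (chartE c y) :=
    (contDiffOn_chart_target hf c).contDiffAt ((isOpen_chartE_target c).mem_nhds hp)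
  have hfm : ∀ z, MDifferentiableAt (𝓡 (2 * n)) 𝓘(ℝ, F) f z :=
    fun z => (hf z).mdifferentiableAt (by simp)
  have key : ∀ (X Y : ∀ x : M, TangentSpace (𝓡 (2 * n)) x) (v w : W n), SmoothVF Y →
      (∀ᶠ z in 𝓝 y, X z = coordField c v z) → (∀ᶠ z in 𝓝 y, Y z = coordField c w z) →
      mvfderiv (𝓡 (2 * n)) (fun z => mvfderiv (𝓡 (2 * n)) f z (Y z)) y (X y)
      = fderiv ℝ (fderiv ℝ g) (chartE c y) v w := by
    intro X Y v w hY hXv hYw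
    rw [hXv.self_of_nhds, mvfderiv_coordField hy
      ((contMDiff_mvfderiv hf hY y).mdifferentiableAt (by simp))]
    have h1 : ((fun z => mvfderiv (𝓡 (2 * n)) f z (Y z)) ∘ (chartE (n := n) c).symm)
        =ᶠ[𝓝 (chartE c y)] fun p => fderiv ℝ g p w := by
      have hcont : Tendsto (chartE (n := n) c).symm (𝓝 (chartE c y)) (𝓝 y) := by
        have := (continuousAt_extChartAt_symm'' (I := 𝓡 (2 * n)) (x := c) hp).tendsto
        rwa [(chartE c).left_inv hy] at this
      filter_upwards [hcont.eventually hYw, (isOpen_chartE_target c).mem_nhds hp] with p hp1 hp2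
      rw [Function.comp_apply, hp1, mvfderiv_coordField ((chartE c).map_target hp2) (hfm _),
        (chartE c).right_inv hp2]
    rw [h1.fderiv_eq]
    have h2 : DifferentiableAt ℝ (fderiv ℝ g) (chartE c y) :=
      (hgc.fderiv_right (m := 1) (by norm_cast)).differentiableAt (by simp)
    rw [fderiv_clm_apply h2 (differentiableAt_const w)]
    simp
  rw [key X Y v w hY hXv hYw, key Y X w v hX hYw hXv]
  have hsymm : IsSymmSndFDerivAt ℝ g (chartE c y) :=
    hgc.isSymmSndFDerivAt (by simp; norm_cast)
  exact hsymm v w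

/-- Near y both fields are pullbacks of constant fields under the chart, and the Lie bracket is
natural. -/
theorem mlieBracket_coordField {c y : M} (hy : y ∈ (chartE (n := n) c).source)
    {X Y : ∀ x : M, TangentSpace (𝓡 (2 * n)) x} {v w : W n}
    (hXv : ∀ᶠ z in 𝓝 y, X z = coordField c v z) (hYw : ∀ᶠ z in 𝓝 y, Y z = coordField c w z) :
    VectorField.mlieBracket (𝓡 (2 * n)) X Y y = 0 := by
  have hpull : ∀ (X : ∀ x : M, TangentSpace (𝓡 (2 * n)) x) (v : W n),
      (∀ᶠ z in 𝓝 y, X z = coordField c v z) →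
      X =ᶠ[𝓝 y] VectorField.mpullback (𝓡 (2 * n)) 𝓘(ℝ, W n) (chartE (n := n) c)
        (fun p => (v : TangentSpace 𝓘(ℝ, W n) p)) := by
    intro X v h
    filter_upwards [h, (isOpen_chartE_source c).mem_nhds hy] with z hz hzs
    rw [hz, coordField_eq hzs]
    change _ = (mfderiv (𝓡 (2 * n)) 𝓘(ℝ, W n) (chartE (n := n) c) z).inverse v
    have h1 := mfderivWithin_extChartAt_symm_comp_mfderiv_extChartAt' (I := 𝓡 (2 * n)) (x := c) hzs
    have h2 := mfderiv_extChartAt_comp_mfderivWithin_extChartAt_symm' (I := 𝓡 (2 * n)) (x := c) hzs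
    rw [range_model, mfderivWithin_univ] at h1 h2
    exact (congrArg (fun L => L v) (ContinuousLinearMap.inverse_eq h2 h1)).symm
  rw [(hpull X v hXv).mlieBracket_vectorField_eq (hpull Y w hYw)]
  have hc : ∀ (v : W n) (p : W n), MDifferentiableAt 𝓘(ℝ, W n) 𝓘(ℝ, W n).tangent
      (fun p => (⟨p, v⟩ : TangentBundle 𝓘(ℝ, W n) (W n))) p := by
    intro v p
    have : ContMDiffAt 𝓘(ℝ, W n) 𝓘(ℝ, W n).tangent 1
        (fun p => (⟨p, v⟩ : TangentBundle 𝓘(ℝ, W n) (W n))) p := by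
      exact (contMDiffAt_section (E := TangentSpace 𝓘(ℝ, W n)) (s := fun _ => v) p).2
        (by simpa using contMDiffAt_const)
    exact this.mdifferentiableAt (by simp)
  have : IsManifold (𝓡 (2 * n)) (minSmoothness ℝ 3) M := .of_le (n := ∞) (by simp; norm_cast)
  rw [← VectorField.mpullback_mlieBracket (n := ∞) (hc v _) (hc w _)
    (contMDiffAt_extChartAt' (by simpa using hy)) (by simp; norm_cast),
    VectorField.mpullback_apply]
  have h0 : VectorField.mlieBracket 𝓘(ℝ, W n) (fun p => (v : TangentSpace 𝓘(ℝ, W n) p))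
      (fun p => (w : TangentSpace 𝓘(ℝ, W n) p)) (chartE (n := n) c y) = 0 := by
    have h1 : VectorField.lieBracketWithin ℝ (fun _ : W n => v) (fun _ => w) Set.univ
        (chartE (n := n) c y) = 0 := by simp [VectorField.lieBracketWithin]
    have h2 := congrFun (VectorField.mlieBracketWithin_eq_lieBracketWithin (𝕜 := ℝ) (E := W n)
      (V := fun _ : W n => v) (W := fun _ => w) (s := Set.univ)) (chartE (n := n) c y)
    have h3 := congrFun (VectorField.mlieBracketWithin_univ (I := 𝓘(ℝ, W n))
      (V := fun _ : W n => v) (W := fun _ => w)) (chartE (n := n) c y)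
    exact h3.symm.trans (h2.trans h1)
  exact (congrArg _ h0).trans (map_zero _)

theorem extVF_self {x : M} (v : TangentSpace (𝓡 (2 * n)) x) : extVF v x = v :=
  FiberBundle.extend_apply_self (F := W n) v

/-- The extension `extVF` is the coordinate field of the chart centred at x. The bracket terms in
the curvature and in d^A θ therefore vanish. -/
theorem mlieBracket_extVF {x : M} (v w : TangentSpace (𝓡 (2 * n)) x) :
    VectorField.mlieBracket (𝓡 (2 * n)) (extVF v) (extVF w) x = 0 :=
  mlieBracket_coordField (mem_extChartAt_source x) (Eventually.of_forall fun _ => rfl)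
    (Eventually.of_forall fun _ => rfl)

theorem exists_smoothVF_extVF [T2Space M] {x : M} (v : TangentSpace (𝓡 (2 * n)) x) :
    ∃ X : ∀ x : M, TangentSpace (𝓡 (2 * n)) x, SmoothVF X ∧ X x = v ∧
      ∀ᶠ z in 𝓝 x, X z = extVF v z := by
  obtain ⟨X, hX, h⟩ := exists_smoothVF_coordField (mem_extChartAt_source x) (coordOf x v)
  exact ⟨X, hX, by rw [h.self_of_nhds, coordField_coordOf (mem_extChartAt_source x)], h⟩

end Charts
end GenKaehler

namespace GenKaehler

/-! ### Identities for an idempotent and its derivations. -/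

section ProjectionAlgebra

variable {A : Type*} [Ring A] {P p q : A}

/-- Differentiating P² = P shows that the derivative of a projection is off-diagonal. -/
theorem proj_deriv_proj (hP : P * P = P) (hp : p = p * P + P * p) : P * p * P = 0 := by
  have h : P * p * P = P * p * P + P * p * P := by
    calc P * p * P = P * (p * P + P * p) * P := by rw [← hp]
      _ = P * p * (P * P) + (P * P) * p * P := by noncomm_ring
      _ = _ := by rw [hP]
  exact left_eq_add.1 h

theorem proj_comm_proj (hP : P * P = P) (a : A) : P * (a * P - P * a) * P = 0 := by
  calc P * (a * P - P * a) * P = P * a * (P * P) - (P * P) * a * P := by noncomm_ring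
    _ = 0 := by rw [hP]; noncomm_ring

theorem proj_mixed (hP : P * P = P) (hp : P * p * P = 0) (hq : P * q * P = 0) (a b : A) :
    P * ((p * (a * P - P * a) - (a * P - P * a) * p) - (q * (b * P - P * b) - (b * P - P * b) * q)) * P
      = P * (p * a + a * p - q * b - b * q) * P := by
  have h1 : P * ((p * (a * P - P * a) - (a * P - P * a) * p)
      - (q * (b * P - P * b) - (b * P - P * b) * q)) * P
      = P * p * a * (P * P) - (P * p * P) * a * P - P * a * (P * p * P) + (P * P) * a * p * P
        - (P * q * b * (P * P) - (P * q * P) * b * P - P * b * (P * q * P) + (P * P) * b * q * P) := by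
    noncomm_ring
  rw [h1, hP, hp, hq]
  noncomm_ring

/-- The commutator of compressions differs from the compression of the commutator by a term
quadratic in [·, P]. This is the Gauss equation for the vector part V. -/
theorem proj_commutator (hP : P * P = P) (a b : A) :
    P * ((a * P - P * a) * (b * P - P * b) - (b * P - P * b) * (a * P - P * a)) * P
      = (P * a * P * (P * b * P) - P * b * P * (P * a * P)) - P * (a * b - b * a) * P := by
  have h1 : P * ((a * P - P * a) * (b * P - P * b) - (b * P - P * b) * (a * P - P * a)) * P
      = P * a * P * b * (P * P) - P * a * (P * P) * b * P - (P * P) * a * b * (P * P)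
          + (P * P) * a * P * b * P
        - (P * b * P * a * (P * P) - P * b * (P * P) * a * P - (P * P) * b * a * (P * P)
          + (P * P) * b * P * a * P) := by
    noncomm_ring
  have h2 : P * a * P * (P * b * P) - P * b * P * (P * a * P)
      = P * a * (P * P) * b * P - P * b * (P * P) * a * P := by noncomm_ring
  rw [h1, h2, hP]
  noncomm_ring

/-- The compression of the covariant derivative of a compressed endomorphism. -/
theorem proj_deriv_compress (hP : P * P = P) (hp : p = p * P + P * p) (t t' : A) :
    P * (p * t * P + P * t' * P + P * t * p) - P * t * P * p = P * (p * t + t * p + t') * P := by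
  calc P * (p * t * P + P * t' * P + P * t * p) - P * t * P * p
      = P * p * t * P + (P * P) * t' * P + (P * P) * t * p - P * t * P * p := by noncomm_ring
    _ = P * p * t * P + P * t' * P + P * t * (p - P * p) := by rw [hP]; noncomm_ring
    _ = P * p * t * P + P * t' * P + P * t * (p * P) := by
        congr 2
        exact sub_eq_iff_eq_add.2 hp
    _ = _ := by noncomm_ring

end ProjectionAlgebra

/-! ### The Gauss equation for the ordinary connection. -/

section BundleCurvature

open Filter Topology

variable {n r : ℕ} {M : Type*} [TopologicalSpace M] [ChartedSpace (W n) M]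
  [IsManifold (𝓡 (2 * n)) ∞ M]
  {E : M → Type*} [TopologicalSpace (TotalSpace (EuclideanSpace ℂ (Fin r)) E)]
  [∀ x, NormedAddCommGroup (E x)] [∀ x, InnerProductSpace ℂ (E x)]
  [FiberBundle (EuclideanSpace ℂ (Fin r)) E]
  [VectorBundle ℂ (EuclideanSpace ℂ (Fin r)) E] [VectorBundle ℝ (EuclideanSpace ℂ (Fin r)) E]
  [ContMDiffVectorBundle ∞ (EuclideanSpace ℂ (Fin r)) E (𝓡 (2 * n))]

theorem smoothSecOn_extSec {x : M} (e : E x) :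
    SmoothSecOn n r (trivializationAt (EuclideanSpace ℂ (Fin r)) E x).baseSet (extSec r e) := by
  refine ((trivializationAt (EuclideanSpace ℂ (Fin r)) E x).contMDiffOn_section_baseSet_iff).2 ?_
  refine (contMDiffOn_const
    (c := (trivializationAt (EuclideanSpace ℂ (Fin r)) E x ⟨x, e⟩).2)).congr fun y hy => ?_
  have h := Trivialization.apply_mk_symm (trivializationAt (EuclideanSpace ℂ (Fin r)) E x) hy
    (trivializationAt (EuclideanSpace ℂ (Fin r)) E x ⟨x, e⟩).2
  have h2 := congrArg Prod.snd h
  exact h2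

theorem exists_smoothSec_extSec [T2Space M] {x : M} (e : E x) :
    ∃ s : ∀ y, E y, SmoothSec n r s ∧ s x = e ∧ ∀ᶠ y in 𝓝 x, extSec r e y = s y := by
  obtain ⟨s, hs, h⟩ := (smoothSecOn_extSec (n := n) (r := r) e).exists_global (Trivialization.open_baseSet _)
    (FiberBundle.mem_baseSet_trivializationAt' x)
  refine ⟨s, hs, ?_, h.mono fun y hy => hy.symm⟩
  rw [h.self_of_nhds]
  exact FiberBundle.extend_apply_self (F := EuclideanSpace ℂ (Fin r)) e

section Compress

variable (C : CConnection n r E) {P Φ : ∀ x, Module.End ℂ (E x)} {x : M}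

theorem compress_eq (hΦ : SmoothEndOn n r Set.univ Φ) (hP : ∀ᶠ y in 𝓝 x, P y = Φ y)
    {s s' : ∀ y, E y} (hs : SmoothSec n r s) (h : ∀ᶠ y in 𝓝 x, s' y = s y) :
    ∀ᶠ y in 𝓝 x, ∀ v, compress P C s' y v = Φ y (C.nabla (fun z => Φ z (s z)) y v) := by
  filter_upwards [hP.eventually_nhds, h.eventually_nhds] with y h1 h2 v
  rw [compress, h1.self_of_nhds, C.nabla_congr (hΦ s hs)
    (by filter_upwards [h1, h2] with z a b; rw [a, b])]

theorem compress_compress_eq (hΦ : SmoothEndOn n r Set.univ Φ) (hP : ∀ᶠ y in 𝓝 x, P y = Φ y)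
    {s s' : ∀ y, E y} (hs : SmoothSec n r s) (h : ∀ᶠ y in 𝓝 x, s' y = s y)
    {X X' : ∀ y : M, TangentSpace (𝓡 (2 * n)) y} (hX : SmoothVF X) (hX' : ∀ᶠ y in 𝓝 x, X y = X' y)
    (v : TangentSpace (𝓡 (2 * n)) x) :
    compress P C (fun y => compress P C s' y (X' y)) x v
      = Φ x (C.nabla (fun y => Φ y (Φ y (C.nabla (fun z => Φ z (s z)) y (X y)))) x v) := by
  refine (compress_eq C hΦ hP (hΦ _ (C.smooth_nabla hX (hΦ s hs))) ?_).self_of_nhds v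
  filter_upwards [compress_eq C hΦ hP hs h, hX'] with y h1 h2
  rw [h1, h2]

variable (F : SecFrame n r E)

theorem SecFrame.covEnd_idem [T2Space M] (hΦ : SmoothEndOn n r Set.univ Φ)
    (hid : ∀ᶠ y in 𝓝 x, Φ y * Φ y = Φ y) (v : TangentSpace (𝓡 (2 * n)) x) :
    F.covEnd C Φ x v = F.covEnd C Φ x v * Φ x + Φ x * F.covEnd C Φ x v := by
  rw [← F.covEnd_mul C hΦ hΦ]
  exact (F.covEnd_congr C hΦ hid v).symm

/-- For u = Φ s one has ∇u = (∇Φ) u + Φ ∇u. The derivative ∇_v Φ is off-diagonal, so after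
compression only its product with (∇_X Φ) u survives. -/
theorem nabla_nabla_proj [T2Space M] (hΦ : SmoothEndOn n r Set.univ Φ)
    (hid : ∀ᶠ y in 𝓝 x, Φ y * Φ y = Φ y) {s : ∀ y, E y} (hs : SmoothSec n r s)
    {X : ∀ y : M, TangentSpace (𝓡 (2 * n)) y} (hX : SmoothVF X) (v : TangentSpace (𝓡 (2 * n)) x) :
    Φ x (C.nabla (fun y => Φ y (Φ y (C.nabla (fun z => Φ z (s z)) y (X y)))) x v)
      = (Φ x * F.covEnd C Φ x v * F.covEnd C Φ x (X x) * Φ x) (s x)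
        + Φ x (C.nabla (fun y => C.nabla (fun z => Φ z (s z)) y (X y)) x v) := by
  have hP := hid.self_of_nhds
  have hu := hΦ s hs
  have hXu := C.smooth_nabla hX hu
  have h1 : C.nabla (fun y => Φ y (Φ y (C.nabla (fun z => Φ z (s z)) y (X y)))) x
      = C.nabla (fun y => Φ y (C.nabla (fun z => Φ z (s z)) y (X y))) x :=
    C.nabla_congr (hΦ _ hXu) (hid.mono fun y hy => by rw [← Module.End.mul_apply, hy])
  have h2 : C.nabla (fun z => Φ z (s z)) x = C.nabla (fun z => Φ z (Φ z (s z))) x :=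
    C.nabla_congr (hΦ _ hu) (hid.mono fun y hy => by rw [← Module.End.mul_apply, hy])
  have h3 := F.nabla_end C hΦ hu x (X x)
  rw [← h2] at h3
  have h4 : ∀ e, Φ x (F.covEnd C Φ x v (Φ x e)) = 0 := fun e => by
    have := congrArg (fun A : Module.End ℂ (E x) => A e)
      (proj_deriv_proj hP (F.covEnd_idem C hΦ hid v))
    exact this
  rw [h1, F.nabla_end C hΦ hXu, map_add, ← Module.End.mul_apply (Φ x) (Φ x), hP]
  conv_lhs => rw [h3]
  rw [map_add, map_add, h4, add_zero]
  rfl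

end Compress

variable (F : SecFrame n r E) (C : CConnection n r E)

theorem nabla_extVF {x : M} {s : ∀ y, E y} (hs : SmoothSec n r s)
    {X : ∀ y : M, TangentSpace (𝓡 (2 * n)) y} (hX : SmoothVF X) {w : TangentSpace (𝓡 (2 * n)) x}
    (h : ∀ᶠ y in 𝓝 x, X y = extVF w y) :
    C.nabla (fun y => C.nabla s y (extVF w y)) x = C.nabla (fun y => C.nabla s y (X y)) x :=
  C.nabla_congr (C.smooth_nabla hX hs) (h.mono fun y hy => by rw [hy])

/-- The curvature endomorphism of a connection. -/
noncomputable def SecFrame.curvEnd (x : M) (v w : TangentSpace (𝓡 (2 * n)) x) :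
    Module.End ℂ (E x) :=
  F.hat (fun s => C.nabla (fun y => C.nabla s y (extVF w y)) x v
    - C.nabla (fun y => C.nabla s y (extVF v y)) x w)

theorem nabla_nabla_smul {f : M → ℂ} {s : ∀ y, E y} (hf : SmoothFn (n := n) f)
    (hs : SmoothSec n r s) {X : ∀ y : M, TangentSpace (𝓡 (2 * n)) y} (hX : SmoothVF X) (x : M)
    (v : TangentSpace (𝓡 (2 * n)) x) :
    C.nabla (fun y => C.nabla (fun z => f z • s z) y (X y)) x v
      = f x • C.nabla (fun y => C.nabla s y (X y)) x v + mvfderiv (𝓡 (2 * n)) f x v • C.nabla s x (X x)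
        + mvfderiv (𝓡 (2 * n)) f x (X x) • C.nabla s x v
        + mvfderiv (𝓡 (2 * n)) (fun y => mvfderiv (𝓡 (2 * n)) f y (X y)) x v • s x := by
  have h1 : (fun y => C.nabla (fun z => f z • s z) y (X y))
      = fun y => f y • C.nabla s y (X y) + mvfderiv (𝓡 (2 * n)) f y (X y) • s y :=
    funext fun y => C.nabla_smul hf hs y _
  have h2 := C.smooth_nabla hX hs
  have h3 : SmoothFn (n := n) (fun y => mvfderiv (𝓡 (2 * n)) f y (X y)) := contMDiff_mvfderiv hf hX
  rw [h1, C.nabla_add (SmoothSec.smul hf h2) (SmoothSec.smul h3 hs), add_apply,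
    C.nabla_smul hf h2, C.nabla_smul h3 hs]
  abel

/-- Tensoriality: the first-order terms cancel by antisymmetry, and the second derivatives of f
cancel because the extended fields are coordinate fields. -/
theorem SecFrame.curvEnd_apply [T2Space M] {x : M} (v w : TangentSpace (𝓡 (2 * n)) x) {s : ∀ y, E y}
    (hs : SmoothSec n r s) :
    F.curvEnd C x v w (s x) = C.nabla (fun y => C.nabla s y (extVF w y)) x v
      - C.nabla (fun y => C.nabla s y (extVF v y)) x w := by
  obtain ⟨X, hX, hXx, hX'⟩ := exists_smoothVF_extVF v
  obtain ⟨Y, hY, hYx, hY'⟩ := exists_smoothVF_extVF w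
  refine F.hat_eq ⟨fun s t hs ht => ?_, fun f s hf hs => ?_⟩ hs
  · have e : ∀ Z : ∀ y : M, TangentSpace (𝓡 (2 * n)) y,
        (fun y => C.nabla (fun z => s z + t z) y (Z y))
          = fun y => C.nabla s y (Z y) + C.nabla t y (Z y) := fun Z => by
      ext y; rw [C.nabla_add hs ht, add_apply]
    rw [nabla_extVF C (SmoothSecOn.add hs ht) hY hY', nabla_extVF C (SmoothSecOn.add hs ht) hX hX',
      nabla_extVF C hs hY hY', nabla_extVF C hs hX hX', nabla_extVF C ht hY hY',
      nabla_extVF C ht hX hX', e, e, C.nabla_add (C.smooth_nabla hY hs) (C.smooth_nabla hY ht),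
      C.nabla_add (C.smooth_nabla hX hs) (C.smooth_nabla hX ht), add_apply, add_apply]
    abel
  · rw [nabla_extVF C (SmoothSec.smul hf hs) hY hY', nabla_extVF C (SmoothSec.smul hf hs) hX hX',
      nabla_extVF C hs hY hY', nabla_extVF C hs hX hX', nabla_nabla_smul C hf hs hY,
      nabla_nabla_smul C hf hs hX, hXx, hYx]
    have hc := mvfderiv_coordField_comm hf (mem_extChartAt_source x) hX hY hX' hY'
    rw [hXx, hYx] at hc
    rw [hc]
    module

section Curv

variable {P Φ : ∀ x, Module.End ℂ (E x)} {x : M}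

/-- The Gauss equation. Φ is a global smooth field with the germ of P at x and is idempotent only
near x; this suffices because curvature is local. -/
theorem curv_eq_global [T2Space M] (hΦ : SmoothEndOn n r Set.univ Φ)
    (hid : ∀ᶠ y in 𝓝 x, Φ y * Φ y = Φ y) (hP : ∀ᶠ y in 𝓝 x, P y = Φ y)
    (v w : TangentSpace (𝓡 (2 * n)) x) :
    curv P C x v w = Φ x * F.curvEnd C x v w * Φ x
      + Φ x * (F.covEnd C Φ x v * F.covEnd C Φ x w - F.covEnd C Φ x w * F.covEnd C Φ x v) * Φ x := by
  refine linearize_eq _ fun e => ?_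
  obtain ⟨s, hs, rfl, hse⟩ := exists_smoothSec_extSec (n := n) (r := r) e
  obtain ⟨X, hX, hXx, hX'⟩ := exists_smoothVF_extVF v
  obtain ⟨Y, hY, hYx, hY'⟩ := exists_smoothVF_extVF w
  have h0 : compress P C (extSec r (s x)) x
      (VectorField.mlieBracket (𝓡 (2 * n)) (extVF v) (extVF w) x) = 0 := by
    rw [mlieBracket_extVF, compress, map_zero, map_zero]
  rw [h0, compress_compress_eq C hΦ hP hs hse hX hX', compress_compress_eq C hΦ hP hs hse hY hY',
    nabla_nabla_proj C F hΦ hid hs hX, nabla_nabla_proj C F hΦ hid hs hY, hXx, hYx,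
    ← nabla_extVF C (hΦ s hs) hX hX', ← nabla_extVF C (hΦ s hs) hY hY']
  have h1 := F.curvEnd_apply C v w (hΦ s hs)
  simp only [LinearMap.add_apply, LinearMap.sub_apply, Module.End.mul_apply, h1, map_sub, sub_zero]
  abel

end Curv

/-- Smooth one-forms with values in the endomorphisms. -/
def SmoothEndForm (Θ : ∀ x : M, TangentSpace (𝓡 (2 * n)) x →ₗ[ℝ] Module.End ℂ (E x)) : Prop :=
  ∀ X : ∀ x : M, TangentSpace (𝓡 (2 * n)) x, SmoothVF X →
    SmoothEndOn n r Set.univ (fun x => Θ x (X x))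

/-- The exterior covariant derivative of a one-form with values in the endomorphisms. -/
noncomputable def SecFrame.dEnd
    (Θ : ∀ x : M, TangentSpace (𝓡 (2 * n)) x →ₗ[ℝ] Module.End ℂ (E x)) (x : M)
    (v w : TangentSpace (𝓡 (2 * n)) x) : Module.End ℂ (E x) :=
  F.covEnd C (fun y => Θ y (extVF w y)) x v - F.covEnd C (fun y => Θ y (extVF v y)) x w

section CompressForm

variable {P Φ Θ Θ' : ∀ x, Module.End ℂ (E x)} {x : M}

theorem compress_form [T2Space M] (hΦ : SmoothEndOn n r Set.univ Φ)
    (hid : ∀ᶠ y in 𝓝 x, Φ y * Φ y = Φ y) (hP : ∀ᶠ y in 𝓝 x, P y = Φ y)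
    (hΘ : SmoothEndOn n r Set.univ Θ) (hΘ' : ∀ᶠ y in 𝓝 x, Θ' y = Θ y)
    {s s' : ∀ y, E y} (hs : SmoothSec n r s) (h : ∀ᶠ y in 𝓝 x, s' y = s y)
    (v : TangentSpace (𝓡 (2 * n)) x) :
    compress P C (fun y => (P y * Θ' y * P y) (s' y)) x v
        - (P x * Θ' x * P x) (compress P C s' x v)
      = (Φ x * (F.covEnd C Φ x v * Θ x + Θ x * F.covEnd C Φ x v + F.covEnd C Θ x v) * Φ x)
        (s x) := by
  have hPP := hid.self_of_nhds
  have hB := (hΦ.mul hΘ isOpen_univ).mul hΦ isOpen_univ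
  have h1 := (compress_eq C hΦ hP (s' := fun y => (P y * Θ' y * P y) (s' y)) (hB s hs) (by
    filter_upwards [hP, hΘ', h] with y h1 h2 h3; rw [h1, h2, h3])).self_of_nhds v
  have h2 := (compress_eq C hΦ hP hs h).self_of_nhds v
  have h3 : C.nabla (fun z => Φ z ((Φ z * Θ z * Φ z) (s z))) x
      = C.nabla (fun z => (Φ z * Θ z * Φ z) (s z)) x :=
    C.nabla_congr (hB s hs) (hid.mono fun y hy => by
      rw [← Module.End.mul_apply, ← mul_assoc, ← mul_assoc, hy])
  rw [h1, h2, h3, hP.self_of_nhds, hΘ'.self_of_nhds, F.nabla_end C hB hs, F.nabla_end C hΦ hs,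
    F.covEnd_mul C (hΦ.mul hΘ isOpen_univ) hΦ, F.covEnd_mul C hΦ hΘ,
    ← proj_deriv_compress hPP (F.covEnd_idem C hΦ hid v)]
  have h4 : ∀ e, Φ x (Φ x e) = Φ x e := fun e => by rw [← Module.End.mul_apply, hPP]
  simp only [LinearMap.add_apply, LinearMap.sub_apply, Module.End.mul_apply, map_add, h4]
  abel

/-- By cyclicity and ∇Φ = (∇Φ) Φ + Φ ∇Φ, the three compressed terms recombine to the derivative of Φ
Θ. -/
theorem trace_deriv_compress [T2Space M] (hΦ : SmoothEndOn n r Set.univ Φ)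
    (hid : ∀ᶠ y in 𝓝 x, Φ y * Φ y = Φ y)
    (hΘ : SmoothEndOn n r Set.univ Θ) (v : TangentSpace (𝓡 (2 * n)) x) :
    LinearMap.trace ℂ (E x)
        (Φ x * (F.covEnd C Φ x v * Θ x + Θ x * F.covEnd C Φ x v + F.covEnd C Θ x v) * Φ x)
      = LinearMap.trace ℂ (E x) (F.covEnd C (fun y => Φ y * Θ y) x v) := by
  have hPP := hid.self_of_nhds
  have hp := F.covEnd_idem C hΦ hid v
  rw [F.covEnd_mul C hΦ hΘ]
  set p := F.covEnd C Φ x v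
  rw [LinearMap.trace_mul_comm, ← mul_assoc, hPP]
  have h1 : Φ x * (p * Θ x + Θ x * p + F.covEnd C Θ x v)
      = Φ x * p * Θ x + Φ x * Θ x * p + Φ x * F.covEnd C Θ x v := by noncomm_ring
  rw [h1, map_add, map_add, map_add]
  congr 1
  conv_rhs => rw [hp, add_mul, map_add, add_comm]
  congr 1
  rw [LinearMap.trace_mul_cycle]

end CompressForm

end BundleCurvature
end GenKaehler

namespace GenKaehler

/-! ### The quadratic term for the total derivative of a projection. -/

section PointwiseQuad

variable {n : ℕ} {H : Type*} [NormedAddCommGroup H] [InnerProductSpace ℂ H]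

namespace PointKaehler

/-- The operator `v + ξ ↦ p v + [V ξ, P]`. -/
noncomputable def totalOp (P : Module.End ℂ H) (p : W n →ₗ[ℝ] Module.End ℂ H)
    (V : (W n →L[ℝ] ℝ) →ₗ[ℝ] Module.End ℂ H) : W n × (W n →L[ℝ] ℝ) →ₗ[ℝ] Module.End ℂ H :=
  LinearMap.coprod p ((LinearMap.mulRight ℝ P - LinearMap.mulLeft ℝ P) ∘ₗ V)

variable (P : Module.End ℂ H) (p : W n →ₗ[ℝ] Module.End ℂ H)
  (V : (W n →L[ℝ] ℝ) →ₗ[ℝ] Module.End ℂ H)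

theorem totalOp_vecPart (v : W n) : totalOp P p V (vecPart v) = p v := by
  simp [totalOp]

theorem totalOp_covPart (ξ : W n →L[ℝ] ℝ) : totalOp P p V (covPart ξ) = V ξ * P - P * V ξ := by
  simp [totalOp]

variable {P p V} (Q : PointKaehler n)

/-- Expands the quadratic term for R = (p, [V, P]) into the corrections that appear when F_A, d^A θ
and [V · V] are compressed separately. -/
theorem proj_quad_proj (hP : P * P = P) (hp : ∀ v, P * p v * P = 0) :
    P * Q.quad (totalOp P p V) * P
      = (1 / 2 : ℂ) • ∑ i, ∑ j, Q.projDx i j •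
          (P * (p (stdVec i) * p (stdVec j) - p (stdVec j) * p (stdVec i)) * P
            + P * (p (stdVec i) * (V (-(Q.b (stdVec j))) - Complex.I • V (-(Q.om (stdVec j))))
              + (V (-(Q.b (stdVec j))) - Complex.I • V (-(Q.om (stdVec j)))) * p (stdVec i)
              - p (stdVec j) * (V (-(Q.b (stdVec i))) - Complex.I • V (-(Q.om (stdVec i))))
              - (V (-(Q.b (stdVec i))) - Complex.I • V (-(Q.om (stdVec i)))) * p (stdVec j)) * P)
        + (1 / 2 : ℂ) • ∑ i, ∑ j, Q.projVec i j •
          ((P * V (dx i) * P * (P * V (dx j) * P) - P * V (dx j) * P * (P * V (dx i) * P))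
            - P * (V (dx i) * V (dx j) - V (dx j) * V (dx i)) * P) := by
  have hθ : ∀ w, totalOp P p V (covPart (-(Q.b w))) - Complex.I • totalOp P p V (covPart (-(Q.om w)))
      = (V (-(Q.b w)) - Complex.I • V (-(Q.om w))) * P
        - P * (V (-(Q.b w)) - Complex.I • V (-(Q.om w))) := by
    intro w
    rw [totalOp_covPart, totalOp_covPart]
    simp only [mul_sub, sub_mul, mul_smul_comm, smul_mul_assoc, smul_sub]
    abel
  have key : ∀ (d e : Fin (2 * n) → Fin (2 * n) → ℂ) (X Y Z : Fin (2 * n) → Fin (2 * n) → Module.End ℂ H),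
      P * ((1 / 2 : ℂ) • ∑ i, ∑ j, d i j • X i j + (1 / 2 : ℂ) • ∑ i, ∑ j, d i j • Y i j
        + (1 / 2 : ℂ) • ∑ i, ∑ j, e i j • Z i j) * P
      = (1 / 2 : ℂ) • ∑ i, ∑ j, d i j • (P * X i j * P + P * Y i j * P)
        + (1 / 2 : ℂ) • ∑ i, ∑ j, e i j • (P * Z i j * P) := by
    intro d e X Y Z
    simp only [mul_add, add_mul, mul_smul_comm, smul_mul_assoc, Finset.mul_sum, Finset.sum_mul,
      smul_add, Finset.sum_add_distrib]
  have hm : ∀ i j a b, P * ((p (stdVec i) * (a * P - P * a) - (a * P - P * a) * p (stdVec i))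
      - (p (stdVec j) * (b * P - P * b) - (b * P - P * b) * p (stdVec j))) * P = _ := fun i j a b =>
    proj_mixed hP (hp (stdVec i)) (hp (stdVec j)) a b
  rw [quad]
  simp only [hθ]
  simp only [totalOp_vecPart, totalOp_covPart]
  rw [key]
  simp only [hm, proj_commutator hP]

end PointKaehler

end PointwiseQuad

/-! ### The Gauss equation for the generalized connection. -/

section CurvU

open Filter Topology

variable {n r : ℕ} {M : Type*} [TopologicalSpace M] [ChartedSpace (W n) M]
  [IsManifold (𝓡 (2 * n)) ∞ M]
  {E : M → Type*} [TopologicalSpace (TotalSpace (EuclideanSpace ℂ (Fin r)) E)]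
  [∀ x, NormedAddCommGroup (E x)] [∀ x, InnerProductSpace ℂ (E x)]
  [FiberBundle (EuclideanSpace ℂ (Fin r)) E]
  [VectorBundle ℂ (EuclideanSpace ℂ (Fin r)) E] [VectorBundle ℝ (EuclideanSpace ℂ (Fin r)) E]
  [ContMDiffVectorBundle ∞ (EuclideanSpace ℂ (Fin r)) E (𝓡 (2 * n))]

variable (F : SecFrame n r E) (C : CConnection n r E) (D : GenConnection n r E)
  (K : GenKaehlerSympl n M)

/-- The one-form `θ` with `V · ψ = θ ∧ ψ`. -/
noncomputable def thetaForm (x : M) : TangentSpace (𝓡 (2 * n)) x →ₗ[ℝ] Module.End ℂ (E x) where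
  toFun w := D.vec x (-(K.b x w)) - Complex.I • D.vec x (-(K.om x w))
  map_add' u w := by
    simp only [map_add, neg_add, smul_add]
    abel
  map_smul' c w := by
    have h : ∀ β : Bilin n M, -(β x (c • w)) = c • -(β x w) := fun β => by ext v; simp
    rw [h, h, map_smul, map_smul, RingHom.id_apply, smul_sub, smul_comm]

theorem thetaForm_apply (x : M) (w : TangentSpace (𝓡 (2 * n)) x) :
    thetaForm D K x w = D.vec x (-(K.b x w)) - Complex.I • D.vec x (-(K.om x w)) := rfl

theorem theta_eq (P : ∀ x, Module.End ℂ (E x)) (x : M) (w : TangentSpace (𝓡 (2 * n)) x) :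
    theta K P D x w = P x * thetaForm D K x w * P x := by
  simp only [theta, compressVec, thetaForm_apply, mul_sub, sub_mul, mul_smul_comm, smul_mul_assoc]

theorem IsSmoothTwoForm.oneForm_neg {β : Bilin n M} (hβ : IsSmoothTwoForm β)
    {X : ∀ x : M, TangentSpace (𝓡 (2 * n)) x} (hX : SmoothVF X) :
    SmoothOneForm (fun x => -(β x (X x))) :=
  SmoothOneForm.neg fun Y hY => hβ.smooth X Y hX hY

theorem smooth_thetaForm : SmoothEndForm (r := r) (thetaForm D K) := fun _ hX =>
  (D.vec_smooth _ (K.b_form.oneForm_neg hX)).sub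
    (SmoothEndOn.smul (f := fun _ => Complex.I) contMDiffOn_const
      (D.vec_smooth _ (K.om_form.oneForm_neg hX)))

variable {P Φ : ∀ x, Module.End ℂ (E x)} {x : M}

theorem dEnd_eq {Θ : ∀ x : M, TangentSpace (𝓡 (2 * n)) x →ₗ[ℝ] Module.End ℂ (E x)}
    (hΘ : SmoothEndForm (r := r) Θ) {v w : TangentSpace (𝓡 (2 * n)) x}
    {X Y : ∀ y : M, TangentSpace (𝓡 (2 * n)) y} (hX : SmoothVF X) (hY : SmoothVF Y)
    (hX' : ∀ᶠ y in 𝓝 x, X y = extVF v y) (hY' : ∀ᶠ y in 𝓝 x, Y y = extVF w y) :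
    F.dEnd C Θ x v w
      = F.covEnd C (fun y => Θ y (Y y)) x v - F.covEnd C (fun y => Θ y (X y)) x w := by
  rw [SecFrame.dEnd, F.covEnd_congr C (Ψ := fun y => Θ y (extVF w y)) (hΘ Y hY) (hY'.mono fun y hy => by rw [hy]),
    F.covEnd_congr C (Ψ := fun y => Θ y (extVF v y)) (hΘ X hX) (hX'.mono fun y hy => by rw [hy])]

/-- The derivative of the compressed one-form `P Θ P`. -/
noncomputable def SecFrame.dCompress (Θ : ∀ x : M, TangentSpace (𝓡 (2 * n)) x →ₗ[ℝ] Module.End ℂ (E x))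
    (P : ∀ x, Module.End ℂ (E x)) (x : M) (v w : TangentSpace (𝓡 (2 * n)) x) :
    Module.End ℂ (E x) :=
  P x * F.dEnd C Θ x v w * P x
    + P x * (F.covEnd C P x v * Θ x w + Θ x w * F.covEnd C P x v
      - F.covEnd C P x w * Θ x v - Θ x v * F.covEnd C P x w) * P x

theorem dTheta_eq_global [T2Space M] (hΦ : SmoothEndOn n r Set.univ Φ)
    (hid : ∀ᶠ y in 𝓝 x, Φ y * Φ y = Φ y) (hP : ∀ᶠ y in 𝓝 x, P y = Φ y)
    (v w : TangentSpace (𝓡 (2 * n)) x) :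
    dTheta K P D x v w = F.dCompress D.toCConnection (thetaForm D K) Φ x v w := by
  refine linearize_eq _ fun e => ?_
  obtain ⟨s, hs, rfl, hse⟩ := exists_smoothSec_extSec (n := n) (r := r) e
  obtain ⟨X, hX, hXx, hX'⟩ := exists_smoothVF_extVF v
  obtain ⟨Y, hY, hYx, hY'⟩ := exists_smoothVF_extVF w
  have h0 : theta K P D x (VectorField.mlieBracket (𝓡 (2 * n)) (extVF v) (extVF w) x) = 0 := by
    rw [theta_eq, mlieBracket_extVF, map_zero, mul_zero, zero_mul]
  have h1 := compress_form F D.toCConnection hΦ hid hP (smooth_thetaForm D K Y hY)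
    (Θ' := fun y => thetaForm D K y (extVF w y)) (hY'.mono fun y hy => by rw [hy]) hs hse v
  have h2 := compress_form F D.toCConnection hΦ hid hP (smooth_thetaForm D K X hX)
    (Θ' := fun y => thetaForm D K y (extVF v y)) (hX'.mono fun y hy => by rw [hy]) hs hse w
  rw [h0]
  simp only [theta_eq]
  simp only [extVF_self] at h1 h2
  rw [h1, h2, SecFrame.dCompress, dEnd_eq F D.toCConnection (smooth_thetaForm D K) hX hY hX' hY',
    hXx, hYx]
  simp only [LinearMap.sub_apply, LinearMap.add_apply, Module.End.mul_apply, map_add, map_sub,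
    LinearMap.zero_apply]
  abel

/-- The compressed derivative of Θ has the trace of an exact form, the differential of tr (Φ Θ).
This lets the term d^A θ disappear from the degree. -/
theorem trace_dCompress_global [T2Space M]
    {Θ : ∀ x : M, TangentSpace (𝓡 (2 * n)) x →ₗ[ℝ] Module.End ℂ (E x)} (hD : D.IsHermitian)
    (hΘ : SmoothEndForm (r := r) Θ) (hΦ : SmoothEndOn n r Set.univ Φ)
    (hid : ∀ᶠ y in 𝓝 x, Φ y * Φ y = Φ y) (v w : TangentSpace (𝓡 (2 * n)) x) :
    LinearMap.trace ℂ (E x) (F.dCompress D.toCConnection Θ Φ x v w)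
      = mvfderiv (𝓡 (2 * n)) (fun y => LinearMap.trace ℂ (E y) (Φ y * Θ y (extVF w y))) x v
        - mvfderiv (𝓡 (2 * n)) (fun y => LinearMap.trace ℂ (E y) (Φ y * Θ y (extVF v y))) x w := by
  obtain ⟨X, hX, hXx, hX'⟩ := exists_smoothVF_extVF v
  obtain ⟨Y, hY, hYx, hY'⟩ := exists_smoothVF_extVF w
  have h1 := trace_deriv_compress F D.toCConnection hΦ hid (hΘ Y hY) v
  have h2 := trace_deriv_compress F D.toCConnection hΦ hid (hΘ X hX) w
  rw [← F.mvfderiv_trace hD (hΦ.mul (hΘ Y hY) isOpen_univ)] at h1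
  rw [← F.mvfderiv_trace hD (hΦ.mul (hΘ X hX) isOpen_univ)] at h2
  rw [mvfderiv_congr (f := fun y => LinearMap.trace ℂ (E y) (Φ y * Θ y (extVF w y)))
      (g := fun y => LinearMap.trace ℂ (E y) (Φ y * Θ y (Y y)))
      (hY'.mono fun y hy => by simp only [hy]),
    mvfderiv_congr (f := fun y => LinearMap.trace ℂ (E y) (Φ y * Θ y (extVF v y)))
      (g := fun y => LinearMap.trace ℂ (E y) (Φ y * Θ y (X y)))
      (hX'.mono fun y hy => by simp only [hy]), ← h1, ← h2, ← map_sub, SecFrame.dCompress,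
    dEnd_eq F D.toCConnection hΘ hX hY hX' hY', hXx, hYx]
  congr 1
  noncomm_ring

section Local

variable {U : Set M}

/-- `P` is a smooth field of projections on `U`. -/
structure IsProjOn (U : Set M) (P : ∀ x, Module.End ℂ (E x)) : Prop where
  isOpen : IsOpen U
  smooth : SmoothEndOn n r U P
  idem : ∀ x ∈ U, P x * P x = P x

theorem IsProjOn.exists_global [T2Space M] (h : IsProjOn (n := n) (r := r) U P) (hx : x ∈ U) :
    ∃ Φ : ∀ x, Module.End ℂ (E x), SmoothEndOn n r Set.univ Φ ∧ (∀ᶠ y in 𝓝 x, P y = Φ y) ∧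
      ∀ᶠ y in 𝓝 x, Φ y * Φ y = Φ y := by
  obtain ⟨Φ, hΦ, h1⟩ := h.smooth.exists_global h.isOpen hx
  refine ⟨Φ, hΦ, h1.mono fun y hy => hy.symm, ?_⟩
  filter_upwards [h1, h.isOpen.mem_nhds hx] with y h1 h2
  rw [h1, h.idem y h2]

theorem isProjOn_one : IsProjOn (n := n) (r := r) (E := E) Set.univ (fun _ => 1) :=
  ⟨isOpen_univ, smoothEndOn_one _, fun _ _ => mul_one _⟩

theorem dCompress_congr {Θ : ∀ x : M, TangentSpace (𝓡 (2 * n)) x →ₗ[ℝ] Module.End ℂ (E x)}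
    (hΦ : SmoothEndOn n r Set.univ Φ) (h : ∀ᶠ y in 𝓝 x, P y = Φ y)
    (v w : TangentSpace (𝓡 (2 * n)) x) : F.dCompress C Θ P x v w = F.dCompress C Θ Φ x v w := by
  rw [SecFrame.dCompress, SecFrame.dCompress, F.covEnd_congr C hΦ h, F.covEnd_congr C hΦ h,
    h.self_of_nhds]

theorem covEnd_proj [T2Space M] (h : IsProjOn (n := n) (r := r) U P) (hx : x ∈ U) (v : TangentSpace (𝓡 (2 * n)) x) :
    F.covEnd C P x v = F.covEnd C P x v * P x + P x * F.covEnd C P x v := by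
  obtain ⟨Φ, hΦ, hP, hid⟩ := h.exists_global hx
  rw [F.covEnd_congr C hΦ hP, hP.self_of_nhds]
  exact F.covEnd_idem C hΦ hid v

theorem curv_eq [T2Space M] (h : IsProjOn (n := n) (r := r) U P) (hx : x ∈ U) (v w : TangentSpace (𝓡 (2 * n)) x) :
    curv P C x v w = P x * F.curvEnd C x v w * P x
      + P x * (F.covEnd C P x v * F.covEnd C P x w - F.covEnd C P x w * F.covEnd C P x v) * P x := by
  obtain ⟨Φ, hΦ, hP, hid⟩ := h.exists_global hx
  rw [curv_eq_global F C hΦ hid hP, F.covEnd_congr C hΦ hP, F.covEnd_congr C hΦ hP,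
    hP.self_of_nhds]

theorem dTheta_eq [T2Space M] (h : IsProjOn (n := n) (r := r) U P) (hx : x ∈ U) (v w : TangentSpace (𝓡 (2 * n)) x) :
    dTheta K P D x v w = F.dCompress D.toCConnection (thetaForm D K) P x v w := by
  obtain ⟨Φ, hΦ, hP, hid⟩ := h.exists_global hx
  rw [dTheta_eq_global F D K hΦ hid hP, dCompress_congr F _ hΦ hP]

theorem trace_dCompress [T2Space M] (h : IsProjOn (n := n) (r := r) U P) (hx : x ∈ U)
    {Θ : ∀ x : M, TangentSpace (𝓡 (2 * n)) x →ₗ[ℝ] Module.End ℂ (E x)} (hD : D.IsHermitian)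
    (hΘ : SmoothEndForm (r := r) Θ) (v w : TangentSpace (𝓡 (2 * n)) x) :
    LinearMap.trace ℂ (E x) (F.dCompress D.toCConnection Θ P x v w)
      = mvfderiv (𝓡 (2 * n)) (fun y => LinearMap.trace ℂ (E y) (P y * Θ y (extVF w y))) x v
        - mvfderiv (𝓡 (2 * n)) (fun y => LinearMap.trace ℂ (E y) (P y * Θ y (extVF v y))) x w := by
  obtain ⟨Φ, hΦ, hP, hid⟩ := h.exists_global hx
  rw [dCompress_congr F _ hΦ hP, trace_dCompress_global F D hD hΘ hΦ hid,
    mvfderiv_congr (f := fun y => LinearMap.trace ℂ (E y) (Φ y * Θ y (extVF w y)))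
      (g := fun y => LinearMap.trace ℂ (E y) (P y * Θ y (extVF w y)))
      (hP.mono fun y hy => by simp only [hy]),
    mvfderiv_congr (f := fun y => LinearMap.trace ℂ (E y) (Φ y * Θ y (extVF v y)))
      (g := fun y => LinearMap.trace ℂ (E y) (P y * Θ y (extVF v y)))
      (hP.mono fun y hy => by simp only [hy])]

theorem curv_one [T2Space M] (v w : TangentSpace (𝓡 (2 * n)) x) :
    curv (fun _ => 1) C x v w = F.curvEnd C x v w := by
  rw [curv_eq F C isProjOn_one (Set.mem_univ x)]
  simp [F.covEnd_one]

theorem dTheta_one [T2Space M] (v w : TangentSpace (𝓡 (2 * n)) x) :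
    dTheta K (fun _ => 1) D x v w = F.dEnd D.toCConnection (thetaForm D K) x v w := by
  rw [dTheta_eq F D K isProjOn_one (Set.mem_univ x), SecFrame.dCompress]
  simp [F.covEnd_one]

end Local

theorem curvU_eq (P : ∀ x, Module.End ℂ (E x)) (x : M) :
    curvU K P D x = (1 / 2 : ℂ) • ∑ i, ∑ j, (K.pt x).projDx i j •
        (curv P D.toCConnection x (stdVec i) (stdVec j) + dTheta K P D x (stdVec i) (stdVec j))
      + (1 / 2 : ℂ) • ∑ i, ∑ j, (K.pt x).projVec i j •
        (compressVec P D x (dx i) * compressVec P D x (dx j)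
          - compressVec P D x (dx j) * compressVec P D x (dx i)) := by
  simp only [curvU, genCurv, actPsi, vecVecPsi, map_add, map_smul, map_sum, LinearMap.lTensor_tmul,
    TensorProduct.rid_tmul, smul_add, Finset.sum_add_distrib]
  rfl

/-- The total derivative `D_a P` of a field of endomorphisms. -/
noncomputable def SecFrame.totalDeriv (P : ∀ x, Module.End ℂ (E x)) (x : M) :
    W n × (W n →L[ℝ] ℝ) →ₗ[ℝ] Module.End ℂ (E x) :=
  PointKaehler.totalOp (P x) (F.covEndₗ D.toCConnection P x) (D.vec x)

theorem totalDeriv_apply (P : ∀ x, Module.End ℂ (E x)) (x : M) (a : GT n x) :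
    F.totalDeriv D P x a = F.covEnd D.toCConnection P x a.1
      + (D.vec x a.2 * P x - P x * D.vec x a.2) := rfl

/-- The corrections to the three parts of the curvature combine exactly into the quadratic
expression in the total derivative of P. No holomorphy or symmetry of P enters here. -/
theorem curvU_eq_quad [T2Space M] {U : Set M} (h : IsProjOn (n := n) (r := r) U P) (hx : x ∈ U) :
    curvU K P D x = P x * curvU K (fun _ => 1) D x * P x
      + P x * (K.pt x).quad (F.totalDeriv D P x) * P x := by
  have hP := h.idem x hx
  have hPp : ∀ v, P x * F.covEnd D.toCConnection P x v * P x = 0 := fun v =>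
    proj_deriv_proj hP (covEnd_proj F _ h hx v)
  have hq : P x * (K.pt x).quad (F.totalDeriv D P x) * P x = _ :=
    (K.pt x).proj_quad_proj hP (p := F.covEndₗ D.toCConnection P x) (V := D.vec x) hPp
  have h1 : ∀ i j, curv P D.toCConnection x (stdVec i) (stdVec j)
      + dTheta K P D x (stdVec i) (stdVec j) = _ := fun i j =>
    congrArg₂ (· + ·) (curv_eq F D.toCConnection h hx (stdVec i) (stdVec j))
      (dTheta_eq F D K h hx (stdVec i) (stdVec j))
  have h2 : ∀ i j, curv (fun _ => 1) D.toCConnection x (stdVec i) (stdVec j)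
      + dTheta K (fun _ => 1) D x (stdVec i) (stdVec j) = _ := fun i j =>
    congrArg₂ (· + ·) (curv_one F D.toCConnection (stdVec i) (stdVec j))
      (dTheta_one F D K (stdVec i) (stdVec j))
  rw [curvU_eq, curvU_eq, hq]
  have key : ∀ (d e : Fin (2 * n) → Fin (2 * n) → ℂ)
      (O B X Y S T : Fin (2 * n) → Fin (2 * n) → Module.End ℂ (E x)),
      P x * ((1 / 2 : ℂ) • ∑ i, ∑ j, d i j • (O i j + B i j)
          + (1 / 2 : ℂ) • ∑ i, ∑ j, e i j • T i j) * P x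
        + ((1 / 2 : ℂ) • ∑ i, ∑ j, d i j • (X i j + Y i j)
          + (1 / 2 : ℂ) • ∑ i, ∑ j, e i j • (S i j - P x * T i j * P x))
      = (1 / 2 : ℂ) • ∑ i, ∑ j, d i j • (P x * O i j * P x + X i j + (P x * B i j * P x + Y i j))
          + (1 / 2 : ℂ) • ∑ i, ∑ j, e i j • S i j := by
    intro d e O B X Y S T
    simp only [mul_add, add_mul, mul_smul_comm, smul_mul_assoc, Finset.mul_sum, Finset.sum_mul,
      smul_add, smul_sub, Finset.sum_add_distrib, Finset.sum_sub_distrib]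
    abel
  simp only [h1, h2, SecFrame.dCompress, compressVec, one_mul, mul_one]
  exact (key _ _ _ _ _ _ _ _).symm

/-- ∇ is unitary and P is self-adjoint, so ∇P is self-adjoint; V is skew, so [V, P] is self-adjoint
as well. -/
theorem isSymm_totalDeriv [T2Space M] (hD : D.IsHermitian) {U : Set M} (h : IsProjOn (n := n) (r := r) U P)
    (hsymm : ∀ x ∈ U, ∀ u w, inner ℂ (P x u) w = inner ℂ u (P x w)) (hx : x ∈ U)
    (a : GT n x) (u w : E x) :
    inner ℂ (F.totalDeriv D P x a u) w = inner ℂ u (F.totalDeriv D P x a w) := by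
  obtain ⟨Φ, hΦ, hP, hid⟩ := h.exists_global hx
  have h1 : ∀ᶠ y in 𝓝 x, ∀ u w, inner ℂ (Φ y u) w = inner ℂ u (Φ y w) := by
    filter_upwards [hP, h.isOpen.mem_nhds hx] with y h1 h2
    rw [← h1]; exact hsymm y h2
  have h2 := F.covEnd_adjoint hD hΦ hΦ h1 a.1 u w
  have hV : ∀ ξ (u w : E x), inner ℂ (D.vec x ξ u) w = -inner ℂ u (D.vec x ξ w) := fun ξ u w =>
    eq_neg_of_add_eq_zero_left (hD.vector x ξ u w)
  rw [totalDeriv_apply, F.covEnd_congr _ hΦ hP]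
  simp only [LinearMap.add_apply, LinearMap.sub_apply, Module.End.mul_apply, inner_add_left,
    inner_add_right, inner_sub_left, inner_sub_right, h2, hV, hsymm x hx]
  ring

theorem proj_totalDeriv_proj [T2Space M] {U : Set M} (h : IsProjOn (n := n) (r := r) U P) (hx : x ∈ U)
    (a : GT n x) : P x * F.totalDeriv D P x a * P x = 0 := by
  rw [totalDeriv_apply, mul_add, add_mul,
    proj_deriv_proj (h.idem x hx) (covEnd_proj F _ h hx a.1), proj_comm_proj (h.idem x hx), add_zero]

end CurvU
end GenKaehler

namespace GenKaehler

/-! ### Dependence of the curvature on the connection. -/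

section CompareConnections

open Filter Topology

variable {n r : ℕ} {M : Type*} [TopologicalSpace M] [ChartedSpace (W n) M]
  [IsManifold (𝓡 (2 * n)) ∞ M]
  {E : M → Type*} [TopologicalSpace (TotalSpace (EuclideanSpace ℂ (Fin r)) E)]
  [∀ x, NormedAddCommGroup (E x)] [∀ x, InnerProductSpace ℂ (E x)]
  [FiberBundle (EuclideanSpace ℂ (Fin r)) E]
  [VectorBundle ℂ (EuclideanSpace ℂ (Fin r)) E] [VectorBundle ℝ (EuclideanSpace ℂ (Fin r)) E]
  [ContMDiffVectorBundle ∞ (EuclideanSpace ℂ (Fin r)) E (𝓡 (2 * n))]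
  (F : SecFrame n r E) (C C' : CConnection n r E) (D : GenConnection n r E)
  (K : GenKaehlerSympl n M) {P Φ : ∀ x, Module.End ℂ (E x)} {x : M} {U : Set M}

/-- The difference of two connections. -/
noncomputable def SecFrame.diffEnd (x : M) :
    TangentSpace (𝓡 (2 * n)) x →ₗ[ℝ] Module.End ℂ (E x) where
  toFun v := F.hat (fun s => C.nabla s x v - C'.nabla s x v)
  map_add' v w := by
    ext e
    simp only [LinearMap.add_apply, SecFrame.hat_apply, map_add, ← Finset.sum_add_distrib, ← smul_add]
    refine Finset.sum_congr rfl fun k _ => ?_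
    congr 1
    abel
  map_smul' c v := by
    ext e
    simp only [LinearMap.smul_apply, SecFrame.hat_apply, map_smul, Finset.smul_sum, RingHom.id_apply]
    refine Finset.sum_congr rfl fun k _ => ?_
    rw [← smul_sub, smul_comm]

theorem diffEnd_apply (v : TangentSpace (𝓡 (2 * n)) x) {s : ∀ y, E y} (hs : SmoothSec n r s) :
    F.diffEnd C C' x v (s x) = C.nabla s x v - C'.nabla s x v := by
  refine F.hat_eq ⟨fun s t hs ht => ?_, fun f s hf hs => ?_⟩ hs
  · rw [C.nabla_add hs ht, C'.nabla_add hs ht, add_apply, add_apply]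
    abel
  · rw [C.nabla_smul hf hs, C'.nabla_smul hf hs]
    module

theorem nabla_eq_add_diffEnd (v : TangentSpace (𝓡 (2 * n)) x) {s : ∀ y, E y}
    (hs : SmoothSec n r s) : C.nabla s x v = C'.nabla s x v + F.diffEnd C C' x v (s x) := by
  rw [diffEnd_apply F C C' v hs]
  abel

theorem smooth_diffEnd : SmoothEndForm (r := r) (F.diffEnd C C') := by
  intro X hX s hs
  refine SmoothSecOn.congr (SmoothSecOn.sub (C.smooth_nabla hX hs) (C'.smooth_nabla hX hs))
    fun x _ => ?_
  exact diffEnd_apply F C C' _ hs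

theorem covEnd_compare (hΦ : SmoothEndOn n r Set.univ Φ) (v : TangentSpace (𝓡 (2 * n)) x) :
    F.covEnd C Φ x v = F.covEnd C' Φ x v
      + (F.diffEnd C C' x v * Φ x - Φ x * F.diffEnd C C' x v) := by
  refine F.end_ext fun s hs => ?_
  simp only [LinearMap.add_apply, LinearMap.sub_apply, Module.End.mul_apply]
  rw [F.covEnd_apply C hΦ hs, F.covEnd_apply C' hΦ hs, nabla_eq_add_diffEnd F C C' v hs,
    nabla_eq_add_diffEnd F C C' v (hΦ s hs), map_add]
  abel

/-- With B the difference of the connections, the new curvature is the old one plus d^∇ B + [B, B].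
-/
theorem curvEnd_compare [T2Space M] (v w : TangentSpace (𝓡 (2 * n)) x) :
    F.curvEnd C x v w = F.curvEnd C' x v w + F.dEnd C' (F.diffEnd C C') x v w
      + (F.diffEnd C C' x v * F.diffEnd C C' x w - F.diffEnd C C' x w * F.diffEnd C C' x v) := by
  refine F.end_ext fun s hs => ?_
  obtain ⟨X, hX, hXx, hX'⟩ := exists_smoothVF_extVF v
  obtain ⟨Y, hY, hYx, hY'⟩ := exists_smoothVF_extVF w
  have hB := smooth_diffEnd F C C'
  have key : ∀ (X : ∀ y : M, TangentSpace (𝓡 (2 * n)) y) (v : TangentSpace (𝓡 (2 * n)) x), SmoothVF X →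
      C.nabla (fun y => C.nabla s y (X y)) x v
        = C'.nabla (fun y => C'.nabla s y (X y)) x v
          + F.covEnd C' (fun y => F.diffEnd C C' y (X y)) x v (s x)
          + F.diffEnd C C' x (X x) (C'.nabla s x v) + F.diffEnd C C' x v (C'.nabla s x (X x))
          + F.diffEnd C C' x v (F.diffEnd C C' x (X x) (s x)) := by
    intro X v hX
    have e : (fun y => C.nabla s y (X y))
        = fun y => C'.nabla s y (X y) + F.diffEnd C C' y (X y) (s y) :=
      funext fun y => nabla_eq_add_diffEnd F C C' (X y) hs
    have h1 := C'.smooth_nabla hX hs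
    rw [nabla_eq_add_diffEnd F C C' v (C.smooth_nabla hX hs), e, C'.nabla_add h1 (hB X hX s hs),
      add_apply, F.nabla_end C' (hB X hX) hs, nabla_eq_add_diffEnd F C C' (X x) hs, map_add]
    abel
  rw [F.curvEnd_apply C v w hs, nabla_extVF C hs hX hX', nabla_extVF C hs hY hY', key X w hX,
    key Y v hY]
  simp only [LinearMap.add_apply, LinearMap.sub_apply, Module.End.mul_apply]
  rw [F.curvEnd_apply C' v w hs, nabla_extVF C' hs hX hX', nabla_extVF C' hs hY hY',
    dEnd_eq F C' hB hX hY hX' hY', hXx, hYx, LinearMap.sub_apply]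
  abel

theorem curv_compare [T2Space M] (h : IsProjOn (n := n) (r := r) U P) (hx : x ∈ U)
    (v w : TangentSpace (𝓡 (2 * n)) x) :
    curv P C x v w = curv P C' x v w + F.dCompress C' (F.diffEnd C C') P x v w
      + (P x * F.diffEnd C C' x v * P x * (P x * F.diffEnd C C' x w * P x)
        - P x * F.diffEnd C C' x w * P x * (P x * F.diffEnd C C' x v * P x)) := by
  have hcov : ∀ v, F.covEnd C P x v = F.covEnd C' P x v
      + (F.diffEnd C C' x v * P x - P x * F.diffEnd C C' x v) := by
    intro v
    obtain ⟨Φ, hΦ, hP, hid⟩ := h.exists_global hx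
    rw [F.covEnd_congr C hΦ hP, F.covEnd_congr C' hΦ hP, covEnd_compare F C C' hΦ, hP.self_of_nhds]
  have hp : ∀ v, P x * F.covEnd C' P x v * P x = 0 := fun v =>
    proj_deriv_proj (h.idem x hx) (covEnd_proj F C' h hx v)
  have h1 := proj_mixed (h.idem x hx) (hp v) (hp w) (F.diffEnd C C' x w) (F.diffEnd C C' x v)
  have h2 := proj_commutator (h.idem x hx) (F.diffEnd C C' x v) (F.diffEnd C C' x w)
  have h3 := sub_eq_iff_eq_add.1 h2.symm
  rw [curv_eq F C h hx, curv_eq F C' h hx, curvEnd_compare F C C', hcov, hcov, SecFrame.dCompress,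
    ← h1, h3]
  noncomm_ring

/-- The quadratic part of the difference is a commutator, so only the compressed exterior derivative
contributes to the trace. With `trace_dCompress` the first Chern forms of two connections differ by
an exact form. -/
theorem trace_curv_compare [T2Space M] (h : IsProjOn (n := n) (r := r) U P) (hx : x ∈ U)
    (v w : TangentSpace (𝓡 (2 * n)) x) :
    LinearMap.trace ℂ (E x) (curv P C x v w) = LinearMap.trace ℂ (E x) (curv P C' x v w)
      + LinearMap.trace ℂ (E x) (F.dCompress C' (F.diffEnd C C') P x v w) := by
  rw [curv_compare F C C' h hx, map_add, map_add, map_sub, LinearMap.trace_mul_comm, sub_self,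
    add_zero]

end CompareConnections

/-! ### Pointwise formula for the degree density. -/

section Densities

open Filter Topology

variable {n r : ℕ} {M : Type*} [TopologicalSpace M] [ChartedSpace (W n) M]
  [IsManifold (𝓡 (2 * n)) ∞ M]
  {E : M → Type*} [TopologicalSpace (TotalSpace (EuclideanSpace ℂ (Fin r)) E)]
  [∀ x, NormedAddCommGroup (E x)] [∀ x, InnerProductSpace ℂ (E x)]
  [FiberBundle (EuclideanSpace ℂ (Fin r)) E]
  [VectorBundle ℂ (EuclideanSpace ℂ (Fin r)) E] [VectorBundle ℝ (EuclideanSpace ℂ (Fin r)) E]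
  [ContMDiffVectorBundle ∞ (EuclideanSpace ℂ (Fin r)) E (𝓡 (2 * n))]
  (F : SecFrame n r E) (C C' : CConnection n r E) (D : GenConnection n r E)
  (K : GenKaehlerSympl n M) {P Φ : ∀ x, Module.End ℂ (E x)} {x : M} {U : Set M}

/-- The `U^{-n}`-component of `(tr F_A) · ψ`. -/
noncomputable def curvTrace (P : ∀ x, Module.End ℂ (E x)) (x : M) : ℂ :=
  (1 / 2 : ℂ) * ∑ i, ∑ j, (K.pt x).projDx i j *
    LinearMap.trace ℂ (E x) (curv P C x (stdVec i) (stdVec j))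

/-- The `U^{-n}`-component of `dτ · ψ` for a complex one-form `τ`. -/
noncomputable def contractD (τ : ∀ x : M, TangentSpace (𝓡 (2 * n)) x → ℂ) (x : M) : ℂ :=
  (1 / 2 : ℂ) * ∑ i, ∑ j, (K.pt x).projDx i j *
    (mvfderiv (𝓡 (2 * n)) (fun y => τ y (extVF (x := x) (stdVec j) y)) x (stdVec i)
      - mvfderiv (𝓡 (2 * n)) (fun y => τ y (extVF (x := x) (stdVec i) y)) x (stdVec j))

theorem mukai_psi_ne_zero (x : M) :
    mukai (psi (K.b x) (K.om x)) (psiBar (K.b x) (K.om x)) ≠ 0 := by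
  exact (mukai_psi (K.b x) (K.om x)).trans_ne (topCoeff_chi_ne_zero (K.om_form.alt x) (K.om_nondeg x))

/-- The factor √-1 ^ (n - 1), written -√-1 · √-1 ^ n, meets the √-1 / 2π of the Chern form, and the
constant 1 / 2π is left. -/
theorem degree_integrand (P : ∀ x, Module.End ℂ (E x)) (x : M) :
    -Complex.I * Complex.I ^ n * mukai (chernForm P C x * psi (K.b x) (K.om x)) (psiBar (K.b x) (K.om x))
      / (Complex.I ^ n * mukai (psi (K.b x) (K.om x)) (psiBar (K.b x) (K.om x)))
      = (1 / (2 * Real.pi) : ℂ) * curvTrace C K P x := by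
  have h0 := mukai_psi_ne_zero K x
  have hI : Complex.I ^ n ≠ 0 := pow_ne_zero _ Complex.I_ne_zero
  have h1 : projU (K.b x) (K.om x) (chernForm P C x * psi (K.b x) (K.om x))
      = Complex.I / (2 * Real.pi) * curvTrace C K P x := by
    simp only [chernForm, curvTrace, smul_mul_assoc, Finset.sum_mul, map_smul, map_sum, smul_eq_mul,
      Finset.mul_sum]
    refine Finset.sum_congr rfl fun i _ => Finset.sum_congr rfl fun j _ => ?_
    change _ * (_ * (K.pt x).projDx i j) = _
    ring
  replace h1 := (projU_apply (K.b x) (K.om x) _).symm.trans h1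
  have h2 : mukai (chernForm P C x * psi (K.b x) (K.om x)) (psiBar (K.b x) (K.om x))
      = mukai (psi (K.b x) (K.om x)) (psiBar (K.b x) (K.om x))
        * (Complex.I / (2 * Real.pi) * curvTrace C K P x) := by
    have h3 : topCoeff (chi (K.om x)) ≠ 0 :=
      topCoeff_chi_ne_zero (K.om_form.alt x) (K.om_nondeg x)
    refine (mukai_mul_psi (K.b x) (K.om x) _).trans
      (Eq.trans ?_ (congrArg (fun z => z * _) (mukai_psi (K.b x) (K.om x)).symm))
    change _ = _ * _
    rw [← h1, mul_inv_cancel_left₀ h3]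
  rw [h2]
  field_simp
  ring_nf
  simp

theorem curvTrace_compare [T2Space M] (hD : D.IsHermitian) (h : IsProjOn (n := n) (r := r) U P)
    (hx : x ∈ U) : curvTrace C K P x = curvTrace D.toCConnection K P x
      + contractD K (fun y v => LinearMap.trace ℂ (E y) (P y * F.diffEnd C D.toCConnection y v)) x := by
  have h1 : ∀ i j, LinearMap.trace ℂ (E x) (curv P C x (stdVec i) (stdVec j)) = _ := fun i j =>
    (trace_curv_compare F C D.toCConnection h hx (stdVec i) (stdVec j)).trans
      (congrArg _ (trace_dCompress F D h hx hD (smooth_diffEnd F C D.toCConnection) (stdVec i) (stdVec j)))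
  simp only [curvTrace, contractD, h1, mul_add, Finset.sum_add_distrib]

/-- The term [V · V] is traceless and d^A θ contributes an exact form, so up to the latter the trace
is the degree density. -/
theorem trace_curvU [T2Space M] (F : SecFrame n r E) (hD : D.IsHermitian) (h : IsProjOn (n := n) (r := r) U P)
    (hx : x ∈ U) : LinearMap.trace ℂ (E x) (curvU K P D x) = curvTrace D.toCConnection K P x
      + contractD K (fun y v => LinearMap.trace ℂ (E y) (P y * thetaForm D K y v)) x := by
  have h1 : ∀ i j, LinearMap.trace ℂ (E x) (dTheta K P D x (stdVec i) (stdVec j)) = _ := fun i j =>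
    (congrArg _ (dTheta_eq F D K h hx (stdVec i) (stdVec j))).trans
      (trace_dCompress F D h hx hD (smooth_thetaForm D K) (stdVec i) (stdVec j))
  rw [curvU_eq]
  simp only [map_add, map_smul, map_sum, map_sub, h1, curvTrace, contractD, smul_eq_mul, mul_add,
    Finset.sum_add_distrib]
  have h2 : ∀ A B : Module.End ℂ (E x), LinearMap.trace ℂ (E x) (A * B)
      - LinearMap.trace ℂ (E x) (B * A) = 0 := fun A B => by
    rw [LinearMap.trace_mul_comm, sub_self]
  simp [h2]

/-- The second fundamental form term. -/
noncomputable def SecFrame.defect (P : ∀ x, Module.End ℂ (E x)) (x : M) : ℝ :=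
  (1 / 2) * pairTr ((PointKaehler.trRe (P x) (F.totalDeriv D P x)).compl₁₂
    (-((K.pt x).J ∘ₗ (K.pt x).Jψ)) LinearMap.id)

/-- The real part of ⟨u, T u⟩ depends only on the Hermitian part of T, which is λ; the rank enters
as the trace of the projection A. -/
theorem re_trace_einstein {lam : ℝ} (hEH : IsEinsteinHermitian K (fun _ => 1) D lam) {A : Module.End ℂ (E x)}
    (hA : A * A = A) (hs : ∀ u w, inner ℂ (A u) w = inner ℂ u (A w)) :
    (LinearMap.trace ℂ (E x) (A * curvU K (fun _ => 1) D x * A)).re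
      = lam * finrank ℂ (LinearMap.range A) := by
  have := finiteDimensional_fibre r (E := E) x
  have htr : LinearMap.trace ℂ (E x) A = finrank ℂ (LinearMap.range A) := by
    exact (LinearMap.IsIdempotentElem.isProj_range A hA).trace
  set T := curvU K (fun _ => 1) D x
  set e := stdOrthonormalBasis ℂ (E x)
  have h1 : ∀ i, (inner ℂ (e i) ((A * T * A) (e i))).re = lam * (inner ℂ (e i) (A (e i))).re := by
    intro i
    have h2 := hEH x (A (e i)) (A (e i))
    have h3 : inner ℂ (T (A (e i))) (A (e i)) = (starRingEnd ℂ) (inner ℂ (A (e i)) (T (A (e i)))) :=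
      (inner_conj_symm _ _).symm
    have h4 : inner ℂ (A (e i)) (A (e i)) = inner ℂ (e i) (A (e i)) := by
      rw [hs, ← Module.End.mul_apply, hA]
    change (1 / 2 : ℂ) * (inner ℂ (A (e i)) (T (A (e i))) + inner ℂ (T (A (e i))) (A (e i)))
      = lam * inner ℂ (A (e i)) (A (e i)) at h2
    rw [h3, Complex.add_conj, h4] at h2
    have h5 : inner ℂ (e i) ((A * T * A) (e i)) = inner ℂ (A (e i)) (T (A (e i))) := by
      rw [hs]; rfl
    rw [h5]
    have h6 := congrArg Complex.re h2
    rw [← h6.trans (Complex.re_ofReal_mul _ _)]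
    norm_num
    ring
  have h2 := congrArg Complex.re htr
  rw [LinearMap.trace_eq_sum_inner A e, Complex.re_sum] at h2
  rw [LinearMap.trace_eq_sum_inner _ e, Complex.re_sum, Finset.sum_congr rfl fun i _ => h1 i,
    ← Finset.mul_sum, h2]
  simp

/-- The pointwise form of the degree formula: the Gauss equation, the Einstein–Hermitian condition
and the trace of the quadratic term combined. Holomorphy is required only at x and on the image of
P, so it may hold just almost everywhere. -/
theorem re_curvTrace [T2Space M] {lam : ℝ} (hD : D.IsHermitian)
    (hEH : IsEinsteinHermitian K (fun _ => 1) D lam) (h : IsProjOn (n := n) (r := r) U P)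
    (hsymm : ∀ x ∈ U, ∀ u w, inner ℂ (P x u) w = inner ℂ u (P x w)) (hx : x ∈ U)
    (hol : ∀ a : GT n x, (1 - P x) * (F.totalDeriv D P x a + Complex.I • F.totalDeriv D P x (K.J x a)) * P x = 0) :
    (curvTrace D.toCConnection K P x).re = lam * finrank ℂ (LinearMap.range (P x)) - F.defect D K P x
      - (contractD K (fun y v => LinearMap.trace ℂ (E y) (P y * thetaForm D K y v)) x).re := by
  have := finiteDimensional_fibre r (E := E) x
  have h1 := congrArg Complex.re (trace_curvU D K F hD h hx)
  have hP := h.idem x hx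
  have h2 := PointKaehler.re_trace_quad (Q := K.pt x) (hsymm x hx)
    (isSymm_totalDeriv F D hD h hsymm hx) (proj_totalDeriv_proj F D h hx) hol
  have h3 : LinearMap.trace ℂ (E x) (P x * (K.pt x).quad (F.totalDeriv D P x) * P x)
      = LinearMap.trace ℂ (E x) (P x * (K.pt x).quad (F.totalDeriv D P x)) := by
    rw [LinearMap.trace_mul_comm, ← mul_assoc, hP]
  rw [curvU_eq_quad F D K h hx, map_add, h3, Complex.add_re, re_trace_einstein D K hEH hP (hsymm x hx),
    Complex.add_re, h2] at h1
  rw [SecFrame.defect]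
  linarith

theorem defect_nonneg [T2Space M] (hD : D.IsHermitian) (h : IsProjOn (n := n) (r := r) U P)
    (hsymm : ∀ x ∈ U, ∀ u w, inner ℂ (P x u) w = inner ℂ u (P x w)) (hx : x ∈ U) :
    0 ≤ F.defect D K P x := by
  have := finiteDimensional_fibre r (E := E) x
  have := (PointKaehler.pairTr_trRe_nonneg (Q := K.pt x) (hsymm x hx) (h.idem x hx)
    (isSymm_totalDeriv F D hD h hsymm hx)).1
  rw [SecFrame.defect]
  linarith

/-- Positivity gives R P = 0, taking adjoints gives P R = 0, and R = R P + P R because both ∇ and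
[V, ·] act as derivations on P² = P. -/
theorem totalDeriv_eq_zero [T2Space M] (hD : D.IsHermitian) (h : IsProjOn (n := n) (r := r) U P)
    (hsymm : ∀ x ∈ U, ∀ u w, inner ℂ (P x u) w = inner ℂ u (P x w)) (hx : x ∈ U)
    (h0 : F.defect D K P x = 0) (a : GT n x) : F.totalDeriv D P x a = 0 := by
  have := finiteDimensional_fibre r (E := E) x
  have hR := isSymm_totalDeriv F D hD h hsymm hx a
  have h1 : F.totalDeriv D P x a * P x = 0 :=
    (PointKaehler.pairTr_trRe_nonneg (Q := K.pt x) (hsymm x hx) (h.idem x hx)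
      (isSymm_totalDeriv F D hD h hsymm hx)).2 (by rw [SecFrame.defect] at h0; linarith) a
  have h2 : P x * F.totalDeriv D P x a = 0 := by
    ext u
    refine ext_inner_left ℂ fun w => ?_
    rw [Module.End.mul_apply, ← hsymm x hx, ← hR, ← Module.End.mul_apply, h1]
    simp
  have h3 : F.totalDeriv D P x a = F.totalDeriv D P x a * P x + P x * F.totalDeriv D P x a := by
    have hP := h.idem x hx
    have e1 := covEnd_proj F D.toCConnection h hx a.1
    have e2 : (D.vec x a.2 * P x - P x * D.vec x a.2) * P x
        + P x * (D.vec x a.2 * P x - P x * D.vec x a.2)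
        = D.vec x a.2 * (P x * P x) - (P x * P x) * D.vec x a.2 := by noncomm_ring
    rw [hP] at e2
    rw [totalDeriv_apply]
    generalize D.vec x a.2 * P x - P x * D.vec x a.2 = c at e2 ⊢
    generalize F.covEnd D.toCConnection P x a.1 = p at e1 ⊢
    calc p + c = (p * P x + P x * p) + (c * P x + P x * c) := by rw [← e1, e2]
      _ = _ := by noncomm_ring
  rw [h3, h1, h2, add_zero]

theorem hol_of_isGenHolSubbundle {p : ℕ} (h : IsGenHolSubbundle K.J D P p) (x : M) (a : GT n x) :
    (1 - P x) * (F.totalDeriv D P x a + Complex.I • F.totalDeriv D P x (K.J x a)) = 0 := by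
  refine F.end_ext fun s hs => ?_
  have h1 := h.hol s hs x a
  have hid : ∀ u, P x (P x u) = P x u := h.idem x
  simp only [GenConnection.dbar, GenConnection.along] at h1
  rw [F.nabla_end _ h.smooth hs, F.nabla_end _ h.smooth hs] at h1
  simp only [map_add, map_smul, hid] at h1
  rw [totalDeriv_apply, totalDeriv_apply]
  simp only [LinearMap.add_apply, LinearMap.sub_apply, Module.End.mul_apply, LinearMap.smul_apply,
    Module.End.one_apply, map_add, map_sub, map_smul, hid, LinearMap.zero_apply]
  refine Eq.trans ?_ (sub_eq_zero.2 h1.symm)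
  module

end Densities
end GenKaehler

namespace GenKaehler

/-! ### The volume measure in charts. -/

section Volume

open Filter Topology

variable {n : ℕ} {M : Type*} [TopologicalSpace M] [ChartedSpace (W n) M]
  [IsManifold (𝓡 (2 * n)) ∞ M] (K : GenKaehlerSympl n M)

theorem contMDiffOn_twoForm_coordField [T2Space M] {β : Bilin n M} (hβ : IsSmoothTwoForm β) (c : M)
    (v w : W n) : ContMDiffOn (𝓡 (2 * n)) 𝓘(ℝ, ℝ) ∞
      (fun y => β y (coordField c v y) (coordField c w y)) (chartE (n := n) c).source := by
  intro y hy
  obtain ⟨X, hX, hX'⟩ := exists_smoothVF_coordField hy v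
  obtain ⟨Y, hY, hY'⟩ := exists_smoothVF_coordField hy w
  refine ((hβ.smooth X Y hX hY y).congr_of_eventuallyEq ?_).contMDiffWithinAt
  filter_upwards [hX', hY'] with z h1 h2
  rw [h1, h2]

/-- The coordinate expression of the symplectic form. -/
noncomputable def pullOm (c : M) (p : W n) : W n →L[ℝ] W n →L[ℝ] ℝ :=
  ContinuousLinearMap.bilinearComp (E := W n) (F := W n) (K.om ((chartE (n := n) c).symm p))
    (chartTangent c p) (chartTangent c p)

theorem pullOm_apply {c : M} {p : W n} (hp : p ∈ (chartE (n := n) c).target) (v w : W n) :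
    pullOm K c p v w = K.om ((chartE (n := n) c).symm p)
      (coordField c v ((chartE c).symm p)) (coordField c w ((chartE c).symm p)) := by
  rw [← chartTangent_eq hp, ← chartTangent_eq hp]
  rfl

theorem contDiffOn_pullOm [T2Space M] (c : M) :
    ContDiffOn ℝ ∞ (pullOm K c) (chartE (n := n) c).target := by
  rw [contDiffOn_clm_apply]
  intro v
  rw [contDiffOn_clm_apply]
  intro w
  refine ((contDiffOn_chart (contMDiffOn_twoForm_coordField K.om_form c v w) c).mono
    fun p hp => ⟨hp, (chartE c).map_target hp⟩).congr fun p hp => pullOm_apply K hp v w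

theorem pullOm_alt (c : M) (p v : W n) : pullOm K c p v v = 0 := K.om_form.alt _ _

theorem pullOm_nondeg {c : M} {p : W n} (hp : p ∈ (chartE (n := n) c).target) (v : W n)
    (h : ∀ w, pullOm K c p v w = 0) : v = 0 := by
  have hx := (chartE (n := n) c).map_target hp
  have h1 : coordField c v ((chartE c).symm p) = 0 := by
    refine K.om_nondeg _ _ fun w => ?_
    have h2 := h (coordOf c w)
    rwa [pullOm_apply K hp, coordField_coordOf hx] at h2
  have h3 := coordOf_coordField hx v
  have h4 := coordOf_coordField hx (0 : W n)
  have h5 : coordField c (0 : W n) ((chartE c).symm p) = 0 := by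
    rw [← chartTangent_eq hp, map_zero]
  rw [h1, ← h5, h4] at h3
  exact h3.symm

/-- The coefficient of the volume form in a chart. -/
noncomputable def volCoeff (c : M) (p : W n) : ℂ := topCoeff (chi (pullOm K c p))

theorem volCoeff_ne_zero {c : M} {p : W n} (hp : p ∈ (chartE (n := n) c).target) :
    volCoeff K c p ≠ 0 :=
  topCoeff_chi_ne_zero (pullOm_alt K c p) (pullOm_nondeg K hp)

theorem contDiffOn_volCoeff [T2Space M] (c : M) :
    ContDiffOn ℝ ∞ (volCoeff K c) (chartE (n := n) c).target :=
  contDiff_topCoeff_chi.comp_contDiffOn (contDiffOn_pullOm K c)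

theorem volDensity_eq (c : M) (p : W n) : volDensity K c p = ‖volCoeff K c p‖ := by
  have h := topCoeff_chi_pull (n := n) (chartTangent c p) (K.om ((chartE (n := n) c).symm p))
  have h1 := mukai_psi (n := n) (K.b ((chartE (n := n) c).symm p)) (K.om ((chartE (n := n) c).symm p))
  have h2 : volCoeff K c p = _ := h
  rw [h2, norm_mul, ← h1, Complex.norm_real, Real.norm_eq_abs, volDensity]
  simp only [norm_mul, norm_pow, Complex.norm_I, one_pow, one_mul]
  exact mul_comm _ _

/-- The norm is smooth away from zero, and the volume coefficient never vanishes. -/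
theorem contDiffOn_volDensity [T2Space M] (c : M) :
    ContDiffOn ℝ ∞ (volDensity K c) (chartE (n := n) c).target := by
  refine ((contDiffOn_volCoeff K c).norm ℂ fun p hp => volCoeff_ne_zero K hp).congr
    fun p _ => volDensity_eq K c p

theorem volDensity_pos {c : M} {p : W n} (hp : p ∈ (chartE (n := n) c).target) :
    0 < volDensity K c p := by
  rw [volDensity_eq]
  exact norm_pos_iff.2 (volCoeff_ne_zero K hp)

section ChangeOfCharts

variable (c c' : M)

theorem isOpen_overlap : IsOpen ((chartE (n := n) c).target ∩ (chartE c).symm ⁻¹' (chartE (n := n) c').source) :=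
  (continuousOn_extChartAt_symm (I := 𝓡 (2 * n)) c).isOpen_inter_preimage
    (isOpen_chartE_target c) (isOpen_chartE_source c')

theorem differentiableAt_transition {p : W n} (hp : p ∈ (chartE (n := n) c).target)
    (hp' : (chartE (n := n) c).symm p ∈ (chartE (n := n) c').source) :
    DifferentiableAt ℝ (chartE (n := n) c' ∘ (chartE (n := n) c).symm) p := by
  have h := contDiffOn_chart (F := W n) (f := chartE (n := n) c')
    (contMDiffOn_extChartAt (I := 𝓡 (2 * n)) (n := ∞) (x := c')) c
  rw [← extChartAt_source (𝓡 (2 * n))] at h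
  exact (h.contDiffAt ((isOpen_overlap c c').mem_nhds ⟨hp, hp'⟩)).differentiableAt (by simp)

theorem fderiv_transition {p : W n} (hp : p ∈ (chartE (n := n) c).target)
    (hp' : (chartE (n := n) c).symm p ∈ (chartE (n := n) c').source) (v : W n) :
    fderiv ℝ (chartE (n := n) c' ∘ (chartE (n := n) c).symm) p v
      = coordOf c' (coordField c v ((chartE (n := n) c).symm p)) := by
  set x := (chartE (n := n) c).symm p with hx
  have hxs : x ∈ (chartE (n := n) c).source := (chartE c).map_target hp
  have hd : MDifferentiableAt (𝓡 (2 * n)) 𝓘(ℝ, W n) (chartE (n := n) c') x :=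
    (contMDiffAt_extChartAt' (n := ∞) (by simpa using hp')).mdifferentiableAt (by simp)
  have h1 := mvfderiv_coordField hxs hd v
  rw [hx, (chartE c).right_inv hp] at h1
  rw [← h1, mvfderiv_eq_coordOf hp' hd]
  have h2 : (chartE (n := n) c' ∘ (chartE (n := n) c').symm) =ᶠ[𝓝 (chartE c' x)] id := by
    filter_upwards [(isOpen_chartE_target c').mem_nhds ((chartE c').map_source hp')] with q hq
    exact (chartE c').right_inv hq
  rw [h2.fderiv_eq, fderiv_id]
  rfl

/-- The chain rule for the chart differentials, after taking determinants. -/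
theorem volDensity_transition {p : W n} (hp : p ∈ (chartE (n := n) c).target)
    (hp' : (chartE (n := n) c).symm p ∈ (chartE (n := n) c').source) :
    volDensity K c p = |(fderiv ℝ (chartE (n := n) c' ∘ (chartE (n := n) c).symm) p).det|
      * volDensity K c' (chartE c' ((chartE (n := n) c).symm p)) := by
  have hq := (chartE c').map_source hp'
  have hl := (chartE c').left_inv hp'
  have hA : (chartTangent c p : W n →L[ℝ] W n)
      = (chartTangent c' (chartE c' ((chartE (n := n) c).symm p)) : W n →L[ℝ] W n) ∘L
        fderiv ℝ (chartE (n := n) c' ∘ (chartE (n := n) c).symm) p := by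
    have key : ∀ (x' x : M) (v : W n), x' = x → x ∈ (chartE (n := n) c').source →
        (coordField c' (coordOf c' (coordField c v x)) x' : W n) = coordField c v x := by
      rintro x' x v rfl hx
      exact coordField_coordOf hx _
    refine ContinuousLinearMap.ext fun v => ?_
    refine Eq.trans ?_ (congrArg (fun z => (chartTangent c' (chartE c' ((chartE (n := n) c).symm p)) z : W n))
      (fderiv_transition c c' hp hp' v).symm)
    exact (chartTangent_eq hp v).trans ((key _ _ v hl hp').symm.trans (chartTangent_eq hq _).symm)
  have hdet : LinearMap.det (M := W n) (chartTangent c p).toLinearMap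
      = LinearMap.det (M := W n) (chartTangent c' (chartE c' ((chartE (n := n) c).symm p))).toLinearMap
        * (fderiv ℝ (chartE (n := n) c' ∘ (chartE (n := n) c).symm) p).det := by
    refine (congrArg (fun A : W n →L[ℝ] W n => LinearMap.det (A : W n →ₗ[ℝ] W n)) hA).trans ?_
    exact LinearMap.det_comp (M := W n) _ _
  simp only [volDensity]
  rw [hdet, abs_mul]
  have h3 : ∀ x' x : M, x' = x → ‖Complex.I ^ n * mukai (psi (K.b x') (K.om x')) (psiBar (K.b x') (K.om x'))‖
      = ‖Complex.I ^ n * mukai (psi (K.b x) (K.om x)) (psiBar (K.b x) (K.om x))‖ := by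
    rintro x' x rfl; rfl
  rw [h3 _ _ hl]
  ring

end ChangeOfCharts

variable [MeasurableSpace M] [BorelSpace M]

theorem aemeasurable_chart_symm (c : M) :
    AEMeasurable (chartE (n := n) c).symm (volume.restrict (chartE (n := n) c).target) :=
  (continuousOn_extChartAt_symm c).aemeasurable (isOpen_chartE_target c).measurableSet

theorem measurableSet_chart_preimage (c : M) {A : Set M} (hA : MeasurableSet A) :
    MeasurableSet ((chartE (n := n) c).symm ⁻¹' A ∩ (chartE (n := n) c).target) := by
  classical
  have h1 : Measurable ((chartE (n := n) c).target.piecewise (chartE (n := n) c).symm fun _ => c) :=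
    ContinuousOn.measurable_piecewise (continuousOn_extChartAt_symm c) continuousOn_const
      (isOpen_chartE_target c).measurableSet
  have h2 := (h1 hA).inter (isOpen_chartE_target (n := n) c).measurableSet
  convert h2 using 1
  ext p
  simp only [Set.mem_inter_iff, Set.mem_preimage]
  refine and_congr_left fun hp => ?_
  rw [Set.piecewise_eq_of_mem _ _ _ hp]

/-- The volume measure on the domain of a chart. -/
noncomputable def chartMeasure (c : M) : Measure M :=
  Measure.map (chartE (n := n) c).symm ((volume.restrict (chartE (n := n) c).target).withDensity
    (fun y => ENNReal.ofReal (volDensity K c y)))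

theorem map_withDensity_apply (c : M) (f : W n → ENNReal) {A : Set M} (hA : MeasurableSet A) :
    Measure.map (chartE (n := n) c).symm
        ((volume.restrict (chartE (n := n) c).target).withDensity f) A
      = ∫⁻ y in (chartE (n := n) c).symm ⁻¹' A ∩ (chartE (n := n) c).target, f y := by
  rw [Measure.map_apply_of_aemeasurable ((aemeasurable_chart_symm c).mono_ac
    (withDensity_absolutelyContinuous _ _)) hA, withDensity_apply',
    Measure.restrict_restrict' (isOpen_chartE_target c).measurableSet]

/-- The change of variables formula for the transition map. The weight ρ is supported in the second
chart, so the set A need lie only in the first. -/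
theorem lintegral_change_chart (c c' : M) (ρ : M → ℝ) (hρ : ∀ x, 0 ≤ ρ x) (hρs : ∀ x, x ∉ (chartE (n := n) c').source → ρ x = 0)
    {A : Set M} (hA : MeasurableSet A) (hAc : A ⊆ (chartE (n := n) c).source) :
    ∫⁻ y in (chartE (n := n) c').symm ⁻¹' A ∩ (chartE (n := n) c').target,
        ENNReal.ofReal (ρ ((chartE (n := n) c').symm y) * volDensity K c' y)
      = ∫⁻ y in (chartE (n := n) c).symm ⁻¹' A ∩ (chartE (n := n) c).target,
        ENNReal.ofReal (ρ ((chartE (n := n) c).symm y) * volDensity K c y) := by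
  set φ := chartE (n := n) c' ∘ (chartE (n := n) c).symm
  set B := (chartE (n := n) c).symm ⁻¹' A ∩ (chartE (n := n) c).target
  set O := (chartE (n := n) c).symm ⁻¹' (chartE (n := n) c').source ∩ (chartE (n := n) c).target
  have hB : MeasurableSet B := measurableSet_chart_preimage c hA
  have hO : MeasurableSet O := measurableSet_chart_preimage c (isOpen_chartE_source c').measurableSet
  have himg : φ '' (B ∩ O) = (chartE (n := n) c').symm ⁻¹' A ∩ (chartE (n := n) c').target := by
    ext q
    constructor
    · rintro ⟨p, ⟨⟨hp1, hp2⟩, hp3, -⟩, rfl⟩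
      refine ⟨?_, (chartE c').map_source hp3⟩
      change (chartE (n := n) c').symm (chartE c' _) ∈ A
      rwa [(chartE c').left_inv hp3]
    · rintro ⟨hq1, hq2⟩
      have h1 : (chartE (n := n) c').symm q ∈ (chartE (n := n) c).source := hAc hq1
      have h2 := (chartE (n := n) c).left_inv h1
      have h3 := (chartE (n := n) c).map_source h1
      refine ⟨chartE c ((chartE (n := n) c').symm q), ⟨⟨?_, h3⟩, ?_, h3⟩, ?_⟩
      · change (chartE (n := n) c).symm _ ∈ A
        rwa [h2]
      · change (chartE (n := n) c).symm _ ∈ (chartE (n := n) c').source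
        rw [h2]
        exact (chartE c').map_target hq2
      · change chartE c' ((chartE (n := n) c).symm _) = q
        rw [h2, (chartE c').right_inv hq2]
  have hinj : Set.InjOn φ (B ∩ O) := by
    rintro p ⟨⟨-, hp2⟩, hp3, -⟩ q ⟨⟨-, hq2⟩, hq3, -⟩ h
    exact (chartE (n := n) c).symm.injOn hp2 hq2 ((chartE (n := n) c').injOn hp3 hq3 h)
  rw [← himg, lintegral_image_eq_lintegral_abs_det_fderiv_mul volume (hB.inter hO)
    (fun p hp => (differentiableAt_transition c c' hp.2.2 hp.2.1).hasFDerivAt.hasFDerivWithinAt) hinj,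
    ← lintegral_inter_add_diff _ B hO]
  -- Outside the overlap of the charts the weight vanishes.
  have h0 : ∫⁻ y in B \ O, ENNReal.ofReal (ρ ((chartE (n := n) c).symm y) * volDensity K c y) = 0 := by
    rw [setLIntegral_congr_fun (g := fun _ => 0) (hB.diff hO) fun p hp => ?_]
    · simp
    · have : (chartE (n := n) c).symm p ∉ (chartE (n := n) c').source := fun h => hp.2 ⟨h, hp.1.2⟩
      change ENNReal.ofReal _ = 0
      rw [hρs _ this, zero_mul, ENNReal.ofReal_zero]
  rw [h0, add_zero]
  refine setLIntegral_congr_fun (hB.inter hO) fun p hp => ?_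
  change ENNReal.ofReal _ * ENNReal.ofReal (ρ ((chartE (n := n) c').symm (chartE c' _)) * _) = _
  rw [← ENNReal.ofReal_mul (abs_nonneg _), (chartE c').left_inv hp.2.1,
    volDensity_transition K c c' hp.2.2 hp.2.1]
  congr 1
  change _ * (_ * volDensity K c' (chartE c' _)) = _
  ring

variable [CompactSpace M] [T2Space M]

/-- All pieces of the partition of unity are transported into the one chart, where their weights sum
to one. From here on the partition in the definition of `vol` plays no role. -/
theorem vol_restrict_chart (c : M) :
    (vol K).restrict (chartE (n := n) c).source = chartMeasure K c := by
  set ρ := Classical.choose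
    (SmoothPartitionOfUnity.exists_isSubordinate_chartAt_source (𝓡 (2 * n)) M) with hρdef
  have hρ : ρ.IsSubordinate fun x => (chartAt (W n) x).source := Classical.choose_spec
    (SmoothPartitionOfUnity.exists_isSubordinate_chartAt_source (𝓡 (2 * n)) M)
  have hsupp : ∀ c' x, x ∉ (chartE (n := n) c').source → ρ c' x = 0 := by
    intro c' x hx
    by_contra h
    refine hx ?_
    rw [extChartAt_source]
    exact hρ c' (subset_tsupport _ h)
  have hfin := ρ.locallyFinite.finite_nonempty_of_compact
  set T := hfin.toFinset
  have hT : ∀ c', c' ∉ T → ∀ x, ρ c' x = 0 := by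
    intro c' hc' x
    by_contra h
    exact hc' (hfin.mem_toFinset.2 ⟨x, h⟩)
  ext A hA
  rw [Measure.restrict_apply hA]
  have hAs := hA.inter (isOpen_chartE_source (n := n) c).measurableSet
  have hset : (chartE (n := n) c).symm ⁻¹' (A ∩ (chartE (n := n) c).source) ∩ (chartE (n := n) c).target
      = (chartE (n := n) c).symm ⁻¹' A ∩ (chartE (n := n) c).target := by
    ext p
    refine ⟨fun h => ⟨h.1.1, h.2⟩, fun h => ⟨⟨h.1, (chartE c).map_target h.2⟩, h.2⟩⟩
  have hB := measurableSet_chart_preimage (n := n) c hA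
  rw [chartMeasure, map_withDensity_apply c _ hA, vol, Measure.sum_apply _ hAs]
  simp only [← hρdef]
  have h1 : ∀ c', Measure.map (chartE (n := n) c').symm
      ((volume.restrict (chartE (n := n) c').target).withDensity
        (fun y => ENNReal.ofReal (ρ c' ((chartE (n := n) c').symm y) * volDensity K c' y)))
        (A ∩ (chartE (n := n) c).source)
      = ∫⁻ y in (chartE (n := n) c).symm ⁻¹' A ∩ (chartE (n := n) c).target,
        ENNReal.ofReal (ρ c' ((chartE (n := n) c).symm y) * volDensity K c y) := by
    intro c'
    rw [map_withDensity_apply c' _ hAs, lintegral_change_chart K c c' (ρ c') (ρ.nonneg c')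
      (hsupp c') hAs Set.inter_subset_right, hset]
  rw [tsum_congr h1, tsum_eq_sum (s := T) fun c' hc' => by simp [hT c' hc'],
    ← lintegral_finsetSum']
  · refine setLIntegral_congr_fun hB fun p hp => ?_
    have hpos := (volDensity_pos K hp.2).le
    change ∑ c' ∈ T, ENNReal.ofReal _ = _
    rw [← ENNReal.ofReal_sum_of_nonneg fun c' _ => mul_nonneg (ρ.nonneg c' _) hpos, ← Finset.sum_mul]
    have h2 : ∑ c' ∈ T, ρ c' ((chartE (n := n) c).symm p) = 1 := by
      rw [← ρ.sum_eq_one (Set.mem_univ ((chartE (n := n) c).symm p))]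
      refine (finsum_eq_sum_of_support_subset _ fun c' hc' => ?_).symm
      by_contra h
      exact hc' (hT c' h _)
    rw [h2, one_mul]
  · intro c' _
    have hcont : ContinuousOn (fun y => ρ c' ((chartE (n := n) c).symm y) * volDensity K c y)
        (chartE (n := n) c).target :=
      ((ρ c').contMDiff.continuous.comp_continuousOn (continuousOn_extChartAt_symm c)).mul
        (contDiffOn_volDensity K c).continuousOn
    exact ((hcont.mono Set.inter_subset_right).aemeasurable hB).ennreal_ofReal

end Volume
end GenKaehler

namespace GenKaehler

/-! ### Integration in charts, finiteness and positivity on open sets. -/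

section VolumeIntegral

open Filter Topology

variable {n : ℕ} {M : Type*} [TopologicalSpace M] [ChartedSpace (W n) M]
  [IsManifold (𝓡 (2 * n)) ∞ M] (K : GenKaehlerSympl n M)
  [MeasurableSpace M] [BorelSpace M] [CompactSpace M] [T2Space M]

theorem aemeasurable_volDensity (c : M) : AEMeasurable (fun y => ENNReal.ofReal (volDensity K c y))
    (volume.restrict (chartE (n := n) c).target) :=
  ((contDiffOn_volDensity K c).continuousOn.aemeasurable
    (isOpen_chartE_target c).measurableSet).ennreal_ofReal

theorem volDensity_toReal (c : M) :
    ∀ᵐ y ∂volume.restrict (chartE (n := n) c).target,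
      (ENNReal.ofReal (volDensity K c y)).toReal = volDensity K c y := by
  filter_upwards [ae_restrict_mem (isOpen_chartE_target c).measurableSet] with y hy
  exact ENNReal.toReal_ofReal (volDensity_pos K hy).le

theorem aemeasurable_symm_withDensity (c : M) : AEMeasurable (chartE (n := n) c).symm
    ((volume.restrict (chartE (n := n) c).target).withDensity
      (fun y => ENNReal.ofReal (volDensity K c y))) :=
  (aemeasurable_chart_symm c).mono_ac (withDensity_absolutelyContinuous _ _)

/-- The density is positive, so null sets for the volume are Lebesgue null sets in every chart. -/
theorem ae_chart (c : M) {p : M → Prop} (h : ∀ᵐ x ∂vol K, p x) :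
    ∀ᵐ y ∂volume.restrict (chartE (n := n) c).target, p ((chartE (n := n) c).symm y) := by
  have h1 : ∀ᵐ x ∂chartMeasure K c, p x := by
    rw [← vol_restrict_chart]
    exact ae_restrict_of_ae h
  have h2 := ae_of_ae_map (aemeasurable_symm_withDensity K c) h1
  rw [ae_withDensity_iff' (aemeasurable_volDensity K c)] at h2
  filter_upwards [h2, ae_restrict_mem (isOpen_chartE_target c).measurableSet] with y hy hyt
  exact hy (by simpa using volDensity_pos K hyt)

theorem integrableOn_chart {F : Type*} [NormedAddCommGroup F] [NormedSpace ℝ F] (c : M) {G : M → F}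
    (hG : Integrable G (vol K)) :
    IntegrableOn (fun y => volDensity K c y • G ((chartE (n := n) c).symm y))
      (chartE (n := n) c).target := by
  have h1 : Integrable G (chartMeasure K c) := by
    rw [← vol_restrict_chart]
    exact hG.restrict
  rw [chartMeasure, integrable_map_measure h1.aestronglyMeasurable (aemeasurable_symm_withDensity K c),
    integrable_withDensity_iff_integrable_smul₀' (aemeasurable_volDensity K c)
      (ae_of_all _ fun _ => ENNReal.ofReal_lt_top)] at h1
  exact h1.congr (by filter_upwards [volDensity_toReal K c] with y hy; rw [hy]; rfl)

theorem integral_chart {F : Type*} [NormedAddCommGroup F] [NormedSpace ℝ F] (c : M) {G : M → F}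
    (hG : Integrable G (vol K)) (hs : ∀ x, x ∉ (chartE (n := n) c).source → G x = 0) :
    ∫ x, G x ∂vol K = ∫ y in (chartE (n := n) c).target,
      volDensity K c y • G ((chartE (n := n) c).symm y) := by
  rw [← setIntegral_eq_integral_of_forall_compl_eq_zero hs, vol_restrict_chart]
  have h1 : AEStronglyMeasurable G (chartMeasure K c) := by
    rw [← vol_restrict_chart]
    exact hG.aestronglyMeasurable.restrict
  rw [chartMeasure] at h1 ⊢
  rw [integral_map (aemeasurable_symm_withDensity K c) h1,
    integral_withDensity_eq_integral_toReal_smul₀ (aemeasurable_volDensity K c)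
      (ae_of_all _ fun _ => ENNReal.ofReal_lt_top)]
  exact integral_congr_ae (by filter_upwards [volDensity_toReal K c] with y hy; rw [hy])

/-- By compactness it is enough to bound the volume near each point, where the density is continuous
on a closed coordinate ball. -/
theorem isFiniteMeasure_vol : IsFiniteMeasure (vol K) := by
  refine ⟨isCompact_univ.measure_lt_top_of_nhdsWithin fun c _ => ?_⟩
  rw [nhdsWithin_univ]
  have hc : c ∈ (chartE (n := n) c).source := mem_extChartAt_source c
  obtain ⟨ε, hε, hball⟩ := Metric.nhds_basis_closedBall.mem_iff.1
    ((isOpen_chartE_target (n := n) c).mem_nhds ((chartE c).map_source hc))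
  refine ⟨(chartE (n := n) c).source ∩ chartE (n := n) c ⁻¹' Metric.ball (chartE c c) ε, ?_, ?_⟩
  · exact ((continuousOn_extChartAt c).isOpen_inter_preimage (isOpen_chartE_source c)
      Metric.isOpen_ball).mem_nhds ⟨hc, Metric.mem_ball_self hε⟩
  · have hA := ((continuousOn_extChartAt (I := 𝓡 (2 * n)) c).isOpen_inter_preimage (isOpen_chartE_source c)
      (Metric.isOpen_ball (x := chartE (n := n) c c) (ε := ε))).measurableSet
    have h1 : vol K ((chartE (n := n) c).source ∩ chartE (n := n) c ⁻¹' Metric.ball (chartE c c) ε)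
        = chartMeasure K c ((chartE (n := n) c).source ∩ chartE (n := n) c ⁻¹' Metric.ball (chartE c c) ε) := by
      rw [← vol_restrict_chart, Measure.restrict_apply hA,
        Set.inter_eq_left.2 Set.inter_subset_left]
    rw [h1, chartMeasure, map_withDensity_apply c _ hA]
    have hcont : ContinuousOn (volDensity K c) (Metric.closedBall (chartE (n := n) c c) ε) :=
      (contDiffOn_volDensity K c).continuousOn.mono hball
    have h2 := (hcont.integrableOn_compact (μ := volume) (isCompact_closedBall _ _)).mono_set
      (s := (chartE (n := n) c).symm ⁻¹' ((chartE (n := n) c).source ∩ chartE (n := n) c ⁻¹' Metric.ball (chartE c c) ε)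
        ∩ (chartE (n := n) c).target) (by
        rintro p ⟨⟨-, hp⟩, hpt⟩
        change chartE (n := n) c ((chartE (n := n) c).symm p) ∈ Metric.ball (chartE (n := n) c c) ε at hp
        rw [(chartE c).right_inv hpt] at hp
        exact Metric.ball_subset_closedBall hp)
    exact (lintegral_ofReal_le_lintegral_enorm _).trans_lt h2.hasFiniteIntegral

theorem vol_pos_of_isOpen {U : Set M} (hU : IsOpen U) (hne : U.Nonempty) : vol K U ≠ 0 := by
  obtain ⟨c, hc⟩ := hne
  intro h0
  have h1 : ∀ᵐ x ∂vol K, x ∉ U := by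
    rw [ae_iff]
    simpa using h0
  have h2 := ae_chart K c h1
  have hO : IsOpen ((chartE (n := n) c).target ∩ (chartE (n := n) c).symm ⁻¹' U) :=
    (continuousOn_extChartAt_symm (I := 𝓡 (2 * n)) c).isOpen_inter_preimage (isOpen_chartE_target c) hU
  have hcs : c ∈ (chartE (n := n) c).source := mem_extChartAt_source c
  have hne' : ((chartE (n := n) c).target ∩ (chartE (n := n) c).symm ⁻¹' U).Nonempty :=
    ⟨chartE c c, (chartE c).map_source hcs, by
      change (chartE (n := n) c).symm _ ∈ U
      rwa [(chartE c).left_inv hcs]⟩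
  refine (hO.measure_pos volume hne').ne' ?_
  rw [ae_restrict_iff' (isOpen_chartE_target c).measurableSet, ae_iff] at h2
  refine measure_mono_null (fun p hp => ?_) h2
  simp only [Set.mem_setOf_eq, not_forall, not_not]
  exact ⟨hp.1, hp.2⟩

/-- Nonempty open sets have positive volume. This density turns identities on the regular set into
identities on M. -/
theorem dense_compl_of_null {S : Set M} (hS : vol K S = 0) : Dense Sᶜ := by
  rw [← interior_eq_empty_iff_dense_compl]
  by_contra h
  exact vol_pos_of_isOpen K isOpen_interior (Set.nonempty_iff_ne_empty.2 h)
    (measure_mono_null interior_subset hS)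

end VolumeIntegral
end GenKaehler

namespace GenKaehler

/-! ### Hamiltonian vector fields are divergence free. -/

section Hamiltonian

open Filter Topology

variable {n : ℕ}

theorem exists_om_inverse {om : W n →L[ℝ] W n →L[ℝ] ℝ}
    (hnd : ∀ v, (∀ w, om v w = 0) → v = 0) (ξ : W n →L[ℝ] ℝ) : ∃ Y, om Y = ξ := by
  let L : W n →ₗ[ℝ] (W n →L[ℝ] ℝ) := om.toLinearMap
  have hinj : Function.Injective L := by
    rw [← LinearMap.ker_eq_bot, LinearMap.ker_eq_bot']
    exact fun v hv => hnd v fun w => congrArg (fun η : W n →L[ℝ] ℝ => η w) hv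
  have hdim : finrank ℝ (W n) = finrank ℝ (W n →L[ℝ] ℝ) := by
    rw [← LinearEquiv.finrank_eq (LinearMap.toContinuousLinearMap (𝕜 := ℝ) (E := W n) (F' := ℝ))]
    exact (Subspace.dual_finrank_eq (K := ℝ) (V := W n)).symm
  exact (LinearMap.injective_iff_surjective_of_finrank_eq_finrank hdim).1 hinj ξ

/-- The divergence of a Hamiltonian vector field vanishes: the algebraic identity. `B i` is the
derivative of the symplectic form, `Z'` the derivative of the field `Z`. -/
theorem divergence_identity {om : W n →L[ℝ] W n →L[ℝ] ℝ} (ho : ∀ v, om v v = 0)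
    {Y : Fin (2 * n) → W n} (hY : ∀ j, om (Y j) = -dx j)
    {B : Fin (2 * n) → Fin (2 * n) → Fin (2 * n) → ℝ} {H : Fin (2 * n) → Fin (2 * n) → ℝ}
    (hB : ∀ i k l, B i k l = -B i l k)
    (hcl : ∀ i k l, B i k l + B k l i + B l i k = 0) (hH : ∀ i l, H i l = H l i) {Z : W n}
    {Z' : Fin (2 * n) → W n}
    (hZ : ∀ i l, ∑ k, B i k l * Z k + om (Z' i) (stdVec l) = -H i l) :
    ∑ i, (Z' i i + Z i * (-(1 / 2) * ∑ k, ∑ l, B i k l * dx k (Y l))) = 0 := by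
  -- The matrix dx k (Y l) is the Poisson bivector, the inverse of `om` up to sign; it is skew.
  have hP : ∀ k l, dx k (Y l) = -dx l (Y k) := by
    intro k l
    have h1 : om (Y k) (Y l) = -dx k (Y l) := by rw [hY]; rfl
    have h2 : om (Y l) (Y k) = -dx l (Y k) := by rw [hY]; rfl
    have h3 := alt_swap ho (Y k) (Y l)
    linarith
  have hinv : ∀ v i, ∑ l, om v (stdVec l) * dx l (Y i) = dx i v := by
    intro v i
    have h1 : om v (Y i) = dx i v := by
      rw [alt_swap ho, hY]
      simp
    rw [← h1]
    conv_rhs => rw [← sum_coord_stdVec (Y i)]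
    simp [dx, mul_comm]
  have h1 : ∀ i, Z' i i = -∑ l, ∑ k, B i k l * Z k * dx l (Y i) - ∑ l, H i l * dx l (Y i) := by
    intro i
    have h2 : Z' i i = dx i (Z' i) := rfl
    rw [h2, ← hinv, ← Finset.sum_neg_distrib, ← Finset.sum_sub_distrib]
    refine Finset.sum_congr rfl fun l _ => ?_
    rw [← Finset.sum_mul, ← sub_eq_zero]
    linear_combination dx l (Y i) * hZ i l
  -- The symmetric Hessian is contracted with the skew bivector.
  have h2 : ∑ i, ∑ l, H i l * dx l (Y i) = 0 := by
    have h3 : ∑ i, ∑ l, H i l * dx l (Y i) = -∑ i, ∑ l, H i l * dx l (Y i) := by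
      conv_lhs => rw [Finset.sum_comm]
      simp only [← Finset.sum_neg_distrib]
      refine Finset.sum_congr rfl fun i _ => Finset.sum_congr rfl fun l _ => ?_
      rw [hH, hP]
      ring
    linarith
  set S : ℝ := ∑ i, ∑ k, ∑ l, Z i * dx k (Y l) * B k i l with hS
  have hS1 : ∑ i, ∑ l, ∑ k, B i k l * Z k * dx l (Y i) = -S := by
    rw [hS]
    calc _ = ∑ k, ∑ i, ∑ l, B i k l * Z k * dx l (Y i) := by
          exact (Finset.sum_congr rfl fun i _ => Finset.sum_comm).trans Finset.sum_comm
      _ = _ := by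
          simp only [← Finset.sum_neg_distrib]
          refine Finset.sum_congr rfl fun i _ => Finset.sum_congr rfl fun k _ =>
            Finset.sum_congr rfl fun l _ => ?_
          rw [hP l k]; ring
  -- Closedness expresses the derivative of the volume coefficient through S. The factor 2 is
  -- matched by the 1/2 in the logarithmic derivative.
  have hS2 : ∑ i, ∑ k, ∑ l, Z i * (B i k l * dx k (Y l)) = 2 * S := by
    have h4 : ∀ i, ∑ k, ∑ l, Z i * dx k (Y l) * B k i l = ∑ k, ∑ l, -(Z i * dx k (Y l) * B l i k) := by
      intro i
      rw [Finset.sum_comm]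
      refine Finset.sum_congr rfl fun k _ => Finset.sum_congr rfl fun l _ => ?_
      rw [hP l k]; ring
    have h5 : S + S = ∑ i, ∑ k, ∑ l, (Z i * dx k (Y l) * B k i l + -(Z i * dx k (Y l) * B l i k)) := by
      simp only [Finset.sum_add_distrib, ← h4]
      rw [hS]
    refine Eq.trans ?_ (h5.symm.trans (two_mul S).symm)
    refine Finset.sum_congr rfl fun i _ => Finset.sum_congr rfl fun k _ =>
      Finset.sum_congr rfl fun l _ => ?_
    linear_combination Z i * dx k (Y l) * hcl i k l - Z i * dx k (Y l) * hB k l i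
  simp only [Finset.sum_add_distrib, h1, Finset.sum_sub_distrib, h2, Finset.sum_neg_distrib, hS1]
  have h6 : ∑ i, Z i * (-(1 / 2) * ∑ k, ∑ l, B i k l * dx k (Y l)) = -(1 / 2) * (2 * S) := by
    rw [← hS2]
    simp only [Finset.mul_sum]
    refine Finset.sum_congr rfl fun i _ => Finset.sum_congr rfl fun k _ =>
      Finset.sum_congr rfl fun l _ => by ring
  rw [h6]
  ring

variable {M : Type*} [TopologicalSpace M] [ChartedSpace (W n) M]
  [IsManifold (𝓡 (2 * n)) ∞ M] (K : GenKaehlerSympl n M)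

/-- The Hamiltonian vector field of a function. -/
noncomputable def hamVF (g : M → ℝ) (x : M) : TangentSpace (𝓡 (2 * n)) x :=
  (K.Jψ x (0, mvfderiv (𝓡 (2 * n)) g x)).1

/-- Smoothness is inherited from Jψ, so no inversion of `om` with parameters is required. -/
theorem smooth_hamVF {g : M → ℝ} (hg : ContMDiff (𝓡 (2 * n)) 𝓘(ℝ, ℝ) ∞ g) :
    SmoothVF (hamVF K g) :=
  (K.Jψ_complex.smooth (fun x => (0, mvfderiv (𝓡 (2 * n)) g x))
    ⟨smoothVF_zero, fun _ hX => contMDiff_mvfderiv hg hX⟩).1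

theorem om_hamVF (g : M → ℝ) (x : M) (v : TangentSpace (𝓡 (2 * n)) x) :
    K.om x (hamVF K g x) v = -mvfderiv (𝓡 (2 * n)) g x v :=
  congrArg (fun ξ : W n →L[ℝ] ℝ => ξ v) (om_anchor (K.b_form.alt x) (K.om_form.alt x) (K.Jψ_ker x)
    (mvfderiv (𝓡 (2 * n)) g x))

variable [T2Space M]

theorem contDiffOn_hamVF {g : M → ℝ} (hg : ContMDiff (𝓡 (2 * n)) 𝓘(ℝ, ℝ) ∞ g) (c : M) :
    ContDiffOn ℝ ∞ (fun p => coordOf c (hamVF K g ((chartE (n := n) c).symm p)))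
      (chartE (n := n) c).target :=
  (contDiffOn_chart (contMDiffOn_coordOf (smooth_hamVF K hg) c) c).mono
    fun _ hp => ⟨hp, (chartE c).map_target hp⟩

theorem pullOm_hamVF {g : M → ℝ} (hg : ContMDiff (𝓡 (2 * n)) 𝓘(ℝ, ℝ) ∞ g) {c : M} {p : W n}
    (hp : p ∈ (chartE (n := n) c).target) (w : W n) :
    pullOm K c p (coordOf c (hamVF K g ((chartE (n := n) c).symm p))) w
      = -fderiv ℝ (g ∘ (chartE (n := n) c).symm) p w := by
  have hx := (chartE (n := n) c).map_target hp
  rw [pullOm_apply K hp, coordField_coordOf hx, om_hamVF,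
    mvfderiv_coordField hx ((hg _).mdifferentiableAt (by simp)), (chartE c).right_inv hp]

theorem hasFDerivAt_pullOm {c : M} {p : W n} (hp : p ∈ (chartE (n := n) c).target) :
    HasFDerivAt (pullOm K c) (fderiv ℝ (pullOm K c) p) p :=
  (((contDiffOn_pullOm K c).contDiffAt ((isOpen_chartE_target c).mem_nhds hp)).differentiableAt
    (by simp)).hasFDerivAt

theorem fderiv_pullOm_alt {c : M} {p : W n} (hp : p ∈ (chartE (n := n) c).target) (u v w : W n) :
    fderiv ℝ (pullOm K c) p u v w = -fderiv ℝ (pullOm K c) p u w v := by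
  have h := hasFDerivAt_pullOm K hp
  have h1 : ∀ v w, HasFDerivAt (fun p => pullOm K c p v w)
      (((ContinuousLinearMap.apply ℝ ℝ w).comp (ContinuousLinearMap.apply ℝ _ v)).comp
        (fderiv ℝ (pullOm K c) p)) p :=
    fun v w => ((ContinuousLinearMap.apply ℝ ℝ w).comp
      (ContinuousLinearMap.apply ℝ (W n →L[ℝ] ℝ) v)).hasFDerivAt.comp p h
  have h3 := (h1 v w).unique ((h1 w v).neg.congr_of_eventuallyEq (Eventually.of_forall fun p => alt_swap (pullOm_alt K c p) v w))
  exact congrArg (fun L : W n →L[ℝ] ℝ => L u) h3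

/-- The invariant formula for d om = 0, evaluated on coordinate fields, whose brackets vanish. -/
theorem fderiv_pullOm_closed {c : M} {p : W n} (hp : p ∈ (chartE (n := n) c).target) (u v w : W n) :
    fderiv ℝ (pullOm K c) p u v w + fderiv ℝ (pullOm K c) p v w u
      + fderiv ℝ (pullOm K c) p w u v = 0 := by
  have hx := (chartE (n := n) c).map_target hp
  set x := (chartE (n := n) c).symm p with hxp
  obtain ⟨X, hX, hXu⟩ := exists_smoothVF_coordField hx u
  obtain ⟨Y, hY, hYv⟩ := exists_smoothVF_coordField hx v
  obtain ⟨Z, hZ, hZw⟩ := exists_smoothVF_coordField hx w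
  have key : ∀ (X Y Z : ∀ x : M, TangentSpace (𝓡 (2 * n)) x) (u v w : W n), SmoothVF Y → SmoothVF Z →
      (∀ᶠ z in 𝓝 x, X z = coordField c u z) → (∀ᶠ z in 𝓝 x, Y z = coordField c v z) →
      (∀ᶠ z in 𝓝 x, Z z = coordField c w z) →
      mvfderiv (𝓡 (2 * n)) (fun y => K.om y (Y y) (Z y)) x (X x) = fderiv ℝ (pullOm K c) p u v w := by
    intro X Y Z u v w hY hZ hXu hYv hZw
    rw [hXu.self_of_nhds, mvfderiv_coordField hx
      ((K.om_form.smooth Y Z hY hZ x).mdifferentiableAt (by simp)), hxp, (chartE c).right_inv hp]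
    have h1 : ((fun y => K.om y (Y y) (Z y)) ∘ (chartE (n := n) c).symm)
        =ᶠ[𝓝 p] fun p => pullOm K c p v w := by
      have hcont : Tendsto (chartE (n := n) c).symm (𝓝 p) (𝓝 x) :=
        (continuousAt_extChartAt_symm'' (I := 𝓡 (2 * n)) (x := c) hp).tendsto
      filter_upwards [hcont.eventually hYv, hcont.eventually hZw,
        (isOpen_chartE_target c).mem_nhds hp] with q h1 h2 hq
      rw [pullOm_apply K hq, Function.comp_apply, h1, h2]
    rw [h1.fderiv_eq]
    have h2 := ((ContinuousLinearMap.apply ℝ ℝ w).comp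
      (ContinuousLinearMap.apply ℝ (W n →L[ℝ] ℝ) v)).hasFDerivAt.comp p (hasFDerivAt_pullOm K hp)
    exact congrArg (fun L : W n →L[ℝ] ℝ => L u) h2.fderiv
  have h := K.om_closed X Y Z hX hY hZ x
  rw [key X Y Z u v w hY hZ hXu hYv hZw, key Y X Z v u w hX hZ hYv hXu hZw,
    key Z X Y w u v hX hY hZw hXu hYv, mlieBracket_coordField hx hXu hYv,
    mlieBracket_coordField hx hXu hZw, mlieBracket_coordField hx hYv hZw,
    fderiv_pullOm_alt K hp v u w] at h
  simp only [map_zero, zero_apply] at h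
  linarith

/-- The derivative of the complex volume coefficient is a real multiple of the coefficient, so its
modulus has the same logarithmic derivative. -/
theorem fderiv_volDensity {c : M} {p : W n} (hp : p ∈ (chartE (n := n) c).target)
    {Y : Fin (2 * n) → W n} (hY : ∀ j, pullOm K c p (Y j) = -dx j) (u : W n) :
    fderiv ℝ (volDensity K c) p u = volDensity K c p *
      (-(1 / 2) * ∑ i, ∑ j, fderiv ℝ (pullOm K c) p u (stdVec i) (stdVec j) * dx i (Y j)) := by
  obtain ⟨L, hL, hL'⟩ := hasFDerivAt_topCoeff_chi (pullOm K c p)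
  have h1 : HasFDerivAt (volCoeff K c) (L.comp (fderiv ℝ (pullOm K c) p)) p :=
    hL.comp p (hasFDerivAt_pullOm K hp)
  have hd := (((contDiffOn_volDensity K c).contDiffAt
    ((isOpen_chartE_target c).mem_nhds hp)).differentiableAt (by simp)).hasFDerivAt
  have h2 := h1.norm_sq
  have h3 := hd.pow 2
  -- Squares are compared, since the squared norm has a simple derivative; afterwards the positive
  -- factor is cancelled.
  have h4 : (fun p => volDensity K c p ^ 2) = (‖volCoeff K c ·‖ ^ 2) := by
    funext p
    simp [volDensity_eq]
  have h5 := congrArg (fun L : W n →L[ℝ] ℝ => L u) (h3.unique (h4 ▸ h2))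
  have h6 : L (fderiv ℝ (pullOm K c) p u) = _ :=
    (hL' _).trans (topCoeff_twoForm_mul_chi (pullOm_alt K c p) (pullOm_nondeg K hp) hY _)
  set a : ℝ := -(1 / 2) * ∑ i, ∑ j, fderiv ℝ (pullOm K c) p u (stdVec i) (stdVec j) * dx i (Y j)
  have h7 : inner ℝ (volCoeff K c p) ((a : ℂ) * topCoeff (chi (pullOm K c p)))
      = a * volDensity K c p ^ 2 := by
    change inner ℝ (volCoeff K c p) ((a : ℂ) * volCoeff K c p) = _
    rw [← Complex.real_smul, real_inner_smul_right, real_inner_self_eq_norm_sq, volDensity_eq]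
  simp only [smul_apply, ContinuousLinearMap.comp_apply, innerSL_apply_apply, h6, h7] at h5
  have h8 := volDensity_pos K hp
  simp only [smul_eq_mul, nsmul_eq_mul] at h5
  refine mul_left_cancel₀ (mul_pos two_pos h8).ne' ?_
  norm_num at h5
  linarith

/-- Differentiating om(X_g) = -dg relates the derivative of the field to that of `om` and the
Hessian of g. The algebraic identity then gives the claim. -/
theorem divergence_hamVF {g : M → ℝ} (hg : ContMDiff (𝓡 (2 * n)) 𝓘(ℝ, ℝ) ∞ g) {c : M} {p : W n}
    (hp : p ∈ (chartE (n := n) c).target) :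
    ∑ i, fderiv ℝ (fun q => volDensity K c q * coordOf c (hamVF K g ((chartE (n := n) c).symm q)) i) p
      (stdVec i) = 0 := by
  have hn := (isOpen_chartE_target (n := n) c).mem_nhds hp
  choose Y hY using fun j => exists_om_inverse (pullOm_nondeg K hp) (-dx j)
  set Z : W n → W n := fun q => coordOf c (hamVF K g ((chartE (n := n) c).symm q)) with hZ
  have hZd : HasFDerivAt Z (fderiv ℝ Z p) p :=
    (((contDiffOn_hamVF K hg c).contDiffAt hn).differentiableAt (by simp)).hasFDerivAt
  have hgc : ContDiffAt ℝ ∞ (g ∘ (chartE (n := n) c).symm) p :=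
    (contDiffOn_chart_target hg c).contDiffAt hn
  have hd := (((contDiffOn_volDensity K c).contDiffAt hn).differentiableAt (by simp)).hasFDerivAt
  have h1 : ∀ i, fderiv ℝ (fun q => volDensity K c q * Z q i) p (stdVec i)
      = volDensity K c p * (fderiv ℝ Z p (stdVec i) i + Z p i *
        (-(1 / 2) * ∑ k, ∑ l, fderiv ℝ (pullOm K c) p (stdVec i) (stdVec k) (stdVec l) * dx k (Y l))) := by
    intro i
    have h2 : HasFDerivAt (fun q => Z q i) ((dx i).comp (fderiv ℝ Z p)) p :=
      (dx i).hasFDerivAt.comp p hZd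
    have h2' : HasFDerivAt (fun q => volDensity K c q * Z q i) _ p := hd.mul h2
    rw [h2'.fderiv]
    simp only [add_apply, smul_apply, smul_eq_mul, fderiv_volDensity K hp hY,
      ContinuousLinearMap.comp_apply]
    change _ * (fderiv ℝ Z p (stdVec i) i) + _ = _
    ring
  refine (Finset.sum_congr rfl fun i _ => h1 i).trans ?_
  rw [← Finset.mul_sum]
  refine mul_eq_zero_of_right _ (divergence_identity (pullOm_alt K c p) hY
    (B := fun i k l => fderiv ℝ (pullOm K c) p (stdVec i) (stdVec k) (stdVec l))
    (Z := Z p) (Z' := fun i => fderiv ℝ Z p (stdVec i))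
    (H := fun i l => fderiv ℝ (fderiv ℝ (g ∘ (chartE (n := n) c).symm)) p (stdVec i) (stdVec l))
    (fun i k l => fderiv_pullOm_alt K hp _ _ _) (fun i k l => fderiv_pullOm_closed K hp _ _ _)
    (fun i l => (hgc.isSymmSndFDerivAt (by simp; norm_cast)) _ _) fun i l => ?_)
  -- The equation om(Z) = -dg is differentiated by the product rule.
  have h3 : HasFDerivAt (fun q => pullOm K c q (Z q)) _ p := (hasFDerivAt_pullOm K hp).clm_apply hZd
  have h4 : (fun q => pullOm K c q (Z q)) =ᶠ[𝓝 p] fun q => -fderiv ℝ (g ∘ (chartE (n := n) c).symm) q := by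
    filter_upwards [hn] with q hq
    ext w
    exact pullOm_hamVF K hg hq w
  have h5 : HasFDerivAt (fderiv ℝ (g ∘ (chartE (n := n) c).symm)) _ p :=
    ((hgc.fderiv_right (m := 1) (by norm_cast)).differentiableAt (by simp)).hasFDerivAt
  have h6 := congrArg (fun L : W n →L[ℝ] W n →L[ℝ] ℝ => L (stdVec i) (stdVec l))
    (h3.unique (h5.neg.congr_of_eventuallyEq h4))
  have h7 : fderiv ℝ (pullOm K c) p (stdVec i) (Z p) (stdVec l)
      = ∑ k, fderiv ℝ (pullOm K c) p (stdVec i) (stdVec k) (stdVec l) * Z p k := by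
    conv_lhs => rw [← sum_coord_stdVec (Z p)]
    simp [mul_comm]
  rw [← h7]
  simp only [add_apply, ContinuousLinearMap.comp_apply, neg_apply,
    ContinuousLinearMap.flip_apply] at h6
  rw [← h6, add_comm]

end Hamiltonian
end GenKaehler

namespace GenKaehler

/-! ### Weakly differentiable functions on M. -/

section WeakDifferential

open Filter Topology

variable {n : ℕ}

theorem integrable_smul_of_tsupport {F : W n → ℂ} {O : Set (W n)}
    (hF : LocallyIntegrableOn F O volume) {φ : W n → ℝ} (hφ : Continuous φ) (hc : HasCompactSupport φ)
    (hs : tsupport φ ⊆ O) : Integrable (fun p => φ p • F p) := by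
  have h1 := hF.integrableOn_compact_subset hs hc
  have h2 : IntegrableOn (fun p => φ p • F p) (tsupport φ) :=
    h1.continuousOn_smul hφ.continuousOn hc
  refine (integrableOn_iff_integrable_of_support_subset fun p hp => ?_).1 h2
  refine subset_tsupport φ fun h0 => hp ?_
  simp [h0]

variable {M : Type*} [TopologicalSpace M] [ChartedSpace (W n) M]
  [IsManifold (𝓡 (2 * n)) ∞ M]

/-- The product of a function on `M` supported in a chart with a function on the chart. -/
noncomputable def chartFn (c : M) (ρ : M → ℝ) (F : W n → ℝ) : W n → ℝ :=
  (chartE (n := n) c).target.indicator fun p => ρ ((chartE (n := n) c).symm p) * F p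

theorem chartFn_eventuallyEq {c : M} {ρ : M → ℝ} {F : W n → ℝ} {p : W n}
    (hp : p ∈ (chartE (n := n) c).target) :
    chartFn c ρ F =ᶠ[𝓝 p] fun p => ρ ((chartE (n := n) c).symm p) * F p :=
  Filter.eventuallyEq_of_mem ((isOpen_chartE_target c).mem_nhds hp) fun _ hq =>
    Set.indicator_of_mem hq _

theorem tsupport_chartFn [T2Space M] [CompactSpace M] {c : M} {ρ : M → ℝ}
    (hs : tsupport ρ ⊆ (chartE (n := n) c).source) (F : W n → ℝ) :
    HasCompactSupport (chartFn c ρ F) ∧ tsupport (chartFn c ρ F) ⊆ (chartE (n := n) c).target := by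
  have hK : IsCompact (chartE (n := n) c '' tsupport ρ) :=
    (isClosed_tsupport ρ).isCompact.image_of_continuousOn ((continuousOn_extChartAt c).mono hs)
  have h1 : Function.support (chartFn c ρ F) ⊆ chartE (n := n) c '' tsupport ρ := by
    intro p hp
    have hpt : p ∈ (chartE (n := n) c).target := by
      by_contra h
      exact hp (Set.indicator_of_notMem h _)
    refine ⟨(chartE c).symm p, subset_tsupport _ fun h0 => hp ?_, (chartE c).right_inv hpt⟩
    rw [chartFn, Set.indicator_of_mem hpt, h0, zero_mul]
  have h2 : tsupport (chartFn c ρ F) ⊆ chartE (n := n) c '' tsupport ρ := closure_minimal h1 hK.isClosed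
  refine ⟨hK.of_isClosed_subset (isClosed_tsupport _) h2, h2.trans ?_⟩
  rintro _ ⟨x, hx, rfl⟩
  exact (chartE c).map_source (hs hx)

theorem contDiff_chartFn [T2Space M] [CompactSpace M] {c : M} {ρ : M → ℝ}
    (hρ : ContMDiff (𝓡 (2 * n)) 𝓘(ℝ, ℝ) ∞ ρ)
    (hs : tsupport ρ ⊆ (chartE (n := n) c).source) {F : W n → ℝ}
    (hF : ContDiffOn ℝ ∞ F (chartE (n := n) c).target) : ContDiff ℝ ∞ (chartFn c ρ F) := by
  refine (contMDiff_of_tsupport (I := 𝓘(ℝ, W n)) (I' := 𝓘(ℝ, ℝ)) fun p hp => ?_).contDiff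
  have hpt := (tsupport_chartFn hs F).2 hp
  have hn := (isOpen_chartE_target (n := n) c).mem_nhds hpt
  exact ((((contDiffOn_chart_target hρ c).mul hF).contDiffAt hn).congr_of_eventuallyEq
    (chartFn_eventuallyEq hpt)).contMDiffAt

variable [MeasurableSpace M] [BorelSpace M] [CompactSpace M] [T2Space M] (K : GenKaehlerSympl n M)

/-- Finitely many charts cover M; this is the converse of `ae_chart`. -/
theorem ae_of_ae_chart {p : M → Prop}
    (h : ∀ c : M, ∀ᵐ y ∂volume.restrict (chartE (n := n) c).target, p ((chartE (n := n) c).symm y)) :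
    ∀ᵐ x ∂vol K, p x := by
  obtain ⟨T, -, hT⟩ := isCompact_univ.elim_nhds_subcover (fun c : M => (chartE (n := n) c).source)
    (fun c _ => (isOpen_chartE_source c).mem_nhds (mem_extChartAt_source c))
  have h1 : ∀ c ∈ (T : Set M), ∀ᵐ x ∂vol K, x ∈ (chartE (n := n) c).source → p x := by
    intro c _
    rw [← ae_restrict_iff' (isOpen_chartE_source c).measurableSet, vol_restrict_chart, ae_iff]
    have hc := h c
    rw [ae_iff] at hc
    obtain ⟨N, hN, hNm, hN0⟩ := exists_measurable_superset_of_null hc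
    have hA : MeasurableSet ((chartE (n := n) c).source ∩ chartE (n := n) c ⁻¹' N) :=
by
      classical
      have h1 : Measurable ((chartE (n := n) c).source.piecewise (chartE (n := n) c) fun _ => 0) :=
        ContinuousOn.measurable_piecewise (continuousOn_extChartAt c) continuousOn_const
          (isOpen_chartE_source c).measurableSet
      convert (isOpen_chartE_source (n := n) c).measurableSet.inter (h1 hNm) using 1
      ext x
      refine and_congr_right fun hx => ?_
      rw [Set.mem_preimage, Set.mem_preimage, Set.piecewise_eq_of_mem _ _ _ hx]
    have h3 : chartMeasure K c ((chartE (n := n) c).source ∩ chartE (n := n) c ⁻¹' N) = 0 := by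
      rw [chartMeasure, map_withDensity_apply c _ hA]
      refine setLIntegral_measure_zero _ _ ?_
      have h4 := hN0
      rw [Measure.restrict_apply hNm] at h4
      refine measure_mono_null ?_ h4
      intro q hq
      refine ⟨?_, hq.2⟩
      have := hq.1.2
      change chartE (n := n) c ((chartE (n := n) c).symm q) ∈ N at this
      rwa [(chartE c).right_inv hq.2] at this
    have h5 : chartMeasure K c (chartE (n := n) c).sourceᶜ = 0 := by
      rw [← vol_restrict_chart, Measure.restrict_apply (isOpen_chartE_source c).measurableSet.compl]
      simp
    refine measure_mono_null ?_ (measure_union_null h3 h5)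
    intro x hx
    by_cases hxs : x ∈ (chartE (n := n) c).source
    · refine Or.inl ⟨hxs, hN ?_⟩
      change ¬ p ((chartE (n := n) c).symm (chartE c x))
      rwa [(chartE c).left_inv hxs]
    · exact Or.inr hxs
  have h2 := (ae_ball_iff T.countable_toSet).2 h1
  filter_upwards [h2] with x hx
  obtain ⟨c, hc, hxc⟩ := Set.mem_iUnion₂.1 (hT (Set.mem_univ x))
  exact hx c hc hxc

/-- An integrable function with an integrable weak differential. -/
structure IsWeaklyDiff (f : M → ℂ) (θ : ∀ x : M, TangentSpace (𝓡 (2 * n)) x →ₗ[ℝ] ℂ) : Prop where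
  integrable : Integrable f (vol K)
  deriv : ∀ X : ∀ x : M, TangentSpace (𝓡 (2 * n)) x, SmoothVF X →
    Integrable (fun x => θ x (X x)) (vol K)
  weak : HasWeakDifferential (n := n) f fun x v => θ x v

theorem locallyIntegrableOn_chart {f : M → ℂ} (hf : Integrable f (vol K)) (c : M) :
    LocallyIntegrableOn (fun p => f ((chartE (n := n) c).symm p)) (chartE (n := n) c).target := by
  have h1 := (integrableOn_chart K c hf).locallyIntegrableOn
  have h2 := h1.continuousOn_smul (isOpen_chartE_target c).isLocallyClosed
    (g := fun p => (volDensity K c p)⁻¹)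
    ((contDiffOn_volDensity K c).continuousOn.inv₀ fun p hp => (volDensity_pos K hp).ne')
  refine h2.congr ?_
  filter_upwards [ae_restrict_mem (isOpen_chartE_target c).measurableSet] with p hp
  rw [smul_smul, inv_mul_cancel₀ (volDensity_pos K hp).ne', one_smul]

theorem tendsto_chart_symm {c : M} {p : W n} (hp : p ∈ (chartE (n := n) c).target) :
    Tendsto (chartE (n := n) c).symm (𝓝 p) (𝓝 ((chartE (n := n) c).symm p)) :=
  (continuousAt_extChartAt_symm'' (I := 𝓡 (2 * n)) (x := c) hp).tendsto

variable {K} {f : M → ℂ} {θ : ∀ x : M, TangentSpace (𝓡 (2 * n)) x →ₗ[ℝ] ℂ}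

/-- Integrability is assumed only along global smooth fields, but near each point a coordinate field
agrees with one of them. -/
theorem IsWeaklyDiff.locallyIntegrableOn (hf : IsWeaklyDiff K f θ) (c : M) (v : W n) :
    LocallyIntegrableOn (fun p => θ ((chartE (n := n) c).symm p) (chartTangent c p v))
      (chartE (n := n) c).target := by
  intro p hp
  have hx := (chartE (n := n) c).map_target hp
  obtain ⟨X, hX, hXv⟩ := exists_smoothVF_coordField hx v
  obtain ⟨s, hs, hi⟩ := locallyIntegrableOn_chart K (hf.deriv X hX) c p hp
  have h1 := nhdsWithin_le_nhds (s := (chartE (n := n) c).target) ((tendsto_chart_symm hp).eventually hXv)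
  obtain ⟨s', hs', hs'm, h2⟩ : ∃ s' ∈ 𝓝[(chartE (n := n) c).target] p, MeasurableSet s' ∧
      s' ⊆ {q | X ((chartE (n := n) c).symm q) = coordField c v ((chartE c).symm q)}
        ∩ (chartE (n := n) c).target := by
    have h3 := inter_mem h1 self_mem_nhdsWithin
    obtain ⟨u, hu, hpu, hsub⟩ := mem_nhdsWithin.1 h3
    exact ⟨u ∩ (chartE (n := n) c).target, mem_nhdsWithin.2 ⟨u, hu, hpu, subset_rfl⟩,
      (hu.inter (isOpen_chartE_target c)).measurableSet, hsub⟩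
  refine ⟨s ∩ s', inter_mem hs hs', ?_⟩
  refine (hi.mono_set Set.inter_subset_left).congr ?_
  have h4 : ∀ᵐ q ∂volume.restrict (s ∩ s'), q ∈ s' :=
    ae_mono (Measure.restrict_mono Set.inter_subset_right le_rfl) (ae_restrict_mem hs'm)
  filter_upwards [h4] with q hq
  exact congrArg (θ _) ((h2 hq).1.trans (chartTangent_eq (h2 hq).2 v).symm)

theorem IsWeaklyDiff.test (hf : IsWeaklyDiff K f θ) {c : M} {φ : W n → ℝ} (hφ : ContDiff ℝ ∞ φ)
    (hc : HasCompactSupport φ) (hs : tsupport φ ⊆ (chartE (n := n) c).target) (i : Fin (2 * n)) :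
    Integrable (fun p => fderiv ℝ φ p (stdVec i) • f ((chartE (n := n) c).symm p)) ∧
    Integrable (fun p => φ p • θ ((chartE (n := n) c).symm p) (chartTangent c p (stdVec i))) ∧
    ∫ p, fderiv ℝ φ p (stdVec i) • f ((chartE (n := n) c).symm p)
      = -∫ p, φ p • θ ((chartE (n := n) c).symm p) (chartTangent c p (stdVec i)) := by
  have hd : tsupport (fun p => fderiv ℝ φ p (stdVec i)) ⊆ tsupport φ :=
    tsupport_fderiv_apply_subset ℝ (stdVec i)
  refine ⟨integrable_smul_of_tsupport (locallyIntegrableOn_chart K hf.integrable c)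
    ((hφ.continuous_fderiv (by simp)).clm_apply continuous_const)
    (hc.of_isClosed_subset (isClosed_tsupport _) hd) (hd.trans hs),
    integrable_smul_of_tsupport (hf.locallyIntegrableOn c _) hφ.continuous hc hs, ?_⟩
  have h := hf.weak c φ hφ hc hs i
  simp only [← Complex.real_smul] at h
  rwa [setIntegral_eq_integral_of_forall_compl_eq_zero, setIntegral_eq_integral_of_forall_compl_eq_zero]
    at h
  · intro p hp
    rw [image_eq_zero_of_notMem_tsupport fun h' => hp (hs h'), zero_smul]
  · intro p hp
    rw [image_eq_zero_of_notMem_tsupport (f := fun p => fderiv ℝ φ p (stdVec i))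
      fun h' => hp (hs (hd h')), zero_smul]

theorem integral_by_parts_chart {U : Set M} (hU : IsOpen U) (hf : ContMDiffOn (𝓡 (2 * n)) 𝓘(ℝ, ℂ) ∞ f U)
    {c : M} {φ : W n → ℝ} (hφ : ContDiff ℝ ∞ φ) (hc : HasCompactSupport φ)
    (hs : tsupport φ ⊆ (chartE (n := n) c).target ∩ (chartE c).symm ⁻¹' U) (v : W n) :
    Integrable (fun p => φ p • fderiv ℝ (f ∘ (chartE (n := n) c).symm) p v) ∧
    ∫ p, fderiv ℝ φ p v • f ((chartE (n := n) c).symm p)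
      = -∫ p, φ p • fderiv ℝ (f ∘ (chartE (n := n) c).symm) p v := by
  set O := (chartE (n := n) c).target ∩ (chartE c).symm ⁻¹' U
  have hO : IsOpen O := (continuousOn_extChartAt_symm (I := 𝓡 (2 * n)) c).isOpen_inter_preimage
    (isOpen_chartE_target c) hU
  have hfc := contDiffOn_chart hf c
  have h1 : LocallyIntegrableOn (f ∘ (chartE (n := n) c).symm) O :=
    hfc.continuousOn.locallyIntegrableOn hO.measurableSet
  have h2 : LocallyIntegrableOn (fun p => fderiv ℝ (f ∘ (chartE (n := n) c).symm) p v) O :=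
    ((hfc.continuousOn_fderiv_of_isOpen hO (by simp)).clm_apply
      continuousOn_const).locallyIntegrableOn hO.measurableSet
  have hd : tsupport (fun p => fderiv ℝ φ p v) ⊆ tsupport φ := tsupport_fderiv_apply_subset ℝ v
  have h3 := integrable_smul_of_tsupport h2 hφ.continuous hc hs
  refine ⟨h3, ?_⟩
  have h4 := integral_smul_fderiv_eq_neg_fderiv_smul_of_integrable (μ := volume) (v := v)
    (integrable_smul_of_tsupport h1 ((hφ.continuous_fderiv (by simp)).clm_apply continuous_const)
      (hc.of_isClosed_subset (isClosed_tsupport _) hd) (hd.trans hs)) h3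
    (integrable_smul_of_tsupport h1 hφ.continuous hc hs)
    (fun p _ => (hφ.differentiable (by simp)) p)
    (fun p hp => (hfc.contDiffAt (hO.mem_nhds (hs hp))).differentiableAt (by simp))
  exact neg_eq_iff_eq_neg.1 h4.symm

theorem fderiv_chart_eq {U : Set M} (hU : IsOpen U) (hf : ContMDiffOn (𝓡 (2 * n)) 𝓘(ℝ, ℂ) ∞ f U)
    {c : M} {p : W n} (hp : p ∈ (chartE (n := n) c).target) (hpU : (chartE (n := n) c).symm p ∈ U)
    (v : W n) : fderiv ℝ (f ∘ (chartE (n := n) c).symm) p v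
      = mvfderiv (𝓡 (2 * n)) f ((chartE (n := n) c).symm p) (chartTangent c p v) := by
  rw [chartTangent_eq hp, mvfderiv_coordField ((chartE c).map_target hp)
    ((hf.contMDiffAt (hU.mem_nhds hpU)).mdifferentiableAt (by simp)), (chartE c).right_inv hp]

/-- Uniqueness of weak derivatives: on U the classical differential satisfies the same identity
against all test functions. -/
theorem IsWeaklyDiff.ae_eq_mvfderiv (hf : IsWeaklyDiff K f θ) {U : Set M} (hU : IsOpen U)
    (hs : ContMDiffOn (𝓡 (2 * n)) 𝓘(ℝ, ℂ) ∞ f U) :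
    ∀ᵐ x ∂vol K, x ∈ U → ∀ v, θ x v = mvfderiv (𝓡 (2 * n)) f x v := by
  refine ae_of_ae_chart K fun c => ?_
  set O := (chartE (n := n) c).target ∩ (chartE c).symm ⁻¹' U
  have hO : IsOpen O := (continuousOn_extChartAt_symm (I := 𝓡 (2 * n)) c).isOpen_inter_preimage
    (isOpen_chartE_target c) hU
  have hfc := contDiffOn_chart hs c
  have h1 : ∀ i : Fin (2 * n), ∀ᵐ p, p ∈ O → θ ((chartE (n := n) c).symm p) (chartTangent c p (stdVec i))
      - fderiv ℝ (f ∘ (chartE (n := n) c).symm) p (stdVec i) = 0 := by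
    intro i
    refine hO.ae_eq_zero_of_integral_contDiff_smul_eq_zero ?_ ?_
    · exact ((hf.locallyIntegrableOn c (stdVec i)).mono_set Set.inter_subset_left).sub
        (((hfc.continuousOn_fderiv_of_isOpen hO (by simp)).clm_apply
          continuousOn_const).locallyIntegrableOn hO.measurableSet)
    · intro φ hφ hc hsupp
      have h2 := hf.test hφ hc (hsupp.trans Set.inter_subset_left) i
      have h3 := integral_by_parts_chart hU hs hφ hc hsupp (stdVec i)
      simp only [smul_sub]
      rw [integral_sub h2.2.1 h3.1, sub_eq_zero]
      exact neg_injective (h2.2.2.symm.trans h3.2)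
  rw [ae_restrict_iff' (isOpen_chartE_target c).measurableSet]
  filter_upwards [ae_all_iff.2 h1] with p hp hpt hpU v
  have hx := (chartE (n := n) c).map_target hpt
  have h5 : (θ ((chartE (n := n) c).symm p)).comp (chartTangent c p).toLinearMap
      = (mvfderiv (𝓡 (2 * n)) f ((chartE (n := n) c).symm p)).toLinearMap.comp
        (chartTangent c p).toLinearMap := by
    refine LinearMap.ext fun w => ?_
    rw [← sum_coord_stdVec w, map_sum, map_sum]
    refine Finset.sum_congr rfl fun i _ => ?_
    rw [map_smul, map_smul]
    congr 1
    exact (sub_eq_zero.1 (hp i ⟨hpt, hpU⟩)).trans (fderiv_chart_eq hU hs hpt hpU _)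
  have h6 : v = chartTangent c p (coordOf c v) := by
    rw [chartTangent_eq hpt, coordField_coordOf hx]
  rw [h6]
  exact congrArg (fun L : W n →ₗ[ℝ] ℂ => L (coordOf c v)) h5

theorem integrable_of_continuous {F : Type*} [NormedAddCommGroup F] [NormedSpace ℝ F]
    [SecondCountableTopology F] (K : GenKaehlerSympl n M) {f : M → F} (hf : Continuous f) :
    Integrable f (vol K) := by
  have := isFiniteMeasure_vol K
  exact hf.integrable_of_hasCompactSupport (.of_compactSpace f)

theorem isWeaklyDiff_of_smooth (K : GenKaehlerSympl n M) (hf : ContMDiff (𝓡 (2 * n)) 𝓘(ℝ, ℂ) ∞ f) :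
    IsWeaklyDiff K f fun x => (mvfderiv (𝓡 (2 * n)) f x).toLinearMap := by
  refine ⟨integrable_of_continuous K hf.continuous,
    fun X hX => integrable_of_continuous K (contMDiff_mvfderiv hf hX).continuous, ?_⟩
  intro c φ hφ hc hs i
  have h := (integral_by_parts_chart isOpen_univ hf.contMDiffOn (c := c) hφ hc
    (hs.trans fun p hp => ⟨hp, Set.mem_univ _⟩) (stdVec i)).2
  have hd : tsupport (fun p => fderiv ℝ φ p (stdVec i)) ⊆ tsupport φ :=
    tsupport_fderiv_apply_subset ℝ (stdVec i)
  simp only [← Complex.real_smul]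
  rw [setIntegral_eq_integral_of_forall_compl_eq_zero, h, ← setIntegral_eq_integral_of_forall_compl_eq_zero
    (s := (chartE (n := n) c).target) (f := fun p => φ p • fderiv ℝ (f ∘ (chartE (n := n) c).symm) p (stdVec i))]
  · congr 1
    refine setIntegral_congr_fun (isOpen_chartE_target c).measurableSet fun p hp => ?_
    exact congrArg (φ p • ·) (fderiv_chart_eq isOpen_univ hf.contMDiffOn hp (Set.mem_univ _) _)
  · intro p hp
    rw [image_eq_zero_of_notMem_tsupport fun h' => hp (hs h'), zero_smul]
  · intro p hp
    rw [image_eq_zero_of_notMem_tsupport (f := fun p => fderiv ℝ φ p (stdVec i))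
      fun h' => hp (hs (hd h')), zero_smul]

end WeakDifferential
end GenKaehler

namespace GenKaehler

/-! ### Stokes' theorem for the exact terms. -/

section Stokes

open Filter Topology

variable {n : ℕ} {M : Type*} [TopologicalSpace M] [ChartedSpace (W n) M]
  [IsManifold (𝓡 (2 * n)) ∞ M]

theorem coordField_sum {c y : M} (hy : y ∈ (chartE (n := n) c).source) (v : W n) :
    ∑ i, v i • coordField c (stdVec i) y = coordField c v y := by
  conv_rhs => rw [← sum_coord_stdVec v]
  simp only [coordField_eq hy]
  refine .trans ?_ (map_sum (mfderiv 𝓘(ℝ, W n) (𝓡 (2 * n)) (chartE (n := n) c).symm (chartE c y)) _ _).symm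
  exact Finset.sum_congr rfl fun i _ => (map_smul
    (mfderiv 𝓘(ℝ, W n) (𝓡 (2 * n)) (chartE (n := n) c).symm (chartE c y)) (v i) (stdVec i)).symm

variable (n M) in
/-- A finite family of functions and vector fields with `v = ∑ a, dg_a(v) X_a`. -/
structure GradFrame where
  /-- the number of functions -/
  card : ℕ
  /-- the functions -/
  g : Fin card → M → ℝ
  /-- the vector fields -/
  X : Fin card → ∀ x : M, TangentSpace (𝓡 (2 * n)) x
  smooth_g : ∀ a, ContMDiff (𝓡 (2 * n)) 𝓘(ℝ, ℝ) ∞ (g a)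
  smooth_X : ∀ a, SmoothVF (X a)
  expand : ∀ x (v : TangentSpace (𝓡 (2 * n)) x), ∑ a, mvfderiv (𝓡 (2 * n)) (g a) x v • X a x = v

/-- The functions are cut-off coordinates. Every one-form τ becomes ∑ τ(X_a) dg_a, so exact
two-forms are handled through Hamiltonian fields of globally defined functions. -/
theorem exists_gradFrame [T2Space M] [CompactSpace M] : Nonempty (GradFrame n M) := by
  choose χ hχ hχs hχ1 using fun c : M =>
    exists_cutoff (n := n) ((isOpen_chartE_source (n := n) c).mem_nhds (mem_extChartAt_source c))
  -- The second cutoffs live in the interior of the set where χ = 1. There the cut-off coordinates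
  -- have the differentials of the true ones.
  obtain ⟨N, c, ρ, σ, hρ, hσ, hρs, hσs, h1⟩ := exists_cutoff_family (n := n) (M := M)
    (fun x => _root_.interior {y | χ x y = 1}) (fun x => isOpen_interior.mem_nhds
      (mem_interior_iff_mem_nhds.2 (hχ1 x)))
  have hsub : ∀ x, _root_.interior {y | χ x y = 1} ⊆ (chartE (n := n) x).source := fun x y hy =>
    hχs x (subset_tsupport _ (by
      have : y ∈ {y | χ x y = 1} := interior_subset hy
      have : χ x y = 1 := this
      simp [this]))
  let e := (finProdFinEquiv (m := N) (n := 2 * n)).symm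
  let g : Fin N → Fin (2 * n) → M → ℝ := fun i j y => χ (c i) y * chartE (n := n) (c i) y j
  have hg : ∀ i j, ContMDiff (𝓡 (2 * n)) 𝓘(ℝ, ℝ) ∞ (g i j) := by
    intro i j
    refine contMDiff_of_tsupport fun x hx => ?_
    have hx' : x ∈ (chartE (n := n) (c i)).source :=
      hχs _ (closure_mono (Function.support_mul_subset_left _ _) hx)
    refine (hχ (c i) x).mul ?_
    exact ((dx j).contMDiff.contMDiffAt).comp x (contMDiffAt_extChartAt' (by simpa using hx'))
  have hX : ∀ (i : Fin N) (j : Fin (2 * n)), SmoothVF (fun x : M => (ρ i x * σ i x) • coordField (c i) (stdVec j) x) := by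
    intro i j
    refine ContMDiffOn.smul_section_of_tsupport ((hρ i).mul (hσ i)).contMDiffOn
      (isOpen_chartE_source (c i)) ?_ (contMDiffOn_coordField (c i) _)
    exact (closure_mono (Function.support_mul_subset_left _ _)).trans ((hρs i).trans (hsub _))
  refine ⟨⟨N * (2 * n), fun a => g (e a).1 (e a).2,
    fun a x => (ρ (e a).1 x * σ (e a).1 x) • coordField (c (e a).1) (stdVec (e a).2) x,
    fun a => hg _ _, fun a => hX _ _, fun x v => ?_⟩⟩
  rw [Equiv.sum_comp e (fun q : Fin N × Fin (2 * n) => mvfderiv (𝓡 (2 * n)) (g q.1 q.2) x v •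
    (ρ q.1 x * σ q.1 x) • coordField (c q.1) (stdVec q.2) x), Fintype.sum_prod_type]
  have h2 : ∀ i, ∑ j, mvfderiv (𝓡 (2 * n)) (g i j) x v •
      (ρ i x * σ i x) • coordField (c i) (stdVec j) x = (ρ i x * σ i x) • v := by
    intro i
    by_cases hx : x ∈ _root_.interior {y | χ (c i) y = 1}
    · have hxs := hsub _ hx
      have h3 : ∀ j, mvfderiv (𝓡 (2 * n)) (g i j) x v = coordOf (c i) v j := by
        intro j
        rw [mvfderiv_eq_coordOf hxs ((hg i j x).mdifferentiableAt (by simp))]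
        have h4 : (g i j ∘ (chartE (n := n) (c i)).symm) =ᶠ[𝓝 (chartE (n := n) (c i) x)] dx j := by
          have hp := (chartE (n := n) (c i)).map_source hxs
          have h5 := (continuousAt_extChartAt_symm'' (I := 𝓡 (2 * n)) (x := c i) hp).tendsto
          rw [(chartE (c i)).left_inv hxs] at h5
          filter_upwards [h5.eventually (isOpen_interior.mem_nhds hx),
            (isOpen_chartE_target (c i)).mem_nhds hp] with q hq hqt
          have hq' : (chartE (n := n) (c i)).symm q ∈ {y | χ (c i) y = 1} := interior_subset hq
          have h6 : χ (c i) ((chartE (n := n) (c i)).symm q) = 1 := hq'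
          change χ (c i) ((chartE (n := n) (c i)).symm q)
            * chartE (n := n) (c i) ((chartE (n := n) (c i)).symm q) j = q j
          rw [h6, (chartE (c i)).right_inv hqt, one_mul]
        rw [h4.fderiv_eq, ContinuousLinearMap.fderiv]
        rfl
      simp only [h3, smul_comm _ (ρ i x * σ i x)]
      rw [← Finset.smul_sum, coordField_sum hxs, coordField_coordOf hxs]
    · have : ρ i x = 0 := image_eq_zero_of_notMem_tsupport fun h => hx (hρs i h)
      simp [this]
  simp only [h2, ← Finset.sum_smul, h1, one_smul]

/-- In d(∑ f dg) = ∑ df ∧ dg the second derivatives of g cancel. The coefficient of ψ in dx_i ∧ dx_j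
∧ ψ is -√-1 ⟨dx_i, Jψ dx_j⟩, and the tangent part of Jψ dg is the Hamiltonian field; the pairing
contributes the factor 1/2. -/
theorem contractD_grad [T2Space M] (K : GenKaehlerSympl n M) {N : ℕ} {g : Fin N → M → ℝ}
    (hg : ∀ a, ContMDiff (𝓡 (2 * n)) 𝓘(ℝ, ℝ) ∞ (g a)) {f : Fin N → M → ℂ} {x : M}
    (hf : ∀ a, MDifferentiableAt (𝓡 (2 * n)) 𝓘(ℝ, ℂ) (f a) x)
    {τ : ∀ x : M, TangentSpace (𝓡 (2 * n)) x → ℂ}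
    (hτ : ∀ y v, τ y v = ∑ a, f a y * (mvfderiv (𝓡 (2 * n)) (g a) y v : ℂ)) :
    contractD K τ x = -(Complex.I / 2) * ∑ a, mvfderiv (𝓡 (2 * n)) (f a) x (hamVF K (g a) x) := by
  have hsm : ∀ X : ∀ x : M, TangentSpace (𝓡 (2 * n)) x, SmoothVF X → ∀ a,
      MDifferentiableAt (𝓡 (2 * n)) 𝓘(ℝ, ℝ) (fun y => mvfderiv (𝓡 (2 * n)) (g a) y (X y)) x :=
    fun X hX a => (contMDiff_mvfderiv (hg a) hX x).mdifferentiableAt (by simp)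
  choose X hX hXx hXe using fun i : Fin (2 * n) => exists_smoothVF_extVF (x := x) (stdVec (n := n) i)
  have h1 : ∀ i j, mvfderiv (𝓡 (2 * n)) (fun y => τ y (extVF (x := x) (stdVec j) y)) x (stdVec i)
      = ∑ a, (f a x * (mvfderiv (𝓡 (2 * n)) (fun y => mvfderiv (𝓡 (2 * n)) (g a) y (X j y)) x (X i x) : ℂ)
        + mvfderiv (𝓡 (2 * n)) (f a) x (stdVec i) * (mvfderiv (𝓡 (2 * n)) (g a) x (stdVec j) : ℂ)) := by
    intro i j
    have h2 : (fun y => τ y (extVF (x := x) (stdVec j) y))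
        =ᶠ[𝓝 x] fun y => ∑ a, f a y * (mvfderiv (𝓡 (2 * n)) (g a) y (X j y) : ℂ) := by
      filter_upwards [hXe j] with y hy
      rw [hτ, hy]
    have hd : ∀ a, MDifferentiableAt (𝓡 (2 * n)) 𝓘(ℝ, ℂ)
        (fun y => (mvfderiv (𝓡 (2 * n)) (g a) y (X j y) : ℂ)) x := fun a =>
      (Complex.ofRealCLM.contMDiff.mdifferentiableAt (n := ∞) (by simp)).comp x (hsm (X j) (hX j) a)
    refine (mvfderiv_congr h2 _).trans ((mvfderiv_sum_apply _ (fun a _ => (hf a).mul (hd a)) _).trans ?_)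
    refine Finset.sum_congr rfl fun a _ => ?_
    refine (mvfderiv_mul_complex (hf a) (hd a) _).trans ?_
    have h3 := mvfderiv_clm_comp Complex.ofRealCLM (hsm (X j) (hX j) a) (X i x)
    have h4 : mvfderiv (𝓡 (2 * n)) (fun y => (mvfderiv (𝓡 (2 * n)) (g a) y (X j y) : ℂ)) x (stdVec i) = _ :=
      (congrArg _ (hXx i)).symm.trans h3
    rw [h4, hXx j]
    rfl
  have hcomm : ∀ i j a, mvfderiv (𝓡 (2 * n)) (fun y => mvfderiv (𝓡 (2 * n)) (g a) y (X j y)) x (X i x)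
      = mvfderiv (𝓡 (2 * n)) (fun y => mvfderiv (𝓡 (2 * n)) (g a) y (X i y)) x (X j x) := fun i j a =>
    mvfderiv_coordField_comm (hg a) (mem_extChartAt_source x) (hX i) (hX j) (hXe i) (hXe j)
  set A : Fin (2 * n) → Fin (2 * n) → ℂ := fun i j => ∑ a, mvfderiv (𝓡 (2 * n)) (f a) x (stdVec i)
    * (mvfderiv (𝓡 (2 * n)) (g a) x (stdVec j) : ℂ) with hA
  have h5 : contractD K τ x = ∑ i, ∑ j, (K.pt x).projDx i j * A i j := by
    have h6 : ∑ i, ∑ j, (K.pt x).projDx i j * A j i = -∑ i, ∑ j, (K.pt x).projDx i j * A i j := by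
      rw [Finset.sum_comm]
      simp only [← Finset.sum_neg_distrib]
      refine Finset.sum_congr rfl fun i _ => Finset.sum_congr rfl fun j _ => ?_
      rw [PointKaehler.projDx_swap]
      ring
    have h7 : contractD K τ x = (1 / 2 : ℂ) * (∑ i, ∑ j, (K.pt x).projDx i j * A i j
        - ∑ i, ∑ j, (K.pt x).projDx i j * A j i) := by
      simp only [contractD, ← Finset.sum_sub_distrib, ← mul_sub]
      refine congrArg _ (Finset.sum_congr rfl fun i _ => Finset.sum_congr rfl fun j _ =>
        congrArg _ ?_)
      rw [h1, h1, hA]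
      simp only [← Finset.sum_sub_distrib]
      refine Finset.sum_congr rfl fun a _ => ?_
      rw [hcomm i j a]
      ring
    rw [h7, h6]
    ring
  have h8 : ∀ a, mvfderiv (𝓡 (2 * n)) (f a) x (hamVF K (g a) x)
      = ∑ i, ∑ j, ((mvfderiv (𝓡 (2 * n)) (g a) x (stdVec j)
        * dx i ((K.pt x).Jψ (covPart (dx j))).1 : ℝ) : ℂ) * mvfderiv (𝓡 (2 * n)) (f a) x (stdVec i) := by
    intro a
    have h9 : hamVF K (g a) x = ∑ i, (∑ j, mvfderiv (𝓡 (2 * n)) (g a) x (stdVec j)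
        * dx i ((K.pt x).Jψ (covPart (dx j))).1) • stdVec i := by
      have h10 : ((0 : W n), (mvfderiv (𝓡 (2 * n)) (g a) x : W n →L[ℝ] ℝ))
          = ∑ j, (mvfderiv (𝓡 (2 * n)) (g a) x : W n →L[ℝ] ℝ) (stdVec j) • covPart (dx j) := by
        refine Prod.ext ?_ ?_
        · simp [Prod.fst_sum, covPart]
        · simp only [Prod.snd_sum, covPart, Prod.smul_snd]
          exact (sum_dx (mvfderiv (𝓡 (2 * n)) (g a) x : W n →L[ℝ] ℝ)).symm
      have h11 : hamVF K (g a) x = ∑ j, (mvfderiv (𝓡 (2 * n)) (g a) x : W n →L[ℝ] ℝ) (stdVec j)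
          • ((K.pt x).Jψ (covPart (dx j))).1 := by
        have := congrArg (fun b => ((K.pt x).Jψ b).1) h10
        simp only [map_sum, map_smul, Prod.fst_sum, Prod.smul_fst] at this
        exact this
      refine h11.trans ?_
      rw [← sum_coord_stdVec (∑ j, (mvfderiv (𝓡 (2 * n)) (g a) x : W n →L[ℝ] ℝ) (stdVec j)
          • ((K.pt x).Jψ (covPart (dx j))).1)]
      refine Finset.sum_congr rfl fun i _ => congrArg (· • stdVec i) ?_
      change dx i (∑ j, (mvfderiv (𝓡 (2 * n)) (g a) x : W n →L[ℝ] ℝ) (stdVec j)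
          • ((K.pt x).Jψ (covPart (dx j))).1) = _
      simp only [map_sum, map_smul, smul_eq_mul]
    refine (congrArg _ h9).trans ((map_sum (mvfderiv (𝓡 (2 * n)) (f a) x) _ _).trans ?_)
    refine Finset.sum_congr rfl fun i _ => ?_
    refine (map_smul (mvfderiv (𝓡 (2 * n)) (f a) x) _ _).trans ?_
    rw [← Finset.sum_mul, Complex.real_smul, Complex.ofReal_sum]
  rw [h5]
  simp only [h8, hA, Finset.mul_sum]
  refine ((Finset.sum_congr rfl fun i _ => Finset.sum_comm).trans Finset.sum_comm).trans ?_
  refine Finset.sum_congr rfl fun a _ => Finset.sum_congr rfl fun i _ =>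
    Finset.sum_congr rfl fun j _ => ?_
  rw [PointKaehler.projDx_eq]
  simp only [pairing, covPart]
  push_cast
  simp
  ring

variable [MeasurableSpace M] [BorelSpace M] [CompactSpace M] [T2Space M] {K : GenKaehlerSympl n M}
  {f : M → ℂ} {θ : ∀ x : M, TangentSpace (𝓡 (2 * n)) x →ₗ[ℝ] ℂ}

/-- The integrand is the derivative of ρ f along the Hamiltonian field. As that field is divergence
free, the weak identity for its coordinate components gives zero. -/
theorem IsWeaklyDiff.stokes_chart (hf : IsWeaklyDiff K f θ) {g ρ : M → ℝ}
    (hg : ContMDiff (𝓡 (2 * n)) 𝓘(ℝ, ℝ) ∞ g) (hρ : ContMDiff (𝓡 (2 * n)) 𝓘(ℝ, ℝ) ∞ ρ) {c : M}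
    (hs : tsupport ρ ⊆ (chartE (n := n) c).source) :
    Integrable (fun x => ρ x • θ x (hamVF K g x)
      + mvfderiv (𝓡 (2 * n)) ρ x (hamVF K g x) • f x) (vol K) ∧
    ∫ x, (ρ x • θ x (hamVF K g x) + mvfderiv (𝓡 (2 * n)) ρ x (hamVF K g x) • f x) ∂vol K = 0 := by
  have := isFiniteMeasure_vol K
  have hint : Integrable (fun x => ρ x • θ x (hamVF K g x)
      + mvfderiv (𝓡 (2 * n)) ρ x (hamVF K g x) • f x) (vol K) := by
    refine ((hf.deriv _ (SmoothVF.smul hρ (smooth_hamVF K hg))).congr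
      (ae_of_all _ fun x => map_smul _ _ _)).add ?_
    exact hf.integrable.locallyIntegrable.integrable_smul_left_of_hasCompactSupport
      (contMDiff_mvfderiv hρ (smooth_hamVF K hg)).continuous (.of_compactSpace _)
  refine ⟨hint, ?_⟩
  set Z : W n → W n := fun q => coordOf c (hamVF K g ((chartE (n := n) c).symm q)) with hZ
  have hF : ∀ i, ContDiffOn ℝ ∞ (fun q => volDensity K c q * Z q i) (chartE (n := n) c).target :=
    fun i => (contDiffOn_volDensity K c).mul
      ((dx i).contDiff.comp_contDiffOn (contDiffOn_hamVF K hg c))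
  -- The test functions are the components of ρ X_g times the volume density.
  set φ : Fin (2 * n) → W n → ℝ := fun i => chartFn c ρ fun q => volDensity K c q * Z q i with hφ
  have ht := fun i => hf.test (contDiff_chartFn hρ hs (hF i)) (tsupport_chartFn hs _).1
    (tsupport_chartFn hs _).2 i
  rw [integral_chart K c hint fun x hx => ?_]
  · have hpt : ∀ p ∈ (chartE (n := n) c).target,
        volDensity K c p • (ρ ((chartE (n := n) c).symm p) • θ ((chartE (n := n) c).symm p) (hamVF K g ((chartE (n := n) c).symm p))
          + mvfderiv (𝓡 (2 * n)) ρ ((chartE (n := n) c).symm p) (hamVF K g ((chartE (n := n) c).symm p)) • f ((chartE (n := n) c).symm p))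
        = ∑ i, (fderiv ℝ (φ i) p (stdVec i) • f ((chartE (n := n) c).symm p)
          + φ i p • θ ((chartE (n := n) c).symm p) (chartTangent c p (stdVec i))) := by
      intro p hp
      have hx := (chartE (n := n) c).map_target hp
      have hn := (isOpen_chartE_target (n := n) c).mem_nhds hp
      have h1 : ∀ i, φ i p = ρ ((chartE (n := n) c).symm p) * (volDensity K c p * Z p i) :=
        fun i => Set.indicator_of_mem hp _
      have h2 : ∀ i, fderiv ℝ (φ i) p (stdVec i) = ρ ((chartE (n := n) c).symm p)
            * fderiv ℝ (fun q => volDensity K c q * Z q i) p (stdVec i)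
          + volDensity K c p * Z p i * fderiv ℝ (ρ ∘ (chartE (n := n) c).symm) p (stdVec i) := by
        intro i
        have hd : HasFDerivAt (fun q => ρ ((chartE (n := n) c).symm q) * (volDensity K c q * Z q i)) _ p :=
          (((contDiffOn_chart_target hρ c).contDiffAt hn).differentiableAt (by simp)).hasFDerivAt.mul
          (((hF i).contDiffAt hn).differentiableAt (by simp)).hasFDerivAt
        have h3 := (chartFn_eventuallyEq (ρ := ρ) (F := fun q => volDensity K c q * Z q i) hp).fderiv_eq
          (𝕜 := ℝ)
        rw [hφ]
        simp only
        rw [h3, hd.fderiv]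
        simp only [add_apply, smul_apply, smul_eq_mul]
        rfl
      have h4 : ∑ i, Z p i • chartTangent c p (stdVec i) = hamVF K g ((chartE (n := n) c).symm p) := by
        simp only [chartTangent_eq hp]
        rw [coordField_sum hx, coordField_coordOf hx]
      have h5 : mvfderiv (𝓡 (2 * n)) ρ ((chartE (n := n) c).symm p) (hamVF K g ((chartE (n := n) c).symm p))
          = ∑ i, Z p i * fderiv ℝ (ρ ∘ (chartE (n := n) c).symm) p (stdVec i) := by
        rw [mvfderiv_eq_coordOf hx ((hρ _).mdifferentiableAt (by simp)), (chartE c).right_inv hp]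
        change fderiv ℝ (ρ ∘ (chartE (n := n) c).symm) p (Z p) = _
        conv_lhs => rw [← sum_coord_stdVec (Z p)]
        simp
      have h6 : θ ((chartE (n := n) c).symm p) (hamVF K g ((chartE (n := n) c).symm p))
          = ∑ i, Z p i • θ ((chartE (n := n) c).symm p) (chartTangent c p (stdVec i)) := by
        rw [← h4, map_sum]
        simp only [map_smul]
      have h7 := divergence_hamVF K hg hp
      rw [Finset.sum_add_distrib, ← Finset.sum_smul]
      simp only [h1, h2, Finset.sum_add_distrib, ← Finset.mul_sum]
      rw [show ∑ i, fderiv ℝ (fun q => volDensity K c q * Z q i) p (stdVec i) = 0 from h7, h5, h6]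
      simp only [smul_add, Finset.smul_sum, smul_smul, mul_zero, zero_add, Finset.mul_sum, mul_assoc]
      rw [add_comm]
      congr 1
      refine Finset.sum_congr rfl fun i _ => ?_
      congr 1
      ring
    rw [setIntegral_congr_fun (isOpen_chartE_target c).measurableSet hpt,
      setIntegral_eq_integral_of_forall_compl_eq_zero, integral_finset_sum]
    · refine Finset.sum_eq_zero fun i _ => ?_
      rw [integral_add (ht i).1 (ht i).2.1, (ht i).2.2, neg_add_cancel]
    · exact fun i _ => (ht i).1.add (ht i).2.1
    · intro p hp
      refine Finset.sum_eq_zero fun i _ => ?_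
      have h8 : p ∉ tsupport (φ i) := fun h => hp ((tsupport_chartFn hs _).2 h)
      rw [image_eq_zero_of_notMem_tsupport h8,
        image_eq_zero_of_notMem_tsupport (f := fun p => fderiv ℝ (φ i) p (stdVec i))
          fun h => h8 (tsupport_fderiv_apply_subset ℝ (stdVec i) h), zero_smul, zero_smul, add_zero]
  · have hx' : x ∉ tsupport ρ := fun h => hx (hs h)
    have h0 : ρ =ᶠ[𝓝 x] fun _ => 0 := notMem_tsupport_iff_eventuallyEq.1 hx'
    have h1 := mvfderiv_congr h0 (hamVF K g x)
    have h2 : mvfderiv (𝓡 (2 * n)) (fun _ : M => (0 : ℝ)) x (hamVF K g x) = 0 := by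
      simp [mvfderiv]
    rw [h0.self_of_nhds, h1.trans h2, zero_smul, zero_smul, add_zero]

/-- Hamiltonian vector fields are divergence free. -/
theorem IsWeaklyDiff.stokes (hf : IsWeaklyDiff K f θ) {g : M → ℝ}
    (hg : ContMDiff (𝓡 (2 * n)) 𝓘(ℝ, ℝ) ∞ g) : ∫ x, θ x (hamVF K g x) ∂vol K = 0 := by
  obtain ⟨N, c, ρ, σ, hρ, hσ, hρs, -, h1⟩ := exists_cutoff_family (n := n) (M := M)
    (fun x => (chartE (n := n) x).source)
    (fun x => (isOpen_chartE_source x).mem_nhds (mem_extChartAt_source x))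
  have h2 := fun i => hf.stokes_chart hg ((hρ i).mul (hσ i)) (c := c i)
    ((closure_mono (Function.support_mul_subset_left _ _)).trans (hρs i))
  have h3 : ∀ x, ∑ i, ((ρ i * σ i) x • θ x (hamVF K g x)
      + mvfderiv (𝓡 (2 * n)) (ρ i * σ i) x (hamVF K g x) • f x) = θ x (hamVF K g x) := by
    intro x
    -- The weights sum to one, so their derivatives sum to zero.
    have h4 : ∑ i, mvfderiv (𝓡 (2 * n)) (ρ i * σ i) x (hamVF K g x) = 0 := by
      have h5 := mvfderiv_sum_apply Finset.univ (f := fun i => ρ i * σ i) (x := x)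
        (fun i _ => (((hρ i).mul (hσ i)) x).mdifferentiableAt (by simp)) (hamVF K g x)
      have h6 : (fun y => ∑ i, (ρ i * σ i) y) = fun _ => 1 := funext h1
      rw [← h5, h6]
      simp [mvfderiv]
    rw [Finset.sum_add_distrib, ← Finset.sum_smul, ← Finset.sum_smul, h4, zero_smul, add_zero]
    rw [show ∑ i, (ρ i * σ i) x = 1 from h1 x, one_smul]
  rw [integral_congr_ae (ae_of_all _ fun x => (h3 x).symm)]
  rw [integral_finset_sum _ fun i _ => (h2 i).1]
  exact Finset.sum_eq_zero fun i _ => (h2 i).2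

end Stokes
end GenKaehler

namespace GenKaehler

/-! ### Weak subbundles: weak derivatives and Stokes' theorem. -/

section WeakEnd

open Filter Topology

variable {n r : ℕ} {M : Type*} [TopologicalSpace M] [ChartedSpace (W n) M]
  [IsManifold (𝓡 (2 * n)) ∞ M]
  {E : M → Type*} [TopologicalSpace (TotalSpace (EuclideanSpace ℂ (Fin r)) E)]
  [∀ x, NormedAddCommGroup (E x)] [∀ x, InnerProductSpace ℂ (E x)]
  [FiberBundle (EuclideanSpace ℂ (Fin r)) E]
  [VectorBundle ℂ (EuclideanSpace ℂ (Fin r)) E] [VectorBundle ℝ (EuclideanSpace ℂ (Fin r)) E]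
  [ContMDiffVectorBundle ∞ (EuclideanSpace ℂ (Fin r)) E (𝓡 (2 * n))]
  {F : SecFrame n r E} {D : GenConnection n r E}
  {K : GenKaehlerSympl n M} {P q : ∀ x, Module.End ℂ (E x)} {x : M}
  {T : ∀ x, TangentSpace (𝓡 (2 * n)) x →ₗ[ℝ] Module.End ℂ (E x)} {U : Set M}

/-- Differentiate h(s, t) twice along commuting coordinate fields and antisymmetrize. -/
theorem curvEnd_skew [T2Space M] (hD : D.IsHermitian) (v w : TangentSpace (𝓡 (2 * n)) x) (u e : E x) :
    inner ℂ (F.curvEnd D.toCConnection x v w u) e = -inner ℂ u (F.curvEnd D.toCConnection x v w e) := by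
  obtain ⟨s, hs, rfl⟩ := F.exists_sec u
  obtain ⟨t, ht, rfl⟩ := F.exists_sec e
  obtain ⟨X, hX, hXx, hX'⟩ := exists_smoothVF_extVF v
  obtain ⟨Y, hY, hYx, hY'⟩ := exists_smoothVF_extVF w
  have key : ∀ {X Y : ∀ y : M, TangentSpace (𝓡 (2 * n)) y}, SmoothVF X → SmoothVF Y →
      mvfderiv (𝓡 (2 * n)) (fun y => mvfderiv (𝓡 (2 * n)) (fun z => inner ℂ (s z) (t z)) y (Y y)) x (X x)
      = inner ℂ (D.nabla (fun y => D.nabla s y (Y y)) x (X x)) (t x)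
        + inner ℂ (D.nabla s x (Y x)) (D.nabla t x (X x))
        + (inner ℂ (D.nabla s x (X x)) (D.nabla t x (Y x))
          + inner ℂ (s x) (D.nabla (fun y => D.nabla t y (Y y)) x (X x))) := by
    intro X Y hX hY
    have h1 := D.toCConnection.smooth_nabla hY hs
    have h2 := D.toCConnection.smooth_nabla hY ht
    have h3 : (fun y => mvfderiv (𝓡 (2 * n)) (fun z => inner ℂ (s z) (t z)) y (Y y))
        = fun y => inner ℂ (D.nabla s y (Y y)) (t y) + inner ℂ (s y) (D.nabla t y (Y y)) :=
      funext fun y => hD.form s t hs ht y (Y y)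
    rw [h3, ← hD.form _ _ h1 ht, ← hD.form _ _ hs h2]
    exact congrArg (fun L => L (X x)) (mvfderiv_add ((F.smooth_inner h1 ht).mdiffAt x)
      ((F.smooth_inner hs h2).mdiffAt x))
  have h1 := mvfderiv_coordField_comm (F.smooth_inner hs ht) (mem_extChartAt_source x) hX hY hX' hY'
  rw [key hX hY, key hY hX, hXx, hYx] at h1
  rw [F.curvEnd_apply _ v w hs, F.curvEnd_apply _ v w ht, nabla_extVF _ hs hY hY',
    nabla_extVF _ hs hX hX', nabla_extVF _ ht hY hY', nabla_extVF _ ht hX hX', inner_sub_left,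
    inner_sub_right]
  linear_combination h1

theorem covEnd_symm [T2Space M] (F : SecFrame n r E) (hD : D.IsHermitian) (h : IsProjOn (n := n) (r := r) U P)
    (hsymm : ∀ x ∈ U, ∀ u w, inner ℂ (P x u) w = inner ℂ u (P x w)) (hx : x ∈ U)
    (v : TangentSpace (𝓡 (2 * n)) x) (u w : E x) :
    inner ℂ (F.covEnd D.toCConnection P x v u) w = inner ℂ u (F.covEnd D.toCConnection P x v w) := by
  have h1 := isSymm_totalDeriv F D hD h hsymm hx (v, 0) u w
  rw [totalDeriv_apply] at h1
  simpa using h1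

/-- The trace of a skew-Hermitian curvature and the coefficients `projDx` are both purely imaginary.
-/
theorem curvTrace_im [T2Space M] (F : SecFrame n r E) (hD : D.IsHermitian) (h : IsProjOn (n := n) (r := r) U P)
    (hsymm : ∀ x ∈ U, ∀ u w, inner ℂ (P x u) w = inner ℂ u (P x w)) (hx : x ∈ U) :
    (curvTrace D.toCConnection K P x).im = 0 := by
  have := finiteDimensional_fibre r (E := E) x
  have h1 : ∀ v w : TangentSpace (𝓡 (2 * n)) x,
      (LinearMap.trace ℂ (E x) (curv P D.toCConnection x v w)).re = 0 := by
    intro v w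
    have hs := hsymm x hx
    have hc := covEnd_symm F hD h hsymm hx
    have h2 : ∀ u e, inner ℂ (curv P D.toCConnection x v w u) e
        = inner ℂ u ((-curv P D.toCConnection x v w) e) := by
      intro u e
      rw [curv_eq F D.toCConnection h hx]
      simp only [LinearMap.neg_apply, LinearMap.add_apply, LinearMap.sub_apply, Module.End.mul_apply,
        inner_add_left, inner_sub_left, inner_add_right, inner_sub_right, inner_neg_right, hs, hc,
        curvEnd_skew hD, map_sub]
      ring
    have h3 := congrArg Complex.re (PointKaehler.trace_eq_conj h2)
    rw [map_neg, Complex.neg_re, Complex.conj_re] at h3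
    linarith
  rw [curvTrace]
  have h4 : ∀ i j, ((K.pt x).projDx i j
      * LinearMap.trace ℂ (E x) (curv P D.toCConnection x (stdVec i) (stdVec j))).im = 0 := by
    intro i j
    rw [PointKaehler.projDx_eq, Complex.mul_im]
    simp [show (LinearMap.trace ℂ (E x) (curv P D.toCConnection x (stdVec i) (stdVec j))).re = 0 from
      h1 (stdVec i) (stdVec j)]
  rw [Complex.mul_im, Complex.im_sum]
  simp [Complex.im_sum, h4]

variable [MeasurableSpace M] [BorelSpace M] [CompactSpace M] [T2Space M]

theorem IsWeaklyDiff.zero : IsWeaklyDiff K (fun _ => 0) fun _ => 0 :=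
  ⟨integrable_zero _ _ _, fun _ _ => integrable_zero _ _ _, fun c φ _ _ _ i => by
    change ∫ y in _, _ * (0 : ℂ) = -∫ y in _, ((φ y : ℝ) : ℂ) * (0 : ℂ)
    simp⟩

theorem IsWeaklyDiff.add {f g : M → ℂ} {θ η : ∀ x : M, TangentSpace (𝓡 (2 * n)) x →ₗ[ℝ] ℂ}
    (hf : IsWeaklyDiff K f θ) (hg : IsWeaklyDiff K g η) :
    IsWeaklyDiff K (fun x => f x + g x) fun x => θ x + η x := by
  refine ⟨hf.integrable.add hg.integrable, fun X hX => (hf.deriv X hX).add (hg.deriv X hX), ?_⟩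
  intro c φ hφ hc hs i
  have h1 := hf.test hφ hc hs i
  have h2 := hg.test hφ hc hs i
  simp only [mul_add, LinearMap.add_apply, ← Complex.real_smul]
  rw [integral_add, integral_add, neg_add]
  · exact congrArg₂ (· + ·) (hf.weak c φ hφ hc hs i) (hg.weak c φ hφ hc hs i)
  all_goals first
    | exact h1.1.integrableOn | exact h1.2.1.integrableOn
    | exact h2.1.integrableOn | exact h2.2.1.integrableOn

theorem IsWeaklyDiff.sum {ι : Type*} (A : Finset ι) {f : ι → M → ℂ}
    {θ : ι → ∀ x : M, TangentSpace (𝓡 (2 * n)) x →ₗ[ℝ] ℂ} (h : ∀ k, IsWeaklyDiff K (f k) (θ k)) :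
    IsWeaklyDiff K (fun x => ∑ k ∈ A, f k x) fun x => ∑ k ∈ A, θ k x := by
  classical
  induction A using Finset.induction_on with
  | empty => simpa using IsWeaklyDiff.zero
  | insert k A hk ih =>
    simp only [Finset.sum_insert hk]
    exact (h k).add ih

/-- The weak differential of `⟨t, q s⟩`. -/
noncomputable def weakDiff (D : GenConnection n r E) (q : ∀ x, Module.End ℂ (E x))
    (T : ∀ x, TangentSpace (𝓡 (2 * n)) x →ₗ[ℝ] Module.End ℂ (E x)) (s t : ∀ x, E x) (x : M) :
    TangentSpace (𝓡 (2 * n)) x →ₗ[ℝ] ℂ where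
  toFun v := inner ℂ (t x) (T x v (s x)) + inner ℂ (t x) (q x (D.nabla s x v))
    + inner ℂ (D.nabla t x v) (q x (s x))
  map_add' v w := by
    simp only [map_add, LinearMap.add_apply, inner_add_left, inner_add_right]
    ring
  map_smul' c v := by
    simp only [map_smul, LinearMap.smul_apply, RingHom.id_apply, ← Complex.coe_smul, inner_smul_left,
      inner_smul_right, Complex.conj_ofReal]
    rw [smul_add, smul_add]
    simp

/-- The volume is finite, so L² bounds imply integrability. -/
theorem IsWeakSubbundle.isWeaklyDiff (h : IsWeakSubbundle K D P q T) {s t : ∀ x, E x}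
    (hs : SmoothSec n r s) (ht : SmoothSec n r t) :
    IsWeaklyDiff K (fun x => inner ℂ (t x) (q x (s x))) (weakDiff D q T s t) := by
  have := isFiniteMeasure_vol K
  refine ⟨(h.memLp s t hs ht).integrable (by norm_num), fun X hX => ?_, h.weak s t hs ht⟩
  exact (((h.memLp_deriv X s t hX hs ht).integrable (by norm_num)).add
    ((h.memLp _ t (D.toCConnection.smooth_nabla hX hs) ht).integrable (by norm_num))).add
    ((h.memLp s _ hs (D.toCConnection.smooth_nabla hX ht)).integrable (by norm_num))

theorem memLp_of_continuous (K : GenKaehlerSympl n M) {f : M → ℂ} (hf : Continuous f) :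
    MemLp f 2 (vol K) := by
  have := isFiniteMeasure_vol K
  exact hf.memLp_of_hasCompactSupport (.of_compactSpace f)

theorem isWeakSubbundle_of_genHol (F : SecFrame n r E) (hD : D.IsHermitian) {p : ℕ}
    (h : IsGenHolSubbundle K.J D P p) : IsWeakSubbundle K D P P (F.covEndₗ D.toCConnection P) := by
  refine ⟨fun s t hs ht => memLp_of_continuous K (F.smooth_inner ht (h.smooth s hs)).continuous,
    fun X s t hX hs ht => memLp_of_continuous K
      (F.smooth_inner ht (F.smooth_covEnd _ h.smooth hX s hs)).continuous, fun s t hs ht => ?_,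
    ae_of_all _ fun x => LinearMap.ext (h.idem x), ae_of_all _ fun x => LinearMap.ext (h.idem x),
    ae_of_all _ h.symm, ae_of_all _ fun x a => hol_of_isGenHolSubbundle F D K h x a⟩
  have h1 := (isWeaklyDiff_of_smooth K (F.smooth_inner ht (h.smooth s hs))).weak
  convert h1 using 3 with x v
  refine Eq.trans ?_ (hD.form t _ ht (h.smooth s hs) x v).symm
  rw [F.nabla_end _ h.smooth hs, inner_add_right, SecFrame.covEndₗ_apply]
  ring

/-- The weak covariant derivative of a smooth field is its covariant derivative. -/
theorem IsWeakSubbundle.ae_eq_covEnd (F : SecFrame n r E) (hD : D.IsHermitian) (h : IsWeakSubbundle K D P q T)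
    (hU : IsOpen U) (hq : SmoothEndOn n r U q) :
    ∀ᵐ x ∂vol K, x ∈ U → T x = F.covEndₗ D.toCConnection q x := by
  have h1 : ∀ k l, ∀ᵐ x ∂vol K, x ∈ U → ∀ v, weakDiff D q T (F.s k) (F.t l) x v
      = mvfderiv (𝓡 (2 * n)) (fun y => inner ℂ (F.t l y) (q y (F.s k y))) x v := fun k l =>
    (h.isWeaklyDiff (F.smooth_s k) (F.smooth_t l)).ae_eq_mvfderiv hU
      (F.metric.inner_on hU ((F.smooth_t l).mono (Set.subset_univ _)) (hq _ (F.smooth_s k)))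
  filter_upwards [ae_all_iff.2 fun k => ae_all_iff.2 fun l => h1 k l] with x hx hxU
  obtain ⟨Φ, hΦ, he⟩ := hq.exists_global hU hxU
  have h2 : ∀ v k, T x v (F.s k x) = F.covEnd D.toCConnection q x v (F.s k x) := by
    intro v k
    rw [← F.expand x (T x v (F.s k x)), ← F.expand x (F.covEnd D.toCConnection q x v (F.s k x))]
    refine Finset.sum_congr rfl fun l _ => congrArg (· • F.s l x) ?_
    have h3 := hx k l hxU v
    have h4 := mvfderiv_congr (n := n) (f := fun y => inner ℂ (F.t l y) (q y (F.s k y)))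
      (g := fun y => inner ℂ (F.t l y) (Φ y (F.s k y))) (he.mono fun y hy => by simp only [hy]) v
    rw [h4, hD.form _ _ (F.smooth_t l) (hΦ _ (F.smooth_s k)), F.nabla_end _ hΦ (F.smooth_s k),
      ← F.covEnd_congr _ hΦ (he.mono fun y hy => hy.symm), he.self_of_nhds, inner_add_right] at h3
    change inner ℂ (F.t l x) (T x v (F.s k x)) + inner ℂ (F.t l x) (q x (D.nabla (F.s k) x v))
      + inner ℂ (D.nabla (F.t l) x v) (q x (F.s k x)) = _ at h3
    linear_combination h3
  refine LinearMap.ext fun v => LinearMap.ext fun u => ?_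
  rw [← F.expand x u, map_sum, map_sum]
  exact Finset.sum_congr rfl fun k _ => by rw [map_smul, map_smul, h2]; rfl

/-- Stokes' theorem for the one-form `tr (q Θ)`. -/
theorem IsWeakSubbundle.integral_contractD (F : SecFrame n r E) (h : IsWeakSubbundle K D P q T) (hU : IsOpen U)
    (hU0 : vol K Uᶜ = 0) (hq : SmoothEndOn n r U q)
    {Θ : ∀ x : M, TangentSpace (𝓡 (2 * n)) x →ₗ[ℝ] Module.End ℂ (E x)}
    (hΘ : SmoothEndForm (r := r) Θ) :
    Integrable (contractD K fun y v => LinearMap.trace ℂ (E y) (q y * Θ y v)) (vol K) ∧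
      ∫ x, contractD K (fun y v => LinearMap.trace ℂ (E y) (q y * Θ y v)) x ∂vol K = 0 := by
  obtain ⟨G⟩ := exists_gradFrame (n := n) (M := M)
  -- f a is the trace of q Θ(X_a), so tr (q Θ) = ∑ f_a dg_a with weakly differentiable coefficients.
  set f : Fin G.card → M → ℂ := fun a x => ∑ k, inner ℂ (F.t k x) (q x (Θ x (G.X a x) (F.s k x))) with hf
  set η : Fin G.card → ∀ x : M, TangentSpace (𝓡 (2 * n)) x →ₗ[ℝ] ℂ := fun a x =>
    ∑ k, weakDiff D q T (fun y => Θ y (G.X a y) (F.s k y)) (F.t k) x with hη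
  have hw : ∀ a, IsWeaklyDiff K (f a) (η a) := fun a => IsWeaklyDiff.sum Finset.univ fun k =>
    h.isWeaklyDiff (hΘ _ (G.smooth_X a) _ (F.smooth_s k)) (F.smooth_t k)
  have hfs : ∀ a, ContMDiffOn (𝓡 (2 * n)) 𝓘(ℝ, ℂ) ∞ (f a) U := fun a =>
    contMDiffOn_finsetSum fun k _ => F.metric.inner_on hU ((F.smooth_t k).mono (Set.subset_univ _))
      (hq _ (hΘ _ (G.smooth_X a) _ (F.smooth_s k)))
  have hτ : ∀ y v, LinearMap.trace ℂ (E y) (q y * Θ y v)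
      = ∑ a, f a y * (mvfderiv (𝓡 (2 * n)) (G.g a) y v : ℂ) := by
    intro y v
    conv_lhs => rw [← G.expand y v]
    rw [map_sum, Finset.mul_sum, map_sum]
    refine Finset.sum_congr rfl fun a _ => ?_
    rw [map_smul, mul_smul_comm, ← Complex.coe_smul, map_smul, F.trace_eq, smul_eq_mul, mul_comm]
    rfl
  have hU1 : ∀ᵐ x ∂vol K, x ∈ U := by
    rw [ae_iff]
    exact hU0
  -- The classical expression is meaningful only where q is smooth. The weak one is global, and the
  -- two agree off a null set.
  have h2 : ∀ᵐ x ∂vol K, -(Complex.I / 2) * ∑ a, η a x (hamVF K (G.g a) x)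
      = contractD K (fun y v => LinearMap.trace ℂ (E y) (q y * Θ y v)) x := by
    filter_upwards [hU1, ae_all_iff.2 fun a => (hw a).ae_eq_mvfderiv hU (hfs a)] with x hx h3
    rw [contractD_grad K G.smooth_g (fun a => ((hfs a).contMDiffAt (hU.mem_nhds hx)).mdifferentiableAt
      (by simp)) hτ]
    exact congrArg _ (Finset.sum_congr rfl fun a _ => h3 a hx _)
  have h4 : ∀ a, Integrable (fun x => η a x (hamVF K (G.g a) x)) (vol K) := fun a =>
    (hw a).deriv _ (smooth_hamVF K (G.smooth_g a))
  refine ⟨((integrable_finset_sum _ fun a _ => h4 a).const_mul _).congr h2, ?_⟩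
  rw [← integral_congr_ae h2, integral_const_mul, integral_finset_sum _ fun a _ => h4 a]
  exact mul_eq_zero_of_right _ (Finset.sum_eq_zero fun a _ => (hw a).stokes (G.smooth_g a))

end WeakEnd
end GenKaehler

namespace GenKaehler

/-! ### Integrability of the defect and the degree formula. -/

section Degrees

open Filter Topology

variable {n r : ℕ} {M : Type*} [TopologicalSpace M] [ChartedSpace (W n) M]
  [IsManifold (𝓡 (2 * n)) ∞ M]
  {E : M → Type*} [TopologicalSpace (TotalSpace (EuclideanSpace ℂ (Fin r)) E)]
  [∀ x, NormedAddCommGroup (E x)] [∀ x, InnerProductSpace ℂ (E x)]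
  [FiberBundle (EuclideanSpace ℂ (Fin r)) E]
  [VectorBundle ℂ (EuclideanSpace ℂ (Fin r)) E] [VectorBundle ℝ (EuclideanSpace ℂ (Fin r)) E]
  [ContMDiffVectorBundle ∞ (EuclideanSpace ℂ (Fin r)) E (𝓡 (2 * n))]
  {D : GenConnection n r E}
  {K : GenKaehlerSympl n M} {P q : ∀ x, Module.End ℂ (E x)}
  {T : ∀ x, TangentSpace (𝓡 (2 * n)) x →ₗ[ℝ] Module.End ℂ (E x)} {U : Set M}
  [MeasurableSpace M] [BorelSpace M] [CompactSpace M] [T2Space M]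

/-- A nonempty open set has positive volume, so a continuous function that vanishes almost
everywhere vanishes. -/
theorem eq_zero_of_ae (K : GenKaehlerSympl n M) {g : M → ℂ} (hU : IsOpen U) (hg : ContinuousOn g U)
    (h : ∀ᵐ x ∂vol K, x ∈ U → g x = 0) {x : M} (hx : x ∈ U) : g x = 0 := by
  by_contra h0
  refine vol_pos_of_isOpen K (hg.isOpen_inter_preimage hU isOpen_compl_singleton)
    ⟨x, hx, h0⟩ (measure_mono_null (fun y hy => ?_) (ae_iff.1 h))
  simp only [Set.mem_setOf_eq, Classical.not_imp]
  exact ⟨hy.1, hy.2⟩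

theorem end_eq_of_ae (K : GenKaehlerSympl n M) (F : SecFrame n r E) {A B : ∀ x, Module.End ℂ (E x)}
    (hU : IsOpen U) (hA : SmoothEndOn n r U A) (hB : SmoothEndOn n r U B)
    (h : ∀ᵐ x ∂vol K, x ∈ U → A x = B x) {x : M} (hx : x ∈ U) : A x = B x := by
  refine F.end_ext fun s hs => ?_
  rw [← F.expand x (A x (s x)), ← F.expand x (B x (s x))]
  refine Finset.sum_congr rfl fun l _ => congrArg (· • F.s l x) ?_
  have h1 : ∀ {A : ∀ x, Module.End ℂ (E x)}, SmoothEndOn n r U A →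
      ContinuousOn (fun y => inner ℂ (F.t l y) (A y (s y))) U := fun hA =>
    (F.metric.inner_on hU ((F.smooth_t l).mono (Set.subset_univ _)) (hA s hs)).continuousOn
  refine sub_eq_zero.1 (eq_zero_of_ae K hU ((h1 hA).sub (h1 hB)) ?_ hx)
  filter_upwards [h] with y hy hyU
  simp only [Pi.sub_apply, hy hyU, sub_self]

/-- The relation q² = q is given almost everywhere; by continuity it holds at every point of the set
where q is smooth. -/
theorem IsWeakSubbundle.isProjOn (F : SecFrame n r E) (h : IsWeakSubbundle K D P q T) (hU : IsOpen U)
    (hq : SmoothEndOn n r U q) : IsProjOn (n := n) (r := r) U q :=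
  ⟨hU, hq, fun _ hx => end_eq_of_ae K F hU (hq.mul hq hU) hq (h.idem.mono fun _ hy _ => hy) hx⟩

theorem IsWeakSubbundle.symmOn (F : SecFrame n r E) (h : IsWeakSubbundle K D P q T) (hU : IsOpen U)
    (hq : SmoothEndOn n r U q) {x : M} (hx : x ∈ U) (u w : E x) :
    inner ℂ (q x u) w = inner ℂ u (q x w) := by
  obtain ⟨s, hs, rfl⟩ := F.exists_sec u
  obtain ⟨t, ht, rfl⟩ := F.exists_sec w
  refine sub_eq_zero.1 (eq_zero_of_ae K hU
    (((F.metric.inner_on hU (hq s hs) (ht.mono (Set.subset_univ _))).continuousOn).sub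
    ((F.metric.inner_on hU (hs.mono (Set.subset_univ _)) (hq t ht)).continuousOn)) ?_ hx)
  filter_upwards [h.symm] with y hy _
  simp only [Pi.sub_apply, hy, sub_self]

/-- The weak total derivative. -/
noncomputable def weakTotal (D : GenConnection n r E) (q : ∀ x, Module.End ℂ (E x))
    (T : ∀ x, TangentSpace (𝓡 (2 * n)) x →ₗ[ℝ] Module.End ℂ (E x)) (x : M) (a : GT n x) :
    Module.End ℂ (E x) :=
  T x a.1 + (D.vec x a.2 * q x - q x * D.vec x a.2)

theorem IsWeakSubbundle.memLp_weakTotal (hD : D.IsHermitian) (h : IsWeakSubbundle K D P q T)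
    {a : ∀ x : M, GT n x} (ha : SmoothGT a) {s t : ∀ x, E x} (hs : SmoothSec n r s)
    (ht : SmoothSec n r t) :
    MemLp (fun x => inner ℂ (t x) (weakTotal D q T x (a x) (s x))) 2 (vol K) := by
  have hV := D.vec_smooth _ ha.2
  have h1 := ((h.memLp_deriv _ s t ha.1 hs ht).sub (h.memLp s _ hs (hV t ht))).sub
    (h.memLp _ t (hV s hs) ht)
  refine h1.ae_eq (ae_of_all _ fun x => ?_)
  have h2 := hD.vector x (a x).2 (t x) (q x (s x))
  simp only [Pi.sub_apply, weakTotal, LinearMap.add_apply, LinearMap.sub_apply, Module.End.mul_apply,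
    inner_add_right, inner_sub_right]
  linear_combination -h2

/-- Orthogonal projections do not increase the norm, and smooth sections are bounded on compact M.
-/
theorem IsWeakSubbundle.bounded (F : SecFrame n r E) (h : IsWeakSubbundle K D P q T) {s t : ∀ x, E x}
    (hs : SmoothSec n r s) (ht : SmoothSec n r t) :
    ∃ C : ℝ, ∀ᵐ x ∂vol K, ‖inner ℂ (t x) (q x (s x))‖ ≤ C := by
  obtain ⟨C, hC⟩ := isCompact_univ.exists_bound_of_continuousOn
    ((F.smooth_inner hs hs).continuous.add (F.smooth_inner ht ht).continuous).continuousOn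
  refine ⟨C, ?_⟩
  filter_upwards [h.idem, h.symm] with x h1 h2
  have h3 : ‖q x (s x)‖ ≤ ‖s x‖ := by
    have h4 : ‖q x (s x)‖ ^ 2 ≤ ‖s x‖ * ‖q x (s x)‖ := by
      rw [← inner_self_eq_norm_sq (𝕜 := ℂ), h2, ← Module.End.mul_apply, h1]
      exact (RCLike.re_le_norm _).trans (norm_inner_le_norm _ _)
    by_contra hlt
    push Not at hlt
    nlinarith [norm_nonneg (s x), norm_nonneg (q x (s x))]
  have h5 : ‖(inner ℂ (s x) (s x) + inner ℂ (t x) (t x) : ℂ)‖ ≤ C := hC x (Set.mem_univ x)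
  have h6 : ‖(inner ℂ (s x) (s x) + inner ℂ (t x) (t x) : ℂ)‖ = ‖s x‖ ^ 2 + ‖t x‖ ^ 2 := by
    rw [inner_self_eq_norm_sq_to_K, inner_self_eq_norm_sq_to_K]
    norm_cast
    exact abs_of_nonneg (by positivity)
  have h7 := norm_inner_le_norm (𝕜 := ℂ) (t x) (q x (s x))
  have h8 : ‖t x‖ * ‖q x (s x)‖ ≤ ‖t x‖ * ‖s x‖ := mul_le_mul_of_nonneg_left h3 (norm_nonneg _)
  rw [h6] at h5
  nlinarith [sq_nonneg (‖s x‖ - ‖t x‖), norm_nonneg (s x), norm_nonneg (t x)]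

theorem SecFrame.trace_mul_mul (F : SecFrame n r E) {x : M} (A B C : Module.End ℂ (E x)) :
    LinearMap.trace ℂ (E x) (A * B * C) = ∑ k, ∑ l, ∑ m, inner ℂ (F.t k x) (A (F.s m x))
      * (inner ℂ (F.t m x) (B (F.s l x)) * inner ℂ (F.t l x) (C (F.s k x))) := by
  have key : ∀ (L : Module.End ℂ (E x)) (k) (u : E x), inner ℂ (F.t k x) (L u)
      = ∑ m, inner ℂ (F.t k x) (L (F.s m x)) * inner ℂ (F.t m x) u := by
    intro L k u
    conv_lhs => rw [← F.expand x u, map_sum, inner_sum]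
    refine Finset.sum_congr rfl fun m _ => ?_
    rw [map_smul, inner_smul_right, mul_comm]
  rw [F.trace_eq]
  refine Finset.sum_congr rfl fun k _ => ?_
  rw [Module.End.mul_apply, key (A * B)]
  refine Finset.sum_congr rfl fun l _ => ?_
  rw [Module.End.mul_apply, key A, Finset.sum_mul]
  exact Finset.sum_congr rfl fun m _ => mul_assoc _ _ _

/-- A product of one bounded factor q and two factors in L². -/
theorem IsWeakSubbundle.integrable_trace (F : SecFrame n r E) (hD : D.IsHermitian)
    (h : IsWeakSubbundle K D P q T) {a c : ∀ x : M, GT n x} (ha : SmoothGT a) (hc : SmoothGT c) :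
    Integrable (fun x => LinearMap.trace ℂ (E x) (q x * weakTotal D q T x (a x)
      * weakTotal D q T x (c x))) (vol K) := by
  simp only [F.trace_mul_mul]
  refine integrable_finset_sum _ fun k _ => integrable_finset_sum _ fun l _ =>
    integrable_finset_sum _ fun m _ => ?_
  obtain ⟨C, hC⟩ := h.bounded F (F.smooth_s m) (F.smooth_t k)
  exact ((h.memLp_weakTotal hD ha (F.smooth_s l) (F.smooth_t m)).integrable_mul
    (h.memLp_weakTotal hD hc (F.smooth_s k) (F.smooth_t l))).bdd_mul
    (h.memLp _ _ (F.smooth_s m) (F.smooth_t k)).aestronglyMeasurable hC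

/-- The contraction in the defect may be computed in a finite global frame of T ⊕ T*. Each term is
then the trace of a product along smooth sections. -/
theorem IsWeakSubbundle.integrable_defect (F : SecFrame n r E) (hD : D.IsHermitian)
    (h : IsWeakSubbundle K D P q T) (hU : IsOpen U) (hU0 : vol K Uᶜ = 0) (hq : SmoothEndOn n r U q) :
    Integrable (F.defect D K q) (vol K) := by
  obtain ⟨G⟩ := exists_vecFrame (n := n) (M := M)
  let f : Fin G.card ⊕ Fin G.card → ∀ x : M, GT n x := fun c x =>
    Sum.elim (fun a => (G.X a x, 0)) (fun a => (0, G.ξ a x)) c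
  let f' : Fin G.card ⊕ Fin G.card → ∀ x : M, GT n x := fun c x =>
    Sum.elim (fun a => (0, G.ξ a x)) (fun a => (G.X a x, 0)) c
  have hzero : SmoothOneForm (fun x : M => (0 : TangentSpace (𝓡 (2 * n)) x →L[ℝ] ℝ)) :=
    fun X _ => contMDiff_const
  have hf : ∀ c, SmoothGT (f c) := by
    rintro (a | a)
    exacts [⟨G.smooth_X a, hzero⟩, ⟨smoothVF_zero, G.smooth_ξ a⟩]
  have hf' : ∀ c, SmoothGT (f' c) := by
    rintro (a | a)
    exacts [⟨smoothVF_zero, G.smooth_ξ a⟩, ⟨G.smooth_X a, hzero⟩]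
  have hg : ∀ c, SmoothGT (fun x => K.J x (K.Jψ x (f' c x))) := fun c =>
    K.J_complex.smooth _ (K.Jψ_complex.smooth _ (hf' c))
  have hi := fun c => (h.integrable_trace F hD (hg c) (hf c)).re
  refine ((integrable_finset_sum Finset.univ fun c _ => hi c).const_mul (-(1 / 2))).congr ?_
  have hU1 : ∀ᵐ x ∂vol K, x ∈ U := by
    rw [ae_iff]
    exact hU0
  filter_upwards [hU1, h.ae_eq_covEnd F hD hU hq] with x hx hT
  have hR : ∀ a, weakTotal D q T x a = F.totalDeriv D q x a := fun a => by
    rw [weakTotal, hT hx]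
    rfl
  have hdual : ∀ y : W n × (W n →L[ℝ] ℝ), ∑ c, (2 * pairing (f' c x) y) • f c x = y := by
    intro y
    rw [Fintype.sum_sum_type]
    refine Prod.ext ?_ ?_
    · refine Eq.trans ?_ (G.expand x y.1)
      simp [f, f', pairing, Prod.fst_sum]
      exact Finset.sum_congr rfl fun a _ => congrArg (· • G.X a x)
        ((congrArg (· + _) (map_zero y.2)).trans (zero_add _))
    · refine ContinuousLinearMap.ext fun v => ?_
      refine Eq.trans ?_ (congrArg y.2 (G.expand x v))
      simp only [f, f', pairing, Prod.snd_sum, Sum.elim_inl, Sum.elim_inr, Prod.snd_add, Prod.smul_snd,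
        smul_zero, Finset.sum_const_zero, zero_add, ContinuousLinearMap.sum_apply, smul_apply, smul_eq_mul]
      refine .trans ?_ (map_sum y.2 _ _).symm
      refine Finset.sum_congr rfl fun a _ => ?_
      refine .trans (congrArg (· * _) ?_) ((mul_comm _ _).trans (map_smul y.2 _ _).symm)
      exact (by ring : (2 : ℝ) * (1 / 2 * (y.2 (G.X a x) + 0)) = y.2 (G.X a x))
  rw [SecFrame.defect, ← pairTr_eq _ (fun c => f c x) (fun c => f' c x) hdual, Finset.mul_sum,
    Finset.mul_sum]
  refine Finset.sum_congr rfl fun c _ => ?_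
  rw [hR, hR]
  have alg : ∀ A B : Module.End ℂ (E x), -(1 / 2) * RCLike.re (LinearMap.trace ℂ (E x) (q x * A * B))
      = 1 / 2 * (LinearMap.trace ℂ (E x) (q x * -A * B)).re := by
    intro A B
    simp
  exact (alg _ _).trans (congrArg (fun A => 1 / 2 * (LinearMap.trace ℂ (E x)
    (q x * A * F.totalDeriv D q x (f c x))).re) (map_neg (F.totalDeriv D q x) _).symm)

/-- Integrate the pointwise formula: the exact terms from θ and from the choice of `C` drop out by
Stokes' theorem. The right-hand side does not involve `C`. -/
theorem IsWeakSubbundle.degreeOn_eq (F : SecFrame n r E) (hD : D.IsHermitian) {lam : ℝ}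
    (hEH : IsEinsteinHermitian K (fun _ => 1) D lam)
    (h : IsWeakSubbundle K D P q T) (hU : IsOpen U) (hU0 : vol K Uᶜ = 0) (hq : SmoothEndOn n r U q)
    {k : ℕ} (hk : ∀ x ∈ U, finrank ℂ (LinearMap.range (q x)) = k) (C : CConnection n r E) :
    degreeOn K C U q
      = 1 / (2 * Real.pi) * (lam * k * (vol K).real Set.univ - ∫ x, F.defect D K q x ∂vol K) := by
  have := isFiniteMeasure_vol K
  have hU1 : ∀ᵐ x ∂vol K, x ∈ U := by
    rw [ae_iff]
    exact hU0
  have hp := h.isProjOn F hU hq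
  have hsymm : ∀ x ∈ U, ∀ u w, inner ℂ (q x u) w = inner ℂ u (q x w) := fun x hx =>
    h.symmOn F hU hq hx
  have hd := h.integrable_defect F hD hU hU0 hq
  have h1 := h.integral_contractD F hU hU0 hq (smooth_thetaForm D K)
  have h2 := h.integral_contractD F hU hU0 hq (smooth_diffEnd F C D.toCConnection)
  set c1 := contractD K fun y v => LinearMap.trace ℂ (E y) (q y * thetaForm D K y v)
  set c2 := contractD K fun y v => LinearMap.trace ℂ (E y) (q y * F.diffEnd C D.toCConnection y v)
  have h3 : ∀ᵐ x ∂vol K, curvTrace C K q x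
      = ((lam * k - F.defect D K q x - (c1 x).re : ℝ) : ℂ) + c2 x := by
    filter_upwards [hU1, h.ae_eq_covEnd F hD hU hq, h.hol] with x hx hT hhol
    rw [curvTrace_compare F C D K hD hp hx]
    congr 1
    have h4 := re_curvTrace F D K hD hEH hp hsymm hx (fun a => by
      have h5 := hhol a
      rw [hT hx] at h5
      exact (congrArg (· * q x) h5).trans (zero_mul _))
    rw [hk x hx] at h4
    rw [← h4]
    -- For the Hermitian connection the density is real, so its real part determines it.
    exact Complex.ext rfl (by rw [curvTrace_im F hD hp hsymm hx]; rfl)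
  have h5 : Integrable (fun x => lam * k - F.defect D K q x - (c1 x).re) (vol K) :=
    ((integrable_const _).sub hd).sub h1.1.re
  have h6 : ∫ x, (c1 x).re ∂vol K = 0 := by
    have := integral_re h1.1
    rw [h1.2] at this
    exact this
  have h9 : Integrable (fun x => (c1 x).re) (vol K) := h1.1.re
  have h10 : Integrable (fun x => lam * k - F.defect D K q x) (vol K) := (integrable_const _).sub hd
  have h8 : ∫ x, (lam * k - F.defect D K q x - (c1 x).re) ∂vol K
      = lam * k * (vol K).real Set.univ - ∫ x, F.defect D K q x ∂vol K := by
    rw [integral_sub h10 h9, h6, sub_zero, integral_sub (integrable_const _) hd,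
      integral_const, smul_eq_mul, mul_comm]
  have h7 : ∫ x, curvTrace C K q x ∂vol K
      = ((lam * k * (vol K).real Set.univ - ∫ x, F.defect D K q x ∂vol K : ℝ) : ℂ) := by
    have h5' : Integrable (fun x => ((lam * k - F.defect D K q x - (c1 x).re : ℝ) : ℂ)) (vol K) := h5.ofReal
    rw [integral_congr_ae h3]
    refine (integral_add h5' h2.1).trans ?_
    rw [h2.2, add_zero]
    exact integral_ofReal.trans (congrArg _ h8)
  rw [degreeOn, integralTop]
  simp only [degree_integrand]
  rw [Measure.restrict_eq_self_of_ae_mem hU1, integral_const_mul, h7]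
  have h8 : (1 / (2 * Real.pi) : ℂ) = ((1 / (2 * Real.pi) : ℝ) : ℂ) := by push_cast; rfl
  rw [h8, ← Complex.ofReal_mul, Complex.ofReal_re]

end Degrees
end GenKaehler

namespace GenKaehler

/-! ### Regularity for weak solutions of linear first-order systems. -/

section WeakRegularity

open Filter Topology
open scoped Convolution
open ContinuousLinearMap (lsmul)

variable {V : Type} [NormedAddCommGroup V] [InnerProductSpace ℝ V] [FiniteDimensional ℝ V]
  [MeasurableSpace V] [BorelSpace V] {O : Set (V)} {f : V → ℂ} {g : V → V →L[ℝ] ℂ}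

/-- `g` is the weak differential of `f` on the open set `O`. -/
structure WeakFDeriv (O : Set (V)) (f : V → ℂ) (g : V → V →L[ℝ] ℂ) : Prop where
  loc : LocallyIntegrableOn f O volume
  loc_deriv : LocallyIntegrableOn g O volume
  weak : ∀ φ : V → ℝ, ContDiff ℝ ∞ φ → HasCompactSupport φ → tsupport φ ⊆ O → ∀ v,
    ∫ p, fderiv ℝ φ p v • f p = -∫ p, φ p • g p v

/-- The function `u`, extended by zero from the set `B`. -/
noncomputable def truncate {V F : Type*} [NormedAddCommGroup F] (B : Set V) (u : V → F) : V → F :=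
  B.indicator u

theorem truncate_of_mem {V F : Type*} [NormedAddCommGroup F] {B : Set V} {p : V} (hp : p ∈ B)
    (u : V → F) : truncate B u p = u p :=
  Set.indicator_of_mem hp u

theorem truncate_of_notMem {V F : Type*} [NormedAddCommGroup F] {B : Set V} {p : V} (hp : p ∉ B)
    (u : V → F) : truncate B u p = 0 :=
  Set.indicator_of_notMem hp u

theorem integrable_truncate {V F : Type*} [MeasureSpace V] [NormedAddCommGroup F] {B : Set V}
    (hB : MeasurableSet B) {u : V → F} (hu : IntegrableOn u B volume) :
    Integrable (truncate B u) volume :=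
  (integrable_indicator_iff hB).2 hu

/-- Mollification commutes with the weak differential in the inner ball, where the translated bump
is a test function supported in the doubled ball. -/
theorem WeakFDeriv.hasFDerivAt_convolution (h : WeakFDeriv O f g) {p₀ : V} {R : ℝ}
    (hO : Metric.closedBall p₀ (2 * R) ⊆ O) (φ : ContDiffBump (0 : V)) (hφ : φ.rOut < R) {x : V}
    (hx : x ∈ Metric.ball p₀ R) :
    HasFDerivAt (φ.normed volume ⋆[lsmul ℝ ℝ, volume] truncate (Metric.closedBall p₀ (2 * R)) f)
      ((φ.normed volume ⋆[lsmul ℝ ℝ, volume] truncate (Metric.closedBall p₀ (2 * R)) g) x) x := by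
  set B := Metric.closedBall p₀ (2 * R) with hB
  have hBc : IsCompact B := isCompact_closedBall _ _
  have hBm : MeasurableSet B := hBc.measurableSet
  have hf0 : Integrable (truncate B f) volume :=
    integrable_truncate hBm (h.loc.integrableOn_compact_subset hO hBc)
  have hg0 : Integrable (truncate B g) volume :=
    integrable_truncate hBm (h.loc_deriv.integrableOn_compact_subset hO hBc)
  have hφs : ContDiff ℝ ∞ (φ.normed volume) := φ.contDiff_normed
  have hφc : HasCompactSupport (φ.normed volume) := φ.hasCompactSupport_normed
  have hd := hφc.hasFDerivAt_convolution_left (lsmul ℝ ℝ) (hφs.of_le (by simp))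
    (hf0.locallyIntegrable) x
  refine hd.congr_fderiv ?_
  -- The reflected and translated bump is the test function; reflection produces a sign that cancels
  -- the one in the weak identity.
  set ψ : V → ℝ := fun t => φ.normed volume (x - t) with hψ
  have hψs : ContDiff ℝ ∞ ψ := hφs.comp (contDiff_const.sub contDiff_id)
  have hsub : tsupport ψ ⊆ B := by
    refine closure_minimal (fun t ht => ?_) Metric.isClosed_closedBall
    have h1 : x - t ∈ Metric.ball (0 : V) φ.rOut := by
      rw [← φ.support_normed_eq (μ := volume)]; exact ht
    have h2 : dist t x < φ.rOut := by rwa [dist_comm, dist_eq_norm, ← mem_ball_zero_iff]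
    have h3 : dist x p₀ < R := hx
    have := dist_triangle t x p₀
    exact Metric.mem_closedBall.2 (by linarith)
  have hψc : HasCompactSupport ψ := hBc.of_isClosed_subset (isClosed_tsupport _) hsub
  have hψd : ∀ t v, fderiv ℝ ψ t v = -(fderiv ℝ (φ.normed volume) (x - t) v) := by
    intro t v
    have h1 : HasFDerivAt ψ ((fderiv ℝ (φ.normed volume) (x - t)).comp (-ContinuousLinearMap.id ℝ (V))) t :=
      ((hφs.differentiable (by simp)) (x - t)).hasFDerivAt.comp t
        ((hasFDerivAt_id t).const_sub x)
    rw [h1.fderiv]; simp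
  ext v
  have e1 : ((fderiv ℝ (φ.normed volume) ⋆[(lsmul ℝ ℝ).precompL (V), volume] truncate B f) x) v
      = ∫ t, fderiv ℝ (φ.normed volume) (x - t) v • truncate B f t := by
    rw [convolution_eq_swap]
    refine (ContinuousLinearMap.integral_apply ?_ v).trans ?_
    · have := ((hφc.fderiv ℝ).convolutionExists_left ((lsmul ℝ ℝ : ℝ →L[ℝ] ℂ →L[ℝ] ℂ).precompL (V))
        (hφs.continuous_fderiv (by simp)) hf0.locallyIntegrable) x
      exact this.integrable_swap
    · rfl
  have e2 : ((φ.normed volume ⋆[lsmul ℝ ℝ, volume] (truncate B g)) x) v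
      = ∫ t, φ.normed volume (x - t) • truncate B g t v := by
    rw [convolution_eq_swap]
    refine (ContinuousLinearMap.integral_apply ?_ v).trans ?_
    · have := (hφc.convolutionExists_left (lsmul ℝ ℝ : ℝ →L[ℝ] (V →L[ℝ] ℂ) →L[ℝ] (V →L[ℝ] ℂ))
        hφs.continuous hg0.locallyIntegrable) x
      exact this.integrable_swap
    · rfl
  have hw := h.weak ψ hψs hψc (hsub.trans hO) v
  have e3 : ∀ t, fderiv ℝ (φ.normed volume) (x - t) v • truncate B f t = -(fderiv ℝ ψ t v • f t) := by
    intro t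
    by_cases ht : t ∈ B
    · rw [truncate_of_mem ht, hψd, neg_smul, neg_neg]
    · have h0 : fderiv ℝ ψ t = 0 := image_eq_zero_of_notMem_tsupport fun h1 =>
        ht (hsub (tsupport_fderiv_subset ℝ h1))
      rw [truncate_of_notMem ht, h0]; simp
  have e4 : ∀ t, φ.normed volume (x - t) • truncate B g t v = ψ t • g t v := by
    intro t
    by_cases ht : t ∈ B
    · rw [truncate_of_mem ht]
    · have h0 : ψ t = 0 := image_eq_zero_of_notMem_tsupport fun h1 => ht (hsub h1)
      rw [truncate_of_notMem ht, h0]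
      change φ.normed volume (x - t) • (0 : ℂ) = _
      simp
  rw [e1, e2]
  simp only [e3, e4, integral_neg, hw, neg_neg]

/-- Bump functions whose supports shrink to the origin. -/
noncomputable def shrinkingBump (V : Type*) [NormedAddCommGroup V] [InnerProductSpace ℝ V] (R : ℝ) (hR : 0 < R) (k : ℕ) : ContDiffBump (0 : V) :=
  ⟨R / (k + 2) / 2, R / (k + 2), by positivity, half_lt_self (by positivity)⟩

theorem shrinkingBump_lt {R : ℝ} (hR : 0 < R) (k : ℕ) : (shrinkingBump V R hR k).rOut < R := by
  change R / (k + 2) < R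
  rw [div_lt_iff₀ (by positivity)]
  nlinarith [(Nat.cast_nonneg k : (0 : ℝ) ≤ k)]

theorem tendsto_shrinkingBump {R : ℝ} (hR : 0 < R) :
    Tendsto (fun k => (shrinkingBump V R hR k).rOut) atTop (𝓝 0) := by
  change Tendsto (fun k : ℕ => R / ((k : ℝ) + 2)) atTop (𝓝 0)
  exact tendsto_const_nhds.div_atTop
    (tendsto_atTop_add_const_right _ _ tendsto_natCast_atTop_atTop)

theorem tendsto_shrinkingBump_convolution {F : Type*} [NormedAddCommGroup F] [NormedSpace ℝ F]
    [CompleteSpace F] {R : ℝ} (hR : 0 < R) {u : V → F} (hu : AEStronglyMeasurable u volume) {x : V}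
    (hx : ContinuousAt u x) :
    Tendsto (fun k => ((shrinkingBump V R hR k).normed volume ⋆[lsmul ℝ ℝ, volume] u) x) atTop
      (𝓝 (u x)) :=
  ContDiffBump.convolution_tendsto_right (tendsto_shrinkingBump hR)
    (Eventually.of_forall fun _ => hu) (hx.tendsto.comp tendsto_snd) tendsto_const_nhds

theorem indicator_eventuallyEq {F : Type*} [NormedAddCommGroup F] (u : V → F) {p₀ x : V} {R : ℝ}
    (hx : x ∈ Metric.ball p₀ R) :
    truncate (Metric.closedBall p₀ (2 * R)) u =ᶠ[𝓝 x] u := by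
  refine Filter.eventuallyEq_of_mem (Metric.isOpen_ball.mem_nhds hx) fun y hy =>
    truncate_of_mem (Metric.mem_closedBall.2 ?_) _
  have h1 : dist y p₀ < R := hy
  have := dist_nonneg (x := y) (y := p₀)
  linarith

/-- Mollifications have gradient at most C, so the mean value inequality holds for them on the
convex ball. They converge at points of continuity of f, and f need not be continuous along the
segment between x and y. -/
theorem WeakFDeriv.norm_sub_le (h : WeakFDeriv O f g) {p₀ : V} {R C : ℝ} (hR : 0 < R)
    (hO : Metric.closedBall p₀ (2 * R) ⊆ O) (hC0 : 0 ≤ C)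
    (hC : ∀ᵐ p, p ∈ Metric.closedBall p₀ (2 * R) → ‖g p‖ ≤ C)
    {x y : V} (hx : x ∈ Metric.ball p₀ R) (hy : y ∈ Metric.ball p₀ R)
    (hfx : ContinuousAt f x) (hfy : ContinuousAt f y) : ‖f y - f x‖ ≤ C * ‖y - x‖ := by
  set B := Metric.closedBall p₀ (2 * R) with hB
  have hBc : IsCompact B := isCompact_closedBall _ _
  have hf0 : Integrable (truncate B f) volume :=
    integrable_truncate hBc.measurableSet (h.loc.integrableOn_compact_subset hO hBc)
  have hlim : ∀ z ∈ Metric.ball p₀ R, ContinuousAt f z →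
      Tendsto (fun k => ((shrinkingBump V R hR k).normed volume ⋆[lsmul ℝ ℝ, volume] (truncate B f)) z)
        atTop (𝓝 (f z)) := by
    intro z hz hfz
    have e := indicator_eventuallyEq f hz
    have := tendsto_shrinkingBump_convolution hR hf0.aestronglyMeasurable
      (hfz.congr_of_eventuallyEq e)
    rwa [e.eq_of_nhds] at this
  have hbd : ∀ k, ∀ z, ‖((shrinkingBump V R hR k).normed volume ⋆[lsmul ℝ ℝ, volume] (truncate B g)) z‖
      ≤ C := by
    intro k z
    rw [convolution_lsmul_swap]
    have hint : Integrable (fun t => (shrinkingBump V R hR k).normed volume (z - t)) volume :=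
      ((shrinkingBump V R hR k).integrable_normed).comp_sub_left z
    refine (norm_integral_le_of_norm_le (hint.mul_const C) ?_).trans_eq ?_
    · filter_upwards [hC] with t ht
      rw [norm_smul, Real.norm_of_nonneg (ContDiffBump.nonneg_normed _ _)]
      refine mul_le_mul_of_nonneg_left ?_ (ContDiffBump.nonneg_normed _ _)
      by_cases htB : t ∈ B
      · rw [truncate_of_mem htB]; exact ht htB
      · rw [truncate_of_notMem htB, norm_zero]; exact hC0
    · rw [integral_mul_const, integral_sub_left_eq_self
        (fun t => (shrinkingBump V R hR k).normed volume t) volume z, ContDiffBump.integral_normed, one_mul]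
  refine le_of_tendsto ((hlim y hy hfy).sub (hlim x hx hfx)).norm (Eventually.of_forall fun k => ?_)
  exact (convex_ball p₀ R).norm_image_sub_le_of_norm_hasFDerivWithin_le
    (fun z hz => (h.hasFDerivAt_convolution hO _ (shrinkingBump_lt hR k) hz).hasFDerivWithinAt)
    (fun z _ => hbd k z) hx hy

/-- The mollified derivatives converge uniformly near x to the continuous g, so the limit may be
differentiated. -/
theorem WeakFDeriv.hasFDerivAt (h : WeakFDeriv O f g) (hO : IsOpen O) (hf : ContinuousOn f O)
    (hg : ContinuousOn g O) {x : V} (hx : x ∈ O) : HasFDerivAt f (g x) x := by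
  obtain ⟨R', hR', hsub⟩ := Metric.nhds_basis_closedBall.mem_iff.1 (hO.mem_nhds hx)
  set R := R' / 2 with hRdef
  have hR : 0 < R := by positivity
  have hsub' : Metric.closedBall x (2 * R) ⊆ O := by rwa [hRdef, mul_div_cancel₀ _ two_ne_zero]
  set B := Metric.closedBall x (2 * R) with hB
  have hBc : IsCompact B := isCompact_closedBall _ _
  have hf0 : Integrable (truncate B f) volume :=
    integrable_truncate hBc.measurableSet (h.loc.integrableOn_compact_subset hsub' hBc)
  have hg0 : Integrable (truncate B g) volume :=
    integrable_truncate hBc.measurableSet (h.loc_deriv.integrableOn_compact_subset hsub' hBc)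
  have hcont : ∀ {F : Type} [NormedAddCommGroup F] (u : V → F), ContinuousOn u O →
      ∀ z ∈ Metric.ball x R, ContinuousAt (truncate B u) z := by
    intro F _ u hu z hz
    refine (hu.continuousAt (hO.mem_nhds (hsub' ?_))).congr_of_eventuallyEq (indicator_eventuallyEq u hz)
    refine Metric.ball_subset_closedBall (Metric.ball_subset_ball (by linarith) hz)
  have hxb : x ∈ Metric.ball x R := Metric.mem_ball_self hR
  have key : HasFDerivAt (truncate B f) (truncate B g x) x := by
    refine hasFDerivAt_of_tendstoUniformlyOnFilter (l := atTop)
      (f := fun k => (shrinkingBump V R hR k).normed volume ⋆[lsmul ℝ ℝ, volume] (truncate B f))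
      (f' := fun k => (shrinkingBump V R hR k).normed volume ⋆[lsmul ℝ ℝ, volume] (truncate B g)) ?_ ?_ ?_
    · rw [Metric.tendstoUniformlyOnFilter_iff]
      intro ε hε
      obtain ⟨δ, hδ, hd⟩ := Metric.continuousAt_iff.1 (hcont g hg x hxb) (ε / 4) (by positivity)
      filter_upwards [prod_mem_prod ((tendsto_shrinkingBump (V := V) hR).eventually_lt_const
        (half_pos hδ)) (Metric.ball_mem_nhds x (half_pos hδ))] with ⟨k, y⟩ ⟨hk, hy⟩
      have hk' : (shrinkingBump V R hR k).rOut < δ / 2 := hk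
      have hy' : dist y x < δ / 2 := hy
      rw [dist_comm]
      refine (ContDiffBump.dist_normed_convolution_le (ε := ε / 2) hg0.aestronglyMeasurable
        fun z hz => ?_).trans_lt (half_lt_self hε)
      have hz' : dist z y < (shrinkingBump V R hR k).rOut := hz
      have h1 := hd (x := z) ((dist_triangle z y x).trans_lt (by linarith))
      have h2 := hd (x := y) (by linarith)
      have := dist_triangle_right (truncate B g z) (truncate B g y) (truncate B g x)
      linarith
    · filter_upwards [prod_mem_prod univ_mem (Metric.ball_mem_nhds x hR)] with ⟨k, y⟩ ⟨_, hy⟩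
      exact h.hasFDerivAt_convolution hsub' _ (shrinkingBump_lt hR k) hy
    · filter_upwards [Metric.ball_mem_nhds x hR] with y hy
      exact tendsto_shrinkingBump_convolution hR hf0.aestronglyMeasurable (hcont f hf y hy)
  rw [(indicator_eventuallyEq g hxb).eq_of_nhds] at key
  exact key.congr_of_eventuallyEq (indicator_eventuallyEq f hxb).symm

theorem subset_closure_of_measure_diff {O O' : Set V} (hO : IsOpen O)
    (h0 : volume (O \ O') = 0) : O ⊆ closure O' := by
  intro x hx
  by_contra h
  have hopen : IsOpen (O ∩ (closure O')ᶜ) := hO.inter isClosed_closure.isOpen_compl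
  refine hopen.measure_ne_zero volume ⟨x, hx, h⟩ (measure_mono_null (fun y hy => ?_) h0)
  exact ⟨hy.1, fun h1 => hy.2 (subset_closure h1)⟩

theorem WeakFDeriv.congr {O : Set V} {f F : V → ℂ} {g G : V → V →L[ℝ] ℂ} (hO : IsOpen O) (h : WeakFDeriv O f g)
    (hf : ∀ᵐ p, p ∈ O → f p = F p) (hg : ∀ᵐ p, p ∈ O → g p = G p) : WeakFDeriv O F G := by
  refine ⟨fun x hx => ?_, fun x hx => ?_, fun φ hφ hc hs v => ?_⟩
  · obtain ⟨u, hu, hi⟩ := h.loc x hx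
    refine ⟨u ∩ O, Filter.inter_mem hu self_mem_nhdsWithin, ?_⟩
    refine (hi.mono_set Set.inter_subset_left).congr_fun_ae ?_
    exact ae_restrict_of_ae_restrict_of_subset Set.inter_subset_right
      ((ae_restrict_iff' hO.measurableSet).2 hf)
  · obtain ⟨u, hu, hi⟩ := h.loc_deriv x hx
    refine ⟨u ∩ O, Filter.inter_mem hu self_mem_nhdsWithin, ?_⟩
    refine (hi.mono_set Set.inter_subset_left).congr_fun_ae ?_
    exact ae_restrict_of_ae_restrict_of_subset Set.inter_subset_right
      ((ae_restrict_iff' hO.measurableSet).2 hg)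
  · have e1 : ∫ p, fderiv ℝ φ p v • F p = ∫ p, fderiv ℝ φ p v • f p := by
      refine integral_congr_ae (hf.mono fun p hp => ?_)
      by_cases hpO : p ∈ O
      · simp only [hp hpO]
      · have h0 : fderiv ℝ φ p = 0 := image_eq_zero_of_notMem_tsupport fun h1 =>
          hpO (hs (tsupport_fderiv_subset ℝ h1))
        simp [h0]
    have e2 : ∫ p, φ p • G p v = ∫ p, φ p • g p v := by
      refine integral_congr_ae (hg.mono fun p hp => ?_)
      by_cases hpO : p ∈ O
      · simp only [hp hpO]
      · have h0 : φ p = 0 := image_eq_zero_of_notMem_tsupport fun h1 => hpO (hs h1)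
        simp [h0]
    rw [e1, e2, h.weak φ hφ hc hs v]

theorem locallyIntegrableOn_sum_smul {κ H : Type*} [Fintype κ] [NormedAddCommGroup H] [NormedSpace ℂ H]
    {O : Set V} (hO : IsOpen O) {f : κ → V → ℂ} {A : κ → V → H}
    (hf : ∀ b, LocallyIntegrableOn (f b) O volume) (hA : ∀ b, ContinuousOn (A b) O) :
    LocallyIntegrableOn (fun p => ∑ b, f b p • A b p) O volume :=
  (locallyIntegrableOn_iff hO.isLocallyClosed).2 fun k hk hkc =>
    integrable_finset_sum _ fun b _ => (locallyIntegrableOn_iff hO.isLocallyClosed).1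
      ((hf b).smul_continuousOn hO.isLocallyClosed (hA b)) k hk hkc

/-- Cauchy criterion, for a function that is Lipschitz only on the points of s near x. -/
theorem exists_tendsto_of_norm_sub_le {s t : Set V} {u : V → ℂ} {x : V} (hx : x ∈ closure s)
    (ht : t ∈ 𝓝 x) {C : ℝ} (h : ∀ y ∈ t ∩ s, ∀ z ∈ t ∩ s, ‖u y - u z‖ ≤ C * ‖y - z‖) :
    ∃ y, Tendsto u (𝓝[s] x) (𝓝 y) := by
  have := mem_closure_iff_nhdsWithin_neBot.1 hx
  refine cauchy_map_iff_exists_tendsto.1 (Metric.cauchy_iff.2 ⟨inferInstance, fun ε hε => ?_⟩)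
  have hδ : 0 < ε / (|C| + 1) / 2 := by positivity
  refine ⟨u '' ((t ∩ Metric.ball x (ε / (|C| + 1) / 2)) ∩ s), Filter.image_mem_map
    (Filter.inter_mem (mem_nhdsWithin_of_mem_nhds (Filter.inter_mem ht (Metric.ball_mem_nhds x hδ)))
      self_mem_nhdsWithin), ?_⟩
  rintro _ ⟨y, ⟨⟨hy, hyb⟩, hys⟩, rfl⟩ _ ⟨z, ⟨⟨hz, hzb⟩, hzs⟩, rfl⟩
  have h1 : dist y z < ε / (|C| + 1) := by
    have := dist_triangle_right y z x
    have h2 : dist y x < _ := hyb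
    have h3 : dist z x < _ := hzb
    linarith
  rw [dist_eq_norm]
  rw [lt_div_iff₀ (by positivity), dist_eq_norm] at h1
  have h2 := h y ⟨hy, hys⟩ z ⟨hz, hzs⟩
  have h3 := mul_le_mul_of_nonneg_right (le_abs_self C) (norm_nonneg (y - z))
  nlinarith [norm_nonneg (y - z)]

/-- Boundedness of f and smoothness of A bound the weak gradient. So f is locally Lipschitz on O'
and extends continuously across the null set; the extension has a continuous weak differential and
is C¹. -/
theorem exists_contDiffOn_of_weakFDeriv {κ : Type*} [Fintype κ] {O O' : Set V} (hO : IsOpen O)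
    (hO' : IsOpen O') (hsub : O' ⊆ O) (h0 : volume (O \ O') = 0) {f : κ → V → ℂ}
    {A : κ → κ → V → V →L[ℝ] ℂ} (hA : ∀ a b, ContDiffOn ℝ ∞ (A a b) O)
    (hw : ∀ a, WeakFDeriv O (f a) fun p => ∑ b, f b p • A a b p) {C : ℝ}
    (hC : ∀ a, ∀ᵐ p, p ∈ O → ‖f a p‖ ≤ C) (hf : ∀ a, ContinuousOn (f a) O') :
    ∃ F : κ → V → ℂ, (∀ a, ContDiffOn ℝ ∞ (F a) O) ∧ ∀ a, ∀ p ∈ O', F a p = f a p := by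
  have hcl := subset_closure_of_measure_diff hO h0
  have hlim : ∀ a, ∀ x ∈ O, ∃ y, Tendsto (f a) (𝓝[O'] x) (𝓝 y) := by
    intro a x hx
    obtain ⟨R', hR', hs⟩ := Metric.nhds_basis_closedBall.mem_iff.1 (hO.mem_nhds hx)
    have hs' : Metric.closedBall x (2 * (R' / 2)) ⊆ O := by rwa [mul_div_cancel₀ _ two_ne_zero]
    have hbA : ∀ b, ∃ c, ∀ p ∈ Metric.closedBall x (2 * (R' / 2)), ‖A a b p‖ ≤ c := fun b =>
      (isCompact_closedBall _ _).exists_bound_of_continuousOn ((hA a b).continuousOn.mono hs')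
    choose c hc using hbA
    have hc0 : ∀ b, 0 ≤ c b := fun b => (norm_nonneg _).trans (hc b x
      (Metric.mem_closedBall_self (by positivity)))
    refine exists_tendsto_of_norm_sub_le (hcl hx) (Metric.ball_mem_nhds x (half_pos hR'))
      (C := ∑ b, |C| * c b) fun y hy z hz => ?_
    refine (hw a).norm_sub_le (half_pos hR') hs' (Finset.sum_nonneg fun b _ =>
      mul_nonneg (abs_nonneg _) (hc0 b)) ?_ hz.1 hy.1
      ((hf a).continuousAt (hO'.mem_nhds hz.2)) ((hf a).continuousAt (hO'.mem_nhds hy.2))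
    filter_upwards [ae_all_iff.2 hC] with p hp hpB
    refine (norm_sum_le _ _).trans (Finset.sum_le_sum fun b _ => ?_)
    rw [norm_smul]
    exact mul_le_mul ((hp b (hs' hpB)).trans (le_abs_self C)) (hc b p hpB) (norm_nonneg _) (abs_nonneg _)
  let F : κ → V → ℂ := fun a => extendFrom O' (f a)
  have hFc : ∀ a, ContinuousOn (F a) O := fun a => continuousOn_extendFrom hcl (hlim a)
  have hFf : ∀ a, ∀ p ∈ O', F a p = f a p := fun a => extendFrom_extends (hf a)
  have hae : ∀ᵐ p, p ∈ O → p ∈ O' := by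
    rw [ae_iff]
    refine measure_mono_null (fun p hp => ?_) h0
    simp only [Set.mem_setOf_eq, Classical.not_imp] at hp
    exact hp
  have hFw : ∀ a, WeakFDeriv O (F a) fun p => ∑ b, F b p • A a b p := by
    refine fun a => (hw a).congr hO (hae.mono fun p hp hpO => (hFf a p (hp hpO)).symm)
      (hae.mono fun p hp hpO => ?_)
    simp only [hFf _ p (hp hpO)]
  have hd : ∀ a, ∀ x ∈ O, HasFDerivAt (F a) (∑ b, F b x • A a b x) x := fun a x hx =>
    (hFw a).hasFDerivAt hO (hFc a) (continuousOn_finsetSum _ fun b _ =>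
      (hFc b).smul (hA a b).continuousOn) hx
  -- Bootstrapping: if all F are C^m, the equation dF = ∑ F A makes them C^(m+1).
  refine ⟨F, fun a => contDiffOn_infty.2 fun m => ?_, hFf⟩
  induction m generalizing a with
  | zero => exact contDiffOn_zero.2 (hFc a)
  | succ m ih =>
    rw [Nat.cast_succ]
    refine (contDiffOn_succ_iff_fderiv_of_isOpen hO).2 ⟨fun x hx =>
      (hd a x hx).differentiableAt.differentiableWithinAt, fun h => absurd h (WithTop.natCast_ne_top m), ?_⟩
    refine ContDiffOn.congr (ContDiffOn.sum fun b _ => (ih b).smul ((hA a b).of_le (by exact_mod_cast le_top)))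
      fun x hx => (hd a x hx).fderiv

end WeakRegularity

end GenKaehler

namespace GenKaehler

/-! ### Smooth extension of weak subbundles with vanishing derivative. -/

section Extension

open Filter Topology

variable {n r : ℕ} {M : Type*} [TopologicalSpace M] [ChartedSpace (W n) M]
  [IsManifold (𝓡 (2 * n)) ∞ M]
  {E : M → Type*} [TopologicalSpace (TotalSpace (EuclideanSpace ℂ (Fin r)) E)]
  [∀ x, NormedAddCommGroup (E x)] [∀ x, InnerProductSpace ℂ (E x)]
  [FiberBundle (EuclideanSpace ℂ (Fin r)) E]
  [VectorBundle ℂ (EuclideanSpace ℂ (Fin r)) E] [VectorBundle ℝ (EuclideanSpace ℂ (Fin r)) E]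
  [ContMDiffVectorBundle ∞ (EuclideanSpace ℂ (Fin r)) E (𝓡 (2 * n))]
  {D : GenConnection n r E}
  {K : GenKaehlerSympl n M} {P q : ∀ x, Module.End ℂ (E x)}
  {T : ∀ x, TangentSpace (𝓡 (2 * n)) x →ₗ[ℝ] Module.End ℂ (E x)} {U : Set M}
  [MeasurableSpace M] [BorelSpace M] [CompactSpace M] [T2Space M]

theorem IsWeaklyDiff.weakFDeriv {f : M → ℂ} {θ : ∀ x : M, TangentSpace (𝓡 (2 * n)) x →ₗ[ℝ] ℂ}
    (hf : IsWeaklyDiff K f θ) {c : M} {O : Set (W n)} (hO : IsOpen O)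
    (hsub : O ⊆ (chartE (n := n) c).target) {g : W n → W n →L[ℝ] ℂ}
    (hg : LocallyIntegrableOn g O volume)
    (h : ∀ᵐ p, p ∈ O → ∀ i, g p (stdVec i) = θ ((chartE (n := n) c).symm p) (chartTangent c p (stdVec i))) :
    WeakFDeriv O (fun p => f ((chartE (n := n) c).symm p)) g := by
  refine ⟨(locallyIntegrableOn_chart K hf.integrable c).mono_set hsub, hg, fun φ hφ hc hs v => ?_⟩
  have ht := fun i => hf.test hφ hc (hs.trans hsub) i
  have hae : ∀ i, (fun p => φ p • g p (stdVec i)) =ᵐ[volume]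
      fun p => φ p • θ ((chartE (n := n) c).symm p) (chartTangent c p (stdVec i)) := by
    intro i
    filter_upwards [h] with p hp
    by_cases hpO : p ∈ O
    · rw [hp hpO i]
    · have h0 : φ p = 0 := image_eq_zero_of_notMem_tsupport fun h1 => hpO (hs h1)
      simp only [h0, zero_smul]
  have e1 : ∀ p, fderiv ℝ φ p v • f ((chartE (n := n) c).symm p)
      = ∑ i, v i • (fderiv ℝ φ p (stdVec i) • f ((chartE (n := n) c).symm p)) := by
    intro p
    conv_lhs => rw [← sum_coord_stdVec v]
    simp only [map_sum, map_smul, Finset.sum_smul, smul_assoc]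
  have e2 : ∀ p, φ p • g p v = ∑ i, v i • (φ p • g p (stdVec i)) := by
    intro p
    conv_lhs => rw [← sum_coord_stdVec v]
    simp only [map_sum, map_smul, Finset.smul_sum, smul_comm (φ p)]
  simp only [e1, e2]
  have hi1 : ∀ i, Integrable (fun p => v i • (fderiv ℝ φ p (stdVec i) • f ((chartE (n := n) c).symm p))) :=
    fun i => (ht i).1.smul (v i)
  have hi2 : ∀ i, Integrable (fun p => v i • (φ p • g p (stdVec i))) :=
    fun i => ((ht i).2.1.congr (hae i).symm).smul (v i)
  rw [integral_finsetSum _ fun i _ => hi1 i, integral_finsetSum _ fun i _ => hi2 i,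
    ← Finset.sum_neg_distrib]
  refine Finset.sum_congr rfl fun i _ => ?_
  rw [integral_smul, integral_smul, (ht i).2.2, integral_congr_ae (hae i), smul_neg]

/-- The complex-valued coordinate of `W n`. -/
noncomputable def coordC (i : Fin (2 * n)) : W n →L[ℝ] ℂ := Complex.ofRealCLM.comp (dx i)

theorem coordC_stdVec (i j : Fin (2 * n)) : coordC i (stdVec j) = if i = j then 1 else 0 := by
  simp only [coordC, dx, stdVec, ContinuousLinearMap.comp_apply, Complex.ofRealCLM_apply]
  by_cases h : i = j <;> simp [h]

theorem SecFrame.inner_end_eq (F : SecFrame n r E) {x : M} (L : Module.End ℂ (E x)) (u w : E x) :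
    inner ℂ u (L w) = ∑ m, inner ℂ (F.t m x) w * inner ℂ u (L (F.s m x)) := by
  conv_lhs => rw [← F.expand x w, map_sum, inner_sum]
  exact Finset.sum_congr rfl fun m _ => by rw [map_smul, inner_smul_right]

theorem SecFrame.inner_eq (F : SecFrame n r E) {x : M} (u w : E x) :
    inner ℂ u w = ∑ m, inner ℂ u (F.s m x) * inner ℂ (F.t m x) w := by
  conv_lhs => rw [← F.expand x w, inner_sum]
  exact Finset.sum_congr rfl fun m _ => by rw [inner_smul_right, mul_comm]

theorem sum_coordC_stdVec (z : Fin (2 * n) → ℂ) (i : Fin (2 * n)) :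
    (∑ j, z j • coordC j) (stdVec i) = z i := by
  simp only [ContinuousLinearMap.sum_apply, ContinuousLinearMap.smul_apply, coordC_stdVec,
    smul_eq_mul, mul_ite, mul_one, mul_zero, Finset.sum_ite_eq', Finset.mem_univ, if_true]

/-- Expanding in the frame expresses the Leibniz terms linearly in the coefficients of L itself, so
the coefficients of a parallel projection satisfy a closed linear system. -/
theorem SecFrame.sum_leibniz (F : SecFrame n r E) {x : M} (L : Module.End ℂ (E x))
    (a : Fin F.card × Fin F.card) (u w : E x) :
    ∑ a' : Fin F.card × Fin F.card, inner ℂ (F.t a'.1 x) (L (F.s a'.2 x))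
        * ((if a.1 = a'.1 then inner ℂ (F.t a'.2 x) w else 0)
          + (if a.2 = a'.2 then inner ℂ u (F.s a'.1 x) else 0))
      = inner ℂ (F.t a.1 x) (L w) + inner ℂ u (L (F.s a.2 x)) := by
  rw [F.inner_end_eq L _ w, F.inner_eq u]
  simp only [mul_add, mul_ite, mul_zero, Finset.sum_add_distrib, Fintype.sum_prod_type]
  congr 1
  · rw [Finset.sum_comm]
    simp only [Finset.sum_ite_eq, Finset.mem_univ, if_true]
    exact Finset.sum_congr rfl fun m _ => mul_comm _ _
  · simp only [Finset.sum_ite_eq, Finset.mem_univ, if_true]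
    exact Finset.sum_congr rfl fun m _ => mul_comm _ _

/-- With T = 0 the weak differential of the coefficients ⟨t, q s⟩ contains only the derivatives of
the frame sections. The coefficients are bounded and solve a linear system with smooth coefficients.
-/
theorem IsWeakSubbundle.exists_local_extension (F : SecFrame n r E) (h : IsWeakSubbundle K D P q T)
    (hU : IsOpen U) (hU0 : vol K Uᶜ = 0) (hq : SmoothEndOn n r U q)
    (hT : ∀ᵐ x ∂vol K, ∀ v, T x v = 0) (c : M) :
    ∃ O : Set M, IsOpen O ∧ c ∈ O ∧ ∃ G : Fin F.card × Fin F.card → M → ℂ,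
      (∀ a, ContMDiffOn (𝓡 (2 * n)) 𝓘(ℝ, ℂ) ∞ (G a) O) ∧
      ∀ a, ∀ x ∈ O ∩ U, G a x = inner ℂ (F.t a.1 x) (q x (F.s a.2 x)) := by
  classical
  choose X hX hXe using fun i => exists_smoothVF_coordField (n := n) (mem_extChartAt_source c) (stdVec i)
  obtain ⟨N, hN, hNo, hcN⟩ := eventually_nhds_iff.1
    ((eventually_all.2 hXe).and ((isOpen_chartE_source (n := n) c).mem_nhds (mem_extChartAt_source c)))
  let C := D.toCConnection
  let b : Fin (2 * n) → Fin F.card → Fin F.card → M → ℂ := fun i m l x =>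
    inner ℂ (F.t m x) (D.nabla (F.s l) x (X i x))
  let b' : Fin (2 * n) → Fin F.card → Fin F.card → M → ℂ := fun i k m x =>
    inner ℂ (D.nabla (F.t k) x (X i x)) (F.s m x)
  have hb : ∀ i m l, SmoothFn (n := n) (b i m l) := fun i m l =>
    F.smooth_inner (F.smooth_t m) (D.toCConnection.smooth_nabla (hX i) (F.smooth_s l))
  have hb' : ∀ i m l, SmoothFn (n := n) (b' i m l) := fun i m l =>
    F.smooth_inner (D.toCConnection.smooth_nabla (hX i) (F.smooth_t m)) (F.smooth_s l)
  let e := chartE (n := n) c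
  let O : Set (W n) := e.target ∩ e.symm ⁻¹' N
  have hO : IsOpen O := (continuousOn_extChartAt_symm (I := 𝓡 (2 * n)) c).isOpen_inter_preimage
    (isOpen_chartE_target c) hNo
  let O' : Set (W n) := e.target ∩ e.symm ⁻¹' (N ∩ U)
  have hO' : IsOpen O' := (continuousOn_extChartAt_symm (I := 𝓡 (2 * n)) c).isOpen_inter_preimage
    (isOpen_chartE_target c) (hNo.inter hU)
  let f : Fin F.card × Fin F.card → M → ℂ := fun a x => inner ℂ (F.t a.1 x) (q x (F.s a.2 x))
  let B : Fin F.card × Fin F.card → Fin F.card × Fin F.card → Fin (2 * n) → M → ℂ := fun a a' i x =>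
    (if a.1 = a'.1 then b i a'.2 a.2 x else 0) + (if a.2 = a'.2 then b' i a.1 a'.1 x else 0)
  have hB : ∀ a a' i, SmoothFn (n := n) (B a a' i) := by
    intro a a' i
    refine ContMDiff.add ?_ ?_
    · by_cases h1 : a.1 = a'.1
      · simpa only [h1, if_true] using hb i a'.2 a.2
      · simpa only [h1, if_false] using contMDiff_const
    · by_cases h1 : a.2 = a'.2
      · simpa only [h1, if_true] using hb' i a.1 a'.1
      · simpa only [h1, if_false] using contMDiff_const
  let A : Fin F.card × Fin F.card → Fin F.card × Fin F.card → W n → W n →L[ℝ] ℂ := fun a a' p =>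
    ∑ i, B a a' i (e.symm p) • coordC i
  have hA : ∀ a a', ContDiffOn ℝ ∞ (A a a') O := fun a a' => ContDiffOn.sum fun i _ =>
    ((contDiffOn_chart_target (hB a a' i) c).mono Set.inter_subset_left).smul contDiffOn_const
  have hae : ∀ᵐ p : W n, p ∈ O → ∀ v, T (e.symm p) v = 0 := by
    have := ae_chart K c hT
    rw [ae_restrict_iff' (isOpen_chartE_target c).measurableSet] at this
    exact this.mono fun p hp hpO => hp hpO.1
  have hU1 : ∀ᵐ x ∂vol K, x ∈ U := hU0
  have hOO' : volume (O \ O') = 0 := by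
    have := ae_chart K c hU1
    rw [ae_restrict_iff' (isOpen_chartE_target c).measurableSet, ae_iff] at this
    refine measure_mono_null (fun p hp => ?_) this
    simp only [Set.mem_setOf_eq, Classical.not_imp]
    exact ⟨hp.1.1, fun h1 => hp.2 ⟨hp.1.1, hp.1.2, h1⟩⟩
  have hwd := fun a : Fin F.card × Fin F.card => h.isWeaklyDiff (F.smooth_s a.2) (F.smooth_t a.1)
  have hw : ∀ a, WeakFDeriv O (fun p => f a (e.symm p)) fun p => ∑ a', f a' (e.symm p) • A a a' p := by
    intro a
    refine (hwd a).weakFDeriv hO Set.inter_subset_left ?_ ?_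
    · exact locallyIntegrableOn_sum_smul hO (fun a' =>
        (locallyIntegrableOn_chart K (hwd a').integrable c).mono_set Set.inter_subset_left)
        fun a' => (hA a a').continuousOn
    · filter_upwards [hae] with p hp hpO i
      have hX1 : chartTangent c p (stdVec i) = X i (e.symm p) :=
        (chartTangent_eq hpO.1 _).trans ((hN _ hpO.2).1 i).symm
      refine Eq.trans ?_ (congrArg (weakDiff D q T (F.s a.2) (F.t a.1) (e.symm p)) hX1).symm
      change _ = inner ℂ (F.t a.1 (e.symm p)) (T (e.symm p) (X i (e.symm p)) (F.s a.2 (e.symm p)))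
        + inner ℂ (F.t a.1 (e.symm p)) (q (e.symm p) (D.nabla (F.s a.2) (e.symm p) (X i (e.symm p))))
        + inner ℂ (D.nabla (F.t a.1) (e.symm p) (X i (e.symm p)))
            (q (e.symm p) (F.s a.2 (e.symm p)))
      rw [hp hpO, LinearMap.zero_apply, inner_zero_right, zero_add, ← F.sum_leibniz]
      have h1 : ∀ a', A a a' p (stdVec i) = B a a' i (e.symm p) := fun a' =>
        sum_coordC_stdVec (fun i => B a a' i (e.symm p)) i
      simp only [ContinuousLinearMap.sum_apply, ContinuousLinearMap.smul_apply, h1, smul_eq_mul]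
      rfl
  choose C hC using fun a : Fin F.card × Fin F.card => h.bounded F (F.smooth_s a.2) (F.smooth_t a.1)
  have hbd : ∀ a, ∀ᵐ p : W n, p ∈ O → ‖f a (e.symm p)‖ ≤ ∑ a, |C a| := by
    intro a
    have := ae_chart K c (hC a)
    rw [ae_restrict_iff' (isOpen_chartE_target c).measurableSet] at this
    filter_upwards [this] with p hp hpO
    exact (hp hpO.1).trans ((le_abs_self _).trans (Finset.single_le_sum
      (f := fun a => |C a|) (fun _ _ => abs_nonneg _) (Finset.mem_univ a)))
  have hfc : ∀ a, ContinuousOn (fun p => f a (e.symm p)) O' := fun a =>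
    (contDiffOn_chart (F.metric.inner_on hU ((F.smooth_t a.1).mono (Set.subset_univ _))
      (hq _ (F.smooth_s a.2))) c).continuousOn.mono fun p hp => ⟨hp.1, hp.2.2⟩
  obtain ⟨G, hG, hGf⟩ := exists_contDiffOn_of_weakFDeriv hO hO' (fun p hp => ⟨hp.1, hp.2.1⟩) hOO' hA hw
    hbd hfc
  have hmaps : ∀ x ∈ N, e x ∈ O := fun x hx => ⟨e.map_source (hN x hx).2, by
    change e.symm (e x) ∈ N
    rwa [e.left_inv (hN x hx).2]⟩
  refine ⟨N, hNo, hcN, fun a x => G a (e x), fun a => ?_, fun a x hx => ?_⟩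
  · exact (hG a).contMDiffOn.comp ((contMDiffOn_extChartAt (I := 𝓡 (2 * n)) (n := ∞)).mono
      fun x hx => (extChartAt_source (𝓡 (2 * n)) c).subset ((hN x hx).2 : x ∈ (chartE (n := n) c).source)) hmaps
  · have h1 := hGf a (e x) ⟨(hmaps x hx.1).1, by
      change e.symm (e x) ∈ N ∩ U
      rwa [e.left_inv (hN x hx.1).2]⟩
    refine h1.trans ?_
    change f a (e.symm (e x)) = f a x
    rw [e.left_inv (hN x hx.1).2]

/-- A weak subbundle with vanishing weak covariant derivative extends smoothly to all of `M`. -/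
theorem IsWeakSubbundle.exists_smooth_extension (F : SecFrame n r E) (h : IsWeakSubbundle K D P q T)
    (hU : IsOpen U) (hU0 : vol K Uᶜ = 0) (hq : SmoothEndOn n r U q)
    (hT : ∀ᵐ x ∂vol K, ∀ v, T x v = 0) :
    ∃ Q : ∀ x, Module.End ℂ (E x), SmoothEndOn n r Set.univ Q ∧ ∀ x ∈ U, Q x = q x := by
  have hd : Dense U := by simpa using dense_compl_of_null K hU0
  let f : Fin F.card × Fin F.card → M → ℂ := fun a x => inner ℂ (F.t a.1 x) (q x (F.s a.2 x))
  have hfs : ∀ a, ContMDiff (𝓡 (2 * n)) 𝓘(ℝ, ℂ) ∞ (extendFrom U (f a)) := by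
    intro a c
    obtain ⟨O, hO, hcO, G, hG, hGf⟩ := h.exists_local_extension F hU hU0 hq hT c
    refine ((hG a).contMDiffAt (hO.mem_nhds hcO)).congr_of_eventuallyEq
      (Filter.eventuallyEq_of_mem (hO.mem_nhds hcO) fun x hx => ?_)
    refine extendFrom_eq (hd x) ?_
    refine (((hG a).continuousOn.continuousAt (hO.mem_nhds hx)).tendsto.mono_left
      nhdsWithin_le_nhds).congr' ?_
    filter_upwards [self_mem_nhdsWithin, mem_nhdsWithin_of_mem_nhds (hO.mem_nhds hx)] with y hy hyO
    exact hGf a y ⟨hyO, hy⟩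
  have hfe : ∀ a, ∀ x ∈ U, extendFrom U (f a) x = f a x := fun a =>
    extendFrom_extends (F.metric.inner_on hU ((F.smooth_t a.1).mono (Set.subset_univ _))
      (hq _ (F.smooth_s a.2))).continuousOn
  -- q is the sum of its frame coefficients times s_k ⊗ ⟨t_l, ·⟩; the same formula with the extended
  -- coefficients defines Q.
  refine ⟨fun x => ∑ l, ∑ k, extendFrom U (f (k, l)) x •
    (innerₛₗ ℂ (F.t l x)).smulRight (F.s k x), fun s hs => ?_, fun x hx => ?_⟩
  · have h1 : SmoothSecOn n r Set.univ fun x => ∑ l, ∑ k,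
        extendFrom U (f (k, l)) x • inner ℂ (F.t l x) (s x) • F.s k x :=
      SmoothSecOn.sum fun l _ => SmoothSecOn.sum fun k _ =>
        SmoothSecOn.smul (hfs (k, l)).contMDiffOn
          (SmoothSecOn.smul (F.smooth_inner (F.smooth_t l) hs).contMDiffOn (F.smooth_s k))
    refine h1.congr fun x _ => ?_
    simp [LinearMap.sum_apply]
  · refine LinearMap.ext fun u => ?_
    conv_rhs => rw [← F.expand x u, map_sum]
    simp only [LinearMap.sum_apply, LinearMap.smul_apply, LinearMap.smulRight_apply, map_smul]
    refine Finset.sum_congr rfl fun l _ => ?_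
    conv_rhs => rw [← F.expand x (q x (F.s l x)), Finset.smul_sum]
    refine Finset.sum_congr rfl fun k _ => ?_
    rw [hfe (k, l) x hx]
    exact smul_comm _ _ _

end Extension

end GenKaehler

namespace GenKaehler

/-! ### Parallel subbundles, slopes and the orthogonal decomposition. -/

section Polystable

open Filter Topology

variable {n r : ℕ} {M : Type*} [TopologicalSpace M] [ChartedSpace (W n) M]
  [IsManifold (𝓡 (2 * n)) ∞ M]
  {E : M → Type*} [TopologicalSpace (TotalSpace (EuclideanSpace ℂ (Fin r)) E)]
  [∀ x, NormedAddCommGroup (E x)] [∀ x, InnerProductSpace ℂ (E x)]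
  [FiberBundle (EuclideanSpace ℂ (Fin r)) E]
  [VectorBundle ℂ (EuclideanSpace ℂ (Fin r)) E] [VectorBundle ℝ (EuclideanSpace ℂ (Fin r)) E]
  [ContMDiffVectorBundle ∞ (EuclideanSpace ℂ (Fin r)) E (𝓡 (2 * n))]
  {D : GenConnection n r E}
  {K : GenKaehlerSympl n M} {P q : ∀ x, Module.End ℂ (E x)}
  {T : ∀ x, TangentSpace (𝓡 (2 * n)) x →ₗ[ℝ] Module.End ℂ (E x)} {U : Set M}
  [MeasurableSpace M] [BorelSpace M] [CompactSpace M] [T2Space M]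

/-- `P` is the orthogonal projection onto a subbundle preserved by the generalized connection. -/
structure IsParallel (F : SecFrame n r E) (D : GenConnection n r E) (P : ∀ x, Module.End ℂ (E x))
    (p : ℕ) : Prop extends IsSubbundle n r P p where
  par : ∀ x v, F.covEnd D.toCConnection P x v = 0
  comm : ∀ x ξ, D.vec x ξ * P x = P x * D.vec x ξ

theorem IsParallel.totalDeriv_eq {F : SecFrame n r E} {p : ℕ} (h : IsParallel F D P p) (x : M) :
    F.totalDeriv D P x = 0 := by
  refine LinearMap.ext fun a => ?_
  have := totalDeriv_apply F D P x a
  refine this.trans ?_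
  rw [h.par, h.comm, sub_self, add_zero]
  rfl

theorem IsParallel.defect_eq {F : SecFrame n r E} {p : ℕ} (h : IsParallel F D P p)
    (K : GenKaehlerSympl n M) (x : M) : F.defect D K P x = 0 := by
  rw [SecFrame.defect, h.totalDeriv_eq]
  have : PointKaehler.trRe (n := n) (P x) 0 = 0 := by
    refine LinearMap.ext₂ fun a c => ?_
    rw [PointKaehler.trRe_apply]
    simp
  rw [this]
  simp [pairTr]

theorem IsParallel.along_eq {F : SecFrame n r E} {p : ℕ} (h : IsParallel F D P p) {s : ∀ x, E x}
    (hs : SmoothSec n r s) (x : M) (a : GT n x) :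
    D.along (fun y => P y (s y)) x a = P x (D.along s x a) := by
  rw [GenConnection.along, F.nabla_end _ h.smooth hs, h.par, LinearMap.zero_apply, zero_add,
    GenConnection.along, map_add]
  exact congrArg _ (LinearMap.congr_fun (h.comm x a.2) (s x))

theorem IsParallel.isGenHol {F : SecFrame n r E} {p : ℕ} (h : IsParallel F D P p)
    (J : ∀ x : M, GT n x →ₗ[ℝ] GT n x) : IsGenHolSubbundle J D P p := by
  refine ⟨h.toIsSubbundle, fun s hs x a => ?_⟩
  simp only [GenConnection.dbar, h.along_eq hs, map_add, map_smul, h.idem]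

theorem IsSubbundle.isProjOn {p : ℕ} (h : IsSubbundle n r P p) :
    IsProjOn (n := n) (r := r) Set.univ P :=
  ⟨isOpen_univ, h.smooth, fun x _ => LinearMap.ext (h.idem x)⟩

/-- Without total derivative the Gauss equation has no quadratic term, so the curvature coefficient
is just compressed. -/
theorem IsParallel.isEinsteinHermitian {F : SecFrame n r E} {p : ℕ} (h : IsParallel F D P p) {lam : ℝ}
    (hEH : IsEinsteinHermitian K (fun _ => 1) D lam) : IsEinsteinHermitian K P D lam := by
  intro x u w
  have h0 : (K.pt x).quad (F.totalDeriv D P x) = 0 := by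
    rw [h.totalDeriv_eq]
    simp [PointKaehler.quad]
  rw [curvU_eq_quad F D K h.isProjOn (Set.mem_univ x), h0, mul_zero, zero_mul, add_zero]
  simp only [Module.End.mul_apply]
  have h1 := hEH x (P x u) (P x w)
  rw [Module.End.one_apply, h.symm x u (P x w), h.idem] at h1
  rw [← h.symm x u, h.symm x _ w]
  exact h1

theorem degreeOn_genHol (F : SecFrame n r E) (hD : D.IsHermitian) {lam : ℝ}
    (hEH : IsEinsteinHermitian K (fun _ => 1) D lam) (C : CConnection n r E) {p : ℕ}
    (h : IsGenHolSubbundle K.J D P p) : degreeOn K C Set.univ P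
      = 1 / (2 * Real.pi) * (lam * p * (vol K).real Set.univ - ∫ x, F.defect D K P x ∂vol K) :=
  (isWeakSubbundle_of_genHol F hD h).degreeOn_eq F hD hEH isOpen_univ (by simp) h.smooth
    (fun x _ => h.rank x) C

/-- Degree formula and nonnegativity of the defect. -/
theorem slope_le (F : SecFrame n r E) (hD : D.IsHermitian) {lam : ℝ}
    (hEH : IsEinsteinHermitian K (fun _ => 1) D lam) (C : CConnection n r E) {p : ℕ} (hp : 0 < p)
    (h : IsGenHolSubbundle K.J D P p) :
    slope K C P p ≤ lam * (vol K).real Set.univ / (2 * Real.pi) := by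
  rw [slope, degreeOn_genHol F hD hEH C h, div_le_div_iff₀ (by exact_mod_cast hp) (by positivity)]
  have h1 : 0 ≤ ∫ x, F.defect D K P x ∂vol K := integral_nonneg fun x =>
    defect_nonneg F D K hD h.isProjOn (fun x _ => h.symm x) (Set.mem_univ x)
  field_simp
  linarith

theorem IsParallel.slope_eq {F : SecFrame n r E} {p : ℕ} (h : IsParallel F D P p) (hD : D.IsHermitian)
    {lam : ℝ} (hEH : IsEinsteinHermitian K (fun _ => 1) D lam) (C : CConnection n r E) (hp : 0 < p) :
    slope K C P p = lam * (vol K).real Set.univ / (2 * Real.pi) := by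
  have hp' : (p : ℝ) ≠ 0 := by exact_mod_cast hp.ne'
  rw [slope, degreeOn_genHol F hD hEH C (h.isGenHol K.J)]
  simp only [h.defect_eq K, integral_zero, sub_zero]
  field_simp

theorem isParallel_one (F : SecFrame n r E) (D : GenConnection n r E) :
    IsParallel F D (fun _ => 1) r where
  smooth := smoothEndOn_one _
  idem _ _ := rfl
  symm _ _ _ := rfl
  rank x := by
    rw [Module.End.one_eq_id, LinearMap.range_id, finrank_top,
      finrank_eq_card_basis (fibreBasis r E x), Fintype.card_fin]
  par := F.covEnd_one _
  comm _ _ := by rw [mul_one, one_mul]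

theorem IsParallel.sub {F : SecFrame n r E} {p k : ℕ} (h : IsParallel F D P p) (hq : IsParallel F D q k)
    (hk : k ≤ p) (hPq : ∀ x, P x * q x = q x) (hqP : ∀ x, q x * P x = q x) :
    IsParallel F D (fun x => P x - q x) (p - k) where
  smooth := h.smooth.sub hq.smooth
  idem x u := by
    have h1 : P x (q x u) = q x u := LinearMap.congr_fun (hPq x) u
    have h2 : q x (P x u) = q x u := LinearMap.congr_fun (hqP x) u
    simp only [LinearMap.sub_apply, map_sub, h.idem, hq.idem, h1, h2]
    abel
  symm x u w := by
    simp only [LinearMap.sub_apply, inner_sub_left, inner_sub_right, h.symm, hq.symm]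
  rank x := by
    have := finiteDimensional_fibre r (E := E) x
    have h1 : (P x - q x) * (P x - q x) = P x - q x := by
      rw [sub_mul, mul_sub, mul_sub, hPq, hqP, LinearMap.ext (f := P x * P x) (h.idem x),
        LinearMap.ext (f := q x * q x) (hq.idem x)]
      abel
    have h2 := (LinearMap.IsIdempotentElem.isProj_range (P x - q x) h1).trace
    have h3 := (LinearMap.IsIdempotentElem.isProj_range (P x) (LinearMap.ext (h.idem x))).trace
    have h4 := (LinearMap.IsIdempotentElem.isProj_range (q x) (LinearMap.ext (hq.idem x))).trace
    rw [map_sub, h3, h4, h.rank, hq.rank, ← Nat.cast_sub hk] at h2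
    exact_mod_cast h2.symm
  par x v := by rw [F.covEnd_sub _ h.smooth hq.smooth, h.par, hq.par, sub_zero]
  comm x ξ := by rw [mul_sub, sub_mul, h.comm, hq.comm]

/-- A parallel subbundle that is not stable has a proper parallel subbundle. -/
theorem IsParallel.exists_of_not_isStable {F : SecFrame n r E} {p : ℕ} (h : IsParallel F D P p)
    (hD : D.IsHermitian) {lam : ℝ} (hEH : IsEinsteinHermitian K (fun _ => 1) D lam)
    (C : CConnection n r E) (hp : 0 < p) (hst : ¬ IsStable K D C P p) :
    ∃ (Q : ∀ x, Module.End ℂ (E x)) (k : ℕ), 0 < k ∧ k < p ∧ IsParallel F D Q k ∧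
      (∀ x, P x * Q x = Q x) ∧ ∀ x, Q x * P x = Q x := by
  rw [IsStable] at hst
  push Not at hst
  obtain ⟨q, T, S, k, hw, hS, hS0, hq, hk, hk0, hkp, hle⟩ := hst
  have hU : IsOpen Sᶜ := hS.isOpen_compl
  have hU0 : vol K Sᶜᶜ = 0 := by rwa [compl_compl]
  have hU1 : ∀ᵐ x ∂vol K, x ∈ Sᶜ := hU0
  have hproj := hw.isProjOn F hU hq
  have hsymm : ∀ x ∈ Sᶜ, ∀ u w, inner ℂ (q x u) w = inner ℂ u (q x w) :=
    fun x hx => hw.symmOn F hU hq hx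
  have hnn : ∀ᵐ x ∂vol K, 0 ≤ F.defect D K q x := hU1.mono fun x hx =>
    defect_nonneg F D K hD hproj hsymm hx
  have hint := hw.integrable_defect F hD hU hU0 hq
  -- The failed slope inequality bounds the integral of the nonnegative defect above by zero,
  -- because the slope of P is the maximal value λ Vol / 2π.
  have hI : ∫ x, F.defect D K q x ∂vol K = 0 := by
    refine le_antisymm ?_ (integral_nonneg_of_ae hnn)
    rw [h.slope_eq hD hEH C hp, hw.degreeOn_eq F hD hEH hU hU0 hq hk,
      div_le_div_iff₀ (by positivity) (by exact_mod_cast hk0)] at hle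
    field_simp at hle
    linarith
  have hz : ∀ᵐ x ∂vol K, F.defect D K q x = 0 := (integral_eq_zero_iff_of_nonneg_ae hnn hint).1 hI
  have htot : ∀ᵐ x ∂vol K, x ∈ Sᶜ ∧ ∀ a, F.totalDeriv D q x a = 0 := by
    filter_upwards [hU1, hz] with x hx h0
    exact ⟨hx, totalDeriv_eq_zero F D K hD hproj hsymm hx h0⟩
  have hcov : ∀ᵐ x ∂vol K, ∀ v, F.covEnd D.toCConnection q x v = 0 := by
    filter_upwards [htot] with x hx v
    have h1 : F.covEnd D.toCConnection q x v
        + (D.vec x 0 * q x - q x * D.vec x 0) = 0 := hx.2 (v, 0)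
    simpa using h1
  have hT : ∀ᵐ x ∂vol K, ∀ v, T x v = 0 := by
    filter_upwards [hU1, hcov, hw.ae_eq_covEnd F hD hU hq] with x hx h1 h2 v
    rw [h2 hx]
    exact h1 v
  obtain ⟨Q, hQ, hQq⟩ := hw.exists_smooth_extension F hU hU0 hq hT
  have hQae : ∀ᵐ x ∂vol K, Q x = q x := hU1.mono hQq
  have hext : ∀ {A B : ∀ x, Module.End ℂ (E x)}, SmoothEndOn n r Set.univ A →
      SmoothEndOn n r Set.univ B → (∀ᵐ x ∂vol K, A x = B x) → ∀ x, A x = B x :=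
    fun hA hB hAB x => end_eq_of_ae K F isOpen_univ hA hB (hAB.mono fun y hy _ => hy) (Set.mem_univ x)
  have hz0 : SmoothEndOn n r Set.univ fun x => (0 : Module.End ℂ (E x)) := fun s _ => smoothSecOn_zero _
  obtain ⟨G⟩ := exists_vecFrame (n := n) (M := M)
  have hidem : ∀ x, Q x * Q x = Q x := by
    refine hext (hQ.mul hQ isOpen_univ) hQ ?_
    filter_upwards [hQae, hw.idem] with x h1 h2
    rw [h1, h2]
  refine ⟨Q, k, hk0, hkp, ⟨⟨hQ, fun x u => LinearMap.congr_fun (hidem x) u, fun x u w => ?_,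
    fun x => ?_⟩, fun x v => ?_, fun x ξ => ?_⟩, ?_, ?_⟩
  · obtain ⟨s, hs, rfl⟩ := F.exists_sec u
    obtain ⟨t, ht, rfl⟩ := F.exists_sec w
    refine sub_eq_zero.1 (eq_zero_of_ae K isOpen_univ
      ((F.smooth_inner (hQ s hs) ht).continuous.sub
        (F.smooth_inner hs (hQ t ht)).continuous).continuousOn ?_ (Set.mem_univ x))
    filter_upwards [hQae, hw.symm] with y h1 h2 _
    simp only [Pi.sub_apply, h1, h2, sub_self]
  -- The rank of a projection is its trace, a continuous function equal to k almost everywhere.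
  · have hfd := fun y => finiteDimensional_fibre r (E := E) y
    have htr : ∀ y, LinearMap.trace ℂ (E y) (Q y) = finrank ℂ (LinearMap.range (Q y)) := fun y =>
      (LinearMap.IsIdempotentElem.isProj_range (Q y) (hidem y)).trace
    have h1 : LinearMap.trace ℂ (E x) (Q x) - (k : ℂ) = 0 := by
      refine eq_zero_of_ae K isOpen_univ
        (g := fun y => LinearMap.trace ℂ (E y) (Q y) - (k : ℂ))
        ((F.smooth_trace hQ).continuous.sub continuous_const).continuousOn ?_ (Set.mem_univ x)
      filter_upwards [hU1] with y hy _
      rw [htr, hQq y hy, hk y hy, sub_self]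
    rw [htr, sub_eq_zero] at h1
    exact_mod_cast h1
  -- Continuity arguments need smooth fields, so vanishing is proved along a global frame; the frame
  -- then expands an arbitrary v.
  · have h1 : ∀ a, F.covEnd D.toCConnection Q x (G.X a x) = 0 := fun a => by
      refine hext (F.smooth_covEnd _ hQ (G.smooth_X a)) hz0 ?_ x
      filter_upwards [hU1, hcov] with y hy h2
      rw [← h2 (G.X a y)]
      exact (F.covEnd_congr _ hQ (Filter.mem_of_superset (hU.mem_nhds hy)
        fun z hz => (hQq z hz).symm) _).symm
    rw [← SecFrame.covEndₗ_apply, ← G.expand x v, map_sum]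
    refine Finset.sum_eq_zero fun a _ => ?_
    rw [map_smul, SecFrame.covEndₗ_apply, h1, smul_zero]
  · have h1 : ∀ a, D.vec x (G.ξ a x) * Q x = Q x * D.vec x (G.ξ a x) := fun a => by
      have hV := D.vec_smooth _ (G.smooth_ξ a)
      refine hext (hV.mul hQ isOpen_univ) (hQ.mul hV isOpen_univ) ?_ x
      filter_upwards [hQae, htot] with y hy h2
      have h3 : F.covEnd D.toCConnection q y 0
          + (D.vec y (G.ξ a y) * q y - q y * D.vec y (G.ξ a y)) = 0 := h2.2 (0, G.ξ a y)
      have h4 : F.covEnd D.toCConnection q y 0 = 0 :=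
        (F.covEndₗ D.toCConnection q y).map_zero
      rw [h4, zero_add, sub_eq_zero] at h3
      rw [hy]
      exact h3
    have h2 : ξ = ∑ a, ξ (G.X a x) • G.ξ a x := by
      ext v
      conv_lhs => rw [← G.expand x v]
      simp [mul_comm]
    rw [h2, map_sum, Finset.sum_mul, Finset.mul_sum]
    refine Finset.sum_congr rfl fun a _ => ?_
    rw [map_smul, smul_mul_assoc, mul_smul_comm, h1]
  · refine hext (h.smooth.mul hQ isOpen_univ) hQ ?_
    filter_upwards [hQae, hw.sub] with y h1 h2
    rw [h1, h2]
  -- This is the adjoint of P q = q.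
  · refine hext (hQ.mul h.smooth isOpen_univ) hQ ?_
    filter_upwards [hQae, hw.sub, hw.symm] with y h1 h2 h3
    rw [h1]
    refine LinearMap.ext fun u => ext_inner_right ℂ fun w => ?_
    rw [Module.End.mul_apply, h3, h.symm, h3]
    exact congrArg _ (LinearMap.congr_fun h2 w)

/-- An orthogonal decomposition of a parallel subbundle into stable parallel subbundles. -/
theorem IsParallel.exists_decomposition {F : SecFrame n r E} (hD : D.IsHermitian) {lam : ℝ}
    (hEH : IsEinsteinHermitian K (fun _ => 1) D lam) (C : CConnection n r E) (p : ℕ) :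
    ∀ P : ∀ x, Module.End ℂ (E x), 0 < p → IsParallel F D P p →
    ∃ (m : ℕ) (Q : Fin m → ∀ x, Module.End ℂ (E x)) (k : Fin m → ℕ),
      (∀ i, 0 < k i ∧ IsParallel F D (Q i) (k i)) ∧
      (∀ i j, i ≠ j → ∀ x, Q i x * Q j x = 0) ∧ (∀ x, ∑ i, Q i x = P x) ∧
      ∀ i, IsStable K D C (Q i) (k i) := by
  induction p using Nat.strong_induction_on with
  | _ p ih =>
  intro P hp h
  by_cases hst : IsStable K D C P p
  · exact ⟨1, fun _ => P, fun _ => p, fun _ => ⟨hp, h⟩,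
      fun i j hij => absurd (Subsingleton.elim i j) hij, fun x => by simp, fun _ => hst⟩
  -- Both R and its complement P - R are parallel of smaller positive rank, so the induction
  -- hypothesis applies to each.
  obtain ⟨R, k, hk0, hkp, hR, hPR, hRP⟩ := h.exists_of_not_isStable hD hEH C hp hst
  have hsub := h.sub hR hkp.le hPR hRP
  obtain ⟨m₁, Q₁, k₁, h₁, ho₁, hs₁, hst₁⟩ := ih k hkp R hk0 hR
  obtain ⟨m₂, Q₂, k₂, h₂, ho₂, hs₂, hst₂⟩ := ih (p - k) (by omega) _ (by omega) hsub
  have key : ∀ {m : ℕ} {Q : Fin m → ∀ x, Module.End ℂ (E x)} {k : Fin m → ℕ}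
      {S : ∀ x, Module.End ℂ (E x)}, (∀ i, 0 < k i ∧ IsParallel F D (Q i) (k i)) →
      (∀ i j, i ≠ j → ∀ x, Q i x * Q j x = 0) → (∀ x, ∑ i, Q i x = S x) →
      ∀ i x, Q i x * S x = Q i x ∧ S x * Q i x = Q i x := by
    intro m Q k S hQ ho hs i x
    have hid : Q i x * Q i x = Q i x := LinearMap.ext ((hQ i).2.idem x)
    rw [← hs x, Finset.mul_sum, Finset.sum_mul, Finset.sum_eq_single i (fun j _ hj => ho i j hj.symm x)
      (by simp), Finset.sum_eq_single i (fun j _ hj => ho j i hj x) (by simp)]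
    exact ⟨hid, hid⟩
  have hid : ∀ x, R x * R x = R x := fun x => LinearMap.ext (hR.idem x)
  have h12 : ∀ i j x, Q₁ i x * Q₂ j x = 0 := fun i j x => by
    rw [← (key h₁ ho₁ hs₁ i x).1, ← (key h₂ ho₂ hs₂ j x).2, mul_assoc, ← mul_assoc (R x), mul_sub, hRP,
      hid, sub_self, zero_mul, mul_zero]
  have h21 : ∀ i j x, Q₂ j x * Q₁ i x = 0 := fun i j x => by
    rw [← (key h₁ ho₁ hs₁ i x).2, ← (key h₂ ho₂ hs₂ j x).1, mul_assoc, ← mul_assoc (P x - R x), sub_mul,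
      hPR, hid, sub_self, zero_mul, mul_zero]
  refine ⟨m₁ + m₂, Fin.append Q₁ Q₂, Fin.append k₁ k₂, fun i => ?_, fun i j => ?_, fun x => ?_,
    fun i => ?_⟩
  · refine Fin.addCases (fun i => ?_) (fun i => ?_) i
    · simpa only [Fin.append_left] using h₁ i
    · simpa only [Fin.append_right] using h₂ i
  · refine Fin.addCases (fun i => ?_) (fun i => ?_) i <;> refine Fin.addCases (fun j => ?_) (fun j => ?_) j <;>
      intro hij x <;> simp only [Fin.append_left, Fin.append_right, h12, h21]
    · exact ho₁ i j (fun e => hij (by rw [e])) x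
    · exact ho₂ i j (fun e => hij (by rw [e])) x
  · rw [Fin.sum_univ_add]
    simp only [Fin.append_left, Fin.append_right, hs₁, hs₂]
    abel
  · refine Fin.addCases (fun i => ?_) (fun i => ?_) i
    · simpa only [Fin.append_left] using hst₁ i
    · simpa only [Fin.append_right] using hst₂ i

theorem slope_le_slope_one (F : SecFrame n r E) (hD : D.IsHermitian) {lam : ℝ}
    (hEH : IsEinsteinHermitian K (fun _ => 1) D lam) (C : CConnection n r E) {p : ℕ} (hp : 0 < p)
    (h : IsGenHolSubbundle K.J D P p) : slope K C P p ≤ slope K C (fun _ => 1) r := by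
  refine (slope_le F hD hEH C hp h).trans ?_
  rcases Nat.eq_zero_or_pos r with rfl | hr
  -- A subbundle of positive rank in a bundle of rank zero exists only over the empty manifold.
  -- There the volume is zero, and the slope of E is a division by zero, which has the value zero.
  · have hM : IsEmpty M := ⟨fun x => by
      have := finiteDimensional_fibre 0 (E := E) x
      have h1 := Submodule.finrank_le (LinearMap.range (P x))
      rw [h.rank, finrank_eq_card_basis (fibreBasis 0 E x), Fintype.card_fin] at h1
      omega⟩
    rw [Measure.eq_zero_of_isEmpty (vol K)]
    simp [slope]
  · exact ((isParallel_one F D).slope_eq hD hEH C hr).ge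

end Polystable

end GenKaehler

theorem mainTheorem6 {n r : ℕ} {M : Type*} [TopologicalSpace M]
    [ChartedSpace (GenKaehler.W n) M] [IsManifold (𝓡 (2 * n)) ∞ M]
    [CompactSpace M] [T2Space M] [MeasurableSpace M] [BorelSpace M]
    {E : M → Type*} [TopologicalSpace (TotalSpace (EuclideanSpace ℂ (Fin r)) E)]
    [∀ x, NormedAddCommGroup (E x)] [∀ x, InnerProductSpace ℂ (E x)]
    [FiberBundle (EuclideanSpace ℂ (Fin r)) E]
    [VectorBundle ℂ (EuclideanSpace ℂ (Fin r)) E] [VectorBundle ℝ (EuclideanSpace ℂ (Fin r)) E]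
    [ContMDiffVectorBundle ∞ (EuclideanSpace ℂ (Fin r)) E (𝓡 (2 * n))]
    (hmetric : GenKaehler.IsSmoothMetric n r E)
    (K : GenKaehler.GenKaehlerSympl n M)
    (D : GenKaehler.GenConnection n r E)
    (hherm : D.IsHermitian) (hflat : D.IsFlat01 K.J)
    (lam : ℝ) (hEH : GenKaehler.IsEinsteinHermitian K (fun _ => 1) D lam)
    (C : GenKaehler.CConnection n r E) :
    (∀ (P : ∀ x, Module.End ℂ (E x)) (p : ℕ), 0 < p →
      GenKaehler.IsGenHolSubbundle K.J D P p →
      GenKaehler.slope K C P p ≤ GenKaehler.slope K C (fun _ => 1) r) ∧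
    ∃ (m : ℕ) (P : Fin m → ∀ x, Module.End ℂ (E x)) (p : Fin m → ℕ),
      (∀ i, 0 < p i ∧ GenKaehler.IsGenHolSubbundle K.J D (P i) (p i)) ∧
      (∀ i j, i ≠ j → ∀ x, P i x * P j x = 0) ∧
      (∀ x, ∑ i, P i x = 1) ∧
      (∀ i, GenKaehler.IsStable K D C (P i) (p i)) ∧
      (∀ i, GenKaehler.IsEinsteinHermitian K (P i) D lam) ∧
      (∀ i, GenKaehler.slope K C (P i) (p i) = GenKaehler.slope K C (fun _ => 1) r) := by
  obtain ⟨F⟩ := GenKaehler.exists_secFrame hmetric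
  refine ⟨fun P p hp h => GenKaehler.slope_le_slope_one F hherm hEH C hp h, ?_⟩
  rcases Nat.eq_zero_or_pos r with rfl | hr
  -- In rank zero the fibres are zero and the empty decomposition sums to the identity.
  · refine ⟨0, Fin.elim0, Fin.elim0, fun i => i.elim0, fun i => i.elim0, fun x => ?_,
      fun i => i.elim0, fun i => i.elim0, fun i => i.elim0⟩
    exact (GenKaehler.fibreBasis 0 E x).ext fun i => i.elim0
  · obtain ⟨m, P, p, h1, h2, h3, h4⟩ := GenKaehler.IsParallel.exists_decomposition hherm hEH C r
      (fun _ => 1) hr (GenKaehler.isParallel_one F D)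
    refine ⟨m, P, p, fun i => ⟨(h1 i).1, (h1 i).2.isGenHol K.J⟩, h2, h3, h4,
      fun i => (h1 i).2.isEinsteinHermitian hEH, fun i => ?_⟩
    rw [(h1 i).2.slope_eq hherm hEH C (h1 i).1,
      (GenKaehler.isParallel_one F D).slope_eq hherm hEH C hr]
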